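/- An instance $I$ consists of $n\ge 1$ jobs $1,\dots,n$, a conflict graph $G=(\{1,\dots,n\},E)$, and for each job $j$ an integer processing time $p_j\ge 1$, an integer release time $r_j\ge 0$, an integer due date $d_j$ and an integer weight $w_j$; all these parameters are written in unary. A schedule assigns to each job $j$ a completion time $C_j\in\mathbb N$. It is feasible if $C_j-p_j\ge r_j$ for all $j$ and $[C_i-p_i,C_i)\cap[C_j-p_j,C_j)=\emptyset$ for all $\{i,j\}\in E$. Its makespan is $C_{\max}=\max_j C_j$. The problems $P_n|conc,r_j\ge 0|WL_{\max}$ and $P_n|conc,r_j\ge 0|\sum w_jT_j$ ask for an optimal schedule, that is, a feasible schedule minimizing $\max_j w_j(C_j-d_j)$ and $\sum_j w_j\max\{0,C_j-d_j\}$, respectively, among all feasible schedules. Theorem. For each of these two problems: 1. There is an algorithm that, given an instance $I$, a tree decomposition of its conflict graph $G$ of some width $t$ (for example, of width $t=tw(G)$), and an integer $k$ (in binary) such that some optimal schedule has makespan at most $k$, computes an optimal schedule in time $O^*(k^{t+1})$. 2. There is an algorithm that, given only an instance $I$ and an integer $k$ (in binary) such that some optimal schedule has makespan at most $k$, computes an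 optimal schedule in time $O^*(k^{O(tw+1)})$, where $tw=tw(G)$ is the treewidth of the conflict graph. Here $O^*$ suppresses factors polynomial in the size of the input, and time is measured on a random access machine with logarithmic cost. -/

import Mathlib

namespace ConcSched

/-! ### A random access machine with logarithmic cost

A program works on integer registers `x₀, x₁, x₂, …` (a given program names finitely many of them)
and on an integer memory with indirect addressing. -/

/-- Programs. Conditionals and loops test whether a register is positive. -/
inductive Prog where
  /-- `x := a` -/
  | const (x : ℕ) (a : ℤ)
  /-- `x := y + z` -/
  | add (x y z : ℕ)
  /-- `x := y - z` -/
  | sub (x y z : ℕ)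
  /-- `x := mem[y]` -/
  | load (x y : ℕ)
  /-- `mem[x] := y` -/
  | store (x y : ℕ)
  /-- first `P`, then `Q` -/
  | seq (P Q : Prog)
  /-- if `0 < x` then `P` else `Q` -/
  | ite (x : ℕ) (P Q : Prog)
  /-- while `0 < x` do `P` -/
  | loop (x : ℕ) (P : Prog)

/-- The contents of the registers and of the memory. -/
structure State where
  reg : ℕ → ℤ
  mem : ℤ → ℤ

/-- The state `s` with `a` written to register `x`. -/
def State.setReg (s : State) (x : ℕ) (a : ℤ) : State :=
  { s with reg := Function.update s.reg x a }

/-- The state `s` with `b` written to the memory cell with address `a`. -/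
def State.setMem (s : State) (a b : ℤ) : State :=
  { s with mem := Function.update s.mem a b }

/-- The number of bits of an integer, with one bit for the sign. -/
def bits (a : ℤ) : ℕ := Nat.size a.natAbs + 1

/-- `Runs P s s' t`: started in state `s`, the program `P` halts in state `s'` at total cost `t`,
where every elementary operation and every test costs the number of bits of the integers, addresses
included, that it handles. -/
inductive Runs : Prog → State → State → ℕ → Prop where
  | const (x : ℕ) (a : ℤ) (s : State) :
      Runs (.const x a) s (s.setReg x a) (bits a)
  | add (x y z : ℕ) (s : State) :
      Runs (.add x y z) s (s.setReg x (s.reg y + s.reg z)) (bits (s.reg y) + bits (s.reg z))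
  | sub (x y z : ℕ) (s : State) :
      Runs (.sub x y z) s (s.setReg x (s.reg y - s.reg z)) (bits (s.reg y) + bits (s.reg z))
  | load (x y : ℕ) (s : State) :
      Runs (.load x y) s (s.setReg x (s.mem (s.reg y)))
        (bits (s.reg y) + bits (s.mem (s.reg y)))
  | store (x y : ℕ) (s : State) :
      Runs (.store x y) s (s.setMem (s.reg x) (s.reg y)) (bits (s.reg x) + bits (s.reg y))
  | seq {P Q : Prog} {s s' s'' : State} {t t' : ℕ} :
      Runs P s s' t → Runs Q s' s'' t' → Runs (.seq P Q) s s'' (t + t')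
  | ite_pos {x : ℕ} {P Q : Prog} {s s' : State} {t : ℕ} :
      0 < s.reg x → Runs P s s' t → Runs (.ite x P Q) s s' (bits (s.reg x) + t)
  | ite_neg {x : ℕ} {P Q : Prog} {s s' : State} {t : ℕ} :
      ¬ 0 < s.reg x → Runs Q s s' t → Runs (.ite x P Q) s s' (bits (s.reg x) + t)
  | loop_pos {x : ℕ} {P : Prog} {s s' s'' : State} {t t' : ℕ} :
      0 < s.reg x → Runs P s s' t → Runs (.loop x P) s' s'' t' →
        Runs (.loop x P) s s'' (bits (s.reg x) + t + t')
  | loop_neg {x : ℕ} {P : Prog} {s : State} :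
      ¬ 0 < s.reg x → Runs (.loop x P) s s (bits (s.reg x))

/-- The initial state: the input stands in the memory cells `0, 1, 2, …`, all else is `0`. -/
def start (input : List ℤ) : State where
  reg _ := 0
  mem a := if 0 ≤ a then input.getD a.toNat 0 else 0

/-- On the given input, `P` halts at cost at most `T` with a memory content that is `good`. -/
def Prog.SolvesWithin (P : Prog) (input : List ℤ) (T : ℕ) (good : (ℤ → ℤ) → Prop) : Prop :=
  ∃ (s : State) (t : ℕ), Runs P (start input) s t ∧ t ≤ T ∧ good s.mem

/-- The length of a list of integers written in unary, with one symbol per entry for its end and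
its sign. -/
def unarySize (l : List ℤ) : ℕ := (l.map fun a => a.natAbs + 1).sum

open Classical in
/-- The truth value of a proposition as a number. -/
noncomputable def truth (A : Prop) : ℤ := if A then 1 else 0

/-- A Boolean matrix, row by row. -/
noncomputable def matrixList {a b : ℕ} (A : Fin a → Fin b → Prop) : List ℤ :=
  (List.finRange a).flatMap fun i => (List.finRange b).map fun j => truth (A i j)

/-! ### Concurrency constrained scheduling -/

/-- An instance: a nonempty set of jobs with a conflict graph, processing times `p`, release times
`r`, due dates `d` and weights `w`. -/
structure Instance where
  n : ℕ
  n_pos : 0 < n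
  graph : SimpleGraph (Fin n)
  p : Fin n → ℕ
  p_pos : ∀ j, 1 ≤ p j
  r : Fin n → ℕ
  d : Fin n → ℤ
  w : Fin n → ℤ

/-- The two objective functions: maximum weighted lateness and total weighted tardiness. -/
inductive Objective where
  | maxWeightedLateness
  | totalWeightedTardiness

namespace Instance

/-- A schedule assigns its completion time to each job. -/
abbrev Schedule (I : Instance) : Type := Fin I.n → ℕ

variable (I : Instance)

/-- No job starts before its release time, and conflicting jobs are never processed at the same
time. -/
def Feasible (C : I.Schedule) : Prop :=
  (∀ j, (I.r j : ℤ) ≤ (C j : ℤ) - I.p j) ∧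
  ∀ i j, I.graph.Adj i j →
    Disjoint (Set.Ico ((C i : ℤ) - I.p i) (C i)) (Set.Ico ((C j : ℤ) - I.p j) (C j))

/-- The lateness of a job. -/
def lateness (C : I.Schedule) (j : Fin I.n) : ℤ := C j - I.d j

/-- The tardiness of a job. -/
def tardiness (C : I.Schedule) (j : Fin I.n) : ℤ := max 0 (C j - I.d j)

/-- The value of a schedule: the maximum of `w j * lateness j`, or the sum of
`w j * tardiness j`. -/
def value : Objective → I.Schedule → ℤ
  | .maxWeightedLateness, C =>
      Finset.univ.sup' ⟨⟨0, I.n_pos⟩, Finset.mem_univ _⟩ fun j => I.w j * I.lateness C j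
  | .totalWeightedTardiness, C => ∑ j, I.w j * I.tardiness C j

/-- The makespan of a schedule. -/
def makespan (C : I.Schedule) : ℕ := Finset.univ.sup C

/-- A feasible schedule of minimum value among all feasible schedules. -/
def IsOptimal (obj : Objective) (C : I.Schedule) : Prop :=
  I.Feasible C ∧ ∀ C' : I.Schedule, I.Feasible C' → I.value obj C ≤ I.value obj C'

/-- The instance as a list of integers: the number of jobs, the four parameters of each job, and the
adjacency matrix of the conflict graph. -/
noncomputable def encode : List ℤ :=
  [(I.n : ℤ)]
    ++ (List.finRange I.n).flatMap (fun j => [(I.p j : ℤ), (I.r j : ℤ), I.d j, I.w j])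
    ++ matrixList I.graph.Adj

/-- The memory holds an optimal schedule, `C j` in the cell with address `j`. -/
def HoldsOptimal (obj : Objective) (mem : ℤ → ℤ) : Prop :=
  ∃ C : I.Schedule, I.IsOptimal obj C ∧ ∀ j : Fin I.n, mem (j : ℕ) = C j

end Instance

/-! ### Tree decompositions -/

/-- A tree decomposition of `G`. -/
structure TreeDecomposition {n : ℕ} (G : SimpleGraph (Fin n)) where
  /-- the number of nodes of the tree -/
  m : ℕ
  tree : SimpleGraph (Fin m)
  isTree : tree.IsTree
  bag : Fin m → Finset (Fin n)
  vertex_mem : ∀ v, ∃ i, v ∈ bag i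
  edge_mem : ∀ u v, G.Adj u v → ∃ i, u ∈ bag i ∧ v ∈ bag i
  connected : ∀ v, (tree.induce {i | v ∈ bag i}).Connected

/-- The width: the maximum size of a bag, minus one. -/
def TreeDecomposition.width {n : ℕ} {G : SimpleGraph (Fin n)} (D : TreeDecomposition G) : ℕ :=
  (Finset.univ.sup fun i => (D.bag i).card) - 1

/-- The tree decomposition as a list of integers: the number of nodes, the adjacency matrix of the
tree, and the incidence matrix of the bags. -/
noncomputable def TreeDecomposition.encode {n : ℕ} {G : SimpleGraph (Fin n)}
    (D : TreeDecomposition G) : List ℤ :=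
  [(D.m : ℤ)] ++ matrixList D.tree.Adj ++ matrixList fun i v => v ∈ D.bag i

/-- The treewidth: the minimum width of a tree decomposition. -/
noncomputable def treewidth {n : ℕ} (G : SimpleGraph (Fin n)) : ℕ :=
  sInf (Set.range fun D : TreeDecomposition G => D.width)

end ConcSched

/-! Both algorithms are dynamic programs over a perfect elimination structure of a chordal
supergraph of the conflict graph (`Layout`): an order of the vertices and, for each vertex i, a set
κ i of at most t later vertices that are pairwise joined. The least element of κ i is the parent of
i; this gives a forest in which κ c ⊆ {i} ∪ κ i for every child c of i (`Elim.subset`).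

A schedule of makespan at most k assigns one of k completion times to each vertex. A conflict is
checked at its earlier endpoint i, where the other endpoint lies in κ i. So the objective, with a
penalty for infeasibility, combines terms that depend on the times of i and of κ i only, by a sum or
by a maximum. The best value of the subtree of i is then a function of the times on κ i: a table
with at most k ^ t entries, each a minimum over k times of i. This is the source of k ^ (t + 1); see
`Elim.optimal` and `optimize_spec`. Costs are shifted by an offset to be natural numbers, and one
penalty exceeds the combined shifted costs of an optimal schedule of makespan at most k, so that a
minimal assignment is an optimal schedule (`Instance.isOptimal_of_fold_le`).

A tree decomposition of width t yields such a structure of width t. Among the remaining vertices,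
take one whose bag nearest to the root is as deep as possible: all remaining vertices that share a
bag with it lie in that one bag (`TreeDecomposition.exists_simplicial`).

If no decomposition is given, structures of width 4b are searched for b = 1, 2, …, adding the
vertices one by one. Declaring a new vertex to be a later neighbour of all others raises the width
to 4b + 1. To return to 4b, an order is built from its end: the vertices not yet placed form blocks,
each with at most 3b placed neighbours, and a block is split along a separator with less than b
elements that leaves at most 2b of these neighbours on either side (`Partial.advance`). Such
separators exist once some structure has width less than b - 1 (`Layout.exists_separation`). They
are found by the same dynamic programming with three values instead of k, once for each of at most 3
^ (3b) distributions of the placed neighbours. The cost is exponential in the treewidth. For k ≥ 2 a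
power of k absorbs it; for k = 1 there are no conflicts at all (`exists_layout_of_makespan`).

For the machine model, the algorithms are commands of a small language with bounded loops, which is
compiled to the machine. Loops belong to one of three classes: `N` for polynomial bounds, `q` for
the values of a vertex, `M` for the table entries. The cost is a polynomial in the bit length times
the product of the limits of the classes, each raised to the nesting depth of its class
(`Cmd.exists_solves`). So the exponent of k is read off the nesting depths of the loops of classes
`q` and `M`. -/

set_option linter.constructorNameAsVariable false
namespace ConcSched

/-! ### A language of bounded loops over the natural numbers -/

/-- Names of variables. -/
inductive Var
  | n | q | i | m | x | l | c | idx | p | fst | val | bv | bx | num | carry | off | inf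
  | u | w | bad | fin | d | e | pos | fnd | sel | aux | tot | b | id | cnt | top | ok | done | stage
  | ca | cb | y | z | g | h | base | size
  deriving DecidableEq

/-- Names of two-dimensional arrays. -/
inductive Arr
  | K | phi | T | X | ord | H | alive | nK | nord | blk | W | sig | pre | side
  deriving DecidableEq

/-- The values of the variables and of the arrays, and the memory cells with nonnegative address. -/
structure St where
  v : Var → ℕ
  a : Arr → ℕ → ℕ → ℕ
  io : ℕ → ℤ

namespace St

/-- Assignment to a variable. -/
def set (s : St) (x : Var) (n : ℕ) : St := { s with v := Function.update s.v x n }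

/-- Assignment to an array cell. -/
def put (s : St) (A : Arr) (i j n : ℕ) : St :=
  { s with a := Function.update s.a A (Function.update (s.a A) i (Function.update (s.a A i) j n)) }

/-- Assignment to a memory cell with nonnegative address. -/
def out (s : St) (i n : ℕ) : St := { s with io := Function.update s.io i n }

@[simp] theorem set_v_self (s : St) (x : Var) (n : ℕ) : (s.set x n).v x = n := by simp [set]
@[simp] theorem set_v (s : St) (x y : Var) (n : ℕ) :
    (s.set x n).v y = if y = x then n else s.v y := by simp [set, Function.update_apply]
@[simp] theorem set_a (s : St) (x : Var) (n : ℕ) : (s.set x n).a = s.a := rfl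
@[simp] theorem set_io (s : St) (x : Var) (n : ℕ) : (s.set x n).io = s.io := rfl
@[simp] theorem put_v (s : St) (A : Arr) (i j n : ℕ) : (s.put A i j n).v = s.v := rfl
@[simp] theorem put_io (s : St) (A : Arr) (i j n : ℕ) : (s.put A i j n).io = s.io := rfl
@[simp] theorem put_a (s : St) (A A' : Arr) (i j n : ℕ) : (s.put A i j n).a A' =
    if A' = A then Function.update (s.a A) i (Function.update (s.a A i) j n) else s.a A' := by
  unfold put; dsimp only; by_cases h : A' = A
  · subst h; simp
  · simp [h]
@[simp] theorem out_v (s : St) (i n : ℕ) : (s.out i n).v = s.v := rfl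
@[simp] theorem out_a (s : St) (i n : ℕ) : (s.out i n).a = s.a := rfl
@[simp] theorem out_io (s : St) (i n : ℕ) : (s.out i n).io = Function.update s.io i n := rfl

end St

/-- Expressions. The positive and the negative part of a memory cell are read separately. -/
inductive Exp
  | lit (n : ℕ)
  | var (x : Var)
  | arr (A : Arr) (i j : Exp)
  | add (e f : Exp)
  | sub (e f : Exp)
  | mul (e f : Exp)
  | ioP (e : Exp)
  | ioN (e : Exp)

namespace Exp

instance : Add Exp := ⟨add⟩
instance : Sub Exp := ⟨sub⟩
instance : Mul Exp := ⟨mul⟩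
instance (n : ℕ) : OfNat Exp n := ⟨lit n⟩

/-- The value of an expression; subtraction is truncated. -/
def ev : Exp → St → ℕ
  | lit n, _ => n
  | var x, s => s.v x
  | arr A i j, s => s.a A (i.ev s) (j.ev s)
  | add e f, s => e.ev s + f.ev s
  | sub e f, s => e.ev s - f.ev s
  | mul e f, s => e.ev s * f.ev s
  | ioP e, s => (s.io (e.ev s)).toNat
  | ioN e, s => (-s.io (e.ev s)).toNat

@[simp] theorem ev_add (e f : Exp) (s : St) : (e + f).ev s = e.ev s + f.ev s := rfl
@[simp] theorem ev_sub (e f : Exp) (s : St) : (e - f).ev s = e.ev s - f.ev s := rfl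
@[simp] theorem ev_mul (e f : Exp) (s : St) : (e * f).ev s = e.ev s * f.ev s := rfl
@[simp] theorem ev_lit (n : ℕ) (s : St) : (no_index (OfNat.ofNat n : Exp)).ev s = (OfNat.ofNat n : ℕ) := rfl
@[simp] theorem ev_var (x : Var) (s : St) : (var x).ev s = s.v x := rfl
@[simp] theorem ev_arr (A : Arr) (i j : Exp) (s : St) :
    (arr A i j).ev s = s.a A (i.ev s) (j.ev s) := rfl
@[simp] theorem ev_ioP (e : Exp) (s : St) : (ioP e).ev s = (s.io (e.ev s)).toNat := rfl
@[simp] theorem ev_ioN (e : Exp) (s : St) : (ioN e).ev s = (-s.io (e.ev s)).toNat := rfl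

end Exp

/-- The classes of loops, by the size of their bounds. -/
inductive Cls
  | N | q | M
  deriving DecidableEq

/-- Bounds for the values of variables and for the numbers of iterations of loops. -/
structure Lim where
  B : ℕ
  lim : Cls → ℕ

/-- Commands. -/
inductive Cmd
  | skip
  | set (x : Var) (e : Exp)
  | put (A : Arr) (i j e : Exp)
  | out (i e : Exp)
  | seq (c d : Cmd)
  | ite (e : Exp) (c d : Cmd)
  /-- `for x < e do c` -/
  | loop (κ : Cls) (x : Var) (e : Exp) (c : Cmd)

infixr:60 " ;; " => Cmd.seq

namespace Cmd

/-- The state after a number of iterations of a loop with body `f`. -/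
def iter (f : St → St) (x : Var) (s : St) : ℕ → St
  | 0 => s
  | i + 1 => f ((iter f x s i).set x i)

/-- The state after the execution of a command. -/
def ex : Cmd → St → St
  | skip, s => s
  | set x e, s => s.set x (e.ev s)
  | put A i j e, s => s.put A (i.ev s) (j.ev s) (e.ev s)
  | out i e, s => s.out (i.ev s) (e.ev s)
  | seq c d, s => d.ex (c.ex s)
  | ite e c d, s => if 0 < e.ev s then c.ex s else d.ex s
  | loop _ x e c, s => iter c.ex x s (e.ev s)

/-- All values assigned and all loops executed are within the limits. -/
def Ok (L : Lim) : Cmd → St → Prop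
  | skip, _ => True
  | set _ e, s => e.ev s ≤ L.B
  | put _ _ _ e, s => e.ev s ≤ L.B
  | out _ e, s => e.ev s ≤ L.B
  | seq c d, s => c.Ok L s ∧ d.Ok L (c.ex s)
  | ite e c d, s => if 0 < e.ev s then c.Ok L s else d.Ok L s
  | loop κ x e c, s => e.ev s ≤ L.lim κ ∧ e.ev s ≤ L.B ∧
      ∀ i < e.ev s, c.Ok L ((iter c.ex x s i).set x i)

/-- Whether a command may assign to a variable. -/
def wv : Cmd → Var → Bool
  | skip, _ => false
  | set x _, y => decide (y = x)
  | put _ _ _ _, _ => false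
  | out _ _, _ => false
  | seq c d, y => c.wv y || d.wv y
  | ite _ c d, y => c.wv y || d.wv y
  | loop _ x _ c, y => decide (y = x) || c.wv y

/-- Whether a command may assign to an array. -/
def wa : Cmd → Arr → Bool
  | skip, _ => false
  | set _ _, _ => false
  | put A _ _ _, A' => decide (A' = A)
  | out _ _, _ => false
  | seq c d, y => c.wa y || d.wa y
  | ite _ c d, y => c.wa y || d.wa y
  | loop _ _ _ c, y => c.wa y

/-- Whether a command may assign to a memory cell with nonnegative address. -/
def wio : Cmd → Bool
  | skip => false
  | set _ _ => false
  | put _ _ _ _ => false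
  | out _ _ => true
  | seq c d => c.wio || d.wio
  | ite _ c d => c.wio || d.wio
  | loop _ _ _ c => c.wio

/-- Two states agree up to assignments that a command may make. -/
structure Agree (c : Cmd) (s s' : St) : Prop where
  v : ∀ x, c.wv x = false → s'.v x = s.v x
  a : ∀ A, c.wa A = false → s'.a A = s.a A
  io : c.wio = false → s'.io = s.io

theorem Agree.refl (c : Cmd) (s : St) : c.Agree s s := ⟨fun _ _ => rfl, fun _ _ => rfl, fun _ => rfl⟩

theorem Agree.trans {c : Cmd} {s s' s'' : St} (h : c.Agree s s') (h' : c.Agree s' s'') :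
    c.Agree s s'' :=
  ⟨fun x hx => (h'.v x hx).trans (h.v x hx), fun x hx => (h'.a x hx).trans (h.a x hx),
    fun hx => (h'.io hx).trans (h.io hx)⟩

theorem Agree.weaken {c d : Cmd} {s s' : St} (h : c.Agree s s')
    (hv : ∀ x, d.wv x = false → c.wv x = false) (ha : ∀ x, d.wa x = false → c.wa x = false)
    (hio : d.wio = false → c.wio = false) : d.Agree s s' :=
  ⟨fun x hx => h.v x (hv x hx), fun x hx => h.a x (ha x hx), fun hx => h.io (hio hx)⟩

theorem agree_iter {κ : Cls} {x : Var} {e : Exp} {c : Cmd} (hc : ∀ s, c.Agree s (c.ex s)) (s : St)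
    (i : ℕ) : (loop κ x e c).Agree s (iter c.ex x s i) := by
  induction i with
  | zero => exact Agree.refl _ _
  | succ i ih =>
    refine ih.trans ⟨fun y hy => ?_, fun A hA => ?_, fun hio => ?_⟩
    · simp only [wv, Bool.or_eq_false_iff, decide_eq_false_iff_not] at hy
      rw [iter, (hc _).v y hy.2]; simp [hy.1]
    · rw [iter, (hc _).a A hA]; rfl
    · rw [iter, (hc _).io hio]; rfl

/-- A frame rule. What a command may assign to is computed from its syntax, so in the specifications
below `rfl` suffices to show that a concrete command leaves a variable or an array alone. -/
theorem agree_ex (c : Cmd) (s : St) : c.Agree s (c.ex s) := by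
  induction c generalizing s with
  | skip => exact Agree.refl _ _
  | set x e => exact ⟨fun y hy => by simp [wv] at hy; simp [ex, hy], fun _ _ => rfl, fun _ => rfl⟩
  | put A i j e =>
    exact ⟨fun _ _ => rfl, fun y hy => by simp [wa] at hy; simp [ex, hy], fun _ => rfl⟩
  | out i e => exact ⟨fun _ _ => rfl, fun _ _ => rfl, fun h => by simp [wio] at h⟩
  | seq c d hc hd =>
    exact ((hc s).weaken (fun x h => by simp_all [wv]) (fun x h => by simp_all [wa])
      (fun h => by simp_all [wio])).trans ((hd _).weaken (fun x h => by simp_all [wv])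
      (fun x h => by simp_all [wa]) (fun h => by simp_all [wio]))
  | ite e c d hc hd =>
    rw [ex]; split_ifs
    · exact (hc s).weaken (fun x h => by simp_all [wv]) (fun x h => by simp_all [wa])
        (fun h => by simp_all [wio])
    · exact (hd s).weaken (fun x h => by simp_all [wv]) (fun x h => by simp_all [wa])
        (fun h => by simp_all [wio])
  | loop κ x e c hc => exact agree_iter hc s _

/-- Started in the state `s`, the command stays within the limits and establishes `Q`. -/
def Spec (L : Lim) (c : Cmd) (s : St) (Q : St → Prop) : Prop := c.Ok L s ∧ Q (c.ex s)

variable {L : Lim} {s : St} {Q R : St → Prop} {c d : Cmd}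

@[simp] theorem spec_skip : Spec L skip s Q ↔ Q s := by simp [Spec, Ok, ex]

@[simp] theorem spec_set {x : Var} {e : Exp} :
    Spec L (set x e) s Q ↔ e.ev s ≤ L.B ∧ Q (s.set x (e.ev s)) := Iff.rfl

@[simp] theorem spec_put {A : Arr} {i j e : Exp} :
    Spec L (put A i j e) s Q ↔ e.ev s ≤ L.B ∧ Q (s.put A (i.ev s) (j.ev s) (e.ev s)) := Iff.rfl

@[simp] theorem spec_out {i e : Exp} :
    Spec L (out i e) s Q ↔ e.ev s ≤ L.B ∧ Q (s.out (i.ev s) (e.ev s)) := Iff.rfl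

@[simp] theorem spec_seq : Spec L (c ;; d) s Q ↔ Spec L c s fun s' => Spec L d s' Q := by
  simp [Spec, Ok, ex, and_assoc]

@[simp] theorem spec_ite {e : Exp} :
    Spec L (ite e c d) s Q ↔ if 0 < e.ev s then Spec L c s Q else Spec L d s Q := by
  simp only [Spec, Ok, ex]; split_ifs <;> rfl

/-- The rule of consequence; the new postcondition may also use the frame of the command. -/
theorem Spec.mono (h : Spec L c s Q) (hQ : ∀ s', c.Agree s s' → Q s' → R s') : Spec L c s R :=
  ⟨h.1, hQ _ (agree_ex c s) h.2⟩

/-- The invariant rule. An invariant need not mention what the loop leaves alone: the body and the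
exit also receive the frame relative to the state before the loop. -/
theorem spec_loop {κ : Cls} {x : Var} {e : Exp} {n : ℕ} (I : ℕ → St → Prop) (hn : e.ev s = n)
    (h1 : n ≤ L.lim κ) (h2 : n ≤ L.B) (h0 : I 0 s)
    (hI : ∀ i < n, ∀ s', (loop κ x e c).Agree s s' → I i s' → Spec L c (s'.set x i) (I (i + 1)))
    (hQ : ∀ s', (loop κ x e c).Agree s s' → I n s' → Q s') :
    Spec L (loop κ x e c) s Q := by
  subst hn
  have key : ∀ i ≤ e.ev s, I i (iter c.ex x s i) := by
    intro i
    induction i with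
    | zero => exact fun _ => h0
    | succ i ih => exact fun hi => (hI i hi _ (agree_iter (agree_ex c) s i) (ih (by omega))).2
  exact ⟨⟨h1, h2, fun i hi => (hI i hi _ (agree_iter (agree_ex c) s i) (key i hi.le)).1⟩,
    hQ _ (agree_ex _ _) (key _ le_rfl)⟩

/-- The largest number of nested loops of a class. -/
def depth (κ : Cls) : Cmd → ℕ
  | skip => 0
  | set _ _ => 0
  | put _ _ _ _ => 0
  | out _ _ => 0
  | seq c d => max (depth κ c) (depth κ d)
  | ite _ c d => max (depth κ c) (depth κ d)
  | loop κ' _ _ c => depth κ c + if κ = κ' then 1 else 0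

end Cmd

/-! ### Compilation of expressions -/

/-- The temporary registers. -/
def tmp (d : ℕ) : ℕ := 2 * d + 1

/-- The register of a variable. -/
def Var.reg (x : Var) : ℕ := 2 * x.ctorIdx

@[simp] theorem tmp_inj {d e : ℕ} : tmp d = tmp e ↔ d = e := by unfold tmp; omega
-- Temporaries occupy the odd registers, variables the even ones.
@[simp] theorem tmp_ne_reg (d : ℕ) (x : Var) : tmp d ≠ x.reg := by unfold tmp Var.reg; omega
@[simp] theorem reg_ne_tmp (d : ℕ) (x : Var) : x.reg ≠ tmp d := by unfold tmp Var.reg; omega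
@[simp] theorem Var.reg_inj {x y : Var} : x.reg = y.reg ↔ x = y := by
  refine ⟨fun h => ?_, fun h => h ▸ rfl⟩
  have h' : x.ctorIdx = y.ctorIdx := by unfold Var.reg at h; omega
  rw [← Var.ofNat_ctorIdx x, ← Var.ofNat_ctorIdx y, h']

/-- Program `P` halts at cost at most `k` operations on integers of at most `m` bits, in a state
that satisfies `Q`. -/
def RT (m : ℕ) (P : Prog) (σ : State) (k : ℕ) (Q : State → Prop) : Prop :=
  ∃ σ' t, Runs P σ σ' t ∧ t ≤ k * (2 * (m + 1)) ∧ Q σ'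

theorem bits_le {m : ℕ} {a : ℤ} (h : a.natAbs < 2 ^ m) : bits a ≤ m + 1 := by
  unfold bits; have := Nat.size_le.2 h; omega

namespace RT

variable {m k l : ℕ} {P P' : Prog} {σ : State} {Q R : State → Prop} {x y z : ℕ}

theorem mono (h : RT m P σ k Q) {m' k' : ℕ} (hm : m ≤ m') (hk : k ≤ k')
    (hQ : ∀ σ', Q σ' → R σ') : RT m' P σ k' R := by
  obtain ⟨σ', t, h1, h2, h3⟩ := h
  exact ⟨σ', t, h1, h2.trans (by gcongr), hQ _ h3⟩

theorem seq (h : RT m P σ k R) (h' : ∀ σ', R σ' → RT m P' σ' l Q) :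
    RT m (.seq P P') σ (k + l) Q := by
  obtain ⟨σ', t, h1, h2, h3⟩ := h
  obtain ⟨σ'', t', h1', h2', h3'⟩ := h' _ h3
  exact ⟨σ'', _, .seq h1 h1', by rw [add_mul]; omega, h3'⟩

theorem seq_le {K : ℕ} (hK : k + l ≤ K) (h : RT m P σ k R) (h' : ∀ σ', R σ' → RT m P' σ' l Q) :
    RT m (.seq P P') σ K Q := (seq h h').mono le_rfl hK fun _ h => h

theorem const {a : ℤ} (ha : a.natAbs < 2 ^ m) (h : Q (σ.setReg x a)) : RT m (.const x a) σ 1 Q :=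
  ⟨_, _, .const x a σ, by have := bits_le ha; omega, h⟩

theorem add (hy : (σ.reg y).natAbs < 2 ^ m) (hz : (σ.reg z).natAbs < 2 ^ m)
    (h : Q (σ.setReg x (σ.reg y + σ.reg z))) : RT m (.add x y z) σ 1 Q :=
  ⟨_, _, .add x y z σ, by have := bits_le hy; have := bits_le hz; omega, h⟩

theorem sub (hy : (σ.reg y).natAbs < 2 ^ m) (hz : (σ.reg z).natAbs < 2 ^ m)
    (h : Q (σ.setReg x (σ.reg y - σ.reg z))) : RT m (.sub x y z) σ 1 Q :=
  ⟨_, _, .sub x y z σ, by have := bits_le hy; have := bits_le hz; omega, h⟩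

theorem load (hy : (σ.reg y).natAbs < 2 ^ m) (hz : (σ.mem (σ.reg y)).natAbs < 2 ^ m)
    (h : Q (σ.setReg x (σ.mem (σ.reg y)))) : RT m (.load x y) σ 1 Q :=
  ⟨_, _, .load x y σ, by have := bits_le hy; have := bits_le hz; omega, h⟩

theorem store (hy : (σ.reg x).natAbs < 2 ^ m) (hz : (σ.reg y).natAbs < 2 ^ m)
    (h : Q (σ.setMem (σ.reg x) (σ.reg y))) : RT m (.store x y) σ 1 Q :=
  ⟨_, _, .store x y σ, by have := bits_le hy; have := bits_le hz; omega, h⟩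

theorem ite (hx : (σ.reg x).natAbs < 2 ^ m) (h1 : 0 < σ.reg x → RT m P σ k Q)
    (h2 : ¬ 0 < σ.reg x → RT m P' σ k Q) : RT m (.ite x P P') σ (k + 1) Q := by
  have := bits_le hx
  by_cases h : 0 < σ.reg x
  · obtain ⟨σ', t, h1, h2, h3⟩ := h1 h
    exact ⟨σ', _, .ite_pos h h1, by rw [add_mul]; omega, h3⟩
  · obtain ⟨σ', t, h1, h2, h3⟩ := h2 h
    exact ⟨σ', _, .ite_neg h h1, by rw [add_mul]; omega, h3⟩

/-- A loop whose measure `f` decreases. -/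
theorem loop (I : ℕ → State → Prop) (hx : ∀ f σ, I f σ → (σ.reg x).natAbs < 2 ^ m)
    (h0 : ∀ σ, I 0 σ → ¬ 0 < σ.reg x)
    (hI : ∀ f σ, I (f + 1) σ → 0 < σ.reg x → RT m P σ k (I f))
    (hQ : ∀ f σ, I f σ → ¬ 0 < σ.reg x → Q σ) (f : ℕ) (σ : State) (h : I f σ) :
    RT m (.loop x P) σ (f * (k + 1) + 1) Q := by
  induction f generalizing σ with
  | zero =>
    exact ⟨σ, _, .loop_neg (h0 σ h), by have := bits_le (hx _ _ h); omega, hQ _ _ h (h0 σ h)⟩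
  | succ f ih =>
    have hb := bits_le (hx _ _ h)
    by_cases hp : 0 < σ.reg x
    · obtain ⟨σ', t, h1, h2, h3⟩ := hI f σ h hp
      obtain ⟨σ'', t', h1', h2', h3'⟩ := ih σ' h3
      refine ⟨σ'', _, .loop_pos hp h1 h1', ?_, h3'⟩
      have : ((f + 1) * (k + 1) + 1) * (2 * (m + 1)) =
        (f * (k + 1) + 1) * (2 * (m + 1)) + k * (2 * (m + 1)) + 2 * (m + 1) := by ring
      omega
    · refine ⟨σ, _, .loop_neg hp, ?_, hQ _ _ h hp⟩
      nlinarith [Nat.zero_le ((f + 1) * (k + 1))]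

theorem const_seq {a : ℤ} (ha : a.natAbs < 2 ^ m) (h : RT m P (σ.setReg x a) k Q) :
    RT m (.seq (.const x a) P) σ (k + 1) Q := Nat.add_comm k 1 ▸ seq (R := (· = σ.setReg x a)) (const ha rfl) (by rintro _ rfl; exact h)

theorem add_seq (hy : (σ.reg y).natAbs < 2 ^ m) (hz : (σ.reg z).natAbs < 2 ^ m)
    (h : RT m P (σ.setReg x (σ.reg y + σ.reg z)) k Q) :
    RT m (.seq (.add x y z) P) σ (k + 1) Q :=
  Nat.add_comm k 1 ▸ seq (R := (· = σ.setReg x (σ.reg y + σ.reg z))) (add hy hz rfl) (by rintro _ rfl; exact h)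

theorem sub_seq (hy : (σ.reg y).natAbs < 2 ^ m) (hz : (σ.reg z).natAbs < 2 ^ m)
    (h : RT m P (σ.setReg x (σ.reg y - σ.reg z)) k Q) :
    RT m (.seq (.sub x y z) P) σ (k + 1) Q :=
  Nat.add_comm k 1 ▸ seq (R := (· = σ.setReg x (σ.reg y - σ.reg z))) (sub hy hz rfl) (by rintro _ rfl; exact h)

end RT

/-- Multiplication: `tmp d := tmp d * tmp (d + 1)`. -/
def mulProg (d : ℕ) : Prog :=
  .seq (.const (tmp (d + 2)) 0) <| .seq
    (.loop (tmp (d + 1)) <|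
      .seq (.const (tmp (d + 3)) 1) <|
      .seq (.const (tmp (d + 4)) 0) <|
      .seq (.add (tmp (d + 4)) (tmp (d + 4)) (tmp d)) <|
      .seq (.sub (tmp (d + 5)) (tmp (d + 1)) (tmp (d + 3))) <|
      .seq
        (.loop (tmp (d + 5)) <|
          .seq (.add (tmp (d + 3)) (tmp (d + 3)) (tmp (d + 3))) <|
          .seq (.add (tmp (d + 4)) (tmp (d + 4)) (tmp (d + 4))) <|
          .seq (.const (tmp (d + 5)) 1) <|
          .seq (.sub (tmp (d + 5)) (tmp (d + 5)) (tmp (d + 3))) <|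
          .seq (.sub (tmp (d + 5)) (tmp (d + 5)) (tmp (d + 3))) <|
          .add (tmp (d + 5)) (tmp (d + 5)) (tmp (d + 1))) <|
      .seq (.add (tmp (d + 2)) (tmp (d + 2)) (tmp (d + 4))) <|
      .sub (tmp (d + 1)) (tmp (d + 1)) (tmp (d + 3))) <|
  .seq (.const (tmp d) 0) <| .add (tmp d) (tmp d) (tmp (d + 2))

/-- The states agree on the memory and on all but the temporary registers from `d` on. -/
def Same (d : ℕ) (σ σ' : State) : Prop :=
  σ'.mem = σ.mem ∧ ∀ r, (∀ e, d ≤ e → r ≠ tmp e) → σ'.reg r = σ.reg r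

theorem Same.refl (d : ℕ) (σ : State) : Same d σ σ := ⟨rfl, fun _ _ => rfl⟩

theorem Same.trans {d : ℕ} {σ σ' σ'' : State} (h : Same d σ σ') (h' : Same d σ' σ'') :
    Same d σ σ'' := ⟨h'.1.trans h.1, fun r hr => (h'.2 r hr).trans (h.2 r hr)⟩

theorem Same.of_le {d e : ℕ} {σ σ' : State} (h : Same d σ σ') (hd : e ≤ d) : Same e σ σ' :=
  ⟨h.1, fun r hr => h.2 r fun _ h' => hr _ (hd.trans h')⟩

theorem Same.set {d e : ℕ} {σ σ' : State} (h : Same d σ σ') (he : d ≤ e) (a : ℤ) :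
    Same d σ (σ'.setReg (tmp e) a) :=
  ⟨h.1, fun r hr => by simp [State.setReg, hr e he, h.2 r hr]⟩

theorem Same.tmp {d e : ℕ} {σ σ' : State} (h : Same d σ σ') (he : e < d) :
    σ'.reg (tmp e) = σ.reg (tmp e) := h.2 _ fun f hf => by simp; omega

theorem Same.var {d : ℕ} {σ σ' : State} (h : Same d σ σ') (x : Var) :
    σ'.reg x.reg = σ.reg x.reg := h.2 _ fun f hf => by simp

@[simp] theorem State.setReg_reg (σ : State) (x y : ℕ) (a : ℤ) :
    (σ.setReg x a).reg y = if y = x then a else σ.reg y := by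
  simp [State.setReg, Function.update_apply]
@[simp] theorem State.setReg_mem (σ : State) (x : ℕ) (a : ℤ) : (σ.setReg x a).mem = σ.mem := rfl

theorem mul_lt_pow {m a b : ℕ} (ha : a < 2 ^ m) (hb : b < 2 ^ m) : a * b < 2 ^ (2 * m) := by
  rw [two_mul, pow_add]; exact Nat.mul_lt_mul'' ha hb

theorem mulProg_spec {m a b d : ℕ} {σ : State} (ha : a < 2 ^ m) (hb : b < 2 ^ m)
    (h1 : σ.reg (tmp d) = a) (h2 : σ.reg (tmp (d + 1)) = b) :
    RT (2 * m + 2) (mulProg d) σ (20 * (m + 1) ^ 2)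
      fun σ' => Same d σ σ' ∧ σ'.reg (tmp d) = (a * b : ℕ) := by
  have hM : (2 : ℕ) ^ m ≤ 2 ^ (2 * m) := Nat.pow_le_pow_right (by norm_num) (by omega)
  have hM2 : (2 : ℕ) ^ (2 * m + 2) = 4 * 2 ^ (2 * m) := by rw [pow_add]; ring
  have hM1 : (1 : ℕ) ≤ 2 ^ m := Nat.one_le_two_pow
  have small : ∀ u v : ℕ, u ≤ a → v ≤ b → u * v < 2 ^ (2 * m) := fun u v hu hv =>
    mul_lt_pow (hu.trans_lt ha) (hv.trans_lt hb)
  -- The inner loop doubles `p` and `a * p` until `p ≤ c < 2 * p`. Its test register holds `c - 2 *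
  -- p + 1`, which is positive exactly as long as `2 * p ≤ c`.
  have inner : ∀ (r c : ℕ), r ≤ a * b → 0 < c → c ≤ b → ∀ σ₁ : State, Same d σ σ₁ →
      σ₁.reg (tmp d) = a → σ₁.reg (tmp (d + 1)) = c → σ₁.reg (tmp (d + 2)) = r →
      σ₁.reg (tmp (d + 3)) = 1 → σ₁.reg (tmp (d + 4)) = a → σ₁.reg (tmp (d + 5)) = (c : ℤ) - 1 →
      RT (2 * m + 2) (.loop (tmp (d + 5)) <|
          .seq (.add (tmp (d + 3)) (tmp (d + 3)) (tmp (d + 3))) <|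
          .seq (.add (tmp (d + 4)) (tmp (d + 4)) (tmp (d + 4))) <|
          .seq (.const (tmp (d + 5)) 1) <|
          .seq (.sub (tmp (d + 5)) (tmp (d + 5)) (tmp (d + 3))) <|
          .seq (.sub (tmp (d + 5)) (tmp (d + 5)) (tmp (d + 3))) <|
          .add (tmp (d + 5)) (tmp (d + 5)) (tmp (d + 1))) σ₁ (m * (6 + 1) + 1)
        fun σ₂ => Same d σ σ₂ ∧ σ₂.reg (tmp d) = a ∧ σ₂.reg (tmp (d + 1)) = c ∧
          σ₂.reg (tmp (d + 2)) = r ∧ ∃ p : ℕ, 0 < p ∧ p ≤ c ∧ c < 2 * p ∧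
            σ₂.reg (tmp (d + 3)) = p ∧ σ₂.reg (tmp (d + 4)) = (a * p : ℕ) := by
    intro r c hr hc hcb σ₁ hs g0 g1 g2 g3 g4 g5
    refine RT.loop (fun f σ₂ => Same d σ σ₂ ∧ σ₂.reg (tmp d) = a ∧ σ₂.reg (tmp (d + 1)) = c ∧
          σ₂.reg (tmp (d + 2)) = r ∧ ∃ p : ℕ, 0 < p ∧ p ≤ c ∧ c < p * 2 ^ (f + 1) ∧
            σ₂.reg (tmp (d + 3)) = p ∧ σ₂.reg (tmp (d + 4)) = (a * p : ℕ) ∧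
            σ₂.reg (tmp (d + 5)) = (c : ℤ) - 2 * p + 1) ?_ ?_ ?_ ?_ m σ₁
        ⟨hs, g0, g1, g2, 1, one_pos, hc, ?_, by simpa using g3, by simpa using g4, by
          rw [g5]; push_cast; ring⟩
    · rintro f σ₂ ⟨-, -, -, -, p, hp, hpc, -, -, -, h5⟩
      rw [h5]; omega
    · rintro σ₂ ⟨-, -, -, -, p, hp, hpc, hlt, -, -, h5⟩
      rw [h5]; simp only [zero_add, pow_one] at hlt; omega
    · rintro f σ₂ ⟨hs2, h0, h1', h2', p, hp, hpc, hlt, h3, h4, h5⟩ hpos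
      rw [h5] at hpos
      have hap := small a p le_rfl (hpc.trans hcb)
      refine RT.add_seq (by rw [h3, Int.natAbs_natCast]; omega)
        (by rw [h3, Int.natAbs_natCast]; omega) ?_
      refine RT.add_seq (by simp [h4, -Nat.cast_mul]; omega) (by simp [h4, -Nat.cast_mul]; omega) ?_
      refine RT.const_seq (by simp) ?_
      refine RT.sub_seq (by simp) (by simp [h3]; omega) ?_
      refine RT.sub_seq (by simp [h3]; omega) (by simp [h3]; omega) ?_
      refine RT.add (by simp [h3]; omega) (by simp [h1']; omega) ?_
      refine ⟨?_, by simp [h0], by simp [h1'], by simp [h2'], 2 * p, by omega, by omega, ?_, ?_, ?_, ?_⟩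
      · exact (((((hs2.set (by omega) _).set (by omega) _).set (by omega) _).set (by omega) _).set
          (by omega) _).set (by omega) _
      · rw [pow_succ] at hlt; linarith
      · simp [h3]; ring
      · simp [h4]; ring
      · simp [h3, h1']; ring
    · rintro f σ₂ ⟨hs2, h0, h1', h2', p, hp, hpc, hlt, h3, h4, h5⟩ hpos
      rw [h5] at hpos
      exact ⟨hs2, h0, h1', h2', p, hp, hpc, by omega, h3, h4⟩
    · rw [one_mul, pow_succ]; omega
  -- The outer loop keeps `r + a * c = a * b` and replaces `c` by `c - p`. This removes the leading
  -- binary digit of `c`, so `c < 2 ^ f` serves as the measure and `m` rounds suffice.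
  have outer := RT.loop (m := 2 * m + 2) (x := tmp (d + 1))
    (fun f σ₁ => Same d σ σ₁ ∧ σ₁.reg (tmp d) = a ∧ ∃ c r : ℕ, c ≤ b ∧ c < 2 ^ f ∧
      r + a * c = a * b ∧ σ₁.reg (tmp (d + 1)) = c ∧ σ₁.reg (tmp (d + 2)) = r)
    (k := m * 7 + 7)
    (P := .seq (.const (tmp (d + 3)) 1) <|
      .seq (.const (tmp (d + 4)) 0) <|
      .seq (.add (tmp (d + 4)) (tmp (d + 4)) (tmp d)) <|
      .seq (.sub (tmp (d + 5)) (tmp (d + 1)) (tmp (d + 3))) <|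
      .seq
        (.loop (tmp (d + 5)) <|
          .seq (.add (tmp (d + 3)) (tmp (d + 3)) (tmp (d + 3))) <|
          .seq (.add (tmp (d + 4)) (tmp (d + 4)) (tmp (d + 4))) <|
          .seq (.const (tmp (d + 5)) 1) <|
          .seq (.sub (tmp (d + 5)) (tmp (d + 5)) (tmp (d + 3))) <|
          .seq (.sub (tmp (d + 5)) (tmp (d + 5)) (tmp (d + 3))) <|
          .add (tmp (d + 5)) (tmp (d + 5)) (tmp (d + 1))) <|
      .seq (.add (tmp (d + 2)) (tmp (d + 2)) (tmp (d + 4))) <|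
      .sub (tmp (d + 1)) (tmp (d + 1)) (tmp (d + 3)))
    (Q := fun σ₁ => Same d σ σ₁ ∧ σ₁.reg (tmp (d + 2)) = (a * b : ℕ)) ?_ ?_ ?_ ?_
  · have hab := small a b le_rfl le_rfl
    refine RT.mono (m := 2 * m + 2) (k := m * (m * 7 + 7 + 1) + 1 + 2 + 1) ?_ le_rfl ?_
      fun _ h => h
    · refine RT.const_seq (by simp) ?_
      refine RT.seq_le (k := m * (m * 7 + 7 + 1) + 1) (l := 2) le_rfl (outer m _ (⟨(Same.refl _ _).set (Nat.le_add_right _ _) _, ?_, b, 0, le_rfl, hb,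
        by simp, ?_, ?_⟩)) ?_
      · simp [h1]
      · simp [h2]
      · simp
      rintro σ₁ ⟨hs, hr⟩
      refine RT.const_seq (by simp) ?_
      refine RT.add (by simp) (by simp [hr, -Nat.cast_mul]; omega) ⟨?_, by simp [hr]⟩
      exact (hs.set le_rfl _).set le_rfl _
    · ring_nf; nlinarith
  · rintro f σ₁ ⟨-, -, c, r, hc, -, -, h, -⟩
    rw [h]; omega
  · rintro σ₁ ⟨-, -, c, r, hc, hlt, -, h, -⟩
    rw [h]; simp at hlt; omega
  · rintro f σ₁ ⟨hs, h0, c, r, hc, hlt, hr, hc', hr'⟩ hpos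
    rw [hc'] at hpos
    have hab := small a b le_rfl le_rfl
    refine RT.const_seq (by simp) ?_
    refine RT.const_seq (by simp) ?_
    refine RT.add_seq (by simp) (by simp [h0]; omega) ?_
    refine RT.sub_seq (by simp [hc']; omega) (by simp) ?_
    refine RT.seq_le (k := m * (6 + 1) + 1) (l := 2) (by omega) (inner r c (by omega) (by omega) hc _ (?_ : Same d σ _) ?_ ?_ ?_ ?_ ?_ ?_) ?_
    · exact (((hs.set (by omega) _).set (by omega) _).set (by omega) _).set (by omega) _
    iterate 6 simp [h0, hc', hr']
    rintro σ₂ ⟨hs2, g0, g1, g2, p, hp, hpc, hpl, g3, g4⟩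
    have hap := small a p le_rfl (hpc.trans hc)
    have e1 : a * c = a * (c - p) + a * p := by rw [← mul_add]; congr 1; omega
    refine RT.add_seq (by rw [g2]; omega) (by rw [g4]; omega) ?_
    refine RT.sub (by simp [g1]; omega) (by simp [g3]; omega) ⟨?_, by simp [g0], c - p, r + a * p,
      by omega, ?_, by omega, ?_, ?_⟩
    · exact (hs2.set (by omega) _).set (by omega) _
    · rw [pow_succ] at hlt; omega
    · simp [g1, g3]; omega
    · simp [g2, g4]
  · rintro f σ₁ ⟨hs, h0, c, r, hc, hlt, hr, hc', hr'⟩ hpos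
    rw [hc'] at hpos
    have : c = 0 := by omega
    subst this
    exact ⟨hs, by rw [hr']; exact_mod_cast hr⟩

/-- An injective pairing of natural numbers. -/
def pairing (x y : ℕ) : ℕ := (x + y) * (x + y) + x

/-- The value lies between (x + y)² and (x + y + 1)², the latter excluded, so it determines x + y
and then x. -/
theorem pairing_inj {x y x' y' : ℕ} (h : pairing x y = pairing x' y') : x = x' ∧ y = y' := by
  unfold pairing at h
  have h1 : x + y = x' + y' := by
    rcases lt_trichotomy (x + y) (x' + y') with h' | h' | h'
    · nlinarith
    · exact h'
    · nlinarith
  rw [h1] at h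
  omega

/-- `tmp d := pairing (tmp d) (tmp (d + 1))` -/
def pairProg (d : ℕ) : Prog :=
  .seq (.add (tmp (d + 2)) (tmp d) (tmp (d + 1))) <|
  .seq (.const (tmp (d + 3)) 0) <|
  .seq (.add (tmp (d + 3)) (tmp (d + 3)) (tmp (d + 2))) <|
  .seq (mulProg (d + 2)) <| .add (tmp d) (tmp d) (tmp (d + 2))

theorem pairing_lt {m a b : ℕ} (ha : a < 2 ^ m) (hb : b < 2 ^ m) :
    pairing a b < 2 ^ (2 * m + 3) := by
  have h : a + b < 2 ^ (m + 1) := by rw [pow_succ]; omega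
  have h' := mul_lt_pow h h
  have h3 : (2 : ℕ) ^ (2 * m + 3) = 2 * 2 ^ (2 * (m + 1)) := by rw [← pow_succ']; ring_nf
  have h4 : (2 : ℕ) ^ m ≤ 2 ^ (2 * (m + 1)) := Nat.pow_le_pow_right (by norm_num) (by omega)
  unfold pairing; omega

theorem pairProg_spec {m a b d : ℕ} {σ : State} (ha : a < 2 ^ m) (hb : b < 2 ^ m)
    (h1 : σ.reg (tmp d) = a) (h2 : σ.reg (tmp (d + 1)) = b) :
    RT (2 * m + 4) (pairProg d) σ (20 * (m + 2) ^ 2 + 4)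
      fun σ' => Same d σ σ' ∧ σ'.reg (tmp d) = (pairing a b : ℕ) := by
  have h : a + b < 2 ^ (m + 1) := by rw [pow_succ]; omega
  have h3 : (2 : ℕ) ^ (m + 1) ≤ 2 ^ (2 * m + 4) := Nat.pow_le_pow_right (by norm_num) (by omega)
  have h4 := mul_lt_pow h h
  have h5 : (2 : ℕ) ^ (2 * (m + 1)) ≤ 2 ^ (2 * m + 4) :=
    Nat.pow_le_pow_right (by norm_num) (by omega)
  refine RT.mono (k := 20 * (m + 2) ^ 2 + 1 + 1 + 1 + 1) ?_ le_rfl le_rfl fun _ h => h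
  refine RT.add_seq (by rw [h1]; omega) (by rw [h2]; omega) ?_
  refine RT.const_seq (by simp) ?_
  refine RT.add_seq (by simp) (by simp [h1, h2]; omega) ?_
  refine RT.seq (RT.mono (mulProg_spec (a := a + b) (b := a + b) h h ?_ ?_)
    (by omega) le_rfl (fun _ h => h)) ?_
  · simp [h1, h2]
  · simp [h1, h2]
  rintro σ' ⟨hs, hr⟩
  refine RT.add ?_ ?_ ⟨?_, ?_⟩
  · rw [hs.tmp (by omega)]; simp [h1]; omega
  · rw [hr]; omega
  · refine Same.set (Same.trans ?_ (hs.of_le (by omega))) le_rfl _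
    exact (((Same.refl d σ).set (by omega) _).set (by omega) _).set (by omega) _
  · simp only [State.setReg_reg, if_true, hr, hs.tmp (show d < d + 2 by omega)]
    simp [h1, pairing]; ring

/-- The address of an array cell. -/
def addr (A : Arr) (i j : ℕ) : ℤ := -1 - (pairing A.ctorIdx (pairing i j) : ℕ)

theorem addr_inj {A A' : Arr} {i i' j j' : ℕ} (h : addr A i j = addr A' i' j') :
    A = A' ∧ i = i' ∧ j = j' := by
  unfold addr at h
  obtain ⟨h1, h2⟩ := pairing_inj (Nat.cast_injective (R := ℤ) (sub_right_injective h))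
  refine ⟨?_, pairing_inj h2⟩
  rw [← Arr.ofNat_ctorIdx A, ← Arr.ofNat_ctorIdx A', h1]

/-- Arrays live at negative addresses, so they never collide with the input and the output. -/
theorem addr_neg (A : Arr) (i j : ℕ) : addr A i j < 0 := by unfold addr; omega

/-- The state of the machine represents the state of the bounded loop language. -/
structure Sim (s : St) (σ : State) : Prop where
  v : ∀ x : Var, σ.reg x.reg = s.v x
  a : ∀ A i j, σ.mem (addr A i j) = s.a A i j
  io : ∀ j : ℕ, σ.mem j = s.io j

theorem Sim.same {s : St} {σ σ' : State} {d : ℕ} (h : Sim s σ) (h' : Same d σ σ') : Sim s σ' :=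
  ⟨fun x => by rw [h'.var, h.v], fun A i j => by rw [h'.1, h.a], fun j => by rw [h'.1, h.io]⟩

/-- All values are at most `B`. -/
structure Bdd (B : ℕ) (s : St) : Prop where
  v : ∀ x, s.v x ≤ B
  a : ∀ A i j, s.a A i j ≤ B
  io : ∀ j, (s.io j).natAbs ≤ B

/-- `tmp d := addr A (tmp d) (tmp (d + 1))` -/
def addrProg (A : Arr) (d : ℕ) : Prog :=
  .seq (pairProg d) <|
  .seq (.const (tmp (d + 1)) 0) <|
  .seq (.add (tmp (d + 1)) (tmp (d + 1)) (tmp d)) <|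
  .seq (.const (tmp d) A.ctorIdx) <|
  .seq (pairProg d) <|
  .seq (.const (tmp (d + 1)) (-1)) <|
  .sub (tmp d) (tmp (d + 1)) (tmp d)

theorem Arr.ctorIdx_lt (A : Arr) : A.ctorIdx < 2 ^ 4 := by cases A <;> decide

theorem addrProg_spec {m i j d : ℕ} {A : Arr} {σ : State} (hi : i < 2 ^ m) (hj : j < 2 ^ m)
    (h1 : σ.reg (tmp d) = i) (h2 : σ.reg (tmp (d + 1)) = j) :
    RT (4 * m + 20) (addrProg A d) σ (200 * (m + 4) ^ 2)
      fun σ' => Same d σ σ' ∧ σ'.reg (tmp d) = addr A i j := by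
  have h3 := (pairing_lt hi hj).trans_le
    (Nat.pow_le_pow_right (n := 2) (by norm_num) (show 2 * m + 3 ≤ 2 * m + 4 by omega))
  have h4 : A.ctorIdx < 2 ^ (2 * m + 4) := A.ctorIdx_lt.trans_le
    (Nat.pow_le_pow_right (by norm_num) (by omega))
  have h5 : (2 : ℕ) ^ (2 * m + 4) ≤ 2 ^ (4 * m + 20) := Nat.pow_le_pow_right (by norm_num) (by omega)
  have h6 := (pairing_lt h4 h3).trans_le
    (Nat.pow_le_pow_right (n := 2) (by norm_num) (show 2 * (2 * m + 4) + 3 ≤ 4 * m + 20 by omega))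
  have h7 : (1 : ℕ) < 2 ^ (4 * m + 20) := Nat.one_lt_pow (by omega) (by norm_num)
  refine RT.mono (m := 4 * m + 20) (k := (20 * (m + 2) ^ 2 + 4) +
    ((20 * (2 * m + 4 + 2) ^ 2 + 4) + (1 + 1) + 1 + 1 + 1)) ?_ le_rfl
    (by ring_nf; nlinarith [Nat.zero_le (m ^ 2)]) fun _ h => h
  refine RT.seq ((pairProg_spec hi hj h1 h2).mono (by omega) le_rfl fun _ h => h) ?_
  rintro σ₁ ⟨hs, hr⟩
  refine RT.const_seq (by simp) ?_
  refine RT.add_seq (by simp) (by simp [hr, -Nat.cast_mul]; omega) ?_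
  refine RT.const_seq (by simp; omega) ?_
  refine RT.seq_le (k := 20 * (2 * m + 4 + 2) ^ 2 + 4) (l := 2) (by omega)
    (RT.mono (pairProg_spec (a := A.ctorIdx) (b := pairing i j) h4 h3 ?_ ?_)
    (show 2 * (2 * m + 4) + 4 ≤ 4 * m + 20 by omega) le_rfl fun _ h => h) ?_
  · simp
  · simp [hr]
  rintro σ₂ ⟨hs2, hr2⟩
  refine RT.const_seq (by simp) ?_
  refine RT.sub (by simp) (by simp [hr2]; omega) ⟨?_, by simp [hr2, addr]⟩
  refine ((hs.trans (Same.trans ?_ hs2)).set (by omega) _).set le_rfl _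
  exact (((Same.refl d _).set (by omega) _).set (by omega) _).set (by omega) _

/-- Replace `tmp d` by its positive part. -/
def posProg (d : ℕ) : Prog := .ite (tmp d) (.const (tmp (d + 1)) 0) (.const (tmp d) 0)

theorem posProg_spec {m d : ℕ} {a : ℤ} {σ : State} (ha : a.natAbs < 2 ^ m) (h : σ.reg (tmp d) = a) :
    RT m (posProg d) σ 2 fun σ' => Same d σ σ' ∧ σ'.reg (tmp d) = (a.toNat : ℕ) := by
  refine RT.ite (by rwa [h]) (fun h' => RT.const (by simp) ⟨?_, ?_⟩) fun h' => RT.const (by simp)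
    ⟨?_, ?_⟩
  · exact (Same.refl d σ).set (by omega) _
  · rw [h] at h'; simp [h]; omega
  · exact (Same.refl d σ).set le_rfl _
  · rw [h] at h'; simp; omega

/-- The program that evaluates an expression into `tmp d`. -/
def Exp.comp : Exp → ℕ → Prog
  | lit n, d => .const (tmp d) n
  | var x, d => .seq (.const (tmp d) 0) (.add (tmp d) (tmp d) x.reg)
  | arr A i j, d => .seq (i.comp d) <| .seq (j.comp (d + 1)) <| .seq (addrProg A d) <|
      .load (tmp d) (tmp d)
  | add e f, d => .seq (e.comp d) <| .seq (f.comp (d + 1)) <| .add (tmp d) (tmp d) (tmp (d + 1))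
  | sub e f, d => .seq (e.comp d) <| .seq (f.comp (d + 1)) <|
      .seq (.sub (tmp d) (tmp d) (tmp (d + 1))) <| posProg d
  | mul e f, d => .seq (e.comp d) <| .seq (f.comp (d + 1)) <| mulProg d
  | ioP e, d => .seq (e.comp d) <| .seq (.load (tmp d) (tmp d)) <| posProg d
  | ioN e, d => .seq (e.comp d) <| .seq (.load (tmp d) (tmp d)) <| .seq (.const (tmp (d + 1)) 0) <|
      .seq (.sub (tmp d) (tmp (d + 1)) (tmp d)) <| posProg d

/-- The compiled expression is correct, with cost factor `C`. -/
def Exp.Good (e : Exp) (d C : ℕ) : Prop :=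
  ∀ (β B : ℕ) (s : St) (σ : State), 1 ≤ β → B < 2 ^ β → Bdd B s → Sim s σ →
    e.ev s < 2 ^ (C * β) ∧
    RT (C * β) (e.comp d) σ (C * β ^ 2) fun σ' => Same d σ σ' ∧ σ'.reg (tmp d) = e.ev s

theorem Exp.Good.then {e : Exp} {d C β B : ℕ} {s : St} {σ : State} (he : e.Good d C)
    (hβ : 1 ≤ β) (hB : B < 2 ^ β) (hs : Bdd B s) (hσ : Sim s σ) {P : Prog} {m k : ℕ}
    {Q : State → Prop} (hm : C * β ≤ m)
    (h : ∀ σ', Same d σ σ' → Sim s σ' → σ'.reg (tmp d) = e.ev s → e.ev s < 2 ^ (C * β) →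
      RT m P σ' k Q) :
    RT m (.seq (e.comp d) P) σ (C * β ^ 2 + k) Q := by
  obtain ⟨h1, h2⟩ := he β B s σ hβ hB hs hσ
  exact RT.seq (h2.mono hm le_rfl fun _ h => h) fun σ' h3 => h σ' h3.1 (hσ.same h3.1) h3.2 h1

theorem Exp.Good.then₂ {e f : Exp} {d C D β B : ℕ} {s : St} {σ : State} (he : e.Good d C)
    (hf : f.Good (d + 1) D)
    (hβ : 1 ≤ β) (hB : B < 2 ^ β) (hs : Bdd B s) (hσ : Sim s σ) {P : Prog} {m k K : ℕ}
    {Q : State → Prop} (hm : (C + D) * β ≤ m)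
    (h : ∀ σ', Same d σ σ' → Sim s σ' → σ'.reg (tmp d) = e.ev s → σ'.reg (tmp (d + 1)) = f.ev s →
      e.ev s < 2 ^ ((C + D) * β) → f.ev s < 2 ^ ((C + D) * β) → RT m P σ' k Q)
    (hK : (C + D) * β ^ 2 + k ≤ K) :
    RT m (.seq (e.comp d) (.seq (f.comp (d + 1)) P)) σ K Q := by
  refine RT.mono (he.then hβ hB hs hσ (le_trans (by gcongr; omega) hm) fun σ₁ h1 h2 h3 h4 =>
    hf.then hβ hB hs h2 (k := k) (le_trans (by gcongr; omega) hm) fun σ₂ h1' h2' h3' h4' => ?_)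
    le_rfl (le_trans (by rw [add_mul]; omega) hK) fun _ h => h
  refine h σ₂ (h1.trans (h1'.of_le (by omega))) h2' (by rw [h1'.tmp (by omega), h3]) h3' ?_ ?_
  · exact h4.trans_le (Nat.pow_le_pow_right (by norm_num) (by gcongr; omega))
  · exact h4'.trans_le (Nat.pow_le_pow_right (by norm_num) (by gcongr; omega))

theorem lt_pow_mul {B β C : ℕ} (h : B < 2 ^ β) (hC : 1 ≤ C) : B < 2 ^ (C * β) :=
  h.trans_le (Nat.pow_le_pow_right (by norm_num) (by nlinarith))

theorem addr_lt {m i j : ℕ} (A : Arr) (hi : i < 2 ^ m) (hj : j < 2 ^ m) :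
    (addr A i j).natAbs < 2 ^ (4 * m + 20) := by
  have h3 := (pairing_lt hi hj).trans_le
    (Nat.pow_le_pow_right (n := 2) (by norm_num) (show 2 * m + 3 ≤ 2 * m + 4 by omega))
  have h4 : A.ctorIdx < 2 ^ (2 * m + 4) := A.ctorIdx_lt.trans_le
    (Nat.pow_le_pow_right (by norm_num) (by omega))
  have h6 := (pairing_lt h4 h3).trans_le
    (Nat.pow_le_pow_right (n := 2) (by norm_num) (show 2 * (2 * m + 4) + 3 ≤ 4 * m + 19 by omega))
  have h7 : (2 : ℕ) ^ (4 * m + 20) = 2 * 2 ^ (4 * m + 19) := by rw [← pow_succ']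
  unfold addr; omega

/-- A cost factor that suffices for a composite expression. -/
def costFactor (E : ℕ) : ℕ := 1000 * (E + 4) ^ 2

theorem costFactor_pos (E : ℕ) : 1 ≤ costFactor E := by
  unfold costFactor; nlinarith [Nat.zero_le E, Nat.zero_le (E ^ 2)]

/-- The left side is the number of bits that suffices for the address of an array cell with indices
of `E * β` bits. -/
theorem costFactor_bits (E : ℕ) {β : ℕ} (hβ : 1 ≤ β) : 4 * (E * β) + 20 ≤ costFactor E * β := by
  unfold costFactor
  have h : 4 * E + 20 ≤ 1000 * (E + 4) ^ 2 := by nlinarith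
  calc 4 * (E * β) + 20 ≤ (4 * E + 20) * β := by nlinarith
    _ ≤ _ := by gcongr

/-- The first summand pays for the subexpressions, the second for an address computation, which is
the most expensive operation; the last covers the remaining instructions. -/
theorem costFactor_time (E : ℕ) {β : ℕ} (hβ : 1 ≤ β) :
    E * β ^ 2 + 200 * (E * β + 4) ^ 2 + 20 ≤ costFactor E * β ^ 2 := by
  unfold costFactor
  have h : E * β + 4 ≤ (E + 4) * β := by nlinarith
  have h' : (E * β + 4) ^ 2 ≤ (E + 4) ^ 2 * β ^ 2 := by rw [← mul_pow]; gcongr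
  have h1 : 1 ≤ β ^ 2 := Nat.one_le_pow _ _ hβ
  have h2 : E ≤ (E + 4) ^ 2 := by nlinarith
  have h3 : E * β ^ 2 ≤ (E + 4) ^ 2 * β ^ 2 := by gcongr
  have h4 : 16 ≤ (E + 4) ^ 2 := by nlinarith
  have h5 : 16 * 1 ≤ (E + 4) ^ 2 * β ^ 2 := by gcongr
  rw [mul_assoc]; omega

/-- The factor may grow quickly with the expression, but it does not depend on the state. Only
finitely many expressions occur in a program, so this is a constant. -/
theorem Exp.exists_good (e : Exp) (d : ℕ) : ∃ C, e.Good d C := by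
  induction e generalizing d with
  | lit n =>
    refine ⟨n + 1, fun β B s σ hβ hB hs hσ => ?_⟩
    have h1 : n < 2 ^ ((n + 1) * β) := Nat.lt_two_pow_self.trans_le
      (Nat.pow_le_pow_right (by norm_num) (by nlinarith))
    refine ⟨h1, RT.mono (RT.const (by simpa using h1) ⟨(Same.refl d σ).set le_rfl _, ?_⟩) le_rfl
      (by nlinarith [Nat.zero_le n]) fun _ h => h⟩
    simp [Exp.ev]
  | var x =>
    refine ⟨2, fun β B s σ hβ hB hs hσ => ?_⟩
    have h1 := lt_pow_mul ((hs.v x).trans_lt hB) one_le_two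
    refine ⟨h1, RT.mono (k := 2) ?_ le_rfl (by nlinarith) fun _ h => h⟩
    refine RT.const_seq (by simp) ?_
    refine RT.add (by simp) (by simpa [hσ.v] using h1) ⟨?_, by simp [hσ.v]⟩
    exact ((Same.refl d σ).set le_rfl _).set le_rfl _
  | arr A i j hi hj =>
    obtain ⟨C, hC⟩ := hi d
    obtain ⟨D, hD⟩ := hj (d + 1)
    refine ⟨costFactor (C + D), fun β B s σ hβ hB hs hσ => ?_⟩
    have hm := costFactor_bits (C + D) hβ
    have ht := costFactor_time (C + D) hβ
    refine ⟨lt_pow_mul ((hs.a _ _ _).trans_lt hB) (costFactor_pos _), ?_⟩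
    refine hC.then₂ hD hβ hB hs hσ (by omega)
      (k := 200 * ((C + D) * β + 4) ^ 2 + 1) (fun σ₁ h1 h2 h3 h4 h5 h6 => ?_) (by omega)
    refine RT.seq ((addrProg_spec h5 h6 h3 h4).mono hm le_rfl fun _ h => h) ?_
    rintro σ₂ ⟨h7, h8⟩
    have h9 := (h2.same h7).a A (i.ev s) (j.ev s)
    rw [← h8] at h9
    refine RT.load ?_ ?_ ⟨(h1.trans h7).set le_rfl _, by simp [h9]⟩
    · rw [h8]; exact (addr_lt A h5 h6).trans_le (Nat.pow_le_pow_right (by norm_num) hm)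
    · rw [h9, Int.natAbs_natCast]
      exact lt_pow_mul ((hs.a _ _ _).trans_lt hB) (costFactor_pos _)
  | add e f he hf =>
    obtain ⟨C, hC⟩ := he d
    obtain ⟨D, hD⟩ := hf (d + 1)
    refine ⟨costFactor (C + D), fun β B s σ hβ hB hs hσ => ?_⟩
    have hm := costFactor_bits (C + D) hβ
    have ht := costFactor_time (C + D) hβ
    have hp : (2 : ℕ) ^ ((C + D) * β) * 2 ≤ 2 ^ (costFactor (C + D) * β) := by
      rw [← pow_succ]; exact Nat.pow_le_pow_right (by norm_num) (by omega)
    have b1 : e.ev s < 2 ^ ((C + D) * β) := (hC β B s σ hβ hB hs hσ).1.trans_le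
      (Nat.pow_le_pow_right (by norm_num) (by gcongr; omega))
    have b2 : f.ev s < 2 ^ ((C + D) * β) := (hD β B s σ hβ hB hs hσ).1.trans_le
      (Nat.pow_le_pow_right (by norm_num) (by gcongr; omega))
    refine ⟨by simp only [Exp.ev]; omega, hC.then₂ hD hβ hB hs hσ (by omega) (k := 1) (fun σ₁ h1 h2 h3 h4 h5 h6 => ?_)
      (by omega)⟩
    refine RT.add (by rw [h3]; omega) (by rw [h4]; omega) ⟨h1.set le_rfl _, ?_⟩
    simp [h3, h4, Exp.ev]
  | sub e f he hf =>
    obtain ⟨C, hC⟩ := he d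
    obtain ⟨D, hD⟩ := hf (d + 1)
    refine ⟨costFactor (C + D), fun β B s σ hβ hB hs hσ => ?_⟩
    have hm := costFactor_bits (C + D) hβ
    have ht := costFactor_time (C + D) hβ
    have hp : (2 : ℕ) ^ ((C + D) * β) ≤ 2 ^ (costFactor (C + D) * β) :=
      Nat.pow_le_pow_right (by norm_num) (by omega)
    obtain ⟨b1, -⟩ := hC β B s σ hβ hB hs hσ
    have b1' : e.ev s < 2 ^ ((C + D) * β) := b1.trans_le
      (Nat.pow_le_pow_right (by norm_num) (by gcongr; omega))
    refine ⟨(Nat.sub_le _ _).trans_lt (b1'.trans_le hp), hC.then₂ hD hβ hB hs hσ (by omega)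
      (k := 2 + 1) (fun σ₁ h1 h2 h3 h4 h5 h6 => ?_) (by omega)⟩
    refine RT.sub_seq (by rw [h3]; omega) (by rw [h4]; omega) ?_
    refine (posProg_spec (a := (e.ev s : ℤ) - f.ev s) (by omega) ?_).mono le_rfl le_rfl ?_
    · simp [h3, h4]
    · rintro σ₂ ⟨h7, h8⟩
      refine ⟨(h1.set le_rfl _).trans h7, ?_⟩
      rw [h8]; simp [Exp.ev]
  | mul e f he hf =>
    obtain ⟨C, hC⟩ := he d
    obtain ⟨D, hD⟩ := hf (d + 1)
    refine ⟨costFactor (C + D), fun β B s σ hβ hB hs hσ => ?_⟩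
    have hm := costFactor_bits (C + D) hβ
    have ht := costFactor_time (C + D) hβ
    have b1 : e.ev s < 2 ^ ((C + D) * β) := (hC β B s σ hβ hB hs hσ).1.trans_le
      (Nat.pow_le_pow_right (by norm_num) (by gcongr; omega))
    have b2 : f.ev s < 2 ^ ((C + D) * β) := (hD β B s σ hβ hB hs hσ).1.trans_le
      (Nat.pow_le_pow_right (by norm_num) (by gcongr; omega))
    refine ⟨(mul_lt_pow b1 b2).trans_le (Nat.pow_le_pow_right (by norm_num) (by omega)),
      hC.then₂ hD hβ hB hs hσ (by omega) (k := 20 * ((C + D) * β + 1) ^ 2)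
      (fun σ₁ h1 h2 h3 h4 h5 h6 => ?_) (by nlinarith)⟩
    refine (mulProg_spec h5 h6 h3 h4).mono (by omega) le_rfl ?_
    rintro σ₂ ⟨h7, h8⟩
    exact ⟨h1.trans h7, h8⟩
  | ioP e he =>
    obtain ⟨C, hC⟩ := he d
    refine ⟨costFactor C, fun β B s σ hβ hB hs hσ => ?_⟩
    have hm := costFactor_bits C hβ
    have ht := costFactor_time C hβ
    have hp : (2 : ℕ) ^ (C * β) ≤ 2 ^ (costFactor C * β) :=
      Nat.pow_le_pow_right (by norm_num) (by omega)
    have hio := lt_pow_mul ((hs.io (e.ev s)).trans_lt hB) (costFactor_pos C)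
    refine ⟨by simp only [Exp.ev]; omega,
      (hC.then hβ hB hs hσ (k := 3) (by omega) fun σ₁ h1 h2 h3 h4 => ?_).mono le_rfl (by omega)
        fun _ h => h⟩
    have h9 := h2.io (e.ev s)
    rw [← h3] at h9
    refine RT.seq_le (k := 1) (l := 2) le_rfl (RT.load (by rw [h3]; omega) (by rw [h9]; exact hio)
      (Q := (· = σ₁.setReg (tmp d) (s.io (e.ev s)))) (by rw [h9])) ?_
    rintro _ rfl
    refine (posProg_spec hio (by simp)).mono le_rfl le_rfl ?_
    rintro σ₂ ⟨h7, h8⟩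
    exact ⟨(h1.set le_rfl _).trans h7, by simp [h8]⟩
  | ioN e he =>
    obtain ⟨C, hC⟩ := he d
    refine ⟨costFactor C, fun β B s σ hβ hB hs hσ => ?_⟩
    have hm := costFactor_bits C hβ
    have ht := costFactor_time C hβ
    have hp : (2 : ℕ) ^ (C * β) ≤ 2 ^ (costFactor C * β) :=
      Nat.pow_le_pow_right (by norm_num) (by omega)
    have hio := lt_pow_mul ((hs.io (e.ev s)).trans_lt hB) (costFactor_pos C)
    refine ⟨by simp only [Exp.ev]; omega,
      (hC.then hβ hB hs hσ (k := 5) (by omega) fun σ₁ h1 h2 h3 h4 => ?_).mono le_rfl (by omega)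
        fun _ h => h⟩
    have h9 := h2.io (e.ev s)
    rw [← h3] at h9
    refine RT.seq_le (k := 1) (l := 4) le_rfl (RT.load (by rw [h3]; omega) (by rw [h9]; exact hio)
      (Q := (· = σ₁.setReg (tmp d) (s.io (e.ev s)))) (by rw [h9])) ?_
    rintro _ rfl
    refine RT.const_seq (by simp) ?_
    refine RT.sub_seq (by simp) (by simpa using hio) ?_
    refine (posProg_spec (a := -s.io (e.ev s)) (by omega) (by simp)).mono le_rfl le_rfl ?_
    rintro σ₂ ⟨h7, h8⟩
    refine ⟨Same.trans ?_ h7, by simp [h8]⟩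
    exact (((h1.set le_rfl _).set (by omega) _).set le_rfl _)

/-! ### Compilation of commands -/

theorem Bdd.set {B : ℕ} {s : St} (h : Bdd B s) (x : Var) {n : ℕ} (hn : n ≤ B) : Bdd B (s.set x n) :=
  ⟨fun y => by rw [St.set_v]; split_ifs; exacts [hn, h.v y], h.a, h.io⟩

theorem Bdd.put {B : ℕ} {s : St} (h : Bdd B s) (A : Arr) (i j : ℕ) {n : ℕ} (hn : n ≤ B) :
    Bdd B (s.put A i j n) := by
  refine ⟨h.v, fun A' i' j' => ?_, h.io⟩
  rw [St.put_a]
  split_ifs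
  · by_cases hi : i' = i
    · subst hi
      by_cases hj : j' = j
      · subst hj; simpa using hn
      · simpa [hj] using h.a _ _ _
    · simpa [hi] using h.a _ _ _
  · exact h.a _ _ _

theorem Bdd.out {B : ℕ} {s : St} (h : Bdd B s) (i : ℕ) {n : ℕ} (hn : n ≤ B) :
    Bdd B (s.out i n) := by
  refine ⟨h.v, h.a, fun j => ?_⟩
  rw [St.out_io, Function.update_apply]
  split_ifs
  exacts [by simpa using hn, h.io j]

theorem Bdd.iter {B n : ℕ} {s : St} {f : St → St} {x : Var} (h : Bdd B s) (_hn : n ≤ B)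
    (hf : ∀ i < n, Bdd B (Cmd.iter f x s i) → Bdd B (f ((Cmd.iter f x s i).set x i))) :
    ∀ i ≤ n, Bdd B (Cmd.iter f x s i) := by
  intro i
  induction i with
  | zero => exact fun _ => h
  | succ i ih => exact fun hi => hf i hi (ih (by omega))

theorem Bdd.ex {L : Lim} {c : Cmd} {s : St} (h : Bdd L.B s) (hc : c.Ok L s) :
    Bdd L.B (c.ex s) := by
  induction c generalizing s with
  | skip => exact h
  | set x e => exact h.set x hc
  | put A i j e => exact h.put A _ _ hc
  | out i e => exact h.out _ hc
  | seq c d ihc ihd => exact ihd (ihc h hc.1) hc.2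
  | ite e c d ihc ihd =>
    rw [Cmd.ex]; rw [Cmd.Ok] at hc
    split_ifs at hc ⊢
    exacts [ihc h hc, ihd h hc]
  | loop κ x e c ih =>
    exact Bdd.iter h hc.2.1 (fun i hi hb => ih (hb.set x (hi.le.trans hc.2.1)) (hc.2.2 i hi)) _ le_rfl

theorem Sim.set {s : St} {σ : State} (h : Sim s σ) (x : Var) (n : ℕ) :
    Sim (s.set x n) (σ.setReg x.reg n) :=
  ⟨fun y => by by_cases hy : y = x <;> simp [hy, h.v], fun A i j => by simp [h.a],
    fun j => by simp [h.io]⟩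

theorem Sim.put {s : St} {σ : State} (h : Sim s σ) (A : Arr) (i j n : ℕ) :
    Sim (s.put A i j n) (σ.setMem (addr A i j) n) := by
  refine ⟨h.v, fun A' i' j' => ?_, fun k => ?_⟩
  · simp only [State.setMem, Function.update_apply, St.put_a]
    by_cases hA : addr A' i' j' = addr A i j
    · obtain ⟨rfl, rfl, rfl⟩ := addr_inj hA
      simp
    · rw [if_neg hA, h.a]
      split_ifs with hA'
      · subst hA'
        by_cases hi : i' = i
        · subst hi
          have hj : j' ≠ j := by rintro rfl; exact hA rfl
          simp [hj]
        · simp [hi]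
      · rfl
  · have := addr_neg A i j
    simp only [State.setMem, Function.update_apply, St.put_io]
    rw [if_neg (by omega), h.io]

theorem Sim.out {s : St} {σ : State} (h : Sim s σ) (i n : ℕ) :
    Sim (s.out i n) (σ.setMem i n) := by
  refine ⟨h.v, fun A i' j' => ?_, fun k => ?_⟩
  · have := addr_neg A i' j'
    simp only [State.setMem, Function.update_apply, St.out_a]
    rw [if_neg (by omega), h.a]
  · simp only [State.setMem, Function.update_apply, St.out_io, Nat.cast_inj]
    split_ifs
    exacts [rfl, h.io k]

/-- The program for a command; it does not use the registers `tmp e` with `e < d`. -/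
def Cmd.comp : Cmd → ℕ → Prog
  | skip, d => .const (tmp d) 0
  | set x e, d => .seq (e.comp d) <| .seq (.const x.reg 0) <| .add x.reg x.reg (tmp d)
  | put A i j e, d => .seq (e.comp d) <| .seq (i.comp (d + 1)) <| .seq (j.comp (d + 2)) <|
      .seq (addrProg A (d + 1)) <| .store (tmp (d + 1)) (tmp d)
  | out i e, d => .seq (i.comp d) <| .seq (e.comp (d + 1)) <| .store (tmp d) (tmp (d + 1))
  | seq c c', d => .seq (c.comp d) (c'.comp d)
  | ite e c c', d => .seq (e.comp d) <| .ite (tmp d) (c.comp d) (c'.comp d)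
  | loop _ x e c, d => .seq (e.comp d) <| .seq (.const (tmp (d + 1)) 0) <|
      .loop (tmp d) <|
        .seq (.const x.reg 0) <|
        .seq (.add x.reg x.reg (tmp (d + 1))) <|
        .seq (c.comp (d + 2)) <|
        .seq (.const (tmp (d + 2)) 1) <|
        .seq (.add (tmp (d + 1)) (tmp (d + 1)) (tmp (d + 2))) <|
        .sub (tmp d) (tmp d) (tmp (d + 2))

/-- A bound for the number of executions of the innermost loops. -/
def Lim.weight (L : Lim) (c : Cmd) : ℕ :=
  L.lim .N ^ c.depth .N * L.lim .q ^ c.depth .q * L.lim .M ^ c.depth .M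

theorem Lim.weight_le {L : Lim} (hL : ∀ κ, 1 ≤ L.lim κ) {c d : Cmd}
    (h : ∀ κ, c.depth κ ≤ d.depth κ) : L.weight c ≤ L.weight d := by
  unfold weight
  gcongr
  exacts [hL _, h _, hL _, h _, hL _, h _]

theorem Lim.one_le_weight {L : Lim} (hL : ∀ κ, 1 ≤ L.lim κ) (c : Cmd) : 1 ≤ L.weight c := by
  unfold weight
  exact Nat.mul_pos (Nat.mul_pos (pow_pos (hL _) _) (pow_pos (hL _) _)) (pow_pos (hL _) _)

theorem Lim.weight_loop (L : Lim) (κ : Cls) (x : Var) (e : Exp) (c : Cmd) :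
    L.weight (.loop κ x e c) = L.weight c * L.lim κ := by
  unfold weight
  cases κ <;> simp [Cmd.depth, pow_succ] <;> ring

/-- The compiled command is correct, with cost factor `C`. -/
def Cmd.Good (c : Cmd) (d C : ℕ) : Prop :=
  ∀ (L : Lim) (β : ℕ) (s : St) (σ : State), 1 ≤ β → L.B < 2 ^ β → (∀ κ, 1 ≤ L.lim κ) →
    Bdd L.B s → Sim s σ → c.Ok L s →
    RT (C * β) (c.comp d) σ (C * β ^ 2 * L.weight c) fun σ' =>
      Sim (c.ex s) σ' ∧ ∀ e < d, σ'.reg (tmp e) = σ.reg (tmp e)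

/-- A loop multiplies the weight by its limit, and the weight of a composite command is at least
that of its parts. So the weight counts operations up to a constant that depends on the command
alone. -/
theorem Cmd.exists_good (c : Cmd) (d : ℕ) : ∃ C, c.Good d C := by
  induction c generalizing d with
  | skip =>
    refine ⟨1, fun L β s σ hβ hB hL hs hσ hc => ?_⟩
    have := L.one_le_weight hL .skip
    refine (RT.const (by simp) ⟨hσ.same ((Same.refl d σ).set le_rfl _), ?_⟩).mono le_rfl
      (by nlinarith [Nat.one_le_pow 2 β hβ]) fun _ h => h
    intro e he; simp; omega
  | set x e =>
    obtain ⟨C, hC⟩ := e.exists_good d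
    refine ⟨C + 2, fun L β s σ hβ hB hL hs hσ hc => ?_⟩
    have hw := L.one_le_weight hL (.set x e)
    have hβ2 := Nat.one_le_pow 2 β hβ
    refine (hC.then hβ hB hs hσ (m := (C + 2) * β) (k := 2) (by gcongr; omega)
      fun σ₁ h1 h2 h3 h4 => ?_).mono le_rfl ?_ fun _ h => h
    · refine RT.const_seq (by simp) ?_
      have := h4.trans_le (Nat.pow_le_pow_right (n := 2) (by norm_num)
        (show C * β ≤ (C + 2) * β by gcongr; omega))
      refine RT.add (by simp) (by simpa [h3] using this) ⟨?_, fun e he => ?_⟩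
      · have := h2.set x (e.ev s)
        simpa [h3, State.setReg, Cmd.ex] using this
      · simp [h1.tmp he]
    · calc C * β ^ 2 + 2 ≤ (C + 2) * β ^ 2 * 1 := by nlinarith
        _ ≤ _ := by gcongr
  | put A i j e =>
    obtain ⟨C, hC⟩ := e.exists_good d
    obtain ⟨D, hD⟩ := i.exists_good (d + 1)
    obtain ⟨E, hE⟩ := j.exists_good (d + 2)
    refine ⟨C + costFactor (D + E) , fun L β s σ hβ hB hL hs hσ hc => ?_⟩
    have hw := L.one_le_weight hL (.put A i j e)
    have hm := costFactor_bits (D + E) hβ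
    have ht := costFactor_time (D + E) hβ
    refine (hC.then hβ hB hs hσ (m := (C + costFactor (D + E)) * β)
      (k := costFactor (D + E) * β ^ 2) (by gcongr; omega)
      fun σ₁ h1 h2 h3 h4 => ?_).mono le_rfl (by rw [← add_mul]; exact Nat.le_mul_of_pos_right _ hw) fun _ h => h
    refine hD.then₂ hE hβ hB hs h2 (by rw [add_mul C]; omega) (k := 200 * ((D + E) * β + 4) ^ 2 + 1)
      (fun σ₂ h1' h2' h3' h4' h5' h6' => ?_) (by omega)
    refine RT.seq ((addrProg_spec h5' h6' h3' h4').mono (by rw [add_mul C]; omega) le_rfl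
      fun _ h => h) ?_
    rintro σ₃ ⟨h7, h8⟩
    have h9 : σ₃.reg (tmp d) = e.ev s := by rw [h7.tmp (by omega), h1'.tmp (by omega), h3]
    refine RT.store ?_ ?_ ⟨?_, fun e he => ?_⟩
    · rw [h8]; exact (addr_lt A h5' h6').trans_le (Nat.pow_le_pow_right (by norm_num)
        (by rw [add_mul C]; omega))
    · rw [h9, Int.natAbs_natCast]
      exact h4.trans_le (Nat.pow_le_pow_right (by norm_num) (by gcongr; omega))
    · rw [h8, h9]; exact (h2'.same h7).put A _ _ _
    · change σ₃.reg _ = _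
      rw [h7.tmp (by omega), h1'.tmp (by omega), h1.tmp he]
  | out i e =>
    obtain ⟨C, hC⟩ := i.exists_good d
    obtain ⟨D, hD⟩ := e.exists_good (d + 1)
    refine ⟨C + D + 1, fun L β s σ hβ hB hL hs hσ hc => ?_⟩
    have hw := L.one_le_weight hL (.out i e)
    have hβ2 := Nat.one_le_pow 2 β hβ
    refine hC.then₂ hD hβ hB hs hσ (k := 1) (Nat.mul_le_mul_right β (Nat.le_succ _))
      (fun σ₁ h1 h2 h3 h4 h5 h6 => ?_) ?_
    · have hp : (2 : ℕ) ^ ((C + D) * β) ≤ 2 ^ ((C + D + 1) * β) :=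
        Nat.pow_le_pow_right (by norm_num) (Nat.mul_le_mul_right β (Nat.le_succ _))
      refine RT.store (by rw [h3]; omega) (by rw [h4]; omega) ⟨?_, fun e he => h1.tmp he⟩
      rw [h3, h4]; exact h2.out _ _
    · calc (C + D) * β ^ 2 + 1 ≤ (C + D + 1) * β ^ 2 * 1 := by nlinarith
        _ ≤ _ := by gcongr
  | seq c c' ih ih' =>
    obtain ⟨C, hC⟩ := ih d
    obtain ⟨D, hD⟩ := ih' d
    refine ⟨C + D, fun L β s σ hβ hB hL hs hσ hc => ?_⟩
    have w1 : L.weight c ≤ L.weight (c ;; c') := Lim.weight_le hL fun κ => le_max_left _ _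
    have w2 : L.weight c' ≤ L.weight (c ;; c') := Lim.weight_le hL fun κ => le_max_right _ _
    refine RT.seq_le ?_ ((hC L β s σ hβ hB hL hs hσ hc.1).mono (by gcongr; omega) le_rfl
      fun _ h => h) fun σ₁ h1 => (hD L β _ σ₁ hβ hB hL (hs.ex hc.1) h1.1 hc.2).mono
      (by gcongr; omega) le_rfl fun σ₂ h2 => ⟨h2.1, fun e he => (h2.2 e he).trans (h1.2 e he)⟩
    calc _ ≤ C * β ^ 2 * L.weight (c ;; c') + D * β ^ 2 * L.weight (c ;; c') := by gcongr
      _ = _ := by ring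
  | ite e c c' ih ih' =>
    obtain ⟨C, hC⟩ := ih d
    obtain ⟨D, hD⟩ := ih' d
    obtain ⟨E, hE⟩ := e.exists_good d
    refine ⟨C + D + E + 1, fun L β s σ hβ hB hL hs hσ hc => ?_⟩
    have w1 : L.weight c ≤ L.weight (.ite e c c') := Lim.weight_le hL fun κ => le_max_left _ _
    have w2 : L.weight c' ≤ L.weight (.ite e c c') := Lim.weight_le hL fun κ => le_max_right _ _
    have hw := L.one_le_weight hL (.ite e c c')
    have hβ2 := Nat.one_le_pow 2 β hβ
    refine (hE.then hβ hB hs hσ (m := (C + D + E + 1) * β)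
      (k := (C + D) * β ^ 2 * L.weight (.ite e c c') + 1) (by gcongr; omega)
      fun σ₁ h1 h2 h3 h4 => ?_).mono le_rfl ?_ fun _ h => h
    · rw [Cmd.Ok] at hc
      refine RT.ite ?_ (fun hp => ?_) (fun hp => ?_)
      · rw [h3, Int.natAbs_natCast]
        exact h4.trans_le (Nat.pow_le_pow_right (by norm_num) (by gcongr; omega))
      · have hp' : 0 < e.ev s := by rw [h3] at hp; exact_mod_cast hp
        rw [if_pos hp'] at hc
        refine (hC L β s σ₁ hβ hB hL hs h2 hc).mono (by gcongr; omega) ?_ fun σ₂ h5 => ⟨?_, ?_⟩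
        · gcongr; omega
        · rw [Cmd.ex, if_pos hp']; exact h5.1
        · exact fun e he => (h5.2 e he).trans (h1.tmp he)
      · have hp' : ¬ 0 < e.ev s := by rw [h3] at hp; exact_mod_cast hp
        rw [if_neg hp'] at hc
        refine (hD L β s σ₁ hβ hB hL hs h2 hc).mono (by gcongr; omega) ?_ fun σ₂ h5 => ⟨?_, ?_⟩
        · gcongr; omega
        · rw [Cmd.ex, if_neg hp']; exact h5.1
        · exact fun e he => (h5.2 e he).trans (h1.tmp he)
    · calc E * β ^ 2 + ((C + D) * β ^ 2 * L.weight (.ite e c c') + 1)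
          ≤ E * β ^ 2 * L.weight (.ite e c c') + ((C + D) * β ^ 2 * L.weight (.ite e c c') +
            1 * β ^ 2 * L.weight (.ite e c c')) := by
            have h1 : E * β ^ 2 * 1 ≤ E * β ^ 2 * L.weight (.ite e c c') := by gcongr
            have h2 : 1 * 1 ≤ β ^ 2 * L.weight (.ite e c c') := Nat.mul_le_mul hβ2 hw
            linarith
        _ = _ := by ring
  | loop κ x e c ih =>
    obtain ⟨C, hC⟩ := ih (d + 2)
    obtain ⟨E, hE⟩ := e.exists_good d
    refine ⟨C + E + 10, fun L β s σ hβ hB hL hs hσ hc => ?_⟩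
    have hw := L.one_le_weight hL c
    have hβ2 := Nat.one_le_pow 2 β hβ
    have hk := hL κ
    have hbody : Bdd L.B s → ∀ i ≤ e.ev s, Bdd L.B (Cmd.iter c.ex x s i) := fun hs =>
      Bdd.iter hs hc.2.1 (fun i hi hb => (hb.set x (hi.le.trans hc.2.1)).ex (hc.2.2 i hi))
    have hp : ∀ a ≤ L.B, a < 2 ^ ((C + E + 10) * β) := fun a ha =>
      lt_pow_mul (ha.trans_lt hB) (by omega)
    have hp1 : 1 < 2 ^ ((C + E + 10) * β) := Nat.one_lt_pow (by positivity) (by norm_num)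
    refine (hE.then hβ hB hs hσ (m := (C + E + 10) * β)
      (k := e.ev s * ((C * β ^ 2 * L.weight c + 5) + 1) + 1 + 1) (by gcongr; omega)
      fun σ₁ h1 h2 h3 h4 => ?_).mono le_rfl ?_ fun _ h => h
    · refine RT.const_seq (by simp) ?_
      -- The number `f` of remaining rounds and the index `i` are kept in two temporaries that the
      -- body does not touch, so the body may even overwrite the loop variable.
      refine RT.loop (fun f σ₂ => ∃ i, i + f = e.ev s ∧ σ₂.reg (tmp d) = f ∧
        σ₂.reg (tmp (d + 1)) = i ∧ Sim (Cmd.iter c.ex x s i) σ₂ ∧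
        ∀ e < d, σ₂.reg (tmp e) = σ.reg (tmp e)) ?_ ?_ ?_ ?_ _ _ ⟨0, ?_⟩
      · rintro f σ₂ ⟨i, hi, hf, -⟩
        rw [hf]; exact hp _ (by have := hc.2.1; omega)
      · rintro σ₂ ⟨i, hi, hf, -⟩; rw [hf]; simp
      · rintro f σ₂ ⟨i, hi, hf, hi', hsim, htmp⟩ -
        have hcB := hc.2.1
        refine RT.mono (k := C * β ^ 2 * L.weight c + 3 + 1 + 1) ?_ le_rfl le_rfl fun _ h => h
        refine RT.const_seq (by simp) ?_
        refine RT.add_seq (by simp) (by simpa [hi'] using hp i (by omega)) ?_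
        refine RT.seq_le (k := C * β ^ 2 * L.weight c) (l := 3) le_rfl
          ((hC L β ((Cmd.iter c.ex x s i).set x i) _ hβ hB hL
          ((hbody hs i (by omega)).set x (by omega)) ?_ (hc.2.2 i (by omega))).mono (by gcongr; omega)
          le_rfl fun _ h => h) ?_
        · have := hsim.set x i
          simpa [hi', State.setReg] using this
        rintro σ₃ ⟨hsim3, htmp3⟩
        have e1 := htmp3 d (by omega)
        have e2 := htmp3 (d + 1) (by omega)
        simp [hf, hi'] at e1 e2
        refine RT.const_seq (by simpa using hp1) ?_
        refine RT.add_seq (by simpa [e2] using hp i (by omega)) (by simpa using hp1) ?_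
        refine RT.sub ?_ (by simpa using hp1) ⟨i + 1, by omega, by simp [e1], by simp [e2], ?_, ?_⟩
        · simp [e1]; have := hp (f + 1) (by omega); omega
        · refine hsim3.same (d := d) (((Same.refl d _).set (by omega) _).set (by omega) _ |>.set le_rfl _)
        · intro e' he'
          have := htmp3 e' (by omega)
          simp at this
          simp [this, htmp e' he']
          omega
      · rintro f σ₂ ⟨i, hi, hf, hi', hsim, htmp⟩ hpos
        rw [hf] at hpos
        have : i = e.ev s := by omega
        subst this
        exact ⟨hsim, htmp⟩
      · refine ⟨by simp, by simp [h3], by simp, ?_, fun e' he' => ?_⟩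
        · exact h2.same ((Same.refl d _).set (by omega) _)
        · simp [h1.tmp he']; omega
    · rw [Lim.weight_loop]
      have h5 : E * β ^ 2 ≤ E * β ^ 2 * (L.weight c * L.lim κ) := Nat.le_mul_of_pos_right _ (by positivity)
      have h6 : e.ev s * (C * β ^ 2 * L.weight c + 5 + 1) ≤ L.lim κ * (C * β ^ 2 * L.weight c + 6) :=
        Nat.mul_le_mul hc.1 le_rfl
      have h7 : L.lim κ ≤ β ^ 2 * (L.weight c * L.lim κ) := by
        have : 1 ≤ β ^ 2 * L.weight c := Nat.mul_pos hβ2 hw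
        nlinarith
      nlinarith

/-- The initial state. -/
def St.init (input : List ℤ) : St where
  v _ := 0
  a _ _ _ := 0
  io j := input.getD j 0

theorem sim_init (input : List ℤ) : Sim (St.init input) (start input) := by
  refine ⟨fun x => rfl, fun A i j => ?_, fun j => ?_⟩
  · have := addr_neg A i j
    simp only [start, St.init]
    rw [if_neg (by omega)]; rfl
  · simp [start, St.init]

/-- There are `O(β ^ 2)` operations per unit of weight, each on `O(β)` bits. The bound `L.B` enters
through its bit length only, so values of exponential size are harmless. -/
theorem Cmd.exists_solves (c : Cmd) : ∃ C, ∀ (L : Lim) (β : ℕ) (input : List ℤ)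
    (good : (ℤ → ℤ) → Prop), 1 ≤ β → L.B < 2 ^ β → (∀ κ, 1 ≤ L.lim κ) →
    (∀ a ∈ input, a.natAbs ≤ L.B) →
    c.Spec L (St.init input) (fun s => ∀ mem : ℤ → ℤ, (∀ j : ℕ, mem j = s.io j) → good mem) →
    (c.comp 0).SolvesWithin input (C * β ^ 3 * L.weight c) good := by
  obtain ⟨C, hC⟩ := c.exists_good 0
  refine ⟨C * (2 * (C + 1)), fun L β input good hβ hB hL hin hc => ?_⟩
  have hb : Bdd L.B (St.init input) := by
    refine ⟨fun _ => Nat.zero_le _, fun _ _ _ => Nat.zero_le _, fun j => ?_⟩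
    simp only [St.init]
    rcases lt_or_ge j input.length with h | h
    · rw [List.getD_eq_getElem _ _ h]; exact hin _ (List.getElem_mem h)
    · rw [List.getD_eq_default _ _ h]; simp
  obtain ⟨σ, t, h1, h2, h3, -⟩ := hC L β _ _ hβ hB hL hb (sim_init input) hc.1
  refine ⟨σ, t, h1, h2.trans ?_, hc.2 _ h3.io⟩
  calc C * β ^ 2 * L.weight c * (2 * (C * β + 1))
      ≤ C * β ^ 2 * L.weight c * (2 * (C * β + 1 * β)) := by gcongr; omega
    _ = _ := by ring

/-! ### Numbers with digits in a set of places -/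

/-- The weight of place `l`: only the places in `S` carry a digit. -/
def wgt (q : ℕ) (S : Finset ℕ) (l : ℕ) : ℕ := ∏ x ∈ Finset.range l, if x ∈ S then q else 1

/-- The number with the digits `φ x`, `x ∈ S`, `x < l`. -/
def code (q : ℕ) (S : Finset ℕ) (φ : ℕ → ℕ) (l : ℕ) : ℕ :=
  ∑ x ∈ Finset.range l, if x ∈ S then φ x * wgt q S x else 0

section code

variable {q : ℕ} {S : Finset ℕ} {φ ψ : ℕ → ℕ} {l : ℕ}

@[simp] theorem wgt_zero : wgt q S 0 = 1 := rfl
@[simp] theorem code_zero : code q S φ 0 = 0 := rfl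
theorem wgt_succ : wgt q S (l + 1) = wgt q S l * if l ∈ S then q else 1 := Finset.prod_range_succ _ _
theorem code_succ : code q S φ (l + 1) = code q S φ l + if l ∈ S then φ l * wgt q S l else 0 :=
  Finset.sum_range_succ _ _

theorem wgt_eq_pow (hS : ∀ x ∈ S, x < l) : wgt q S l = q ^ S.card := by
  rw [wgt, Finset.prod_ite, Finset.prod_const, Finset.prod_const_one, mul_one]
  congr 2
  ext x; simpa using fun h => hS x h

theorem wgt_le_pow (hq : 1 ≤ q) : wgt q S l ≤ q ^ l := by
  calc wgt q S l ≤ ∏ x ∈ Finset.range l, q :=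
        Finset.prod_le_prod' fun x _ => by split_ifs <;> omega
    _ = q ^ l := by simp

theorem code_lt_wgt (hφ : ∀ x ∈ S, φ x < q) : code q S φ l < wgt q S l := by
  induction l with
  | zero => simp
  | succ l ih =>
    rw [code_succ, wgt_succ]
    split_ifs with h
    · have := hφ l h
      have : (φ l + 1) * wgt q S l ≤ q * wgt q S l := Nat.mul_le_mul_right _ this
      nlinarith
    · simpa using ih

theorem code_congr (h : ∀ x ∈ S, x < l → φ x = ψ x) : code q S φ l = code q S ψ l :=
  Finset.sum_congr rfl fun x hx => by
    split_ifs with h'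
    · rw [h x h' (Finset.mem_range.1 hx)]
    · rfl

/-- The lower digits contribute less than the weight of the next place, so they cannot compensate
for different leading digits. -/
theorem code_inj (hφ : ∀ x ∈ S, φ x < q) (hψ : ∀ x ∈ S, ψ x < q)
    (h : code q S φ l = code q S ψ l) : ∀ x ∈ S, x < l → φ x = ψ x := by
  induction l with
  | zero => intro x _ hx; omega
  | succ l ih =>
    rw [code_succ, code_succ] at h
    split_ifs at h with hl
    · have h1 := code_lt_wgt (l := l) hφ
      have h2 := code_lt_wgt (l := l) hψ
      have h3 : φ l = ψ l := by
        rcases lt_trichotomy (φ l) (ψ l) with h' | h' | h'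
        · have : (φ l + 1) * wgt q S l ≤ ψ l * wgt q S l := Nat.mul_le_mul_right _ h'
          nlinarith
        · exact h'
        · have : (ψ l + 1) * wgt q S l ≤ φ l * wgt q S l := Nat.mul_le_mul_right _ h'
          nlinarith
      intro x hx hxl
      rcases eq_or_ne x l with rfl | hne
      · exact h3
      · exact ih (by rw [h3] at h; omega) x hx (by omega)
    · intro x hx hxl
      have : x ≠ l := by rintro rfl; exact hl hx
      exact ih (by omega) x hx (by omega)

end code

/-! ### Elimination structures -/

/-- The sets `κ i` of later neighbours in a chordal graph on `0, …, n - 1` with the perfect elimination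
order `0, …, n - 1`. -/
structure Elim (n : ℕ) (κ : ℕ → Finset ℕ) : Prop where
  lt : ∀ i, ∀ j ∈ κ i, i < j
  lt_n : ∀ i, ∀ j ∈ κ i, j < n
  trans : ∀ i, ∀ j ∈ κ i, ∀ l ∈ κ i, j < l → l ∈ κ j

/-- The least element of `S`, or `n` if there is none below `n`. -/
def least (n : ℕ) (S : Finset ℕ) : ℕ := (insert n S).min' (Finset.insert_nonempty _ _)

theorem least_eq_iff {n m : ℕ} {S : Finset ℕ} :
    least n S = m ↔ m ∈ insert n S ∧ ∀ x ∈ insert n S, m ≤ x := by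
  rw [least, Finset.min'_eq_iff]

theorem least_mem {n : ℕ} {S : Finset ℕ} : least n S ∈ insert n S := Finset.min'_mem _ _

theorem least_le {n x : ℕ} {S : Finset ℕ} (hx : x ∈ insert n S) : least n S ≤ x :=
  Finset.min'_le _ _ hx

variable {n q : ℕ} {κ : ℕ → Finset ℕ}

/-- The parent of a vertex in the elimination forest; `n` if there is none. -/
abbrev parent (n : ℕ) (κ : ℕ → Finset ℕ) (i : ℕ) : ℕ := least n (κ i)

theorem Elim.lt_parent (h : Elim n κ) {i : ℕ} (hi : i < n) : i < parent n κ i := by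
  have := least_mem (n := n) (S := κ i)
  rw [Finset.mem_insert] at this
  rcases this with h' | h'
  · rw [parent, h']; exact hi
  · exact h.lt i _ h'

theorem Elim.parent_le (_h : Elim n κ) (i : ℕ) : parent n κ i ≤ n := least_le (by simp)

/-- This makes the parents the tree of the dynamic programming: the parent is the least later
neighbour of `c`, and by transitivity all others are later neighbours of the parent. An assignment
on i and κ i thus determines which entry is used in the table of each child. -/
theorem Elim.subset (h : Elim n κ) {c i : ℕ} (hi : i < n) (hc : parent n κ c = i) :
    ∀ x ∈ κ c, x = i ∨ x ∈ κ i := by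
  intro x hx
  have h1 := least_mem (n := n) (S := κ c)
  have h2 : i ≤ x := hc ▸ least_le (n := n) (by simp [hx])
  rw [show least n (κ c) = i from hc, Finset.mem_insert] at h1
  rcases h1 with h1 | h1
  · omega
  · rcases h2.eq_or_lt with h2 | h2
    · exact Or.inl h2.symm
    · exact Or.inr (h.trans c i h1 x hx h2)

/-! ### Dynamic programming over an elimination structure -/

/-- How the values of the jobs are combined. -/
def Objective.op : Objective → ℕ → ℕ → ℕ
  | .maxWeightedLateness => max
  | .totalWeightedTardiness => (· + ·)

instance (o : Objective) : Std.Commutative o.op :=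
  ⟨fun a b => by cases o; exacts [max_comm a b, add_comm a b]⟩

instance (o : Objective) : Std.Associative o.op :=
  ⟨fun a b c => by cases o; exacts [max_assoc a b c, add_assoc a b c]⟩

theorem Objective.op_mono (o : Objective) {a b a' b' : ℕ} (h : a ≤ a') (h' : b ≤ b') :
    o.op a b ≤ o.op a' b' := by cases o; exacts [max_le_max h h', add_le_add h h']

theorem Objective.zero_op (o : Objective) (a : ℕ) : o.op 0 a = a := by
  cases o <;> simp [op]

theorem Objective.op_le_add (o : Objective) (a b : ℕ) : o.op a b ≤ a + b := by
  cases o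
  · exact max_le (Nat.le_add_right _ _) (Nat.le_add_left _ _)
  · exact le_rfl

/-- The combination of the values of `f` on a finite set. -/
def Objective.fold (o : Objective) (f : ℕ → ℕ) (s : Finset ℕ) : ℕ := s.fold o.op 0 f

theorem Objective.fold_insert (o : Objective) {f : ℕ → ℕ} {s : Finset ℕ} {a : ℕ} (h : a ∉ s) :
    o.fold f (insert a s) = o.op (f a) (o.fold f s) := Finset.fold_insert h

theorem Objective.fold_union (o : Objective) {f : ℕ → ℕ} {s t : Finset ℕ} (h : Disjoint s t) :
    o.fold f (s ∪ t) = o.op (o.fold f s) (o.fold f t) := by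
  have := Finset.fold_disjUnion (op := o.op) (f := f) (b₁ := 0) (b₂ := 0) h
  rwa [o.zero_op, Finset.disjUnion_eq_union] at this

theorem Objective.fold_congr (o : Objective) {f g : ℕ → ℕ} {s : Finset ℕ}
    (h : ∀ a ∈ s, f a = g a) : o.fold f s = o.fold g s := Finset.fold_congr h

/-- The value of vertex `i` combined with the tables of its children among `0, …, l - 1`. -/
def localVal (o : Objective) (n q : ℕ) (κ : ℕ → Finset ℕ) (g : ℕ → (ℕ → ℕ) → ℕ) (T : ℕ → ℕ → ℕ)
    (φ : ℕ → ℕ) (i : ℕ) : ℕ → ℕ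
  | 0 => g i φ
  | c + 1 => if parent n κ c = i
      then o.op (localVal o n q κ g T φ i c) (T c (code q (κ c) φ n))
      else localVal o n q κ g T φ i c

theorem localVal_eq (o : Objective) (g : ℕ → (ℕ → ℕ) → ℕ) (T : ℕ → ℕ → ℕ) (φ : ℕ → ℕ) (i l : ℕ) :
    localVal o n q κ g T φ i l = o.op (g i φ) (o.fold (fun c => T c (code q (κ c) φ n))
      ((Finset.range l).filter fun c => parent n κ c = i)) := by
  induction l with
  | zero =>
    rw [localVal, Std.Commutative.comm (op := o.op)]
    simp [Objective.fold, o.zero_op]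
  | succ l ih =>
    rw [localVal, Finset.range_add_one, Finset.filter_insert]
    split_ifs with h
    · rw [o.fold_insert (by simp), ih, Std.Associative.assoc (op := o.op),
        Std.Commutative.comm (op := o.op) (o.fold _ _)]
    · exact ih

/-- The tables are correct: `T i` holds minimum values and `X i` minimizers. -/
def Tables (o : Objective) (n q : ℕ) (κ : ℕ → Finset ℕ) (g : ℕ → (ℕ → ℕ) → ℕ) (T X : ℕ → ℕ → ℕ)
    (i : ℕ) : Prop :=
  ∀ φ : ℕ → ℕ, (∀ x < n, φ x < q) → T i (code q (κ i) φ n) ≤ localVal o n q κ g T φ i i ∧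
    X i (code q (κ i) φ n) < q ∧
    (φ i = X i (code q (κ i) φ n) → T i (code q (κ i) φ n) = localVal o n q κ g T φ i i)

/-- A sweep over the vertices. In `F i`, the vertices from `i` on count with their own values, and
each earlier vertex whose parent is at least `i` counts with its table entry, which stands for its
subtree. Passing from `i` to `i + 1` replaces a local value by a table entry; this does not increase
the value of `ψ`, and preserves that of `φ`. At the end only roots are left. Their sets `κ c` are
empty, so `F n` does not depend on the assignment. -/
theorem Elim.optimal (hκ : Elim n κ) (o : Objective) {g : ℕ → (ℕ → ℕ) → ℕ} {T X : ℕ → ℕ → ℕ}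
    (hT : ∀ i < n, Tables o n q κ g T X i) {φ ψ : ℕ → ℕ} (hφ : ∀ x < n, φ x < q) (hψ : ∀ x < n, ψ x < q)
    (hX : ∀ i < n, φ i = X i (code q (κ i) φ n)) :
    o.fold (fun i => g i φ) (Finset.range n) ≤ o.fold (fun i => g i ψ) (Finset.range n) := by
  -- The part that `F i` and `F (i + 1)` have in common.
  let R : ℕ → (ℕ → ℕ) → ℕ := fun i χ => o.op (o.fold (fun j => g j χ) (Finset.Ico (i + 1) n))
    (o.fold (fun c => T c (code q (κ c) χ n)) ((Finset.range i).filter fun c => i < parent n κ c))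
  let F : ℕ → (ℕ → ℕ) → ℕ := fun i χ => o.op (o.fold (fun j => g j χ) (Finset.Ico i n))
    (o.fold (fun c => T c (code q (κ c) χ n)) ((Finset.range i).filter fun c => i ≤ parent n κ c))
  have F1 : ∀ i < n, ∀ χ, F i χ = o.op (localVal o n q κ g T χ i i) (R i χ) := by
    intro i hi χ
    have e1 : Finset.Ico i n = insert i (Finset.Ico (i + 1) n) := by ext; simp; omega
    have e2 : (Finset.range i).filter (fun c => i ≤ parent n κ c) =
        (Finset.range i).filter (fun c => parent n κ c = i) ∪
        (Finset.range i).filter (fun c => i < parent n κ c) := by ext; simp; omega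
    have e3 : Disjoint ((Finset.range i).filter (fun c => parent n κ c = i))
        ((Finset.range i).filter (fun c => i < parent n κ c)) := by
      rw [Finset.disjoint_filter]; intro x _ h; omega
    simp only [F, R, localVal_eq, e1, e2, o.fold_union e3]
    rw [o.fold_insert (by simp)]
    ac_rfl
  have F2 : ∀ i < n, ∀ χ, F (i + 1) χ = o.op (T i (code q (κ i) χ n)) (R i χ) := by
    intro i hi χ
    have e2 : (Finset.range (i + 1)).filter (fun c => i + 1 ≤ parent n κ c) =
        insert i ((Finset.range i).filter (fun c => i < parent n κ c)) := by
      rw [Finset.range_add_one, Finset.filter_insert, if_pos (show i + 1 ≤ _ from hκ.lt_parent hi)]; rfl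
    simp only [F, R, e2]
    rw [o.fold_insert (by simp)]
    ac_rfl
  have hle : ∀ i ≤ n, F i ψ ≤ F 0 ψ := by
    intro i
    induction i with
    | zero => exact fun _ => le_rfl
    | succ i ih =>
      intro hi
      refine le_trans ?_ (ih (by omega))
      rw [F1 i hi, F2 i hi]
      exact o.op_mono (hT i hi ψ hψ).1 le_rfl
  have heq : ∀ i ≤ n, F i φ = F 0 φ := by
    intro i
    induction i with
    | zero => exact fun _ => rfl
    | succ i ih =>
      intro hi
      rw [← ih (by omega), F1 i hi, F2 i hi, (hT i hi φ hφ).2.2 (hX i hi)]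
  have hend : F n φ = F n ψ := by
    simp only [F, Finset.Ico_self]
    congr 1
    refine o.fold_congr fun c hc => ?_
    rw [Finset.mem_filter] at hc
    have : κ c = ∅ := by
      refine Finset.eq_empty_of_forall_notMem fun x hx => ?_
      have h1 : parent n κ c ≤ x := least_le (by simp [hx])
      have := hκ.lt_n c x hx
      omega
    rw [this]
    exact congrArg _ (code_congr (by simp))
  have hF0 : ∀ χ, F 0 χ = o.fold (fun i => g i χ) (Finset.range n) := by
    intro χ
    simp only [F, Finset.range_zero, Finset.filter_empty]
    rw [Std.Commutative.comm (op := o.op), ← Finset.range_eq_Ico]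
    exact o.zero_op _
  rw [← hF0, ← hF0, ← heq n le_rfl, hend]
  exact hle n le_rfl

/-! ### The programs of the dynamic programming -/

open Cmd

/-- Compute the number of an assignment of the row `c` of the array `K`, and its first element. -/
def scan (c : Var) : Cmd :=
  .set .idx 0 ;; .set .p 1 ;; .set .fst (.var .n) ;;
  .loop .N .l (.var .n)
    (.ite (.arr .K (.var c) (.var .l))
      (.set .idx (.var .idx + .var .p * .arr .phi 0 (.var .l)) ;;
        .set .p (.var .p * .var .q) ;;
        .ite (.var .n - .var .fst) .skip (.set .fst (.var .l)))
      .skip)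

/-- Compute the number of assignments of the row `r` of the array `A`. -/
def rowCount (A : Arr) (r : Var) : Cmd :=
  .set .num 1 ;;
  .loop .N .l (.var .n) (.ite (.arr A (.var r) (.var .l)) (.set .num (.var .num * .var .q)) .skip)

/-- Proceed to the next assignment of the row `r` of the array `A`. -/
def odometer (A : Arr) (r : Var) (P : Arr) : Cmd :=
  .set .carry 1 ;;
  .loop .N .l (.var .n)
    (.ite (.var .carry)
      (.ite (.arr A (.var r) (.var .l))
        (.ite (.var .q - (.arr P 0 (.var .l) + 1))
          (.put P 0 (.var .l) (.arr P 0 (.var .l) + 1) ;; .set .carry 0)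
          (.put P 0 (.var .l) 0))
        .skip)
      .skip)

/-- The entries `0, …, n - 1` of a row of an array are set to zero. -/
def clear (P : Arr) : Cmd := .loop .N .l (.var .n) (.put P 0 (.var .l) 0)

/-- The update of `fst` in `scan`; the value `n` means that no element has been found yet. -/
theorem least_filter_succ {n l : ℕ} {S : Finset ℕ} (hl : l < n) :
    least n (S.filter (· < l + 1)) =
      if l ∈ S ∧ least n (S.filter (· < l)) = n then l else least n (S.filter (· < l)) := by
  have h := least_eq_iff.1 (rfl : least n (S.filter (· < l)) = _)
  simp only [Finset.mem_insert, Finset.mem_filter] at h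
  rw [least_eq_iff]
  simp only [Finset.mem_insert, Finset.mem_filter]
  split_ifs with h'
  · refine ⟨Or.inr ⟨h'.1, by omega⟩, fun x hx => ?_⟩
    rcases hx with hx | ⟨hx, hxl⟩
    · omega
    · by_contra hlt
      have := h.2 x (Or.inr ⟨hx, by omega⟩)
      omega
  · refine ⟨h.1.imp_right fun h => ⟨h.1, by omega⟩, fun x hx => ?_⟩
    rcases hx with hx | ⟨hx, hxl⟩
    · exact h.2 x (Or.inl hx)
    · rcases (show x < l ∨ x = l by omega) with hxl | rfl
      · exact h.2 x (Or.inr ⟨hx, hxl⟩)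
      · have h1 : least n (S.filter (· < x)) ≠ n := fun h1 => h' ⟨hx, h1⟩
        have := (h.1.resolve_left h1).2
        omega

theorem filter_lt_eq {n : ℕ} {S : Finset ℕ} (h : ∀ x ∈ S, x < n) : S.filter (· < n) = S :=
  Finset.filter_true_of_mem h

section specs

variable {L : Lim} {s : St} {n q : ℕ} {S : Finset ℕ}

theorem scan_spec {c : Var} (hc : c ≠ .idx ∧ c ≠ .p ∧ c ≠ .fst ∧ c ≠ .l) (hn : s.v .n = n)
    (hq : s.v .q = q) (hq1 : 1 ≤ q) (hK : ∀ l < n, 0 < s.a .K (s.v c) l ↔ l ∈ S)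
    (hS : ∀ x ∈ S, x < n) (hφ : ∀ x < n, s.a .phi 0 x < q) (hN : n ≤ L.lim .N) (hB : n ≤ L.B)
    (hqB : q ^ n ≤ L.B) :
    Spec L (scan c) s fun s' => s'.v .idx = code q S (s.a .phi 0) n ∧ s'.v .fst = least n S := by
  have hB1 : 1 ≤ L.B := (Nat.one_le_pow _ _ hq1).trans hqB
  have hw : ∀ l ≤ n, wgt q S l ≤ L.B := fun l hl =>
    (wgt_le_pow hq1).trans ((Nat.pow_le_pow_right hq1 hl).trans hqB)
  have hcode : ∀ l ≤ n, code q S (s.a .phi 0) l ≤ L.B := fun l hl =>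
    (code_lt_wgt fun x hx => hφ x (hS x hx)).le.trans (hw l hl)
  simp only [scan, spec_seq, spec_set, Exp.ev_lit, Exp.ev_var, St.set_v, reduceCtorEq, if_false, hn]
  refine ⟨Nat.zero_le _, hB1, hB, ?_⟩
  refine spec_loop (n := n) (fun l s' => s'.v .idx = code q S (s.a .phi 0) l ∧ s'.v .p = wgt q S l ∧
    s'.v .fst = least n (S.filter (· < l))) (by simp [hn]) hN hB (by simp [least]) ?_ ?_
  · rintro l hl s' hs' ⟨h1, h2, h3⟩
    have e1 : s'.v .n = n := by rw [hs'.v .n rfl]; simp [hn]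
    have e2 : s'.v .q = q := by rw [hs'.v .q rfl]; simp [hq]
    have e3 : s'.v c = s.v c := by rw [hs'.v c (by simp [wv, hc])]; simp [hc]
    have e4 : s'.a .K = s.a .K := by rw [hs'.a .K rfl]; simp
    have e5 : s'.a .phi = s.a .phi := by rw [hs'.a .phi rfl]; simp
    have hw' := hw (l + 1) hl
    have hc' := hcode (l + 1) hl
    rw [wgt_succ] at hw'
    rw [code_succ] at hc'
    simp only [code_succ, wgt_succ, least_filter_succ hl, spec_ite, spec_seq, spec_set, spec_skip,
      Exp.ev_arr, Exp.ev_var, Exp.ev_add, Exp.ev_mul, Exp.ev_sub, St.set_v, St.set_a, hc.2.2.2, e1,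
      e2, e3, e4, e5, h1, h2, h3, hK l hl, if_true, if_false, reduceCtorEq]
    by_cases hlS : l ∈ S
    · simp only [hlS, if_true, true_and, Exp.ev_lit] at hw' hc' ⊢
      have h5 := least_le (n := n) (x := n) (S := S.filter (· < l)) (by simp)
      rw [mul_comm (s.a .phi 0 l)] at hc' ⊢
      refine ⟨hc', hw', ?_⟩
      by_cases h4 : least n (S.filter (· < l)) = n
      · simp [h4, hl.le.trans hB]
      · rw [if_pos (by omega), if_neg h4]
        exact ⟨rfl, rfl⟩
    · simp [hlS]
  · rintro s' - ⟨h1, -, h3⟩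
    exact ⟨h1, by rw [h3, filter_lt_eq hS]⟩

theorem rowCount_spec {A : Arr} {r : Var} (hr : r ≠ .num ∧ r ≠ .l) (hn : s.v .n = n)
    (hq : s.v .q = q) (hq1 : 1 ≤ q) (hA : ∀ l < n, 0 < s.a A (s.v r) l ↔ l ∈ S)
    (hS : ∀ x ∈ S, x < n) (hN : n ≤ L.lim .N) (hB : n ≤ L.B) (hqB : q ^ n ≤ L.B) :
    Spec L (rowCount A r) s fun s' => s'.v .num = q ^ S.card := by
  have hB1 : 1 ≤ L.B := (Nat.one_le_pow _ _ hq1).trans hqB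
  simp only [rowCount, spec_seq, spec_set, Exp.ev_lit]
  refine ⟨hB1, ?_⟩
  refine spec_loop (n := n) (fun l s' => s'.v .num = wgt q S l) (by simp [hn]) hN hB (by simp) ?_ ?_
  · rintro l hl s' hs' h1
    have e2 : s'.v .q = q := by rw [hs'.v .q rfl]; simp [hq]
    have e3 : s'.v r = s.v r := by rw [hs'.v r (by simp [wv, hr])]; simp [hr]
    have e4 : s'.a A = s.a A := by rw [hs'.a A rfl]; simp
    have hw' : wgt q S (l + 1) ≤ L.B :=
      (wgt_le_pow hq1).trans ((Nat.pow_le_pow_right hq1 hl).trans hqB)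
    rw [wgt_succ] at hw'
    simp only [wgt_succ, spec_ite, spec_set, spec_skip, Exp.ev_arr, Exp.ev_var, Exp.ev_mul,
      St.set_v, St.set_a, hr.2, e2, e3, e4, h1, hA l hl, if_true, if_false, reduceCtorEq]
    split_ifs with h
    · rw [if_pos h] at hw'; exact ⟨hw', rfl⟩
    · simp
  · rintro s' - h
    rw [h, wgt_eq_pow hS]

theorem clear_spec {P : Arr} (hn : s.v .n = n) (hN : n ≤ L.lim .N) (hB : n ≤ L.B) :
    Spec L (clear P) s fun s' => (∀ x < n, s'.a P 0 x = 0) := by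
  refine spec_loop (n := n) (fun l s' => ∀ x < l, s'.a P 0 x = 0) hn hN hB (by simp) ?_
    fun s' _ h => h
  intro l hl s' hs' h1
  simp only [spec_put, Exp.ev_lit, Exp.ev_var, St.set_v, if_true, St.put_a, St.set_a,
    Function.update_apply, Nat.zero_le, true_and]
  intro x hx
  split_ifs with h
  · rfl
  · exact h1 x (by omega)

/-- Invariant: the new digits below `l`, plus the carry times the weight of place `l`, represent the
old number below `l` plus one. If the counter overflows, only the range of the digits is claimed;
the surrounding loops end there. -/
theorem odometer_spec {A P : Arr} {r : Var} (hr : r ≠ .carry ∧ r ≠ .l) (hAP : A ≠ P)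
    (hn : s.v .n = n) (hq : s.v .q = q) (hA : ∀ l < n, 0 < s.a A (s.v r) l ↔ l ∈ S)
    (hφ : ∀ x < n, s.a P 0 x < q) (hN : n ≤ L.lim .N) (hB : n ≤ L.B) (hB1 : 1 ≤ L.B)
    (hqB : q ≤ L.B) :
    Spec L (odometer A r P) s fun s' => (∀ x < n, s'.a P 0 x < q) ∧
      (code q S (s.a P 0) n + 1 < wgt q S n → code q S (s'.a P 0) n = code q S (s.a P 0) n + 1) := by
  simp only [odometer, spec_seq, spec_set, Exp.ev_lit]
  refine ⟨hB1, ?_⟩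
  refine spec_loop (n := n) (fun l s' => (∀ x < n, s'.a P 0 x < q) ∧
    (∀ x, l ≤ x → s'.a P 0 x = s.a P 0 x) ∧ (s'.v .carry = 0 ∨ s'.v .carry = 1) ∧
    code q S (s'.a P 0) l + s'.v .carry * wgt q S l = code q S (s.a P 0) l + 1)
    (by simp [hn]) hN hB (by simpa using hφ) ?_ ?_
  · rintro l hl s' hs' ⟨h1, h2, h3, h4⟩
    have e2 : s'.v .q = q := by rw [hs'.v .q rfl]; simp [hq]
    have e3 : s'.v r = s.v r := by rw [hs'.v r (by simp [wv, hr])]; simp [hr]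
    have e4 : s'.a A = s.a A := by rw [hs'.a A (by simp [wa, hAP])]; simp
    have e5 := h2 l le_rfl
    have hφl := hφ l hl
    have hup : ∀ (u : ℕ → ℕ) (v : ℕ), code q S (Function.update u l v) l = code q S u l :=
      fun u v => code_congr fun x _ hx => Function.update_of_ne (by omega) _ _
    simp only [spec_ite, spec_seq, spec_put, spec_set, spec_skip, Exp.ev_arr, Exp.ev_var,
      Exp.ev_sub, Exp.ev_add, Exp.ev_lit, St.set_v, St.set_a, hr.2, e2, e3, e4, e5, hA l hl, if_true,
      if_false, reduceCtorEq, St.put_a, St.put_v, Nat.zero_le, true_and, code_succ, wgt_succ,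
      Function.update_self]
    rcases h3 with h3 | h3
    · rw [h3] at h4 ⊢
      simp only [lt_self_iff_false, if_false]
      refine ⟨h1, fun x hx => h2 x (by omega), by simp, ?_⟩
      simp only [zero_mul, add_zero] at h4 ⊢
      omega
    · rw [h3] at h4 ⊢
      simp only [zero_lt_one, if_true]
      by_cases hlS : l ∈ S
      · simp only [hlS, if_true]
        split_ifs with hlt
        · refine ⟨by omega, fun x hx => ?_, fun x hx => ?_, Or.inl trivial, ?_⟩
          · rw [Function.update_apply]; split_ifs; exacts [by omega, h1 x hx]
          · rw [Function.update_of_ne (by omega)]; exact h2 x (by omega)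
          · rw [hup]; linarith
        · refine ⟨fun x hx => ?_, fun x hx => ?_, Or.inr trivial, ?_⟩
          · rw [Function.update_apply]; split_ifs; exacts [by omega, h1 x hx]
          · rw [Function.update_of_ne (by omega)]; exact h2 x (by omega)
          · rw [hup]
            have hq' : q = s.a P 0 l + 1 := by omega
            have : wgt q S l * q = s.a P 0 l * wgt q S l + wgt q S l := by
              generalize wgt q S l = w
              rw [hq']; ring
            omega
      · simp only [hlS, if_false]
        refine ⟨h1, fun x hx => h2 x (by omega), Or.inr trivial, ?_⟩
        simpa using h4
  · rintro s' - ⟨h1, -, h3, h4⟩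
    refine ⟨h1, fun h => ?_⟩
    rcases h3 with h3 | h3
    · simpa [h3] using h4
    · rw [h3] at h4; omega

end specs

/-! ### Assembling the dynamic programming -/

open Cmd

/-- The variables that a program for local values may use. -/
def Var.isLocal : Var → Bool
  | .val | .l | .u | .w | .bad | .fin | .d | .e => true
  | _ => false

/-- The variables of the dynamic programming. -/
def Var.isScratch : Var → Bool
  | .i | .m | .x | .c | .idx | .p | .fst | .bv | .bx | .num | .carry => true
  | a => a.isLocal

/-- The arrays of the dynamic programming. -/
def Arr.isScratch : Arr → Bool
  | .phi | .T | .X => true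
  | _ => false

/-- The command assigns to nothing but variables and arrays of the dynamic programming. -/
structure Cmd.IsScratch (c : Cmd) : Prop where
  v : ∀ x, c.wv x = true → x.isScratch = true
  a : ∀ A, c.wa A = true → A.isScratch = true
  io : c.wio = false

namespace Cmd.IsScratch

variable {c d : Cmd}

theorem skip : IsScratch .skip := ⟨by simp [wv], by simp [wa], rfl⟩
theorem set {x : Var} {e : Exp} (h : x.isScratch = true) : IsScratch (.set x e) :=
  ⟨by simp [wv, h], by simp [wa], rfl⟩
theorem put {A : Arr} {i j e : Exp} (h : A.isScratch = true) : IsScratch (.put A i j e) :=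
  ⟨by simp [wv], by simp [wa, h], rfl⟩
theorem seq (hc : IsScratch c) (hd : IsScratch d) : IsScratch (c ;; d) :=
  ⟨fun x h => by simp only [wv, Bool.or_eq_true] at h; exact h.elim (hc.v x) (hd.v x),
   fun x h => by simp only [wa, Bool.or_eq_true] at h; exact h.elim (hc.a x) (hd.a x),
   by simp [wio, hc.io, hd.io]⟩
theorem ite {e : Exp} (hc : IsScratch c) (hd : IsScratch d) : IsScratch (.ite e c d) :=
  ⟨fun x h => by simp only [wv, Bool.or_eq_true] at h; exact h.elim (hc.v x) (hd.v x),
   fun x h => by simp only [wa, Bool.or_eq_true] at h; exact h.elim (hc.a x) (hd.a x),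
   by simp [wio, hc.io, hd.io]⟩
theorem loop {κ : Cls} {x : Var} {e : Exp} (hx : x.isScratch = true) (hc : IsScratch c) :
    IsScratch (.loop κ x e c) :=
  ⟨fun y h => by
    simp only [wv, Bool.or_eq_true, decide_eq_true_eq] at h
    rcases h with rfl | h
    exacts [hx, hc.v _ h], hc.a, hc.io⟩

end Cmd.IsScratch

/-- The states agree up to the variables and arrays of the dynamic programming. -/
structure Near (s s' : St) : Prop where
  v : ∀ x : Var, x.isScratch = false → s'.v x = s.v x
  a : ∀ A : Arr, A.isScratch = false → s'.a A = s.a A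
  io : s'.io = s.io

namespace Near

variable {s s' s'' : St} {c : Cmd}

theorem trans (h : Near s s') (h' : Near s' s'') : Near s s'' :=
  ⟨fun x hx => (h'.v x hx).trans (h.v x hx), fun x hx => (h'.a x hx).trans (h.a x hx),
    h'.io.trans h.io⟩

theorem of_agree (hc : c.IsScratch) (h : c.Agree s s') : Near s s' :=
  ⟨fun x hx => h.v x (Bool.eq_false_iff.2 fun h' => by simp [hc.v x h'] at hx),
   fun x hx => h.a x (Bool.eq_false_iff.2 fun h' => by simp [hc.a x h'] at hx), h.io hc.io⟩

theorem agree (h : Near s s') (hc : c.IsScratch) (h' : c.Agree s' s'') : Near s s'' :=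
  h.trans (of_agree hc h')

theorem set (h : Near s s') {x : Var} (hx : x.isScratch = true) (a : ℕ) : Near s (s'.set x a) :=
  ⟨fun y hy => by
    have : y ≠ x := by rintro rfl; simp [hx] at hy
    simp [this, h.v y hy], h.a, h.io⟩

theorem put (h : Near s s') {A : Arr} (hA : A.isScratch = true) (i j a : ℕ) :
    Near s (s'.put A i j a) :=
  ⟨h.v, fun y hy => by
    have : y ≠ A := by rintro rfl; simp [hA] at hy
    simp [this, h.a y hy], h.io⟩

end Near

/-- A program for local values uses only its own variables. -/
structure Cmd.IsLocal (c : Cmd) : Prop where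
  v : ∀ x, c.wv x = true → x.isLocal = true
  a : ∀ A, c.wa A = false
  io : c.wio = false

theorem Cmd.IsLocal.wv {c : Cmd} (h : c.IsLocal) {x : Var} (hx : x.isLocal = false) :
    c.wv x = false := Bool.eq_false_iff.2 fun h' => by simp [h.v x h'] at hx

theorem Cmd.IsLocal.isScratch {c : Cmd} (h : c.IsLocal) : c.IsScratch :=
  ⟨fun x hx => by have := h.v x hx; cases x <;> simp_all [Var.isScratch, Var.isLocal],
    fun A hA => by simp [h.a A] at hA, h.io⟩

/-- `val := op val (T c idx)` -/
def combine : Objective → Cmd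
  | .maxWeightedLateness => .ite (.arr .T (.var .c) (.var .idx) - .var .val)
      (.set .val (.arr .T (.var .c) (.var .idx))) .skip
  | .totalWeightedTardiness => .set .val (.var .val + .arr .T (.var .c) (.var .idx))

/-- Combine `val` with the entries for the current assignment in the tables of the children of `i`. -/
def gather (o : Objective) : Cmd :=
  .loop .N .c (.var .i) (scan .c ;;
    .ite ((.var .fst - .var .i) + (.var .i - .var .fst)) .skip (combine o))

/-- Find the best value for vertex `i`. -/
def bestValue (o : Objective) (loc : Cmd) : Cmd :=
  .loop .q .x (.var .q) (.put .phi 0 (.var .i) (.var .x) ;; loc ;; gather o ;;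
    .ite ((1 - .var .x) + (.var .bv - .var .val)) (.set .bv (.var .val) ;; .set .bx (.var .x)) .skip)

/-- Fill the tables for vertex `i`. -/
def fillTable (o : Objective) (loc : Cmd) : Cmd :=
  rowCount .K .i ;; clear .phi ;;
  .loop .M .m (.var .num) (bestValue o loc ;; .put .T (.var .i) (.var .m) (.var .bv) ;;
    .put .X (.var .i) (.var .m) (.var .bx) ;; odometer .K .i .phi)

/-- Read an optimal assignment off the tables. -/
def readBack : Cmd :=
  clear .phi ;;
  .loop .N .m (.var .n) (.set .i (.var .n - (.var .m + 1)) ;; scan .i ;;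
    .put .phi 0 (.var .i) (.arr .X (.var .i) (.var .idx)))

/-- Find an optimal assignment by dynamic programming. -/
def optimize (o : Objective) (loc : Cmd) : Cmd :=
  .loop .N .i (.var .n) (fillTable o loc) ;; readBack

theorem isScratch_scan {c : Var} : (scan c).IsScratch := by
  unfold scan
  repeat' first
    | exact .set rfl | exact .put rfl | exact .skip | apply IsScratch.seq | apply IsScratch.ite
    | apply IsScratch.loop rfl

theorem isScratch_rowCount {A : Arr} {r : Var} : (rowCount A r).IsScratch := by
  unfold rowCount
  repeat' first
    | exact .set rfl | exact .put rfl | exact .skip | apply IsScratch.seq | apply IsScratch.ite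
    | apply IsScratch.loop rfl

theorem isScratch_clear : (clear .phi).IsScratch := .loop rfl (.put rfl)

theorem isScratch_odometer {A : Arr} {r : Var} : (odometer A r .phi).IsScratch := by
  unfold odometer
  repeat' first
    | exact .set rfl | exact .put rfl | exact .skip | apply IsScratch.seq | apply IsScratch.ite
    | apply IsScratch.loop rfl

theorem isScratch_combine {o : Objective} : (combine o).IsScratch := by
  cases o
  exacts [.ite (.set rfl) .skip, .set rfl]

theorem isScratch_gather {o : Objective} : (gather o).IsScratch :=
  .loop rfl (.seq isScratch_scan (.ite .skip isScratch_combine))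

theorem isScratch_bestValue {o : Objective} {loc : Cmd} (h : loc.IsLocal) :
    (bestValue o loc).IsScratch :=
  .loop rfl (.seq (.put rfl) (.seq h.isScratch (.seq isScratch_gather
    (.ite (.seq (.set rfl) (.set rfl)) .skip))))

theorem isScratch_fillTable {o : Objective} {loc : Cmd} (h : loc.IsLocal) :
    (fillTable o loc).IsScratch :=
  .seq isScratch_rowCount (.seq isScratch_clear (.loop rfl (.seq (isScratch_bestValue h)
    (.seq (.put rfl) (.seq (.put rfl) isScratch_odometer)))))

theorem isScratch_readBack : readBack.IsScratch :=
  .seq isScratch_clear (.loop rfl (.seq (.set rfl) (.seq isScratch_scan (.put rfl))))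

theorem isScratch_optimize {o : Objective} {loc : Cmd} (h : loc.IsLocal) :
    (optimize o loc).IsScratch := .seq (.loop rfl (isScratch_fillTable h)) isScratch_readBack

/-- The limits suffice for the dynamic programming over `q` values and `n` vertices with at most `t`
later neighbours each, with local values at most `G`. -/
structure Lim.Suffices (L : Lim) (n q t G : ℕ) : Prop where
  one_le_q : 1 ≤ q
  n_le_N : n ≤ L.lim .N
  q_le : q ≤ L.lim .q
  pow_le_M : q ^ t ≤ L.lim .M
  n_le_B : n ≤ L.B
  q_le_B : q ≤ L.B
  pow_le_B : q ^ n ≤ L.B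
  G_le_B : 2 ^ n * G ≤ L.B

theorem Lim.Suffices.one_le_B {L : Lim} {n q t G : ℕ} (h : L.Suffices n q t G) : 1 ≤ L.B :=
  h.one_le_q.trans h.q_le_B

variable {L : Lim} {s : St} {n q t G : ℕ} {κ : ℕ → Finset ℕ} {o : Objective}

/-- Both operations are bounded by the sum, and G + (1 + 2 + … + 2 ^ (l - 1)) G = 2 ^ l G. -/
theorem localVal_le {g : ℕ → (ℕ → ℕ) → ℕ} {T : ℕ → ℕ → ℕ} {φ : ℕ → ℕ} {i : ℕ}
    (hg : g i φ ≤ G) {l : ℕ} (hT : ∀ c < l, T c (code q (κ c) φ n) ≤ 2 ^ c * G) :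
    localVal o n q κ g T φ i l ≤ 2 ^ l * G := by
  induction l with
  | zero => simpa [localVal] using hg
  | succ l ih =>
    have h1 := ih fun c hc => hT c (by omega)
    have h2 := hT l (by omega)
    have h3 : 2 ^ (l + 1) * G = 2 ^ l * G + 2 ^ l * G := by ring
    rw [localVal]
    split_ifs
    · exact (o.op_le_add _ _).trans (by omega)
    · omega

/-- By `Elim.subset`, the entries taken from the children depend on the values at i and κ i only. -/
theorem localVal_congr (hκ : Elim n κ) {g : ℕ → (ℕ → ℕ) → ℕ} {T T' : ℕ → ℕ → ℕ} {φ ψ : ℕ → ℕ} {i : ℕ}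
    (hi : i < n) (hg : g i φ = g i ψ) (h : ∀ x, x = i ∨ x ∈ κ i → φ x = ψ x) {l : ℕ}
    (hT : ∀ c < l, T c = T' c) :
    localVal o n q κ g T φ i l = localVal o n q κ g T' ψ i l := by
  induction l with
  | zero => exact hg
  | succ l ih =>
    rw [localVal, localVal, ih fun c hc => hT c (by omega)]
    split_ifs with hp
    · rw [hT l (by omega), code_congr fun x hx _ => h x (hκ.subset hi hp x hx)]
    · rfl

theorem gather_spec (hL : L.Suffices n q t G) (hκ : Elim n κ) {g : ℕ → (ℕ → ℕ) → ℕ} {i : ℕ}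
    {φ : ℕ → ℕ}
    (hn : s.v .n = n) (hq : s.v .q = q) (hi : s.v .i = i) (hin : i < n)
    (hK : ∀ i l, i < n → l < n → (0 < s.a .K i l ↔ l ∈ κ i)) (hφ : s.a .phi 0 = φ)
    (hφq : ∀ x < n, φ x < q) (hval : s.v .val = g i φ) (hG : g i φ ≤ G)
    (hT : ∀ c < i, s.a .T c (code q (κ c) φ n) ≤ 2 ^ c * G) :
    Spec L (gather o) s fun s' => s'.v .val = localVal o n q κ g (s.a .T) φ i i := by
  refine spec_loop (n := i) (fun l s' => s'.v .val = localVal o n q κ g (s.a .T) φ i l)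
    (by simp [hi]) (hin.le.trans hL.n_le_N) (hin.le.trans hL.n_le_B) hval ?_ fun _ _ h => h
  intro c hc s' hs' h1
  have hloop : ∀ x, x ∈ [Var.n, .q, .i] → s'.v x = s.v x := by
    intro x hx; refine hs'.v x ?_
    cases o <;> fin_cases hx <;> rfl
  have harr : s'.a = s.a := by
    funext A; refine hs'.a A ?_
    cases o <;> rfl
  rw [spec_seq]
  refine (scan_spec (n := n) (q := q) (S := κ c) (by simp) (by simp [hloop, hn])
    (by simp [hloop, hq]) hL.one_le_q (by simpa [harr] using fun l hl => hK c l (by omega) hl)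
    (hκ.lt_n c) (by simpa [harr, hφ] using hφq) hL.n_le_N hL.n_le_B hL.pow_le_B).mono ?_
  rintro s'' hs'' ⟨h2, h3⟩
  have e1 : s''.v .i = i := by rw [hs''.v .i rfl]; simp [hloop, hi]
  have e2 : s''.v .c = c := by rw [hs''.v .c rfl]; simp
  have e3 : s''.v .val = localVal o n q κ g (s.a .T) φ i c := by rw [hs''.v .val rfl]; simp [h1]
  have e4 : s''.a .T = s.a .T := by rw [hs''.a .T rfl]; simp [harr]
  simp only [St.set_a, harr, hφ] at h2
  have hle : localVal o n q κ g (s.a .T) φ i (c + 1) ≤ L.B := by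
    refine (localVal_le hG fun c' hc' => hT c' (by omega)).trans (le_trans ?_ hL.G_le_B)
    gcongr <;> omega
  -- The sum of both truncated differences vanishes exactly if `fst = i`, that is, if `i` is the
  -- parent of `c`.
  simp only [spec_ite, Exp.ev_add, Exp.ev_sub, Exp.ev_var, e1, h3, spec_skip]
  rw [localVal] at hle ⊢
  by_cases hp : parent n κ c = i
  · rw [if_pos hp] at hle ⊢
    rw [if_neg (by rw [show least n (κ c) = i from hp]; simp)]
    revert hle
    cases o
    · simp only [combine, spec_ite, spec_set, spec_skip, Exp.ev_sub, Exp.ev_arr, Exp.ev_var, e2, e3,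
        e4, h2, Objective.op, St.set_v, if_true]
      intro hle
      split_ifs with hlt
      · have := max_eq_right (show localVal .maxWeightedLateness n q κ g (s.a .T) φ i c ≤
          s.a .T c (code q (κ c) φ n) by omega)
        rw [this] at hle ⊢
        exact ⟨hle, rfl⟩
      · rw [max_eq_left (by omega)]
    · simp only [combine, spec_set, Exp.ev_add, Exp.ev_arr, Exp.ev_var, e2, e3,
        e4, h2, Objective.op, St.set_v, if_true]
      exact fun hle => ⟨hle, trivial⟩
  · have hp' : least n (κ c) ≠ i := hp
    rw [if_pos (by omega), if_neg hp]
    exact e3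

/-- The hypotheses of the dynamic programming. -/
structure DPInput (L : Lim) (n q t G : ℕ) (κ : ℕ → Finset ℕ) (o : Objective) (loc : Cmd)
    (g : ℕ → (ℕ → ℕ) → ℕ) (s : St) : Prop where
  lim : L.Suffices n q t G
  elim : Elim n κ
  card : ∀ i < n, (κ i).card ≤ t
  hn : s.v .n = n
  hq : s.v .q = q
  hK : ∀ i l, i < n → l < n → (0 < s.a .K i l ↔ l ∈ κ i)
  isLocal : loc.IsLocal
  spec : ∀ s', Near s s' → s'.v .i < n → (∀ x < n, s'.a .phi 0 x < q) →
    Spec L loc s' fun s'' => s''.v .val = g (s'.v .i) (s'.a .phi 0)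
  congr : ∀ i < n, ∀ φ ψ : ℕ → ℕ, (∀ x < n, x = i ∨ x ∈ κ i → φ x = ψ x) → g i φ = g i ψ
  le : ∀ i < n, ∀ φ, (∀ x < n, φ x < q) → g i φ ≤ G

/-! ### Correctness of the dynamic programming -/

open Cmd

variable {L : Lim} {s : St} {n q t G : ℕ} {κ : ℕ → Finset ℕ} {o : Objective} {loc : Cmd}
  {g : ℕ → (ℕ → ℕ) → ℕ}

theorem wv_gather {x : Var} (h : x ∉ [Var.c, .idx, .p, .fst, .l, .val]) :
    (gather o).wv x = false := by
  simp only [List.mem_cons, List.not_mem_nil, or_false, not_or] at h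
  cases o <;> simp [gather, scan, combine, wv, h]

theorem wa_gather (A : Arr) : (gather o).wa A = false := by cases o <;> rfl

theorem wv_bestValue (h : loc.IsLocal) {x : Var} (hx : x ∈ [Var.i, .m, .num]) :
    (bestValue o loc).wv x = false := by
  fin_cases hx <;> simp [bestValue, wv, h.wv (x := .i) rfl, h.wv (x := .m) rfl,
    h.wv (x := .num) rfl, wv_gather]

theorem wa_bestValue (h : loc.IsLocal) {A : Arr} (hA : A ≠ .phi) :
    (bestValue o loc).wa A = false := by
  simp [bestValue, wa, h.a, wa_gather, hA]

theorem bestValue_spec {s₀ : St} (H : DPInput L n q t G κ o loc g s₀) (hs : Near s₀ s) {i : ℕ}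
    (hi : s.v .i = i) (hin : i < n) {φ : ℕ → ℕ} (hφ : s.a .phi 0 = φ) (hφq : ∀ x < n, φ x < q)
    (hT : ∀ c < i, ∀ ψ, (∀ x < n, ψ x < q) → s.a .T c (code q (κ c) ψ n) ≤ 2 ^ c * G) :
    Spec L (bestValue o loc) s fun s' =>
      s'.v .bx < q ∧
      s'.v .bv = localVal o n q κ g (s.a .T) (Function.update φ i (s'.v .bx)) i i ∧
      (∀ y < q, s'.v .bv ≤ localVal o n q κ g (s.a .T) (Function.update φ i y) i i) ∧
      (∀ z, z ≠ i → s'.a .phi 0 z = φ z) ∧ ∀ z < n, s'.a .phi 0 z < q := by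
  have hq : s.v .q = q := (hs.v .q rfl).trans H.hq
  refine spec_loop (n := q) (fun x s' =>
      (0 < x → s'.v .bx < q ∧
      s'.v .bv = localVal o n q κ g (s.a .T) (Function.update φ i (s'.v .bx)) i i) ∧
      (∀ y < x, s'.v .bv ≤ localVal o n q κ g (s.a .T) (Function.update φ i y) i i) ∧
      (∀ z, z ≠ i → s'.a .phi 0 z = φ z) ∧ ∀ z < n, s'.a .phi 0 z < q)
    hq H.lim.q_le H.lim.q_le_B ⟨by simp, by simp, by simp [hφ], by simpa [hφ] using hφq⟩ ?_
    fun s' _ h => ⟨(h.1 H.lim.one_le_q).1, (h.1 H.lim.one_le_q).2, h.2⟩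
  rintro x hx s' hs' ⟨h1, h2, h3, h4⟩
  have near' : Near s₀ s' := hs.agree (isScratch_bestValue H.isLocal) hs'
  have hi' : s'.v .i = i := by rw [hs'.v .i (wv_bestValue H.isLocal (by simp))]; exact hi
  have hT' : s'.a .T = s.a .T := hs'.a .T (wa_bestValue H.isLocal (by simp))
  have hxB : x ≤ L.B := hx.le.trans H.lim.q_le_B
  have hup : Function.update (s'.a .phi 0) i x = Function.update φ i x := by
    funext z
    by_cases hz : z = i
    · simp [hz]
    · simp [hz, h3 z hz]
  have hupq : ∀ z < n, Function.update φ i x z < q := by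
    intro z hz
    rw [Function.update_apply]
    split_ifs; exacts [hx, hφq z hz]
  simp only [spec_seq, spec_put, Exp.ev_var, Exp.ev_lit, St.set_v, if_true, reduceCtorEq, if_false,
    hi']
  refine ⟨hxB, ?_⟩
  set s₁ := (s'.set .x x).put .phi 0 i x with hs₁
  have near₁ : Near s₀ s₁ := (near'.set rfl _).put rfl _ _ _
  have hφ₁ : s₁.a .phi 0 = Function.update φ i x := by
    rw [hs₁]; simp [hup]
  have hi₁ : s₁.v .i = i := by simp [hs₁, hi']
  have hT₁ : s₁.a .T = s.a .T := by simp [hs₁, hT']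
  refine (H.spec s₁ near₁ (by rw [hi₁]; exact hin) (by rw [hφ₁]; exact hupq)).mono fun s₂ hs₂ hval => ?_
  rw [hφ₁, hi₁] at hval
  have arr₂ : s₂.a = s₁.a := by funext A; exact hs₂.a A (H.isLocal.a A)
  have near₂ : Near s₀ s₂ := near₁.agree H.isLocal.isScratch hs₂
  have hi₂ : s₂.v .i = i := by rw [hs₂.v .i (H.isLocal.wv rfl), hi₁]
  have hn₂ : s₂.v .n = n := (near₂.v .n rfl).trans H.hn
  have hq₂ : s₂.v .q = q := (near₂.v .q rfl).trans H.hq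
  refine (gather_spec H.lim H.elim (g := g) (φ := Function.update φ i x) hn₂ hq₂ hi₂ hin
    (by rw [near₂.a .K rfl]; exact H.hK) (by rw [arr₂, hφ₁]) hupq hval
    (H.le i hin _ hupq) (by rw [arr₂, hT₁]; exact fun c hc => hT c hc _ hupq)).mono
    fun s₃ hs₃ hval₃ => ?_
  rw [arr₂, hT₁] at hval₃
  have hv₃ : ∀ y ∈ [Var.x, .bv, .bx], s₃.v y = s₁.v y := by
    intro y hy
    have e1 : s₃.v y = s₂.v y := hs₃.v y (wv_gather (by fin_cases hy <;> decide))
    have e2 : s₂.v y = s₁.v y := hs₂.v y (H.isLocal.wv (by fin_cases hy <;> rfl))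
    rw [e1, e2]
  have arr₃ : s₃.a = s₁.a := by rw [← arr₂]; funext A; exact hs₃.a A (wa_gather A)
  have hx₃ : s₃.v .x = x := by rw [hv₃ .x (by simp)]; simp [hs₁]
  have hbv₃ : s₃.v .bv = s'.v .bv := by rw [hv₃ .bv (by simp)]; simp [hs₁]
  have hbx₃ : s₃.v .bx = s'.v .bx := by rw [hv₃ .bx (by simp)]; simp [hs₁]
  have hle : localVal o n q κ g (s.a .T) (Function.update φ i x) i i ≤ L.B := by
    refine (localVal_le (H.le i hin _ hupq) fun c hc => hT c hc _ hupq).trans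
      (le_trans ?_ H.lim.G_le_B)
    gcongr; norm_num
  -- The test is positive if `x = 0` or `val < bv`. So the first round always stores its result,
  -- whatever `bv` contained before.
  simp only [spec_ite, spec_seq, spec_set, spec_skip, Exp.ev_add, Exp.ev_sub, Exp.ev_lit, Exp.ev_var,
    St.set_v, if_true, if_false, reduceCtorEq, hx₃, hbv₃, hval₃, hbx₃, St.set_a, arr₃, hφ₁]
  have hz1 : ∀ z, z ≠ i → Function.update φ i x z = φ z := fun z hz => Function.update_of_ne hz _ _
  split_ifs with hc
  · refine ⟨hle, hxB, fun _ => ⟨hx, trivial⟩, fun y hy => ?_, hz1, hupq⟩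
    rcases (show y < x ∨ y = x by omega) with hy | rfl
    · refine le_trans ?_ (h2 y hy); omega
    · exact le_rfl
  · have hx0 : 0 < x := by omega
    refine ⟨fun _ => h1 hx0, fun y hy => ?_, hz1, hupq⟩
    rcases (show y < x ∨ y = x by omega) with hy | rfl
    · exact h2 y hy
    · omega

/-- A row of the tables is correct and has bounded entries. -/
structure RowOk (o : Objective) (n q G : ℕ) (κ : ℕ → Finset ℕ) (g : ℕ → (ℕ → ℕ) → ℕ)
    (T X : ℕ → ℕ → ℕ) (i : ℕ) : Prop where
  tables : Tables o n q κ g T X i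
  le : ∀ ψ : ℕ → ℕ, (∀ x < n, ψ x < q) → T i (code q (κ i) ψ n) ≤ 2 ^ i * G

/-- The local value of a vertex reads earlier rows only, so a finished row stays correct while later
rows are filled. -/
theorem RowOk.congr (hκ : Elim n κ) {T T' X X' : ℕ → ℕ → ℕ} {i : ℕ} (hi : i < n)
    (h : RowOk o n q G κ g T X i) (hT : ∀ c ≤ i, T' c = T c) (hX : X' i = X i) :
    RowOk o n q G κ g T' X' i := by
  have hl : ∀ ψ, localVal o n q κ g T' ψ i i = localVal o n q κ g T ψ i i := fun ψ =>
    localVal_congr hκ hi rfl (fun _ _ => rfl) fun c hc => hT c hc.le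
  refine ⟨fun ψ hψ => ?_, fun ψ hψ => ?_⟩
  · rw [hT i le_rfl, hX, hl]; exact h.tables ψ hψ
  · rw [hT i le_rfl]; exact h.le ψ hψ

theorem fillTable_spec {s₀ : St} (H : DPInput L n q t G κ o loc g s₀) (hs : Near s₀ s) {i : ℕ}
    (hi : s.v .i = i) (hin : i < n) (hrow : ∀ c < i, RowOk o n q G κ g (s.a .T) (s.a .X) c) :
    Spec L (fillTable o loc) s fun s' => RowOk o n q G κ g (s'.a .T) (s'.a .X) i ∧
      ∀ c, c ≠ i → s'.a .T c = s.a .T c ∧ s'.a .X c = s.a .X c := by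
  have hS := H.elim.lt_n i
  have hiS : ∀ x ∈ κ i, x ≠ i := fun x hx => (H.elim.lt i x hx).ne'
  have hn : s.v .n = n := (hs.v .n rfl).trans H.hn
  have hq : s.v .q = q := (hs.v .q rfl).trans H.hq
  have hK : s.a .K = s₀.a .K := hs.a .K rfl
  rw [fillTable, spec_seq]
  refine (rowCount_spec (n := n) (q := q) (S := κ i) (by simp) hn hq H.lim.one_le_q
    (by rw [hi, hK]; exact fun l hl => H.hK i l hin hl) hS H.lim.n_le_N H.lim.n_le_B
    H.lim.pow_le_B).mono fun s₁ hs₁ hnum => ?_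
  rw [spec_seq]
  have hn₁ : s₁.v .n = n := (hs₁.v .n rfl).trans hn
  refine (clear_spec hn₁ H.lim.n_le_N H.lim.n_le_B).mono fun s₂ hs₂ hclear => ?_
  have near₂ : Near s₀ s₂ := (hs.agree isScratch_rowCount hs₁).agree isScratch_clear hs₂
  have hnum₂ : s₂.v .num = q ^ (κ i).card := (hs₂.v .num rfl).trans hnum
  have hi₂ : s₂.v .i = i := (hs₂.v .i rfl).trans ((hs₁.v .i rfl).trans hi)
  have hT₂ : s₂.a .T = s.a .T := (hs₂.a .T rfl).trans (hs₁.a .T rfl)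
  have hX₂ : s₂.a .X = s.a .X := (hs₂.a .X rfl).trans (hs₁.a .X rfl)
  have hwgt : wgt q (κ i) n = q ^ (κ i).card := wgt_eq_pow hS
  -- Before round `m`, the digits of `phi` on `κ i` represent `m`, and all entries with smaller
  -- numbers are correct.
  refine spec_loop (n := q ^ (κ i).card) (fun m s' => (∀ x < n, s'.a .phi 0 x < q) ∧
      (m < q ^ (κ i).card → code q (κ i) (s'.a .phi 0) n = m) ∧
      (∀ c, c ≠ i → s'.a .T c = s.a .T c ∧ s'.a .X c = s.a .X c) ∧
      ∀ ψ, (∀ x < n, ψ x < q) → code q (κ i) ψ n < m →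
        s'.a .T i (code q (κ i) ψ n) ≤ localVal o n q κ g (s.a .T) ψ i i ∧
        s'.a .X i (code q (κ i) ψ n) < q ∧
        (ψ i = s'.a .X i (code q (κ i) ψ n) →
          s'.a .T i (code q (κ i) ψ n) = localVal o n q κ g (s.a .T) ψ i i))
    hnum₂ ((Nat.pow_le_pow_right H.lim.one_le_q (H.card i hin)).trans H.lim.pow_le_M)
    (by rw [← hwgt]; exact (wgt_le_pow H.lim.one_le_q).trans H.lim.pow_le_B) ?_ ?_ ?_
  · refine ⟨fun x hx => by rw [hclear x hx]; exact H.lim.one_le_q, fun _ => ?_, fun c _ => ?_, by simp⟩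
    · refine (code_congr (ψ := fun _ => 0) fun x hx _ => hclear x (hS x hx)).trans ?_
      simp [code]
    · rw [hT₂, hX₂]; exact ⟨rfl, rfl⟩
  · rintro m hm s' hs' ⟨h1, h2, h3, h4⟩
    have near' : Near s₀ s' := near₂.agree (.loop rfl (.seq (isScratch_bestValue H.isLocal)
      (.seq (.put rfl) (.seq (.put rfl) isScratch_odometer)))) hs'
    have hi' : s'.v .i = i := by
      rw [hs'.v .i ?_, hi₂]
      simp [wv, wv_bestValue H.isLocal, odometer]
    have hTlow : ∀ c < i, s'.a .T c = s.a .T c := fun c hc => (h3 c hc.ne).1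
    have hLV : ∀ ψ, localVal o n q κ g (s'.a .T) ψ i i = localVal o n q κ g (s.a .T) ψ i i := fun ψ =>
      localVal_congr H.elim hin rfl (fun _ _ => rfl) hTlow
    have hmB : m ≤ L.B := hm.le.trans
      (by rw [← hwgt]; exact (wgt_le_pow H.lim.one_le_q).trans H.lim.pow_le_B)
    rw [spec_seq]
    refine (bestValue_spec H (near'.set rfl m) (i := i) (by simp [hi']) hin rfl
      (by simpa using h1) fun c hc ψ hψ => ?_).mono ?_
    · simpa [hTlow c hc] using (hrow c hc).le ψ hψ
    rintro s₃ hs₃ ⟨b1, b2, b3, b4, b5⟩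
    simp only [St.set_a, hLV] at b2 b3 b4
    have arr₃ : ∀ A, A ≠ .phi → s₃.a A = s'.a A := fun A hA => by
      rw [hs₃.a A (wa_bestValue H.isLocal hA)]; simp
    have hi₃ : s₃.v .i = i := by rw [hs₃.v .i (wv_bestValue H.isLocal (by simp))]; simp [hi']
    have hm₃ : s₃.v .m = m := by rw [hs₃.v .m (wv_bestValue H.isLocal (by simp))]; simp
    have near₃ : Near s₀ s₃ := (near'.set rfl m).agree (isScratch_bestValue H.isLocal) hs₃
    have hbv : s₃.v .bv ≤ L.B := by
      have h0 : ∀ x < n, Function.update (s'.a .phi 0) i (s₃.v .bx) x < q := fun x hx => by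
        rw [Function.update_apply]; split_ifs; exacts [b1, h1 x hx]
      rw [b2]
      refine (localVal_le (H.le i hin _ h0) fun c hc => (hrow c hc).le _ h0).trans
        (le_trans ?_ H.lim.G_le_B)
      gcongr; norm_num
    simp only [spec_seq, spec_put, Exp.ev_var, hi₃, hm₃, St.put_v]
    refine ⟨hbv, b1.le.trans H.lim.q_le_B, ?_⟩
    set s₄ := (s₃.put .T i m (s₃.v .bv)).put .X i m (s₃.v .bx) with hs₄
    have near₄ : Near s₀ s₄ := (near₃.put rfl _ _ _).put rfl _ _ _
    have hφ₄ : s₄.a .phi = s₃.a .phi := by simp [hs₄]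
    have hi₄ : s₄.v .i = i := by simp [hs₄, hi₃]
    refine (odometer_spec (n := n) (q := q) (S := κ i) (by simp) (by simp)
      ((near₄.v .n rfl).trans H.hn) ((near₄.v .q rfl).trans H.hq)
      (by rw [hi₄, near₄.a .K rfl]; exact fun l hl => H.hK i l hin hl) (by rw [hφ₄]; exact b5)
      H.lim.n_le_N H.lim.n_le_B H.lim.one_le_B H.lim.q_le_B).mono ?_
    rintro s₅ hs₅ ⟨d1, d2⟩
    have hT₅ : s₅.a .T = Function.update (s'.a .T) i (Function.update (s'.a .T i) m (s₃.v .bv)) := by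
      rw [hs₅.a .T rfl, hs₄]; simp [arr₃]
    have hX₅ : s₅.a .X = Function.update (s'.a .X) i (Function.update (s'.a .X i) m (s₃.v .bx)) := by
      rw [hs₅.a .X rfl, hs₄]; simp [arr₃]
    -- The search for the best value has changed `phi` at place `i` only. As `i ∉ κ i`, the counter
    -- is intact.
    have hcode : code q (κ i) (s₄.a .phi 0) n = m := by
      rw [hφ₄, ← h2 hm]
      exact code_congr fun x hx _ => b4 x (hiS x hx)
    refine ⟨d1, fun hm1 => ?_, fun c hc => ?_, fun ψ hψ hlt => ?_⟩
    · rw [d2 (by rw [hcode, hwgt]; exact hm1), hcode]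
    · rw [hT₅, hX₅, Function.update_of_ne hc, Function.update_of_ne hc]; exact h3 c hc
    · rw [hT₅, hX₅, Function.update_self, Function.update_self]
      rcases (show code q (κ i) ψ n < m ∨ code q (κ i) ψ n = m by omega) with hlt | heq
      · rw [Function.update_of_ne hlt.ne, Function.update_of_ne hlt.ne]; exact h4 ψ hψ hlt
      · rw [heq, Function.update_self, Function.update_self]
        -- An assignment with number `m` agrees with `phi` on `κ i`. So its local value is one of
        -- those among which the minimum was taken.
        have hψφ : localVal o n q κ g (s.a .T) ψ i i =
            localVal o n q κ g (s.a .T) (Function.update (s'.a .phi 0) i (ψ i)) i i := by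
          have hag : ∀ x, x = i ∨ x ∈ κ i → ψ x = Function.update (s'.a .phi 0) i (ψ i) x := by
            rintro x (rfl | hx)
            · simp
            · rw [Function.update_of_ne (hiS x hx)]
              exact code_inj (q := q) (fun x hx => hψ x (hS x hx)) (fun x hx => h1 x (hS x hx))
                (heq.trans (h2 hm).symm) x hx (hS x hx)
          exact localVal_congr H.elim hin (H.congr i hin _ _ fun x _ hx => hag x hx) hag
            fun _ _ => rfl
        rw [hψφ]
        refine ⟨b3 _ (hψ i hin), b1, fun h => ?_⟩
        rw [h, b2]
  · rintro s' - ⟨-, -, h3, h4⟩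
    refine ⟨⟨fun ψ hψ => ?_, fun ψ hψ => ?_⟩, h3⟩
    all_goals
      have h5 := h4 ψ hψ (by rw [← hwgt]; exact code_lt_wgt fun x hx => hψ x (hS x hx))
      have hTlow : ∀ c < i, s'.a .T c = s.a .T c := fun c hc => (h3 c hc.ne).1
    · rwa [localVal_congr H.elim hin rfl (fun _ _ => rfl) hTlow]
    · exact h5.1.trans (localVal_le (H.le i hin _ hψ) fun c hc => (hrow c hc).le ψ hψ)

/-- The vertices are treated in decreasing order: when the minimizer for `i` is looked up, the
values on `κ i` are final. -/
theorem readBack_spec {s₀ : St} (H : DPInput L n q t G κ o loc g s₀) (hs : Near s₀ s)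
    (hX : ∀ i < n, ∀ ψ : ℕ → ℕ, (∀ x < n, ψ x < q) → s.a .X i (code q (κ i) ψ n) < q) :
    Spec L readBack s fun s' => (∀ x < n, s'.a .phi 0 x < q) ∧
      ∀ i < n, s'.a .phi 0 i = s.a .X i (code q (κ i) (s'.a .phi 0) n) := by
  have hn : s.v .n = n := (hs.v .n rfl).trans H.hn
  rw [readBack, spec_seq]
  refine (clear_spec hn H.lim.n_le_N H.lim.n_le_B).mono fun s₁ hs₁ hclear => ?_
  have near₁ : Near s₀ s₁ := hs.agree isScratch_clear hs₁
  refine spec_loop (n := n) (fun m s' => (∀ x < n, s'.a .phi 0 x < q) ∧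
      ∀ i < n, n ≤ i + m → s'.a .phi 0 i = s.a .X i (code q (κ i) (s'.a .phi 0) n))
    ((hs₁.v .n rfl).trans hn) H.lim.n_le_N H.lim.n_le_B
    ⟨fun x hx => by rw [hclear x hx]; exact H.lim.one_le_q, fun i hi h => by omega⟩ ?_
    fun s' _ h => ⟨h.1, fun i hi => h.2 i hi (by omega)⟩
  rintro m hm s' hs' ⟨h1, h2⟩
  have near' : Near s₀ s' := near₁.agree
    (.loop rfl (.seq (.set rfl) (.seq isScratch_scan (.put rfl)))) hs'
  have hX' : s'.a .X = s.a .X := (hs'.a .X rfl).trans (hs₁.a .X rfl)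
  have hn' : s'.v .n = n := (near'.v .n rfl).trans H.hn
  have hq' : s'.v .q = q := (near'.v .q rfl).trans H.hq
  have hin : n - (m + 1) < n := by omega
  have hS := H.elim.lt_n (n - (m + 1))
  have hnB := H.lim.n_le_B
  simp only [spec_seq, spec_set, Exp.ev_sub, Exp.ev_add, Exp.ev_var, Exp.ev_lit, St.set_v, if_true,
    reduceCtorEq, if_false, hn']
  refine ⟨by omega, ?_⟩
  generalize hidef : n - (m + 1) = i at *
  refine (scan_spec (n := n) (q := q) (S := κ i) (by simp) (by simp [hn']) (by simp [hq'])
    H.lim.one_le_q ?_ hS (by simpa using h1) H.lim.n_le_N H.lim.n_le_B H.lim.pow_le_B).mono ?_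
  · simp only [St.set_v, if_true, St.set_a, near'.a .K rfl]
    exact fun l hl => H.hK i l hin hl
  rintro s₂ hs₂ ⟨h3, -⟩
  have hi₂ : s₂.v .i = i := by rw [hs₂.v .i rfl]; simp
  have arr₂ : s₂.a = s'.a := by funext A; rw [hs₂.a A rfl]; simp
  simp only [St.set_a] at h3
  simp only [spec_put, Exp.ev_arr, Exp.ev_var, Exp.ev_lit, hi₂, h3, arr₂, hX', St.put_a, if_true,
    Function.update_self]
  have hlt := hX i hin _ h1
  refine ⟨hlt.le.trans H.lim.q_le_B, fun x hx => ?_, fun j hj hjm => ?_⟩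
  · rw [Function.update_apply]; split_ifs; exacts [hlt, h1 x hx]
  · have hc : ∀ v, code q (κ j) (Function.update (s'.a .phi 0) i v) n = code q (κ j) (s'.a .phi 0) n :=
      fun v => code_congr fun x hx _ => Function.update_of_ne (by
        have := H.elim.lt j x hx; omega) _ _
    rw [hc]
    by_cases hji : j = i
    · subst hji; simp
    · rw [Function.update_of_ne hji]; exact h2 j hj (by omega)

/-- The dynamic programming finds an assignment of minimum value. -/
theorem optimize_spec (H : DPInput L n q t G κ o loc g s) :
    Spec L (optimize o loc) s fun s' => (∀ x < n, s'.a .phi 0 x < q) ∧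
      ∀ ψ : ℕ → ℕ, (∀ x < n, ψ x < q) →
        o.fold (fun i => g i (s'.a .phi 0)) (Finset.range n) ≤
          o.fold (fun i => g i ψ) (Finset.range n) := by
  rw [optimize, spec_seq]
  refine spec_loop (n := n) (fun i s' => ∀ c < i, RowOk o n q G κ g (s'.a .T) (s'.a .X) c)
    H.hn H.lim.n_le_N H.lim.n_le_B (by simp) ?_ ?_
  · intro i hi s' hs' h
    have near' : Near s s' := Near.of_agree (.loop rfl (isScratch_fillTable H.isLocal)) hs'
    refine (fillTable_spec H (near'.set rfl i) (i := i) (by simp) hi (by simpa using h)).mono ?_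
    rintro s₁ - ⟨h1, h2⟩ c hc
    simp only [St.set_a] at h2
    rcases (show c < i ∨ c = i by omega) with hc | rfl
    · exact (h c hc).congr H.elim (hc.trans hi) (fun d hd => (h2 d (by omega)).1) (h2 c hc.ne).2
    · exact h1
  · intro s' hs' h
    have near' : Near s s' := Near.of_agree (.loop rfl (isScratch_fillTable H.isLocal)) hs'
    refine (readBack_spec H near' fun i hi ψ hψ => ((h i hi).tables ψ hψ).2.1).mono ?_
    rintro s₁ - ⟨h1, h2⟩
    exact ⟨h1, fun ψ hψ => H.elim.optimal o (fun i hi => (h i hi).tables) h1 hψ h2⟩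

open Cmd

/-! ### The local values of the scheduling problem -/

/-- A function on `Fin n`, extended by zero. -/
def ext {n : ℕ} {α : Type*} [Zero α] (f : Fin n → α) (u : ℕ) : α := if h : u < n then f ⟨u, h⟩ else 0

theorem ext_val {n : ℕ} {α : Type*} [Zero α] (f : Fin n → α) (j : Fin n) : ext f j = f j := by
  simp [ext]

/-- A relation between `Fin a` and `Fin b`, extended by `False`. -/
def extRel {a b : ℕ} (A : Fin a → Fin b → Prop) (u v : ℕ) : Prop :=
  ∃ (hu : u < a) (hv : v < b), A ⟨u, hu⟩ ⟨v, hv⟩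

theorem extRel_val {a b : ℕ} (A : Fin a → Fin b → Prop) (i : Fin a) (j : Fin b) :
    extRel A i j ↔ A i j := by
  simp [extRel]

/-- An elimination structure `κ` of width `t` whose vertices are in bijection with those of the graph
`adj`, with an edge for each edge of the graph. -/
structure Layout (n : ℕ) (adj : ℕ → ℕ → Prop) (κ : ℕ → Finset ℕ) (ord : ℕ → ℕ) (t : ℕ) : Prop where
  elim : Elim n κ
  card : ∀ i < n, (κ i).card ≤ t
  ord_lt : ∀ i < n, ord i < n
  ord_inj : ∀ i < n, ∀ j < n, ord i = ord j → i = j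
  edge : ∀ i < n, ∀ j < n, i < j → adj (ord i) (ord j) → j ∈ κ i

theorem Layout.exists_ord {n : ℕ} {adj : ℕ → ℕ → Prop} {κ : ℕ → Finset ℕ} {ord : ℕ → ℕ} {t : ℕ}
    (h : Layout n adj κ ord t) {u : ℕ} (hu : u < n) : ∃ i < n, ord i = u := by
  have h1 : (Finset.range n).image ord = Finset.range n := by
    refine Finset.eq_of_subset_of_card_le (fun x hx => ?_) ?_
    · obtain ⟨i, hi, rfl⟩ := Finset.mem_image.1 hx
      exact Finset.mem_range.2 (h.ord_lt i (Finset.mem_range.1 hi))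
    · rw [Finset.card_image_of_injOn fun i hi j hj hij => h.ord_inj i (by simpa using hi) j
        (by simpa using hj) hij]
  have h2 : u ∈ (Finset.range n).image ord := by rw [h1]; exact Finset.mem_range.2 hu
  obtain ⟨i, hi, rfl⟩ := Finset.mem_image.1 h2
  exact ⟨i, Finset.mem_range.1 hi, rfl⟩

namespace Instance

variable (I : Instance)

/-- The cost of a job with weight `w` and due date `d` that is completed at time `C`. -/
def jobCost (o : Objective) (w d : ℤ) (C : ℕ) : ℤ :=
  match o with
  | .maxWeightedLateness => w * (C - d)
  | .totalWeightedTardiness => w * max 0 (C - d)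

/-- A bound for the absolute values of the costs of the jobs. -/
def offset (k : ℕ) : ℕ :=
  ∑ u ∈ Finset.range I.n, (ext I.w u).natAbs * (k + (ext I.d u).natAbs)

/-- A value larger than that of all feasible schedules. -/
def penalty (k : ℕ) : ℕ := I.n * (I.offset k + I.offset k) + 1

/-- Vertex `i` violates its release time or is in conflict with a later neighbour. -/
def Bad (κ : ℕ → Finset ℕ) (ord : ℕ → ℕ) (i : ℕ) (φ : ℕ → ℕ) : Prop :=
  φ i + 1 < ext I.p (ord i) + ext I.r (ord i) ∨
  ∃ l < I.n, l ∈ κ i ∧ extRel I.graph.Adj (ord i) (ord l) ∧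
    φ i + 1 < φ l + 1 + ext I.p (ord i) ∧ φ l + 1 < φ i + 1 + ext I.p (ord l)

open Classical in
/-- The value of vertex `i`, when the jobs are completed at the times `φ j + 1`. -/
noncomputable def vertexVal (o : Objective) (k : ℕ) (κ : ℕ → Finset ℕ) (ord : ℕ → ℕ) (i : ℕ)
    (φ : ℕ → ℕ) : ℕ :=
  if I.Bad κ ord i φ then I.penalty k
  else (I.offset k + jobCost o (ext I.w (ord i)) (ext I.d (ord i)) (φ i + 1)).toNat

variable {I} {o : Objective} {k : ℕ}

/-- The bound for a single job is one of the summands of the offset. Hence the offset makes the cost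
of every job nonnegative. -/
theorem abs_jobCost_le {u C : ℕ} (hu : u < I.n) (hC : C ≤ k) :
    |jobCost o (ext I.w u) (ext I.d u) C| ≤ I.offset k := by
  have h1 : (ext I.w u).natAbs * (k + (ext I.d u).natAbs) ≤ I.offset k :=
    Finset.single_le_sum (f := fun u => (ext I.w u).natAbs * (k + (ext I.d u).natAbs))
      (fun _ _ => Nat.zero_le _) (Finset.mem_range.2 hu)
  generalize ext I.w u = w at *
  generalize ext I.d u = d at *
  have h2 : |(C : ℤ) - d| ≤ (k + d.natAbs : ℕ) := abs_le.2 ⟨by omega, by omega⟩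
  have h3 : |max 0 ((C : ℤ) - d)| ≤ (k + d.natAbs : ℕ) := abs_le.2 ⟨by omega, by omega⟩
  have h4 : |w| * ((k + d.natAbs : ℕ) : ℤ) ≤ I.offset k := by
    rw [Int.abs_eq_natAbs]; exact_mod_cast h1
  cases o
  · rw [jobCost, abs_mul]
    exact (mul_le_mul_of_nonneg_left h2 (abs_nonneg w)).trans h4
  · rw [jobCost, abs_mul]
    exact (mul_le_mul_of_nonneg_left h3 (abs_nonneg w)).trans h4

theorem two_offset_le : I.offset k + I.offset k ≤ I.penalty k := by
  have := Nat.le_mul_of_pos_left (I.offset k + I.offset k) I.n_pos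
  unfold penalty; omega

theorem vertexVal_le {κ : ℕ → Finset ℕ} {ord : ℕ → ℕ} {i : ℕ} {φ : ℕ → ℕ} (hi : ord i < I.n)
    (hφ : φ i < k) : I.vertexVal o k κ ord i φ ≤ I.penalty k := by
  rw [vertexVal]
  split_ifs
  · exact le_rfl
  · have := abs_le.1 (abs_jobCost_le (o := o) hi (show φ i + 1 ≤ k by omega))
    have := two_offset_le (I := I) (k := k)
    omega

theorem vertexVal_congr {κ : ℕ → Finset ℕ} {ord : ℕ → ℕ} {i : ℕ} {φ ψ : ℕ → ℕ} (hi : i < I.n)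
    (h : ∀ x < I.n, x = i ∨ x ∈ κ i → φ x = ψ x) :
    I.vertexVal o k κ ord i φ = I.vertexVal o k κ ord i ψ := by
  have h0 := h i hi (Or.inl rfl)
  have : I.Bad κ ord i φ ↔ I.Bad κ ord i ψ := by
    unfold Bad
    rw [h0]
    refine or_congr Iff.rfl (exists_congr fun l => and_congr_right fun hl => and_congr_right fun hl' => ?_)
    rw [h l hl (Or.inr hl')]
  by_cases hb : I.Bad κ ord i φ
  · rw [vertexVal, vertexVal, if_pos hb, if_pos (this.1 hb)]
  · rw [vertexVal, vertexVal, if_neg hb, if_neg (mt this.2 hb), h0]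

theorem le_fold (o : Objective) {f : ℕ → ℕ} {s : Finset ℕ} {a : ℕ} (ha : a ∈ s) : f a ≤ o.fold f s := by
  rw [← Finset.insert_erase ha, o.fold_insert (by simp)]
  cases o
  exacts [le_max_left _ _, Nat.le_add_right _ _]

theorem fold_le (o : Objective) {f : ℕ → ℕ} {s : Finset ℕ} {c : ℕ} (h : ∀ a ∈ s, f a ≤ c) :
    o.fold f s ≤ s.card * c := by
  induction s using Finset.induction_on with
  | empty => simp [Objective.fold]
  | insert a s ha ih =>
    rw [o.fold_insert ha, Finset.card_insert_of_notMem ha, add_mul, one_mul, add_comm]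
    exact (o.op_le_add _ _).trans (add_le_add (h a (by simp)) (ih fun b hb => h b (by simp [hb])))

/-- The combination of costs increased by the offset is determined by the value. -/
theorem fold_le_iff {α : Type*} [Fintype α] [Nonempty α] (o : Objective) {f f' : ℕ → ℕ} {n : ℕ}
    {c c' : α → ℤ} {off : ℤ} (e : α → ℕ) (he : ∀ a, e a < n) (hinj : Function.Injective e)
    (hsurj : ∀ i < n, ∃ a, e a = i)
    (hf : ∀ a, (f (e a) : ℤ) = off + c a) (hf' : ∀ a, (f' (e a) : ℤ) = off + c' a)
    (h : o.fold f (Finset.range n) ≤ o.fold f' (Finset.range n)) :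
    match o with
    | .maxWeightedLateness => Finset.univ.sup' Finset.univ_nonempty c ≤
        Finset.univ.sup' Finset.univ_nonempty c'
    | .totalWeightedTardiness => ∑ a, c a ≤ ∑ a, c' a := by
  have himg : Finset.range n = Finset.univ.image e := by
    ext i
    simp only [Finset.mem_range, Finset.mem_image, Finset.mem_univ, true_and]
    exact ⟨hsurj i, by rintro ⟨a, rfl⟩; exact he a⟩
  cases o
  · simp only [Finset.sup'_le_iff, Finset.mem_univ, forall_const]
    intro a
    have h1 := (le_fold .maxWeightedLateness (f := f) (Finset.mem_range.2 (he a))).trans h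
    -- Otherwise all terms of `f'` are less than `f (e a)`. This number is then positive, so it also
    -- exceeds the start value `0` of the fold, and thus the whole fold.
    have h2 : ∃ b, f (e a) ≤ f' (e b) := by
      by_contra! hb
      have h3 : Objective.fold .maxWeightedLateness f' (Finset.range n) < f (e a) := by
        have := (Finset.fold_max_lt (f := f') (s := Finset.range n) (b := 0) (c := f (e a))).2
          ⟨(Nat.zero_le _).trans_lt (hb a), fun x hx => by
            obtain ⟨b, rfl⟩ := hsurj x (Finset.mem_range.1 hx)
            exact hb b⟩
        exact this
      omega
    obtain ⟨b, hb⟩ := h2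
    have h4 := hf a
    have h5 := hf' b
    have h6 : c a ≤ c' b := by omega
    exact h6.trans (Finset.le_sup' c' (Finset.mem_univ b))
  · have hs : ∀ g : ℕ → ℕ, Objective.fold .totalWeightedTardiness g (Finset.range n) =
        ∑ a, g (e a) := by
      intro g
      rw [himg, ← Finset.sum_image (f := g) (fun a _ b _ hab => hinj hab)]
      rfl
    rw [hs, hs] at h
    have h' : ((∑ a, f (e a) : ℕ) : ℤ) ≤ ((∑ a, f' (e a) : ℕ) : ℤ) := by exact_mod_cast h
    push_cast at h'
    simp only [hf, hf', Finset.sum_add_distrib] at h'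
    simpa using h'

/-- Two nonempty intervals meet exactly if each begins before the other one ends. Positive lengths
matter: an empty interval meets nothing. -/
theorem disjoint_iff {a b p q : ℕ} (hp : 1 ≤ p) (hq : 1 ≤ q) :
    Disjoint (Set.Ico ((a : ℤ) - p) a) (Set.Ico ((b : ℤ) - q) b) ↔ ¬ (a < b + p ∧ b < a + q) := by
  rw [Set.Ico_disjoint_Ico]
  omega

/-- Optimal assignments are optimal schedules. -/
theorem isOptimal_of_fold_le {κ : ℕ → Finset ℕ} {ord : ℕ → ℕ} {t : ℕ}
    (hl : Layout I.n (extRel I.graph.Adj) κ ord t) {φ : ℕ → ℕ} (hφ : ∀ x < I.n, φ x < k)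
    (hex : ∃ C : I.Schedule, I.IsOptimal o C ∧ I.makespan C ≤ k)
    (hmin : ∀ ψ : ℕ → ℕ, (∀ x < I.n, ψ x < k) →
      o.fold (fun i => I.vertexVal o k κ ord i φ) (Finset.range I.n) ≤
        o.fold (fun i => I.vertexVal o k κ ord i ψ) (Finset.range I.n))
    {C : I.Schedule} (hC : ∀ j : Fin I.n, ∀ i < I.n, ord i = j → C j = φ i + 1) :
    I.IsOptimal o C := by
  obtain ⟨C₀, hopt, hmk⟩ := hex
  have hC₀ : ∀ j, C₀ j ≤ k := fun j => (Finset.le_sup (f := C₀) (Finset.mem_univ j)).trans hmk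
  have hC₁ : ∀ j, 1 ≤ C₀ j := fun j => by
    have := hopt.1.1 j; have := I.p_pos j; omega
  -- Completion times are at least 1, as processing times are. So the times 1, …, k are represented
  -- by the values 0, …, k - 1.
  let ψ : ℕ → ℕ := fun i => ext C₀ (ord i) - 1
  have hψ : ∀ i < I.n, ψ i < k ∧ ∃ j : Fin I.n, (j : ℕ) = ord i ∧ ψ i + 1 = C₀ j := by
    intro i hi
    have h1 := hl.ord_lt i hi
    have h2 : ext C₀ (ord i) = C₀ ⟨ord i, h1⟩ := ext_val C₀ ⟨ord i, h1⟩
    have h3 := hC₀ ⟨ord i, h1⟩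
    have h4 := hC₁ ⟨ord i, h1⟩
    refine ⟨by simp only [ψ]; omega, ⟨ord i, h1⟩, rfl, by simp only [ψ]; omega⟩
  choose pos hpos hordpos using fun j : Fin I.n => hl.exists_ord j.isLt
  have hpos_inj : Function.Injective pos := fun a b hab => by
    have := hordpos a; rw [hab, hordpos b] at this; exact Fin.ext this.symm
  have hpos_surj : ∀ i < I.n, ∃ a, pos a = i := fun i hi =>
    ⟨⟨ord i, hl.ord_lt i hi⟩, hl.ord_inj _ (hpos _) _ hi (hordpos _)⟩
  have hψC : ∀ j, ψ (pos j) + 1 = C₀ j := by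
    intro j
    obtain ⟨j', h1, h2⟩ := (hψ (pos j) (hpos j)).2
    have : j' = j := Fin.ext (by rw [h1, hordpos])
    rw [h2, this]
  have hφC : ∀ j, φ (pos j) + 1 = C j := fun j => (hC j _ (hpos j) (hordpos j)).symm
  have hψbad : ∀ i < I.n, ¬ I.Bad κ ord i ψ := by
    rintro i hi (h | ⟨l, hl', -, hadj, h1, h2⟩)
    · obtain ⟨j, h1, h2⟩ := (hψ i hi).2
      rw [← h1, ext_val, ext_val, h2] at h
      have := hopt.1.1 j
      omega
    · obtain ⟨a, rfl⟩ := hpos_surj i hi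
      obtain ⟨b, rfl⟩ := hpos_surj l hl'
      rw [hordpos, hordpos, extRel_val] at hadj
      rw [hordpos, ext_val, hψC, hψC] at h1 h2
      exact (disjoint_iff (I.p_pos a) (I.p_pos b)).1 (hopt.1.2 a b hadj) ⟨h1, h2⟩
  have hval : ∀ χ : ℕ → ℕ, (∀ x < I.n, χ x < k) → (∀ i < I.n, ¬ I.Bad κ ord i χ) → ∀ j,
      (I.vertexVal o k κ ord (pos j) χ : ℤ) =
        I.offset k + jobCost o (I.w j) (I.d j) (χ (pos j) + 1) := by
    intro χ hχ hbad j
    have h1 := abs_le.1 (abs_jobCost_le (I := I) (o := o) (k := k) j.isLt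
      (show χ (pos j) + 1 ≤ k from hχ _ (hpos j)))
    rw [vertexVal, if_neg (hbad _ (hpos j)), hordpos, ext_val, ext_val]
    rw [ext_val, ext_val] at h1
    exact Int.toNat_of_nonneg (by omega)
  -- The given optimal schedule costs less than a single penalty, so a minimal assignment cannot
  -- have a bad vertex.
  have hψlt : o.fold (fun i => I.vertexVal o k κ ord i ψ) (Finset.range I.n) < I.penalty k := by
    refine lt_of_le_of_lt (fold_le o (c := I.offset k + I.offset k) fun i hi => ?_) ?_
    · obtain ⟨a, rfl⟩ := hpos_surj i (Finset.mem_range.1 hi)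
      have h1 := hval ψ (fun x hx => (hψ x hx).1) hψbad a
      have h2 := abs_le.1 (abs_jobCost_le (I := I) (o := o) (k := k) a.isLt
        (show ψ (pos a) + 1 ≤ k from (hψ _ (hpos a)).1))
      rw [ext_val, ext_val] at h2
      omega
    · simp [penalty]
  have hφbad : ∀ i < I.n, ¬ I.Bad κ ord i φ := by
    intro i hi hb
    have h1 := le_fold o (f := fun i => I.vertexVal o k κ ord i φ) (Finset.mem_range.2 hi)
    have h2 := hmin ψ fun x hx => (hψ x hx).1
    simp only [vertexVal, if_pos hb] at h1
    simp only [vertexVal] at h2 hψlt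
    omega
  have hfeas : I.Feasible C := by
    refine ⟨fun j => ?_, fun a b hab => ?_⟩
    · have h := mt Or.inl (hφbad (pos j) (hpos j))
      rw [hordpos, ext_val, ext_val, hφC] at h
      omega
    -- A conflict is visible at the endpoint that comes first in the order; there, the other
    -- endpoint is a later neighbour.
    · have key : ∀ a b : Fin I.n, I.graph.Adj a b → pos a < pos b →
          ¬ (C a < C b + I.p a ∧ C b < C a + I.p b) := by
        intro a b hab hlt h
        have hadj : extRel I.graph.Adj (ord (pos a)) (ord (pos b)) := by
          rw [hordpos, hordpos, extRel_val]; exact hab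
        refine hφbad _ (hpos a) (Or.inr ⟨pos b, hpos b, hl.edge _ (hpos a) _ (hpos b) hlt hadj, hadj, ?_⟩)
        rw [hordpos, hordpos, ext_val, ext_val, hφC, hφC]
        exact h
      have hne : pos a ≠ pos b := fun h => hab.ne (hpos_inj h)
      rw [disjoint_iff (I.p_pos a) (I.p_pos b)]
      rcases lt_or_gt_of_ne hne with h | h
      · exact key a b hab h
      · exact fun h' => key b a hab.symm h ⟨h'.2, h'.1⟩
  refine ⟨hfeas, fun C' hC' => le_trans ?_ (hopt.2 C' hC')⟩
  have : Nonempty (Fin I.n) := ⟨⟨0, I.n_pos⟩⟩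
  have h1 := fold_le_iff o pos hpos hpos_inj hpos_surj (hval φ hφ hφbad)
    (hval ψ (fun x hx => (hψ x hx).1) hψbad) (hmin ψ fun x hx => (hψ x hx).1)
  simp only [hφC, hψC] at h1
  cases o
  · exact h1
  · exact h1

end Instance

open Cmd

/-! ### The scheduling program -/

/-- The memory contains the number `k` and the instance `I`. -/
structure Reads (I : Instance) (k : ℕ) (io : ℕ → ℤ) : Prop where
  k : io 0 = k
  n : io 1 = I.n
  p : ∀ u < I.n, io (2 + 4 * u) = ext I.p u
  r : ∀ u < I.n, io (2 + 4 * u + 1) = ext I.r u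
  d : ∀ u < I.n, io (2 + 4 * u + 2) = ext I.d u
  w : ∀ u < I.n, io (2 + 4 * u + 3) = ext I.w u
  adj : ∀ u < I.n, ∀ v < I.n, 0 < io (2 + 4 * I.n + u * I.n + v) ↔ extRel I.graph.Adj u v

/-- The address of the first parameter of a job. -/
def jobAddr (u : Var) : Exp := 2 + 4 * .var u

/-- `val := off +` the cost of job `u` at completion time `fin` -/
def costProg : Objective → Cmd
  | .maxWeightedLateness =>
    .set .e (.ioP (jobAddr .u + 2) - (.var .fin + .ioN (jobAddr .u + 2))) ;;
    .set .val (.var .off + (.ioP (jobAddr .u + 3) * .var .d + .ioN (jobAddr .u + 3) * .var .e) -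
      (.ioN (jobAddr .u + 3) * .var .d + .ioP (jobAddr .u + 3) * .var .e))
  | .totalWeightedTardiness =>
    .set .val (.var .off + .ioP (jobAddr .u + 3) * .var .d - .ioN (jobAddr .u + 3) * .var .d)

/-- `bad := 1` if vertex `i` is in conflict with a later neighbour -/
def conflictProg : Cmd :=
  .loop .N .l (.var .n) (.ite (.arr .K (.var .i) (.var .l))
    (.set .w (.arr .ord 0 (.var .l)) ;;
      .ite (.ioP (2 + 4 * .var .n + .var .u * .var .n + .var .w))
        (.ite (.arr .phi 0 (.var .l) + 1 + .ioP (jobAddr .u) - .var .fin)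
          (.ite (.var .fin + .ioP (jobAddr .w) - (.arr .phi 0 (.var .l) + 1)) (.set .bad 1) .skip)
          .skip) .skip) .skip)

/-- Compute the value of vertex `i`. -/
def jobProg (o : Objective) : Cmd :=
  .set .u (.arr .ord 0 (.var .i)) ;;
  .set .fin (.arr .phi 0 (.var .i) + 1) ;;
  .set .bad (.ioP (jobAddr .u) + .ioP (jobAddr .u + 1) - .var .fin) ;;
  conflictProg ;;
  .ite (.var .bad) (.set .val (.var .inf))
    (.set .d (.var .fin + .ioN (jobAddr .u + 2) - .ioP (jobAddr .u + 2)) ;; costProg o)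

/-- Compute the offset and the penalty. -/
def offsetProg : Cmd :=
  .set .off 0 ;;
  .loop .N .l (.var .n) (.set .off (.var .off + (.ioP (jobAddr .l + 3) + .ioN (jobAddr .l + 3)) *
    (.var .q + (.ioP (jobAddr .l + 2) + .ioN (jobAddr .l + 2))))) ;;
  .set .inf (.var .n * (.var .off + .var .off) + 1)

/-- Find an optimal schedule along a given layout. -/
def schedule (o : Objective) : Cmd :=
  offsetProg ;; optimize o (jobProg o) ;;
  .loop .N .l (.var .n) (.out (.arr .ord 0 (.var .l)) (.arr .phi 0 (.var .l) + 1))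

/-- The limits suffice for the local programs. -/
structure Lim.SufficesJobs (L : Lim) (I : Instance) (k t : ℕ) : Prop
    extends L.Suffices I.n k t (I.penalty k) where
  release : ∀ u < I.n, ext I.p u + ext I.r u ≤ L.B
  due : ∀ u < I.n, k + (ext I.d u).natAbs ≤ L.B

variable {L : Lim} {I : Instance} {k t : ℕ} {o : Objective} {s : St} {κ : ℕ → Finset ℕ} {ord : ℕ → ℕ}

theorem toNat_add_toNat (a : ℤ) : a.toNat + (-a).toNat = a.natAbs := by omega

theorem Lim.SufficesJobs.penalty_le (hL : L.SufficesJobs I k t) : I.penalty k ≤ L.B :=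
  (Nat.le_mul_of_pos_left _ (by positivity)).trans hL.G_le_B

theorem offsetProg_spec (hL : L.SufficesJobs I k t) (hR : Reads I k s.io) (hn : s.v .n = I.n)
    (hq : s.v .q = k) :
    Spec L offsetProg s fun s' => s'.v .off = I.offset k ∧ s'.v .inf = I.penalty k := by
  have hoff : I.offset k ≤ L.B :=
    (Nat.le_add_right _ _).trans (Instance.two_offset_le.trans hL.penalty_le)
  simp only [offsetProg, spec_seq, spec_set, Exp.ev_lit, Nat.zero_le, true_and]
  refine spec_loop (n := I.n) (fun l s' => s'.v .off = ∑ u ∈ Finset.range l,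
    (ext I.w u).natAbs * (k + (ext I.d u).natAbs)) (by simp [hn]) hL.n_le_N hL.n_le_B (by simp) ?_ ?_
  · intro l hl s' hs' h
    have e1 : s'.v .q = k := by rw [hs'.v .q rfl]; simp [hq]
    have e2 : s'.io = s.io := by rw [hs'.io rfl]; simp
    simp only [spec_set, jobAddr, Exp.ev_add, Exp.ev_mul, Exp.ev_ioP, Exp.ev_ioN, Exp.ev_var,
      Exp.ev_lit, St.set_v, St.set_io, if_true, if_false, reduceCtorEq, e1, e2, h, hR.w l hl,
      hR.d l hl, toNat_add_toNat, ← Finset.sum_range_succ, and_true]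
    exact (Finset.sum_le_sum_of_subset (Finset.range_mono hl)).trans hoff
  · intro s' hs' h
    have e1 : s'.v .n = I.n := by rw [hs'.v .n rfl]; simp [hn]
    simp only [Exp.ev_add, Exp.ev_mul, Exp.ev_var, Exp.ev_lit, St.set_v,
      if_true, if_false, reduceCtorEq, e1, h]
    exact ⟨hL.penalty_le, rfl, rfl⟩

theorem isLocal_jobProg : (jobProg o).IsLocal := by
  constructor
  · intro x hx; cases o <;> cases x <;> first | rfl | (exact absurd hx (by decide))
  · intro A; cases o <;> cases A <;> rfl
  · cases o <;> rfl

/-- The bounded loop language knows natural numbers only, so signed factors are split into positive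
and negative parts. The negative products are subtracted last; the offset keeps this difference from
being truncated. -/
theorem cost_eq {off c w : ℤ} (wp wn dp dn : ℕ) (hw : w = wp - wn) (hc : c = dp - dn) :
    off + w * c = off + ((wp * dp + wn * dn : ℕ) : ℤ) - ((wn * dp + wp * dn : ℕ) : ℤ) := by
  rw [hw, hc]; push_cast; ring

theorem costProg_spec (hL : L.SufficesJobs I k t) (hR : Reads I k s.io) {u C : ℕ} (hu : u < I.n)
    (hu' : s.v .u = u) (hC : s.v .fin = C) (hCk : C ≤ k) (hoff : s.v .off = I.offset k)
    (hd : s.v .d = ((C : ℤ) - ext I.d u).toNat) :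
    Spec L (costProg o) s fun s' =>
      s'.v .val = (I.offset k + Instance.jobCost o (ext I.w u) (ext I.d u) C).toNat := by
  have h1 := abs_le.1 (Instance.abs_jobCost_le (I := I) (o := o) hu hCk)
  have h2 := (Instance.two_offset_le (I := I) (k := k)).trans hL.penalty_le
  have h3 := hL.due u hu
  have hw : ext I.w u = (ext I.w u).toNat - (-ext I.w u).toNat := by omega
  cases o
  · have hc : (C : ℤ) - ext I.d u = ((C : ℤ) - ext I.d u).toNat -
      ((ext I.d u).toNat - (C + (-ext I.d u).toNat) : ℕ) := by omega
    simp only [costProg, jobAddr, spec_seq, spec_set, Exp.ev_add, Exp.ev_sub, Exp.ev_mul, Exp.ev_ioP,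
      Exp.ev_ioN, Exp.ev_var, Exp.ev_lit, St.set_v, St.set_io, if_true, if_false, reduceCtorEq, hu',
      hC, hoff, hd, hR.w u hu, hR.d u hu, Instance.jobCost] at h1 ⊢
    have := cost_eq (off := I.offset k) _ _ _ _ hw hc
    exact ⟨by omega, by omega, by omega⟩
  · have hc : max 0 ((C : ℤ) - ext I.d u) = ((C : ℤ) - ext I.d u).toNat - (0 : ℕ) := by omega
    simp only [costProg, jobAddr, spec_set, Exp.ev_add, Exp.ev_sub, Exp.ev_mul, Exp.ev_ioP,
      Exp.ev_ioN, Exp.ev_var, Exp.ev_lit, St.set_v, if_true, hu', hoff, hd, hR.w u hu,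
      Instance.jobCost] at h1 ⊢
    have := cost_eq (off := I.offset k) _ _ _ _ hw hc
    simp only [mul_zero, add_zero] at this
    exact ⟨by omega, by omega⟩

theorem conflictProg_spec (hL : L.SufficesJobs I k t) (hR : Reads I k s.io)
    (hlay : Layout I.n (extRel I.graph.Adj) κ ord t) {i : ℕ} (hi : i < I.n) (hn : s.v .n = I.n)
    (hi' : s.v .i = i) (hu : s.v .u = ord i)
    (hK : ∀ i l, i < I.n → l < I.n → (0 < s.a .K i l ↔ l ∈ κ i))
    (hord : ∀ l < I.n, s.a .ord 0 l = ord l) (hfin : s.v .fin = s.a .phi 0 i + 1) :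
    Spec L conflictProg s fun s' => 0 < s'.v .bad ↔ 0 < s.v .bad ∨
      ∃ l < I.n, l ∈ κ i ∧ extRel I.graph.Adj (ord i) (ord l) ∧
        s.a .phi 0 i + 1 < s.a .phi 0 l + 1 + ext I.p (ord i) ∧
        s.a .phi 0 l + 1 < s.a .phi 0 i + 1 + ext I.p (ord l) := by
  refine spec_loop (n := I.n) (fun m s' => 0 < s'.v .bad ↔ 0 < s.v .bad ∨
      ∃ l < m, l ∈ κ i ∧ extRel I.graph.Adj (ord i) (ord l) ∧
        s.a .phi 0 i + 1 < s.a .phi 0 l + 1 + ext I.p (ord i) ∧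
        s.a .phi 0 l + 1 < s.a .phi 0 i + 1 + ext I.p (ord l)) hn hL.n_le_N hL.n_le_B (by simp) ?_
    fun _ _ h => h
  intro l hl s' hs' h
  have e1 : s'.v .n = I.n := by rw [hs'.v .n rfl, hn]
  have e2 : s'.v .i = i := by rw [hs'.v .i rfl, hi']
  have e3 : s'.v .u = ord i := by rw [hs'.v .u rfl, hu]
  have e4 : s'.v .fin = s.a .phi 0 i + 1 := by rw [hs'.v .fin rfl, hfin]
  have e5 : s'.a = s.a := by funext A; exact hs'.a A rfl
  have e6 : s'.io = s.io := hs'.io rfl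
  have hstep : ∀ Pr : ℕ → Prop, (∃ l' < l + 1, Pr l') ↔ ((∃ l' < l, Pr l') ∨ Pr l) := by
    intro Pr
    constructor
    · rintro ⟨l', h1, h2⟩
      rcases (show l' < l ∨ l' = l by omega) with h3 | rfl
      exacts [Or.inl ⟨l', h3, h2⟩, Or.inr h2]
    · rintro (⟨l', h1, h2⟩ | h2)
      exacts [⟨l', by omega, h2⟩, ⟨l, by omega, h2⟩]
  simp only [hstep, ← or_assoc, ← h]
  have h1B := hL.one_le_B
  have hoB : ord l ≤ L.B := (hlay.ord_lt l hl).le.trans hL.n_le_B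
  have hK' := hK i l hi hl
  have hadj := hR.adj _ (hlay.ord_lt i hi) _ (hlay.ord_lt l hl)
  by_cases h1 : l ∈ κ i
  · by_cases h2 : extRel I.graph.Adj (ord i) (ord l)
    · by_cases h3 : s.a .phi 0 i + 1 < s.a .phi 0 l + 1 + ext I.p (ord i)
      · by_cases h4 : s.a .phi 0 l + 1 < s.a .phi 0 i + 1 + ext I.p (ord l)
        all_goals
          simp [jobAddr, e1, e2, e3, e4, e5, e6, hK'.2 h1, hord l hl, hR.p _ (hlay.ord_lt i hi),
            hR.p _ (hlay.ord_lt l hl), hadj.2 h2, hoB, h1B, h1, h2, h3, h4]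
      · simp [jobAddr, e1, e2, e3, e4, e5, e6, hK'.2 h1, hord l hl, hR.p _ (hlay.ord_lt i hi),
          hadj.2 h2, hoB, h2, h3]
    · simp [e1, e2, e3, e5, e6, hK'.2 h1, hord l hl, mt hadj.1 h2, hoB, h2]
  · simp [e2, e5, mt hK'.1 h1, h1]

theorem jobProg_spec (hL : L.SufficesJobs I k t) (hR : Reads I k s.io)
    (hlay : Layout I.n (extRel I.graph.Adj) κ ord t) (hi : s.v .i < I.n) (hn : s.v .n = I.n)
    (hK : ∀ i l, i < I.n → l < I.n → (0 < s.a .K i l ↔ l ∈ κ i))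
    (hord : ∀ l < I.n, s.a .ord 0 l = ord l) (hoff : s.v .off = I.offset k)
    (hinf : s.v .inf = I.penalty k) (hφ : ∀ x < I.n, s.a .phi 0 x < k) :
    Spec L (jobProg o) s fun s' => s'.v .val = I.vertexVal o k κ ord (s.v .i) (s.a .phi 0) := by
  have hui := hlay.ord_lt _ hi
  have h1 := hφ _ hi
  have h2 := hL.q_le_B
  have h3 := hL.n_le_B
  have h4 := hL.release _ hui
  have h5 := hL.due _ hui
  simp only [jobProg, spec_seq, spec_set, jobAddr, Exp.ev_add, Exp.ev_sub, Exp.ev_mul, Exp.ev_ioP,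
    Exp.ev_var, Exp.ev_lit, Exp.ev_arr, St.set_v, St.set_a, St.set_io, if_true, if_false,
    reduceCtorEq, hord _ hi, hR.p _ hui, hR.r _ hui, Int.toNat_natCast]
  refine ⟨by omega, by omega, by omega, ?_⟩
  refine (conflictProg_spec hL (s := St.set _ _ _) (by simpa using hR) hlay hi (by simp [hn]) (by simp) (by simp)
    (by simpa using hK) (by simpa using hord) (by simp)).mono ?_
  intro s' hs' hbad
  have e1 : s'.v .u = ord (s.v .i) := by rw [hs'.v .u rfl]; simp
  have e2 : s'.v .fin = s.a .phi 0 (s.v .i) + 1 := by rw [hs'.v .fin rfl]; simp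
  have e3 : s'.v .off = I.offset k := by rw [hs'.v .off rfl]; simp [hoff]
  have e4 : s'.v .inf = I.penalty k := by rw [hs'.v .inf rfl]; simp [hinf]
  have e5 : s'.io = s.io := by rw [hs'.io rfl]; simp
  simp only [St.set_v, St.set_a, if_true, Nat.sub_pos_iff_lt] at hbad
  have hbad' : 0 < s'.v .bad ↔ I.Bad κ ord (s.v .i) (s.a .phi 0) := hbad
  rw [spec_ite, Exp.ev_var]
  by_cases hb : I.Bad κ ord (s.v .i) (s.a .phi 0)
  · rw [if_pos (hbad'.2 hb), Instance.vertexVal, if_pos hb]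
    simp only [spec_set, Exp.ev_var, e4, St.set_v_self]
    exact ⟨hL.penalty_le, trivial⟩
  · rw [if_neg (mt hbad'.1 hb), Instance.vertexVal, if_neg hb]
    simp only [spec_seq, spec_set, Exp.ev_add, Exp.ev_sub, Exp.ev_mul, Exp.ev_ioP, Exp.ev_ioN,
      Exp.ev_var, Exp.ev_lit, e1, e2, e5, hR.d _ hui]
    refine ⟨by omega, ?_⟩
    have := costProg_spec (o := o) (C := s.a .phi 0 (s.v .i) + 1) hL (s := s'.set .d (s.a .phi 0 (s.v .i) + 1 +
      (-ext I.d (ord (s.v .i))).toNat - (ext I.d (ord (s.v .i))).toNat)) (by simpa [e5] using hR) hui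
      (by simp [e1]) (by simp [e2]) (by omega) (by simp [e3]) (by simp; omega)
    simpa using this

theorem schedule_spec (hL : L.SufficesJobs I k t) (hR : Reads I k s.io)
    (hlay : Layout I.n (extRel I.graph.Adj) κ ord t) (hn : s.v .n = I.n) (hq : s.v .q = k)
    (hK : ∀ i l, i < I.n → l < I.n → (0 < s.a .K i l ↔ l ∈ κ i))
    (hord : ∀ l < I.n, s.a .ord 0 l = ord l)
    (hex : ∃ C : I.Schedule, I.IsOptimal o C ∧ I.makespan C ≤ k) :
    Spec L (schedule o) s fun s' =>
      ∃ C : I.Schedule, I.IsOptimal o C ∧ ∀ j : Fin I.n, s'.io (j : ℕ) = C j := by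
  simp only [schedule, spec_seq]
  refine (offsetProg_spec hL hR hn hq).mono ?_
  rintro s₁ hs₁ ⟨hoff, hinf⟩
  have arr₁ : s₁.a = s.a := by funext A; exact hs₁.a A rfl
  have io₁ : s₁.io = s.io := hs₁.io rfl
  have hn₁ : s₁.v .n = I.n := (hs₁.v .n rfl).trans hn
  have H : DPInput L I.n k t (I.penalty k) κ o (jobProg o) (I.vertexVal o k κ ord) s₁ := by
    refine ⟨hL.toSuffices, hlay.elim, hlay.card, hn₁, (hs₁.v .q rfl).trans hq,
      by rwa [arr₁], isLocal_jobProg, fun s' hs' hi hφ => ?_, fun i hi φ ψ h =>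
        Instance.vertexVal_congr hi h, fun i hi φ hφ =>
        Instance.vertexVal_le (hlay.ord_lt i hi) (hφ i hi)⟩
    exact jobProg_spec hL (by rwa [hs'.io, io₁]) hlay hi ((hs'.v .n rfl).trans hn₁)
      (by rwa [hs'.a .K rfl, arr₁]) (by rwa [hs'.a .ord rfl, arr₁]) ((hs'.v .off rfl).trans hoff)
      ((hs'.v .inf rfl).trans hinf) hφ
  refine (optimize_spec H).mono ?_
  rintro s₂ hs₂ ⟨hφ, hmin⟩
  have near := Near.of_agree (isScratch_optimize isLocal_jobProg) hs₂
  have hord₂ : ∀ l < I.n, s₂.a .ord 0 l = ord l := by rwa [near.a .ord rfl, arr₁]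
  -- The output overwrites the input, which is no longer needed at this point.
  refine spec_loop (n := I.n) (fun m s' => ∀ l < m, s'.io (ord l) = (s₂.a .phi 0 l + 1 : ℕ))
    ((near.v .n rfl).trans hn₁) hL.n_le_N hL.n_le_B (by simp) ?_ ?_
  · intro l hl s' hs' h
    have e : s'.a = s₂.a := by funext A; exact hs'.a A rfl
    have := hφ l hl
    have := hL.q_le_B
    simp only [spec_out, Exp.ev_arr, Exp.ev_add, Exp.ev_lit, Exp.ev_var, St.set_v_self, St.set_a, e,
      St.out_io, St.set_io, hord₂ l hl]
    refine ⟨by omega, fun l' hl' => ?_⟩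
    rw [Function.update_apply]
    split_ifs with h1
    · rw [hlay.ord_inj l' (by omega) l hl h1]
    · exact h l' (by
        have : l' ≠ l := fun h' => h1 (by rw [h'])
        omega)
  · intro s' hs' h
    choose pos hpos hordpos using fun j : Fin I.n => hlay.exists_ord j.isLt
    refine ⟨fun j => s₂.a .phi 0 (pos j) + 1, Instance.isOptimal_of_fold_le hlay hφ hex hmin ?_, ?_⟩
    · intro j i hi hij
      rw [hlay.ord_inj _ (hpos j) i hi ((hordpos j).trans hij.symm)]
    · intro j
      have := h _ (hpos j)
      rwa [hordpos] at this

/-! ### Layouts from tree decompositions -/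

section tree

variable {V : Type*} {T : SimpleGraph V}

/-- Shortest walks from `r` to `b` and to `c`, prolonged to `a`, are both the unique path from `r`
to `a`. So they have the same last but one vertex. -/
theorem _root_.SimpleGraph.IsTree.eq_of_adj_of_dist (hT : T.IsTree) {r a b c : V} (hb : T.Adj b a) (hc : T.Adj c a)
    (hb' : T.dist r a = T.dist r b + 1) (hc' : T.dist r a = T.dist r c + 1) : b = c := by
  obtain ⟨p, hp⟩ := hT.connected.exists_walk_length_eq_dist r b
  obtain ⟨p', hp'⟩ := hT.connected.exists_walk_length_eq_dist r c
  have h1 := (p.concat hb).isPath_of_length_eq_dist (by simp [hp, hb'])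
  have h2 := (p'.concat hc).isPath_of_length_eq_dist (by simp [hp', hc'])
  have h3 := (hT.isAcyclic.subsingleton_path r a).elim ⟨_, h1⟩ ⟨_, h2⟩
  have h4 := congrArg (fun w : T.Path r a => w.1.penultimate) h3
  simpa using h4

/-- An edge that leaves the set of the descendants of `x` is the edge from `x` to its parent. -/
theorem _root_.SimpleGraph.IsTree.eq_of_adj_of_not_descendant (hT : T.IsTree) {r x a b : V} (hab : T.Adj a b)
    (ha : T.dist r a = T.dist r x + T.dist x a) (hb : T.dist r b ≠ T.dist r x + T.dist x b) :
    a = x ∧ T.dist r b < T.dist r x := by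
  have h1 := hT.dist_eq_dist_add_one_of_adj r hab
  have h2 := hT.dist_eq_dist_add_one_of_adj x hab
  have h3 := hT.connected.dist_triangle (u := r) (v := x) (w := b)
  -- If `a ≠ x`, the neighbour of `a` on the way to `x` is nearer to the root than `a`, and so is
  -- `b`. Hence both coincide, and `b` is a descendant of `x`, contrary to the assumption.
  have h4 : a = x := by
    by_contra hne
    obtain ⟨p, hp⟩ := hT.connected.exists_walk_length_eq_dist x a
    have hpn : ¬ p.Nil := fun h => hne h.eq.symm
    have h5 := p.adj_penultimate hpn
    have h6 : T.dist x p.penultimate + 1 ≤ T.dist x a := by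
      have h7 := T.dist_le p.dropLast
      have h8 : p.dropLast.length + 1 = p.length := p.length_dropLast_add_one hpn
      omega
    have h7 := hT.dist_eq_dist_add_one_of_adj r h5
    have h8 := hT.connected.dist_triangle (u := r) (v := x) (w := p.penultimate)
    have h9 := hT.eq_of_adj_of_dist (r := r) hab.symm h5 (by omega) (by omega)
    rw [← h9] at h6
    omega
  subst h4
  refine ⟨rfl, ?_⟩
  rw [SimpleGraph.dist_self] at h2
  omega

/-- A connected set that contains descendants and nondescendants of `x` contains `x`, and an element
nearer to the root. -/
theorem _root_.SimpleGraph.IsTree.mem_of_connected (hT : T.IsTree) {r x a b : V} {S : Set V}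
    (hS : (T.induce S).Connected) (ha : a ∈ S) (hb : b ∈ S)
    (ha' : T.dist r a = T.dist r x + T.dist x a) (hb' : T.dist r b ≠ T.dist r x + T.dist x b) :
    x ∈ S ∧ ∃ c ∈ S, T.dist r c < T.dist r x := by
  obtain ⟨p⟩ := hS.preconnected ⟨a, ha⟩ ⟨b, hb⟩
  obtain ⟨e, -, h1, h2⟩ := p.exists_boundary_dart
    {c | T.dist r c.1 = T.dist r x + T.dist x c.1} ha' hb'
  have h3 := hT.eq_of_adj_of_not_descendant (r := r) (x := x) e.adj h1 h2
  exact ⟨h3.1 ▸ e.fst.2, e.snd.1, e.snd.2, h3.2⟩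

end tree

namespace TreeDecomposition

variable {n : ℕ} {G : SimpleGraph (Fin n)} (D : TreeDecomposition G)

/-- Vertex `v` is in bag `i`. -/
def InBag (i v : ℕ) : Prop := extRel (fun i v => v ∈ D.bag i) i v

/-- Two vertices share a bag. -/
def Share (u v : ℕ) : Prop := ∃ i < D.m, D.InBag i u ∧ D.InBag i v

/-- In each nonempty set of vertices, one shares bags only with elements of a single bag. -/
theorem exists_simplicial {U : Finset ℕ} (hU : U.Nonempty) (hUn : ∀ u ∈ U, u < n) :
    ∃ u ∈ U, ∃ i < D.m, ∀ w ∈ U, D.Share u w → D.InBag i w := by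
  obtain ⟨u₀, hu₀⟩ := hU
  obtain ⟨r, -⟩ := D.vertex_mem ⟨u₀, hUn u₀ hu₀⟩
  have hmin : ∀ v, ∃ i, v ∈ D.bag i ∧ ∀ j, v ∈ D.bag j → D.tree.dist r i ≤ D.tree.dist r j := by
    intro v
    obtain ⟨i, hi⟩ := D.vertex_mem v
    obtain ⟨i, h1, h2⟩ := Finset.exists_min_image (Finset.univ.filter fun i => v ∈ D.bag i)
      (D.tree.dist r) ⟨i, by simpa using hi⟩
    exact ⟨i, by simpa using h1, fun j hj => h2 j (by simpa using hj)⟩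
  -- `top v` is a node nearest to the root among those whose bags contain `v`. The vertex `u` is
  -- chosen such that `top u` is as far from the root as possible.
  choose top htop htop' using hmin
  obtain ⟨u, hu, hmax⟩ := Finset.exists_max_image (Finset.univ.filter fun v : Fin n => (v : ℕ) ∈ U)
    (fun v => D.tree.dist r (top v)) ⟨⟨u₀, hUn u₀ hu₀⟩, by simpa using hu₀⟩
  refine ⟨u, by simpa using hu, top u, (top u).2, ?_⟩
  rintro w hw ⟨j, hj, hju, _, hw', hjw⟩
  lift w to Fin n using hw'
  lift j to Fin D.m using hj
  rw [InBag, extRel_val] at hju ⊢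
  replace hjw : w ∈ D.bag j := hjw
  -- All nodes of `u` lie below `top u`: otherwise, by connectedness, there would be one nearer to
  -- the root.
  have hj : D.tree.dist r j = D.tree.dist r (top u) + D.tree.dist (top u) j := by
    by_contra hne
    obtain ⟨-, c, hc, hlt⟩ := D.isTree.mem_of_connected (D.connected u) (htop u) hju (by simp) hne
    have := htop' u c hc
    omega
  have hle := hmax w (by simpa using hw)
  -- If `top w` lies below `top u`, both are equal by the choice of `u`. Otherwise the nodes of `w`
  -- lead from `j`, which is below `top u`, to a node that is not; hence `top u` is one of them.
  by_cases h : D.tree.dist r (top w) = D.tree.dist r (top u) + D.tree.dist (top u) (top w)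
  · have h0 : D.tree.dist (top u) (top w) = 0 := by omega
    rw [D.isTree.connected.dist_eq_zero_iff] at h0
    rw [h0]; exact htop w
  · exact (D.isTree.mem_of_connected (D.connected w) hjw (htop w) hj h).1

open Classical in
/-- The elimination structure of an order of the vertices. -/
noncomputable def later (ord : ℕ → ℕ) (p : ℕ) : Finset ℕ :=
  (Finset.range n).filter fun p' => p < p' ∧ D.Share (ord p) (ord p')

theorem mem_later {ord : ℕ → ℕ} {p p' : ℕ} :
    p' ∈ D.later ord p ↔ p' < n ∧ p < p' ∧ D.Share (ord p) (ord p') := by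
  simp [later]

/-- Joining vertices that share a bag gives a chordal supergraph, and `h` says that the order is a
perfect elimination order of it: a vertex and its later neighbours lie in a single bag. This bag
makes the later neighbours pairwise joined. As it also contains the vertex itself, they are at most
as many as the width. -/
theorem layout {ord : ℕ → ℕ} (hlt : ∀ p < n, ord p < n)
    (hinj : ∀ p < n, ∀ p' < n, ord p = ord p' → p = p')
    (h : ∀ p < n, ∃ i < D.m, ∀ p', p ≤ p' → p' < n → D.Share (ord p) (ord p') → D.InBag i (ord p')) :
    Layout n (extRel G.Adj) (D.later ord) ord D.width := by
  refine ⟨⟨fun p p' hp' => (D.mem_later.1 hp').2.1, fun p p' hp' => (D.mem_later.1 hp').1, ?_⟩, ?_, hlt,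
    hinj, ?_⟩
  · intro p j hj l hl hjl
    rw [mem_later] at hj hl ⊢
    obtain ⟨i, hi, hbag⟩ := h p (by omega)
    exact ⟨hl.1, hjl, i, hi, hbag j hj.2.1.le hj.1 hj.2.2, hbag l hl.2.1.le hl.1 hl.2.2⟩
  · intro p hp
    obtain ⟨i, hi, hbag⟩ := h p hp
    obtain ⟨i', hi'⟩ := D.vertex_mem ⟨ord p, hlt p hp⟩
    have hpp : D.Share (ord p) (ord p) :=
      ⟨i', i'.2, ⟨i'.2, hlt p hp, hi'⟩, ⟨i'.2, hlt p hp, hi'⟩⟩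
    have h1 : ((insert p (D.later ord p)).image ord).card ≤ (D.bag ⟨i, hi⟩).card := by
      rw [← Finset.card_map Fin.valEmbedding]
      refine Finset.card_le_card fun x hx => ?_
      obtain ⟨y, hy, rfl⟩ := Finset.mem_image.1 hx
      have hy' : D.InBag i (ord y) := by
        rcases Finset.mem_insert.1 hy with rfl | hy
        · exact hbag y le_rfl hp hpp
        · rw [mem_later] at hy
          exact hbag y hy.2.1.le hy.1 hy.2.2
      obtain ⟨_, h2, h3⟩ := hy'
      exact Finset.mem_map.2 ⟨⟨ord y, h2⟩, h3, rfl⟩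
    have h2 : (D.bag ⟨i, hi⟩).card ≤ Finset.univ.sup fun i => (D.bag i).card :=
      Finset.le_sup (f := fun i => (D.bag i).card) (Finset.mem_univ _)
    rw [Finset.card_image_of_injOn, Finset.card_insert_of_notMem] at h1
    · rw [width]; omega
    · intro h; have := (D.mem_later.1 h).2.1; omega
    · intro a ha b hb hab
      have hlt' : ∀ a ∈ (insert p (D.later ord p) : Finset ℕ), a < n := by
        intro a ha
        rcases Finset.mem_insert.1 ha with rfl | ha
        exacts [hp, (D.mem_later.1 ha).1]
      exact hinj a (hlt' a ha) b (hlt' b hb) hab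
  · rintro i hi j hj hij ⟨h1, h2, hadj⟩
    obtain ⟨b, hb, hb'⟩ := D.edge_mem _ _ hadj
    exact D.mem_later.2 ⟨hj, hij, b, b.2, ⟨b.2, h1, hb⟩, ⟨b.2, h2, hb'⟩⟩

end TreeDecomposition

open Cmd

/-! ### Reading the input -/

section lists

theorem getD_flatMap_finRange {a b : ℕ} {f : Fin a → List ℤ} (hf : ∀ i, (f i).length = b) (i : Fin a)
    {j : ℕ} (hj : j < b) : ((List.finRange a).flatMap f).getD (i * b + j) 0 = (f i).getD j 0 := by
  induction a with
  | zero => exact i.elim0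
  | succ a ih =>
    rw [List.finRange_succ, List.flatMap_cons, List.flatMap_map]
    refine Fin.cases ?_ (fun i => ?_) i
    · rw [List.getD_append _ _ _ _ (by rw [hf]; simpa using hj)]; simp
    · have e : (i.succ : ℕ) * b + j = b + (i * b + j) := by rw [Fin.val_succ]; ring
      rw [List.getD_append_right _ _ _ _ (by rw [hf, e]; omega), hf, e, Nat.add_sub_cancel_left]
      exact ih (f := fun i => f i.succ) (fun i => hf _) i

theorem length_flatMap_finRange {a b : ℕ} {f : Fin a → List ℤ} (hf : ∀ i, (f i).length = b) :
    ((List.finRange a).flatMap f).length = a * b := by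
  simp [List.length_flatMap, hf]

theorem length_matrixList {a b : ℕ} (A : Fin a → Fin b → Prop) : (matrixList A).length = a * b :=
  length_flatMap_finRange fun _ => by simp

theorem matrixList_pos {a b : ℕ} (A : Fin a → Fin b → Prop) {i j : ℕ} (hi : i < a) (hj : j < b) :
    0 < (matrixList A).getD (i * b + j) 0 ↔ extRel A i j := by
  have := getD_flatMap_finRange (f := fun i => (List.finRange b).map fun j => truth (A i j))
    (fun _ => by simp) ⟨i, hi⟩ hj
  rw [matrixList, this, List.getD_eq_getElem _ _ (by simpa using hj)]
  simp only [List.getElem_map, List.getElem_finRange, truth, extRel, hi, hj, exists_true_left]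
  split_ifs with h <;> simpa using h

theorem add_mul_lt {a b i j : ℕ} (hi : i < a) (hj : j < b) : i * b + j < a * b :=
  calc i * b + j < i * b + b := by omega
    _ = (i + 1) * b := by ring
    _ ≤ a * b := Nat.mul_le_mul_right _ hi

variable (I : Instance) (k : ℕ) (rest : List ℤ)

/-- The parameters of the jobs. -/
def Instance.jobList : List ℤ :=
  (List.finRange I.n).flatMap fun j => [(I.p j : ℤ), (I.r j : ℤ), I.d j, I.w j]

theorem Instance.length_jobList : I.jobList.length = 4 * I.n := by
  rw [jobList, length_flatMap_finRange (b := 4) (fun _ => rfl), mul_comm]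

theorem Instance.jobList_getD {u c : ℕ} (hu : u < I.n) (hc : c < 4) : I.jobList.getD (4 * u + c) 0 =
    [(I.p ⟨u, hu⟩ : ℤ), (I.r ⟨u, hu⟩ : ℤ), I.d ⟨u, hu⟩, I.w ⟨u, hu⟩].getD c 0 := by
  rw [mul_comm 4]
  exact getD_flatMap_finRange (b := 4) (f := fun j => [(I.p j : ℤ), (I.r j : ℤ), I.d j, I.w j])
    (fun _ => rfl) ⟨u, hu⟩ hc

theorem Instance.encode_eq : I.encode = (I.n : ℤ) :: (I.jobList ++ matrixList I.graph.Adj) := by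
  simp [encode, jobList]

theorem Instance.length_encode : I.encode.length = 1 + (4 * I.n + I.n * I.n) := by
  rw [encode_eq, List.length_cons, List.length_append, length_jobList, length_matrixList, add_comm 1]

/-- Cell 0 holds `k` and cell 1 the number of jobs; hence the shift by 2. -/
theorem reads_init : Reads I k (St.init ((k : ℤ) :: (I.encode ++ rest))).io := by
  have key : ∀ x, (St.init ((k : ℤ) :: (I.encode ++ rest))).io (2 + x) =
      (I.jobList ++ (matrixList I.graph.Adj ++ rest)).getD x 0 := by
    intro x
    rw [add_comm, St.init, I.encode_eq]
    simp
  have job : ∀ u < I.n, ∀ c < 4, (St.init ((k : ℤ) :: (I.encode ++ rest))).io (2 + (4 * u + c)) =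
      I.jobList.getD (4 * u + c) 0 := by
    intro u hu c hc
    rw [key, List.getD_append _ _ _ _ (by rw [I.length_jobList]; omega)]
  refine ⟨rfl, by rw [I.encode_eq]; rfl, fun u hu => ?_, fun u hu => ?_, fun u hu => ?_,
    fun u hu => ?_, fun u hu v hv => ?_⟩
  · have := job u hu 0 (by omega)
    rw [I.jobList_getD hu (by omega)] at this
    simpa [ext, hu] using this
  · have := job u hu 1 (by omega)
    rw [I.jobList_getD hu (by omega)] at this
    simpa [ext, hu, add_assoc] using this
  · have := job u hu 2 (by omega)
    rw [I.jobList_getD hu (by omega)] at this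
    simpa [ext, hu, add_assoc] using this
  · have := job u hu 3 (by omega)
    rw [I.jobList_getD hu (by omega)] at this
    simpa [ext, hu, add_assoc] using this
  · rw [show 2 + 4 * I.n + u * I.n + v = 2 + (4 * I.n + (u * I.n + v)) by ring, key,
      List.getD_append_right _ _ _ _ (by rw [I.length_jobList]; omega), I.length_jobList,
      Nat.add_sub_cancel_left, List.getD_append _ _ _ _ (by
        rw [length_matrixList]; exact add_mul_lt hu hv), matrixList_pos _ hu hv]

variable {n : ℕ} {G : SimpleGraph (Fin n)}

/-- The memory contains the tree decomposition `D`, from address `b` on. -/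
structure TreeDecomposition.Reads (D : TreeDecomposition G) (b : ℕ) (io : ℕ → ℤ) : Prop where
  m : io b = D.m
  bag : ∀ i < D.m, ∀ v < n, 0 < io (b + 1 + D.m * D.m + i * n + v) ↔ D.InBag i v

/-- The `D.m * D.m` entries for the tree are skipped: the algorithm reads only the bags. The tree
enters only into the proof that the elimination order exists. -/
theorem TreeDecomposition.reads_init (D : TreeDecomposition I.graph) :
    D.Reads (2 + 4 * I.n + I.n * I.n) (St.init ((k : ℤ) :: (I.encode ++ D.encode))).io := by
  have key : ∀ x, (St.init ((k : ℤ) :: (I.encode ++ D.encode))).io (2 + 4 * I.n + I.n * I.n + x) =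
      ((D.m : ℤ) :: (matrixList D.tree.Adj ++ matrixList fun i v => v ∈ D.bag i)).getD x 0 := by
    intro x
    have e : 2 + 4 * I.n + I.n * I.n + x = I.encode.length + x + 1 := by rw [I.length_encode]; ring
    rw [St.init, e]
    simp only [List.getD_cons_succ]
    rw [List.getD_append_right _ _ _ _ (by omega), Nat.add_sub_cancel_left, TreeDecomposition.encode]
    simp
  refine ⟨key 0, fun i hi v hv => ?_⟩
  rw [show 2 + 4 * I.n + I.n * I.n + 1 + D.m * D.m + i * I.n + v =
      2 + 4 * I.n + I.n * I.n + (D.m * D.m + (i * I.n + v) + 1) by ring, key, List.getD_cons_succ,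
    List.getD_append_right _ _ _ _ (by rw [length_matrixList]; omega), length_matrixList,
    Nat.add_sub_cancel_left, matrixList_pos _ hi hv]
  rfl

end lists

/-! ### Simple loops -/

theorem pos_mul_iff {a b : ℕ} : 0 < a * b ↔ 0 < a ∧ 0 < b := CanonicallyOrderedAdd.mul_pos

theorem pos_one_sub_iff {a : ℕ} : 0 < 1 - a ↔ ¬ 0 < a := by omega

/-- Enter a `1` into the matrix `A` wherever the condition `c` holds. -/
def mark (A : Arr) (x y : Var) (c : Exp) : Cmd :=
  .loop .N x (.var .n) (.loop .N y (.var .n) (.ite c (.put A (.var x) (.var y) 1) .skip))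

/-- Let `b` be `1` if the condition `c` holds for some `x`, and `0` otherwise. -/
def any (b x : Var) (c : Exp) : Cmd :=
  .set b 0 ;; .loop .N x (.var .n) (.ite c (.set b 1) .skip)

section loops

variable {L : Lim} {s : St} {n : ℕ} {b x y : Var} {A : Arr} {c : Exp}

theorem Cmd.Agree.set {d : Cmd} {s' : St} (h : d.Agree s s') (hx : d.wv x = true) (a : ℕ) :
    d.Agree s (s'.set x a) :=
  ⟨fun y hy => by
    have : y ≠ x := by rintro rfl; simp [hx] at hy
    simp [this, h.v y hy], h.a, h.io⟩

theorem mark_spec {P : ℕ → ℕ → Prop} (hxy : x ≠ y) (hx : x ≠ .n) (hy : y ≠ .n) (hn : s.v .n = n)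
    (hN : n ≤ L.lim .N) (hB : n ≤ L.B) (hB1 : 1 ≤ L.B)
    (hc : ∀ i < n, ∀ j < n, ∀ s', (mark A x y c).Agree s s' → s'.v x = i → s'.v y = j →
      (0 < c.ev s' ↔ P i j)) :
    Spec L (mark A x y c) s fun s' =>
      ∀ i j, 0 < s'.a A i j ↔ 0 < s.a A i j ∨ (i < n ∧ j < n ∧ P i j) := by
  refine spec_loop (n := n) (fun i₀ s' => ∀ i j, 0 < s'.a A i j ↔ 0 < s.a A i j ∨
    (i < i₀ ∧ j < n ∧ P i j)) hn hN hB (by simp) ?_ fun s' _ h => h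
  intro i₀ hi₀ s' hs' h
  replace hs' : (mark A x y c).Agree s s' := hs'
  have hs₁ := hs'.set (x := x) (by simp [mark, wv]) i₀
  have hn₁ : (s'.set x i₀).v .n = n := by
    rw [hs₁.v .n (by simp [mark, wv, hx.symm, hy.symm]), hn]
  refine spec_loop (n := n) (fun j₀ s' => ∀ i j, 0 < s'.a A i j ↔ 0 < s.a A i j ∨
    ((i < i₀ ∨ i = i₀ ∧ j < j₀) ∧ j < n ∧ P i j)) hn₁ hN hB (by simpa using h) ?_ ?_
  · intro j₀ hj₀ s₂ hs₂ h₂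
    have hx₂ : s₂.v x = i₀ := by rw [hs₂.v x (by simp [wv, hxy])]; simp
    have hs₃ : (mark A x y c).Agree s (s₂.set y j₀) :=
      (hs₁.trans (hs₂.weaken (by simp [mark, wv]) (by simp [mark, wa]) (by simp [mark, wio]))).set
        (by simp [mark, wv]) _
    have hP := hc i₀ hi₀ j₀ hj₀ _ hs₃ (by simp [hxy, hx₂]) (by simp)
    rw [spec_ite]
    split_ifs with h'
    · rw [hP] at h'
      simp only [spec_put, Exp.ev_lit, Exp.ev_var, St.set_v_self, St.set_v, hxy, if_false, hx₂,
        St.put_a, if_true, St.set_a, hB1, true_and, Function.update_apply]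
      intro i j
      by_cases hi : i = i₀
      · subst hi
        by_cases hj : j = j₀
        · subst hj; simp [hj₀, h']
        · have : j < j₀ + 1 ↔ j < j₀ := by omega
          simp [hj, h₂, this]
      · simp [hi, h₂]
    · rw [hP] at h'
      simp only [spec_skip, St.set_a]
      intro i j
      rw [h₂]
      by_cases hij : i = i₀ ∧ j = j₀
      · obtain ⟨rfl, rfl⟩ := hij; simp [h']
      · have : i = i₀ ∧ j < j₀ + 1 ↔ i = i₀ ∧ j < j₀ := by omega
        rw [this]
  · intro s₂ _ h₂ i j
    rw [h₂]
    have : (i < i₀ ∨ i = i₀ ∧ j < n) ∧ j < n ∧ P i j ↔ i < i₀ + 1 ∧ j < n ∧ P i j := by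
      constructor
      · rintro ⟨h1, h2⟩; exact ⟨by omega, h2⟩
      · rintro ⟨h1, h2⟩; exact ⟨by omega, h2⟩
    rw [this]

theorem any_spec {P : ℕ → Prop} (hbx : b ≠ x) (hb : b ≠ .n) (hn : s.v .n = n)
    (hN : n ≤ L.lim .N) (hB : n ≤ L.B) (hB1 : 1 ≤ L.B)
    (hc : ∀ i < n, ∀ s', (any b x c).Agree s s' → s'.v x = i → (0 < c.ev s' ↔ P i)) :
    Spec L (any b x c) s fun s' => s'.v b ≤ 1 ∧ (0 < s'.v b ↔ ∃ i < n, P i) := by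
  simp only [any, spec_seq, spec_set, Exp.ev_lit, Nat.zero_le, true_and]
  have hs₁ : (any b x c).Agree s (s.set b 0) := (Agree.refl _ s).set (by simp [any, wv]) 0
  refine spec_loop (n := n) (fun i₀ s' => s'.v b ≤ 1 ∧ (0 < s'.v b ↔ ∃ i < i₀, P i))
    (by simp [hb.symm, hn]) hN hB (by simp) ?_ fun s' _ h => h
  rintro i₀ hi₀ s' hs' ⟨h1, h2⟩
  have hs₂ : (any b x c).Agree s (s'.set x i₀) :=
    (hs₁.trans (hs'.weaken (by simp [any, wv]) (by simp [any, wa]) (by simp [any, wio]))).set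
      (by simp [any, wv]) _
  have hP := hc i₀ hi₀ _ hs₂ (by simp)
  rw [spec_ite]
  split_ifs with h'
  · simp only [spec_set, Exp.ev_lit, St.set_v_self, hB1, true_and, le_refl, zero_lt_one, true_iff]
    exact ⟨i₀, by omega, hP.1 h'⟩
  · simp only [spec_skip, St.set_v, hbx, if_false, h1, true_and]
    rw [h2]
    refine ⟨fun ⟨i, hi, h⟩ => ⟨i, by omega, h⟩, fun ⟨i, hi, h⟩ => ⟨i, ?_, h⟩⟩
    have : i ≠ i₀ := by rintro rfl; exact h' (hP.2 h)
    omega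

end loops

open Cmd

/-! ### Computing a layout from a tree decomposition -/

/-- The entry of the bag matrix for bag `y` and vertex `v`. -/
def bagEntry (v : Var) : Exp :=
  .ioP (.var .base + 1 + .var .cnt * .var .cnt + .var .y * .var .n + .var v)

/-- Compute which vertices share a bag. -/
def shareProg : Cmd := .loop .N .y (.var .cnt) (mark .H .u .w (bagEntry .u * bagEntry .w))

/-- Let `sel` be a remaining vertex whose remaining neighbours lie in one bag. -/
def pickProg : Cmd :=
  .loop .N .u (.var .n) (.loop .N .y (.var .cnt)
    (any .bad .w (.arr .alive 0 (.var .w) * .arr .H (.var .u) (.var .w) * (1 - bagEntry .w)) ;;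
      .ite (.arr .alive 0 (.var .u) * (1 - .var .bad)) (.set .sel (.var .u)) .skip))

/-- Compute an elimination order. -/
def orderProg : Cmd :=
  .loop .N .l (.var .n) (.put .alive 0 (.var .l) 1) ;;
  .loop .N .pos (.var .n) (pickProg ;; .put .ord 0 (.var .pos) (.var .sel) ;;
    .put .alive 0 (.var .sel) 0)

/-- Compute a layout. -/
def layoutProg : Cmd :=
  .set .n (.ioP 1) ;; .set .q (.ioP 0) ;; .set .base (2 + 4 * .var .n + .var .n * .var .n) ;;
  .set .cnt (.ioP (.var .base)) ;; shareProg ;; orderProg ;;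
  mark .K .z .g ((.var .g - .var .z) * .arr .H (.arr .ord 0 (.var .z)) (.arr .ord 0 (.var .g)))

section

variable {L : Lim} {s : St} {n b : ℕ} {G : SimpleGraph (Fin n)} {D : TreeDecomposition G}

/-- The limits suffice for the computation of a layout, the variables have the right values. -/
structure TreeDecomposition.Input (D : TreeDecomposition G) (L : Lim) (b : ℕ) (s : St) : Prop where
  reads : D.Reads b s.io
  n_le_N : n ≤ L.lim .N
  n_le_B : n ≤ L.B
  m_le_N : D.m ≤ L.lim .N
  m_le_B : D.m ≤ L.B
  one_le_B : 1 ≤ L.B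
  hn : s.v .n = n
  hcnt : s.v .cnt = D.m
  hbase : s.v .base = b

theorem TreeDecomposition.Input.agree (h : D.Input L b s) {c : Cmd} {s' : St} (hs : c.Agree s s')
    (h1 : c.wv .n = false) (h2 : c.wv .cnt = false) (h3 : c.wv .base = false) (h4 : c.wio = false) :
    D.Input L b s' :=
  { h with
    reads := by rw [hs.io h4]; exact h.reads
    hn := (hs.v _ h1).trans h.hn
    hcnt := (hs.v _ h2).trans h.hcnt
    hbase := (hs.v _ h3).trans h.hbase }

theorem TreeDecomposition.Input.set (h : D.Input L b s) {x : Var} (a : ℕ)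
    (hx : x ≠ .n ∧ x ≠ .cnt ∧ x ≠ .base) : D.Input L b (s.set x a) :=
  { h with
    hn := by simpa [hx.1.symm] using h.hn
    hcnt := by simpa [hx.2.1.symm] using h.hcnt
    hbase := by simpa [hx.2.2.symm] using h.hbase }

theorem TreeDecomposition.Input.bagEntry (h : D.Input L b s) {y v : ℕ} {x : Var} (hy : y < D.m)
    (hv : v < n) (hy' : s.v .y = y) (hv' : s.v x = v) :
    0 < (bagEntry x).ev s ↔ D.InBag y v := by
  rw [← h.reads.bag y hy v hv]
  simp [ConcSched.bagEntry, h.hn, h.hcnt, h.hbase, hy', hv']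

theorem shareProg_spec (h : D.Input L b s) (h0 : ∀ u v, s.a .H u v = 0) :
    Spec L shareProg s fun s' => ∀ u v, 0 < s'.a .H u v ↔ u < n ∧ v < n ∧ D.Share u v := by
  refine spec_loop (n := D.m) (fun y s' => ∀ u v, 0 < s'.a .H u v ↔ u < n ∧ v < n ∧
    ∃ i < y, D.InBag i u ∧ D.InBag i v) (by simp [h.hcnt]) h.m_le_N h.m_le_B (by simp [h0]) ?_
    fun s' _ h => h
  intro y hy s' hs' h'
  have hI : D.Input L b (s'.set .y y) := (h.agree hs' rfl rfl rfl rfl).set y (by simp)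
  refine (mark_spec (n := n) (P := fun u v => D.InBag y u ∧ D.InBag y v) (by simp) (by simp) (by simp)
    hI.hn h.n_le_N h.n_le_B h.one_le_B ?_).mono ?_
  · intro u hu v hv s₂ hs₂ hu' hv'
    have hI₂ := hI.agree hs₂ rfl rfl rfl rfl
    have hy₂ : s₂.v .y = y := (hs₂.v .y rfl).trans (by simp)
    rw [Exp.ev_mul, pos_mul_iff, hI₂.bagEntry hy hu hy₂ hu', hI₂.bagEntry hy hv hy₂ hv']
  · intro s₂ _ h₂ u v
    rw [h₂, St.set_a, h']
    rw [Nat.exists_lt_succ_right]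
    simp only [and_or_left]

/-- Vertex `u` shares bags only with those elements of `U` that lie in bag `i`. -/
def TreeDecomposition.Fits (D : TreeDecomposition G) (U : ℕ → Prop) (u i : ℕ) : Prop :=
  ∀ w < n, U w → D.Share u w → D.InBag i w

/-- All pairs of a vertex and a bag are tried. By `exists_simplicial` one of them passes the test,
so the previous value of `sel` is irrelevant. -/
theorem pickProg_spec (h : D.Input L b s) (hH : ∀ u v, 0 < s.a .H u v ↔ u < n ∧ v < n ∧ D.Share u v)
    (hU : ∃ u < n, 0 < s.a .alive 0 u) :
    Spec L pickProg s fun s' => s'.v .sel < n ∧ 0 < s.a .alive 0 (s'.v .sel) ∧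
      ∃ i < D.m, D.Fits (fun w => 0 < s.a .alive 0 w) (s'.v .sel) i := by
  obtain ⟨u₁, hu₁, i₁, hi₁, hfit₁⟩ := D.exists_simplicial
    (U := (Finset.range n).filter fun u => 0 < s.a .alive 0 u)
    (by obtain ⟨u, h1, h2⟩ := hU; exact ⟨u, by simp [h1, h2]⟩) (by simp +contextual)
  simp only [Finset.mem_filter, Finset.mem_range] at hu₁ hfit₁
  set good : ℕ → ℕ → Prop := fun u i => 0 < s.a .alive 0 u ∧
    D.Fits (fun w => 0 < s.a .alive 0 w) u i with hgood
  refine spec_loop (n := n) (fun u s' => (s'.v .sel < n ∧ ∃ i < D.m, good (s'.v .sel) i) ∨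
    ∀ u' < u, ∀ i < D.m, ¬ good u' i) (by simp [h.hn]) h.n_le_N h.n_le_B (by simp) ?_ ?_
  · intro u hu s' hs' h'
    replace hs' : pickProg.Agree s s' := hs'
    have hs₁ := hs'.set (x := .u) rfl u
    have hI := h.agree hs₁ rfl rfl rfl rfl
    refine spec_loop (n := D.m) (fun y s' => (s'.v .sel < n ∧ ∃ i < D.m, good (s'.v .sel) i) ∨
      ((∀ u' < u, ∀ i < D.m, ¬ good u' i) ∧ ∀ i < y, ¬ good u i)) (by simpa using hI.hcnt) h.m_le_N
      h.m_le_B (by simpa using h') ?_ ?_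
    · intro y hy s₂ hs₂ h₂
      have hI₂ := hI.agree hs₂ rfl rfl rfl rfl
      have hs₃ := hs₂.set (x := .y) rfl y
      have hI₃ := hI.agree hs₃ rfl rfl rfl rfl
      have hu₃ : (s₂.set .y y).v .u = u := by simp [hs₂.v .u rfl]
      have ha₃ : (s₂.set .y y).a = s.a := by
        funext A
        exact (hs₃.a A rfl).trans (hs'.a A rfl)
      rw [spec_seq]
      refine (any_spec (n := n) (P := fun w => 0 < s.a .alive 0 w ∧ D.Share u w ∧ ¬ D.InBag y w)
        (by simp) (by simp) hI₃.hn h.n_le_N h.n_le_B h.one_le_B ?_).mono ?_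
      · intro w hw s₄ hs₄ hw'
        have hI₄ := hI₃.agree hs₄ rfl rfl rfl rfl
        have e1 : s₄.a = s.a := by rw [← ha₃]; funext A; exact hs₄.a A rfl
        have e2 : s₄.v .u = u := (hs₄.v .u rfl).trans hu₃
        have e3 := hI₄.bagEntry (x := .w) hy hw ((hs₄.v .y rfl).trans (by simp)) hw'
        have e4 := hH u w
        simp only [Exp.ev_mul, Exp.ev_sub, Exp.ev_arr, Exp.ev_lit, Exp.ev_var, e1, e2, hw',
          pos_mul_iff, pos_one_sub_iff, e3, e4, hu, hw, true_and, and_assoc]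
      · rintro s₄ hs₄ ⟨-, hbad⟩
        have hI₄ := hI₃.agree hs₄ rfl rfl rfl rfl
        have e1 : s₄.a = s.a := by rw [← ha₃]; funext A; exact hs₄.a A rfl
        have e2 : s₄.v .u = u := (hs₄.v .u rfl).trans hu₃
        have e3 : s₄.v .sel = s₂.v .sel := (hs₄.v .sel rfl).trans (by simp)
        have key : 0 < (Exp.arr .alive 0 (.var .u) * (1 - .var .bad) : Exp).ev s₄ ↔ good u y := by
          simp only [Exp.ev_mul, Exp.ev_sub, Exp.ev_arr, Exp.ev_lit, Exp.ev_var, e1, e2,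
            pos_mul_iff, pos_one_sub_iff, hbad, hgood, TreeDecomposition.Fits]
          refine and_congr_right fun _ => ?_
          push Not
          rfl
        rw [spec_ite]
        split_ifs with hk
        · simp only [spec_set, Exp.ev_var, e2, St.set_v_self]
          exact ⟨hu.le.trans h.n_le_B, Or.inl ⟨hu, y, hy, key.1 hk⟩⟩
        · simp only [spec_skip, e3]
          refine h₂.imp_right fun h₂ => ⟨h₂.1, fun i hi => ?_⟩
          rcases (show i < y ∨ i = y by omega) with hi | rfl
          exacts [h₂.2 i hi, mt key.2 hk]
    · intro s₂ _ h₂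
      refine h₂.imp_right fun h₂ u' hu' => ?_
      rcases (show u' < u ∨ u' = u by omega) with hu' | rfl
      exacts [h₂.1 u' hu', h₂.2]
  · rintro s' - (⟨h1, i, h2, h3⟩ | h')
    · exact ⟨h1, h3.1, i, h2, h3.2⟩
    · exact absurd ⟨hu₁.2, fun w hw hw' => hfit₁ w ⟨hw, hw'⟩⟩ (h' u₁ hu₁.1 i₁ hi₁)

theorem orderProg_spec (h : D.Input L b s)
    (hH : ∀ u v, 0 < s.a .H u v ↔ u < n ∧ v < n ∧ D.Share u v) :
    Spec L orderProg s fun s' =>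
      Layout n (extRel G.Adj) (D.later (s'.a .ord 0)) (s'.a .ord 0) D.width := by
  rw [orderProg, spec_seq]
  refine (spec_loop (n := n) (Q := fun s' => ∀ u < n, s'.a .alive 0 u = 1)
    (fun l s' => ∀ u < l, s'.a .alive 0 u = 1) (by simp [h.hn]) h.n_le_N h.n_le_B
    (by simp) ?_ fun s' _ h => h).mono ?_
  · intro l hl s' hs' h'
    simp only [spec_put, Exp.ev_lit, Exp.ev_var, St.set_v_self, St.put_a, if_true, St.set_a,
      Function.update_self, h.one_le_B, true_and]
    intro u hu
    rw [Function.update_apply]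
    split_ifs
    exacts [rfl, h' u (by omega)]
  intro s₁ hs₁ halive₁
  have hI₁ := h.agree hs₁ rfl rfl rfl rfl
  have hH₁ : s₁.a .H = s.a .H := hs₁.a .H rfl
  refine spec_loop (n := n) (fun p s' =>
    (∀ v < n, 0 < s'.a .alive 0 v ↔ ∀ p' < p, s'.a .ord 0 p' ≠ v) ∧
    ∀ p₁ < p, s'.a .ord 0 p₁ < n ∧ (∀ p' < p₁, s'.a .ord 0 p' ≠ s'.a .ord 0 p₁) ∧
      ∃ i < D.m, D.Fits (fun w => ∀ p' < p₁, s'.a .ord 0 p' ≠ w) (s'.a .ord 0 p₁) i)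
    (by simp [hI₁.hn]) h.n_le_N h.n_le_B ⟨fun v hv => by simp [halive₁ v hv], by simp⟩ ?_ ?_
  · rintro p hp s' hs' ⟨h1, h2⟩
    have hI' := hI₁.agree hs' rfl rfl rfl rfl
    have hI₂ : D.Input L b (s'.set .pos p) := hI'.set p (by simp)
    simp only [spec_seq]
    refine (pickProg_spec hI₂ (by simpa [hs'.a .H rfl, hH₁] using hH) ?_).mono ?_
    · have hcard : ((Finset.range p).image (s'.a .ord 0)).card < (Finset.range n).card :=
        Finset.card_image_le.trans_lt (by simpa using hp)
      obtain ⟨v, hv, hv'⟩ := Finset.exists_mem_notMem_of_card_lt_card hcard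
      refine ⟨v, Finset.mem_range.1 hv, (h1 v (Finset.mem_range.1 hv)).2 fun p' hp' he => hv' ?_⟩
      exact Finset.mem_image.2 ⟨p', Finset.mem_range.2 hp', he⟩
    · rintro s₃ hs₃ ⟨h3, h4, i, hi, hfit⟩
      have e1 : s₃.a = s'.a := by funext A; exact (hs₃.a A rfl).trans (by simp)
      have e2 : s₃.v .pos = p := (hs₃.v .pos rfl).trans (by simp)
      simp only [St.set_a] at h4 hfit
      obtain ⟨u, hu⟩ : ∃ u, s₃.v .sel = u := ⟨_, rfl⟩
      rw [hu] at h3 h4 hfit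
      simp only [spec_put, Exp.ev_var, Exp.ev_lit, e2, e1, hu, St.put_a, St.put_v, if_true, if_false,
        reduceCtorEq, Function.update_self, Nat.zero_le, true_and]
      have hord : ∀ p' < p, Function.update (s'.a .ord 0) p u p' = s'.a .ord 0 p' :=
        fun p' hp' => Function.update_of_ne hp'.ne _ _
      refine ⟨h3.le.trans h.n_le_B, fun v hv => ?_, fun p₁ hp₁ => ?_⟩
      · rw [Nat.forall_lt_succ_right, Function.update_self, Function.update_apply]
        split_ifs with hvu
        · simp [hvu]
        · rw [h1 v hv]
          exact ⟨fun h' => ⟨fun p' hp' => by rw [hord p' hp']; exact h' p' hp', Ne.symm hvu⟩,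
            fun h' p' hp' => by rw [← hord p' hp']; exact h'.1 p' hp'⟩
      · rcases (show p₁ < p ∨ p₁ = p by omega) with hp₁ | rfl
        · rw [hord p₁ hp₁]
          obtain ⟨h5, h6, i, hi, h7⟩ := h2 p₁ hp₁
          refine ⟨h5, fun p' hp' => by rw [hord p' (by omega)]; exact h6 p' hp', i, hi, ?_⟩
          exact fun w hw hw' => h7 w hw fun p' hp' => by rw [← hord p' (by omega)]; exact hw' p' hp'
        · rw [Function.update_self]
          refine ⟨h3, fun p' hp' => ?_, i, hi, fun w hw hw' => hfit w hw ((h1 w hw).2 fun p' hp' => ?_)⟩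
          · rw [hord p' hp']; exact (h1 u h3).1 h4 p' hp'
          · rw [← hord p' hp']; exact hw' p' hp'
  · rintro s' - ⟨-, h2⟩
    refine D.layout (fun p hp => (h2 p hp).1) ?_ fun p hp => ?_
    · intro p hp p' hp' hpp
      rcases lt_trichotomy p p' with h | h | h
      · exact absurd hpp ((h2 p' hp').2.1 p h)
      · exact h
      · exact absurd hpp.symm ((h2 p hp).2.1 p' h)
    · obtain ⟨i, hi, hfit⟩ := (h2 p hp).2.2
      refine ⟨i, hi, fun p' hpp' hp' hsh => hfit _ (h2 p' hp').1 (fun q hq => ?_) hsh⟩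
      exact (h2 p' hp').2.1 q (by omega)

end

variable {L : Lim} {I : Instance} {k : ℕ} {D : TreeDecomposition I.graph} {s : St} {o : Objective}

theorem layoutProg_spec (hR : Reads I k s.io) (hD : D.Reads (2 + 4 * I.n + I.n * I.n) s.io)
    (hN : I.n ≤ L.lim .N) (hm : D.m ≤ L.lim .N) (hB1 : 1 ≤ L.B) (hk : k ≤ L.B) (hmB : D.m ≤ L.B)
    (hB : 2 + 4 * I.n + I.n * I.n ≤ L.B) (h0 : ∀ A i j, s.a A i j = 0) :
    Spec L layoutProg s fun s' => s'.v .n = I.n ∧ s'.v .q = k ∧ s'.io = s.io ∧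
      Layout I.n (extRel I.graph.Adj) (D.later (s'.a .ord 0)) (s'.a .ord 0) D.width ∧
      ∀ i l, i < I.n → l < I.n → (0 < s'.a .K i l ↔ l ∈ D.later (s'.a .ord 0) i) := by
  have hnB : I.n ≤ L.B := by omega
  simp only [layoutProg, spec_seq, spec_set, Exp.ev_ioP, Exp.ev_lit, Exp.ev_var, Exp.ev_add,
    Exp.ev_mul, St.set_v, St.set_io, hR.n, hR.k, hD.m, Int.toNat_natCast, if_true, if_false,
    reduceCtorEq]
  refine ⟨hnB, hk, hB, hmB, ?_⟩
  have hI : D.Input L (2 + 4 * I.n + I.n * I.n) ((((s.set .n I.n).set .q k).set .base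
      (2 + 4 * I.n + I.n * I.n)).set .cnt D.m) :=
    ⟨by simpa using hD, hN, hnB, hm, hmB, hB1, by simp, by simp, by simp⟩
  refine (shareProg_spec hI (by simp [h0])).mono fun s₁ hs₁ hH => ?_
  have hI₁ := hI.agree hs₁ rfl rfl rfl rfl
  refine (orderProg_spec hI₁ hH).mono fun s₂ hs₂ hlay => ?_
  have hI₂ := hI₁.agree hs₂ rfl rfl rfl rfl
  have hH₂ : s₂.a .H = s₁.a .H := hs₂.a .H rfl
  have hK₂ : s₂.a .K = s.a .K := (hs₂.a .K rfl).trans ((hs₁.a .K rfl).trans (by simp))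
  have hq₂ : s₂.v .q = k := (hs₂.v .q rfl).trans ((hs₁.v .q rfl).trans (by simp))
  have hio₂ : s₂.io = s.io := (hs₂.io rfl).trans ((hs₁.io rfl).trans (by simp))
  refine (mark_spec (n := I.n) (P := fun i l => i < l ∧ D.Share (s₂.a .ord 0 i) (s₂.a .ord 0 l))
    (by simp) (by simp) (by simp) hI₂.hn hN hnB hB1 ?_).mono fun s₃ hs₃ hK => ?_
  · intro i hi l hl s' hs' hi' hl'
    simp only [Exp.ev_mul, Exp.ev_sub, Exp.ev_arr, Exp.ev_lit, Exp.ev_var, hs'.a .H rfl,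
      hs'.a .ord rfl, hi', hl', pos_mul_iff, hH₂, hH, hlay.ord_lt i hi, hlay.ord_lt l hl, true_and,
      Nat.sub_pos_iff_lt]
  · have hord₃ : s₃.a .ord = s₂.a .ord := hs₃.a .ord rfl
    refine ⟨(hs₃.v .n rfl).trans hI₂.hn, (hs₃.v .q rfl).trans hq₂, (hs₃.io rfl).trans hio₂,
      by rwa [hord₃], fun i l hi hl => ?_⟩
    simp [hK, D.mem_later, hord₃, hK₂, h0, hi, hl]

/-- Find an optimal schedule along a given tree decomposition. -/
def scheduleAlong (o : Objective) : Cmd := layoutProg ;; schedule o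

theorem scheduleAlong_spec (hL : L.SufficesJobs I k D.width) (hm : D.m ≤ L.lim .N) (hmB : D.m ≤ L.B)
    (hB : 2 + 4 * I.n + I.n * I.n ≤ L.B) (hex : ∃ C : I.Schedule, I.IsOptimal o C ∧ I.makespan C ≤ k) :
    Spec L (scheduleAlong o) (St.init ((k : ℤ) :: (I.encode ++ D.encode))) fun s' =>
      ∃ C : I.Schedule, I.IsOptimal o C ∧ ∀ j : Fin I.n, s'.io (j : ℕ) = C j := by
  rw [scheduleAlong, spec_seq]
  refine (layoutProg_spec (reads_init I k _) (D.reads_init I k) hL.n_le_N hm hL.one_le_B hL.q_le_B hmB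
    hB (fun _ _ _ => rfl)).mono ?_
  rintro s₁ - ⟨hn, hq, hio, hlay, hK⟩
  exact schedule_spec hL (by rw [hio]; exact reads_init I k _) hlay hn hq hK (fun _ _ => rfl) hex

open Cmd

/-! ### Limits -/

/-- Limits for inputs of size `U`. -/
def limits (U q M : ℕ) : Lim where
  B := 2 ^ ((U + 2) ^ 2) - 1
  lim
    | .N => 2 * U + 3
    | .q => q
    | .M => M

theorem le_limits {U q M x e : ℕ} (h : x ≤ 2 ^ e) (he : e < (U + 2) ^ 2) : x ≤ (limits U q M).B := by
  have := Nat.pow_lt_pow_right (a := 2) (by omega) he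
  simp only [limits]; omega

theorem le_limits' {U q M x : ℕ} (h : x < (U + 2) ^ 2) : x ≤ (limits U q M).B :=
  le_limits Nat.lt_two_pow_self.le h

/-- The parameters of the instance are at most `U`, the number `k` has at most `U` bits. -/
structure Instance.Bounded (I : Instance) (k U : ℕ) : Prop where
  n : I.n ≤ U
  p : ∀ u < I.n, ext I.p u ≤ U
  r : ∀ u < I.n, ext I.r u ≤ U
  d : ∀ u < I.n, (ext I.d u).natAbs ≤ U
  w : ∀ u < I.n, (ext I.w u).natAbs ≤ U
  k : k.size ≤ U

namespace Instance.Bounded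

variable {I : Instance} {k U t q M : ℕ}

theorem k_lt (h : I.Bounded k U) : k < 2 ^ U :=
  (Nat.lt_size_self k).trans_le (Nat.pow_le_pow_right (by omega) h.k)

theorem penalty_le (h : I.Bounded k U) : I.penalty k ≤ 2 ^ (4 * U + 3) := by
  have hU : U ≤ 2 ^ U := Nat.lt_two_pow_self.le
  have h1 : I.offset k ≤ 2 ^ (3 * U + 1) := by
    calc I.offset k ≤ ∑ _u ∈ Finset.range I.n, 2 ^ U * (2 ^ U + 2 ^ U) := by
          refine Finset.sum_le_sum fun u hu => ?_
          have := h.w u (Finset.mem_range.1 hu)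
          have := h.d u (Finset.mem_range.1 hu)
          exact Nat.mul_le_mul (by omega) (add_le_add h.k_lt.le (by omega))
      _ = I.n * (2 ^ U * (2 ^ U + 2 ^ U)) := by simp
      _ ≤ 2 ^ U * (2 ^ U * (2 ^ U + 2 ^ U)) := Nat.mul_le_mul_right _ (h.n.trans hU)
      _ = 2 ^ (3 * U + 1) := by ring
  calc I.penalty k ≤ 2 ^ U * (2 ^ (3 * U + 1) + 2 ^ (3 * U + 1)) + 2 ^ (4 * U + 2) := by
        unfold penalty
        gcongr
        exacts [h.n.trans hU, Nat.one_le_two_pow]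
    _ = 2 ^ (4 * U + 3) := by ring

/-- The critical quantities are `k ^ n`, at most 2 ^ (U * U), and `2 ^ n` times the penalty, at most
2 ^ (5 * U + 3). Both exponents are less than (U + 2) ^ 2. -/
theorem sufficesJobs (h : I.Bounded k U) (hk : 1 ≤ k) (hq : k ≤ q) (hM : k ^ t ≤ M) :
    (limits U q M).SufficesJobs I k t := by
  have hsq : (U + 2) ^ 2 = U * U + 4 * U + 4 := by ring
  have hU : U ≤ U * U := Nat.le_mul_self U
  have hn := h.n
  refine ⟨⟨hk, ?_, hq, hM, le_limits' (by omega), le_limits h.k_lt.le (by omega), ?_, ?_⟩, ?_, ?_⟩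
  · simp only [limits]; omega
  · refine le_limits (e := U * U) ?_ (by omega)
    calc k ^ I.n ≤ (2 ^ U) ^ I.n := Nat.pow_le_pow_left h.k_lt.le _
      _ ≤ (2 ^ U) ^ U := Nat.pow_le_pow_right (by positivity) hn
      _ = 2 ^ (U * U) := by rw [← pow_mul]
  · refine le_limits (e := U + (4 * U + 3)) ?_ (by omega)
    rw [pow_add]
    exact Nat.mul_le_mul (Nat.pow_le_pow_right (by omega) hn) h.penalty_le
  · intro u hu
    have := h.p u hu
    have := h.r u hu
    exact le_limits' (by omega)
  · intro u hu
    refine le_limits (e := U + 1) ?_ (by omega)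
    have := h.d u hu
    have := h.k_lt
    have := Nat.lt_two_pow_self (n := U)
    rw [pow_succ]; omega

end Instance.Bounded

section unarySize

variable {l l' : List ℤ}

theorem natAbs_lt_unarySize {a : ℤ} (h : a ∈ l) : a.natAbs < unarySize l :=
  List.single_le_sum (fun _ _ => Nat.zero_le _) _ (List.mem_map.2 ⟨a, h, rfl⟩)

theorem unarySize_append : unarySize (l ++ l') = unarySize l + unarySize l' := by simp [unarySize]

theorem Instance.bounded (I : Instance) (k : ℕ) {U : ℕ} (h : unarySize I.encode + k.size ≤ U) :
    I.Bounded k U := by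
  have mem : ∀ a ∈ I.encode, a.natAbs ≤ U := fun a ha => by
    have := natAbs_lt_unarySize ha; omega
  have job : ∀ u (hu : u < I.n), ∀ a ∈ [(I.p ⟨u, hu⟩ : ℤ), (I.r ⟨u, hu⟩ : ℤ), I.d ⟨u, hu⟩, I.w ⟨u, hu⟩],
      a.natAbs ≤ U := fun u hu a ha => mem a (by
    rw [I.encode_eq, jobList]
    exact List.mem_cons_of_mem _ (List.mem_append_left _ (List.mem_flatMap.2
      ⟨⟨u, hu⟩, List.mem_finRange _, ha⟩)))
  refine ⟨?_, fun u hu => ?_, fun u hu => ?_, fun u hu => ?_, fun u hu => ?_, by omega⟩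
  · simpa using mem I.n (by simp [I.encode_eq])
  · simpa [ext, hu] using job u hu (I.p ⟨u, hu⟩) (by simp)
  · simpa [ext, hu] using job u hu (I.r ⟨u, hu⟩) (by simp)
  · simpa [ext, hu] using job u hu (I.d ⟨u, hu⟩) (by simp)
  · simpa [ext, hu] using job u hu (I.w ⟨u, hu⟩) (by simp)

end unarySize

variable {I : Instance} {o : Objective} {k : ℕ}

theorem Instance.one_le_of_makespan (h : ∃ C : I.Schedule, I.IsOptimal o C ∧ I.makespan C ≤ k) :
    1 ≤ k := by
  obtain ⟨C, hC, hk⟩ := h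
  have h1 := hC.1.1 ⟨0, I.n_pos⟩
  have h2 := I.p_pos ⟨0, I.n_pos⟩
  have h3 : C ⟨0, I.n_pos⟩ ≤ I.makespan C := Finset.le_sup (f := C) (Finset.mem_univ _)
  omega

/-- A polynomial factor. -/
theorem exists_polynomial (C d : ℕ) : ∃ c, ∀ U, 1 ≤ U →
    C * ((U + 2) ^ 2) ^ 3 * (2 * U + 3) ^ d ≤ c * U ^ c := by
  refine ⟨C * 3 ^ 6 * 5 ^ d + (6 + d), fun U hU => ?_⟩
  calc C * ((U + 2) ^ 2) ^ 3 * (2 * U + 3) ^ d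
      ≤ C * ((3 * U) ^ 2) ^ 3 * (5 * U) ^ d := by gcongr <;> omega
    _ = C * 3 ^ 6 * 5 ^ d * U ^ (6 + d) := by ring
    _ ≤ _ := Nat.mul_le_mul (by omega) (Nat.pow_le_pow_right hU (by omega))

/-- The command contains no nested loops of class `M` and none of class `q`: the times of a vertex
are tried inside the loop over the entries of its table. This yields k times k ^ width. -/
theorem exists_scheduleAlong (o : Objective) : ∃ (P : Prog) (c : ℕ),
    ∀ (I : Instance) (D : TreeDecomposition I.graph) (k : ℕ),
      (∃ C : I.Schedule, I.IsOptimal o C ∧ I.makespan C ≤ k) →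
      P.SolvesWithin ((k : ℤ) :: (I.encode ++ D.encode))
        (c * (unarySize (I.encode ++ D.encode) + Nat.size k) ^ c * k ^ (D.width + 1))
        (I.HoldsOptimal o) := by
  obtain ⟨C, hC⟩ := (scheduleAlong o).exists_solves
  obtain ⟨c, hc⟩ := exists_polynomial C ((scheduleAlong o).depth .N)
  refine ⟨(scheduleAlong o).comp 0, c, fun I D k hex => ?_⟩
  have hk := Instance.one_le_of_makespan hex
  set U := unarySize (I.encode ++ D.encode) + k.size with hU
  have hb : I.Bounded k U := I.bounded k (by rw [hU, unarySize_append]; omega)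
  have hm : D.m ≤ U := by
    have := natAbs_lt_unarySize (l := I.encode ++ D.encode) (a := D.m)
      (by simp [TreeDecomposition.encode])
    simp only [Int.natAbs_natCast] at this
    omega
  have hU1 : 1 ≤ U := I.n_pos.trans_le hb.n
  have hsq : (U + 2) ^ 2 = U * U + 4 * U + 4 := by ring
  have hnn := Nat.mul_le_mul hb.n hb.n
  have hn := hb.n
  obtain ⟨s, t, h1, h2, h3⟩ := hC (limits U k (k ^ D.width)) ((U + 2) ^ 2)
    ((k : ℤ) :: (I.encode ++ D.encode)) (I.HoldsOptimal o) (by omega)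
    (by simp [limits]) (by
      rintro (_ | _ | _)
      exacts [by simp only [limits]; omega, hk, Nat.one_le_pow _ _ hk])
    (by
      intro a ha
      rcases List.mem_cons.1 ha with rfl | ha
      · exact le_limits hb.k_lt.le (by omega)
      · have := natAbs_lt_unarySize ha
        exact le_limits' (by omega))
    ((scheduleAlong_spec (hb.sufficesJobs hk le_rfl le_rfl) (by simp only [limits]; omega)
      (le_limits' (by omega)) (le_limits' (by omega)) hex).mono fun s' _ ⟨C, h1, h2⟩ mem hmem =>
        ⟨C, h1, fun j => by rw [hmem, h2]⟩)
  refine ⟨s, t, h1, h2.trans ?_, h3⟩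
  have e1 : (scheduleAlong o).depth .q = 1 := by cases o <;> rfl
  have e2 : (scheduleAlong o).depth .M = 1 := by cases o <;> rfl
  calc C * ((U + 2) ^ 2) ^ 3 * (limits U k (k ^ D.width)).weight (scheduleAlong o)
      = C * ((U + 2) ^ 2) ^ 3 * (2 * U + 3) ^ (scheduleAlong o).depth .N * k ^ (D.width + 1) := by
        simp only [Lim.weight, e1, e2, limits]; ring
    _ ≤ _ := Nat.mul_le_mul_right _ (hc U hU1)

/-! ### Balanced separators -/

/-- In the elimination forest with the additional root `n`, `i` is `x` or an ancestor of `x`. -/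
def Desc (n : ℕ) (κ : ℕ → Finset ℕ) : ℕ → ℕ → Prop :=
  Relation.ReflTransGen fun a b => a < n ∧ parent n κ a = b

section Desc

variable {n : ℕ} {κ : ℕ → Finset ℕ}

/-- All later neighbours lie on the path to the root: by `Elim.subset`, each of them is the parent
or a later neighbour of the parent. -/
theorem Elim.desc_of_mem (h : Elim n κ) {x y : ℕ} (hx : x < n) (hy : y ∈ κ x) : Desc n κ x y := by
  induction hd : n - x using Nat.strong_induction_on generalizing x with
  | _ d ih =>
    have hp : parent n κ x ≤ y := least_le (by simp [hy])
    have hyn := h.lt_n x y hy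
    have hxp := h.lt_parent hx
    have h1 : Desc n κ x (parent n κ x) := .single ⟨hx, rfl⟩
    rcases h.subset (by omega) rfl y hy with h2 | h2
    · rwa [← h2] at h1
    · exact h1.trans (ih (n - parent n κ x) (by omega) (by omega) h2 rfl)

/-- On the way from `x` up to `c`, the vertex `y` remains a later neighbour of the current vertex
until it is reached. So an edge can leave the subtree of `c` only towards `κ c`. -/
theorem Elim.desc_or_mem (h : Elim n κ) {x y c : ℕ} (hxc : Desc n κ x c) (hy : y ∈ κ x) :
    Desc n κ y c ∨ y ∈ κ c := by
  induction hxc using Relation.ReflTransGen.head_induction_on with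
  | refl => exact Or.inr hy
  | head hstep hrest ih =>
    rename_i a b
    have hyn := h.lt_n a y hy
    have hb : b < n := by
      have : parent n κ a ≤ y := least_le (by simp [hy])
      omega
    rcases h.subset hb hstep.2 y hy with rfl | h2
    · exact Or.inl hrest
    · exact ih h2

theorem Elim.desc_root (h : Elim n κ) {x : ℕ} (hx : x ≤ n) : Desc n κ x n := by
  induction hd : n - x using Nat.strong_induction_on generalizing x with
  | _ d ih =>
    rcases hx.eq_or_lt with rfl | hx
    · exact .refl
    · have hxp := h.lt_parent hx
      have hp := h.parent_le x
      exact .head ⟨hx, rfl⟩ (ih (n - parent n κ x) (by omega) (by omega) rfl)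

end Desc

/-- A partition into three parts, `0`, `1` and `2`, with part `1` separating the other two. -/
structure Separation (n : ℕ) (adj : ℕ → ℕ → Prop) (U : ℕ → Prop) (side : ℕ → ℕ) : Prop where
  lt : ∀ v < n, side v < 3
  sep : ∀ u < n, ∀ v < n, U u → U v → adj u v → side u = 0 → side v ≠ 2

open Classical in
/-- A graph with a layout of width `t` has, for each set `W` of vertices, a separator with at most
`t + 1` elements such that both sides contain at most two thirds of `W`. -/
theorem Layout.exists_separation {n : ℕ} {adj : ℕ → ℕ → Prop} {κ : ℕ → Finset ℕ} {ord : ℕ → ℕ} {t : ℕ}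
    (h : Layout n adj κ ord t) (hadj : ∀ u v, adj u v → adj v u) (W : ℕ → Prop) :
    ∃ side : ℕ → ℕ, Separation n adj (fun _ => True) side ∧
      ((Finset.range n).filter fun v => side v = 1).card ≤ t + 1 ∧
      ∀ c, c = 0 ∨ c = 2 → 3 * ((Finset.range n).filter fun v => W v ∧ side v = c).card ≤
        2 * ((Finset.range n).filter W).card := by
  let w : (ℕ → Prop) → ℕ := fun X => ((Finset.range n).filter fun x => W (ord x) ∧ X x).card
  have w_mono : ∀ X Y : ℕ → Prop, (∀ x < n, X x → Y x) → w X ≤ w Y := fun X Y hXY =>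
    Finset.card_le_card fun x hx => by
      simp only [Finset.mem_filter, Finset.mem_range] at hx ⊢
      exact ⟨hx.1, hx.2.1, hXY x hx.1 hx.2.2⟩
  have w_or : ∀ X Y : ℕ → Prop, w (fun x => X x ∨ Y x) ≤ w X + w Y := fun X Y => by
    refine le_trans (Finset.card_le_card fun x hx => ?_) (Finset.card_union_le _ _)
    simp only [Finset.mem_filter, Finset.mem_range, Finset.mem_union] at hx ⊢
    tauto
  have w_disj : ∀ X Y : ℕ → Prop, (∀ x < n, X x → ¬ Y x) → w X + w Y ≤ w fun _ => True := fun X Y hXY => by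
    rw [← Finset.card_union_of_disjoint]
    · refine Finset.card_le_card fun x hx => ?_
      simp only [Finset.mem_filter, Finset.mem_range, Finset.mem_union] at hx ⊢
      tauto
    · rw [Finset.disjoint_filter]
      exact fun x hx h1 h2 => hXY x (Finset.mem_range.1 hx) h1.2 h2.2
  have hW : w (fun _ => True) = ((Finset.range n).filter W).card := by
    refine Finset.card_bij (fun x _ => ord x) ?_ ?_ ?_
    · intro x hx
      simp only [Finset.mem_filter, Finset.mem_range] at hx ⊢
      exact ⟨h.ord_lt x hx.1, hx.2.1⟩
    · intro x hx y hy hxy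
      simp only [Finset.mem_filter, Finset.mem_range] at hx hy
      exact h.ord_inj x hx.1 y hy.1 hxy
    · intro v hv
      simp only [Finset.mem_filter, Finset.mem_range] at hv
      obtain ⟨x, hx, rfl⟩ := h.exists_ord hv.1
      exact ⟨x, by simp [hx, hv.2], rfl⟩
  rcases Nat.eq_zero_or_pos (w fun _ => True) with h0 | hpos
  · refine ⟨fun _ => 0, ⟨by simp, by simp⟩, by simp, fun c hc => ?_⟩
    rw [← hW, h0]
    have : ((Finset.range n).filter fun v => W v ∧ 0 = c).card ≤ ((Finset.range n).filter W).card :=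
      Finset.card_le_card fun x hx => by
        simp only [Finset.mem_filter] at hx ⊢; exact ⟨hx.1, hx.2.1⟩
    simp only at this ⊢
    omega
  have hroot : 2 * w (fun _ => True) < 3 * w (fun x => Desc n κ x n) := by
    have := w_mono (fun _ => True) (fun x => Desc n κ x n) fun x hx _ => h.elim.desc_root hx.le
    omega
  have hex : ∃ i, 2 * w (fun _ => True) < 3 * w (fun x => Desc n κ x i) := ⟨n, hroot⟩
  -- Numbers increase towards the root, so for a minimal `i` whose subtree contains more than two
  -- thirds of `W`, the subtree of each child contains at most two thirds. If `i` is the additional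
  -- root `n`, the separator will be empty.
  obtain ⟨i, hi, hmin⟩ : ∃ i, 2 * w (fun _ => True) < 3 * w (fun x => Desc n κ x i) ∧
      ∀ c < i, 3 * w (fun x => Desc n κ x c) ≤ 2 * w fun _ => True :=
    ⟨Nat.find hex, Nat.find_spec hex, fun c hc => not_lt.1 (Nat.find_min hex hc)⟩
  have hin : i ≤ n := by by_contra hlt; exact absurd (hmin n (by omega)) (by omega)
  let children := (Finset.range n).filter fun c => parent n κ c = i
  have hchild : ∀ c ∈ children, c < n ∧ parent n κ c = i ∧ c < i := fun c hc => by
    simp only [children, Finset.mem_filter, Finset.mem_range] at hc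
    exact ⟨hc.1, hc.2, hc.2 ▸ h.elim.lt_parent hc.1⟩
  let A : Finset ℕ → ℕ → Prop := fun Ch x => ∃ c ∈ Ch, Desc n κ x c
  -- Among the sets of children whose subtrees together contain at most two thirds, one of maximum
  -- weight and, subject to this, of maximum size. The factor `n + 1` makes the comparison
  -- lexicographic.
  obtain ⟨Ch, hCh, hmax⟩ := Finset.exists_max_image
    (children.powerset.filter fun Ch => 3 * w (A Ch) ≤ 2 * w fun _ => True) (fun Ch => w (A Ch) * (n + 1) + Ch.card)
    ⟨∅, by simp [A, w]⟩
  simp only [Finset.mem_filter, Finset.mem_powerset] at hCh hmax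
  have hcard : Ch.card ≤ n := by
    simpa using Finset.card_le_card (hCh.1.trans (Finset.filter_subset _ _))
  have hmax' : ∀ Ch', Ch' ⊆ children → 3 * w (A Ch') ≤ 2 * w (fun _ => True) → w (A Ch') ≤ w (A Ch) := by
    intro Ch' h1 h2
    have h3 := hmax Ch' ⟨h1, h2⟩
    by_contra! hlt
    have := Nat.mul_le_mul_right (n + 1) (show w (A Ch) + 1 ≤ w (A Ch') from hlt)
    rw [add_mul] at this
    omega
  let S : ℕ → Prop := fun x => x = i ∨ x ∈ κ i
  let sd : ℕ → ℕ := fun x => if S x then 1 else if A Ch x then 0 else 2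
  have hsd : ∀ x, sd x < 3 := fun x => by simp only [sd]; split_ifs <;> omega
  have hA : 3 * w (A Ch) ≤ 2 * w fun _ => True := hCh.2
  have hsd0 : ∀ x, sd x = 0 ↔ A Ch x ∧ ¬ S x := fun x => by
    simp only [sd]; split_ifs <;> simp [*]
  have hsd2 : ∀ x, sd x = 2 ↔ ¬ A Ch x ∧ ¬ S x := fun x => by
    simp only [sd]; split_ifs <;> simp [*]
  have hR : 3 * w (fun x => sd x = 2) ≤ 2 * w fun _ => True := by
    have hR0 : ∀ x, sd x = 2 → ¬ S x ∧ ¬ A Ch x := fun x hx => ((hsd2 x).1 hx).symm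
    -- If `Ch` contains all children, side 2 contains no descendant of `i`, hence less than a third
    -- of `W`.
    by_cases hall : children ⊆ Ch
    · have := w_disj (fun x => sd x = 2) (fun x => Desc n κ x i) fun x hx hx2 hd => by
        obtain ⟨h1, h2⟩ := hR0 x hx2
        rcases Relation.ReflTransGen.cases_tail hd with h3 | ⟨c, h3, h4⟩
        · exact h1 (Or.inl h3.symm)
        · exact h2 ⟨c, hall (by simpa [children] using h4), h3⟩
      omega
    · obtain ⟨c, hc, hcCh⟩ := Finset.not_subset.1 hall
      have h1 := w_disj (fun x => sd x = 2) (A Ch) fun x _ hx2 => (hR0 x hx2).2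
      -- If `Ch` had less than a third, so would `{c}` by maximality of the weight. Then `Ch` with
      -- `c` would have less than two thirds and would be preferred to `Ch`.
      suffices w (fun _ => True) ≤ 3 * w (A Ch) by omega
      by_contra hlt
      have h2 : ¬ 3 * w (A (insert c Ch)) ≤ 2 * w fun _ => True := fun h2 => by
        have h3 := hmax (insert c Ch) ⟨Finset.insert_subset hc hCh.1, h2⟩
        have h4 := w_mono (A Ch) (A (insert c Ch)) fun x _ ⟨d, hd, hd'⟩ => ⟨d, by simp [hd], hd'⟩
        rw [Finset.card_insert_of_notMem hcCh] at h3
        have := Nat.mul_le_mul_right (n + 1) h4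
        omega
      have h3 : w (A (insert c Ch)) ≤ w (A {c}) + w (A Ch) :=
        (w_mono _ (fun x => A {c} x ∨ A Ch x) fun x _ => by simp [A]).trans (w_or _ _)
      have h4 : 3 * w (A {c}) ≤ 2 * w (fun _ => True) := by
        have := hmin c (hchild c hc).2.2
        simpa [A] using this
      have h5 := hmax' {c} (by simpa using hc) h4
      omega
  -- Edges join vertices to their ancestors, so the subtrees below `i` can be left only through `i`
  -- and `κ i`.
  have hedge : ∀ x < n, ∀ y ∈ κ x, (A Ch x → A Ch y ∨ S y) ∧ (A Ch y → A Ch x) := by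
    refine fun x hx y hy => ⟨fun ⟨c, hc, hxc⟩ => ?_, fun ⟨c, hc, hyc⟩ =>
      ⟨c, hc, (h.elim.desc_of_mem hx hy).trans hyc⟩⟩
    rcases h.elim.desc_or_mem hxc hy with h1 | h1
    · exact Or.inl ⟨c, hc, h1⟩
    · obtain ⟨hcn, hpar, -⟩ := hchild c (hCh.1 hc)
      rcases hin.eq_or_lt with rfl | hin
      · have h2 : parent i κ c ≤ y := least_le (by simp [h1])
        have := h.elim.lt_n c y h1
        omega
      · exact Or.inr (h.elim.subset hin hpar y h1)
  have hsd1 : ∀ x, sd x = 1 ↔ S x := fun x => by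
    simp only [sd]; split_ifs with h1 h2 <;> simp [h1]
  choose! pos hpos_lt hpos_ord using fun v (hv : v < n) => h.exists_ord hv
  have hord_pos : ∀ x < n, pos (ord x) = x := fun x hx =>
    h.ord_inj _ (hpos_lt _ (h.ord_lt x hx)) x hx (hpos_ord _ (h.ord_lt x hx))
  have hcount : ∀ (P : ℕ → ℕ → Prop) [DecidableRel P], ((Finset.range n).filter fun v => P v (sd (pos v))).card ≤
      ((Finset.range n).filter fun x => P (ord x) (sd x)).card := fun P _ => by
    refine Finset.card_le_card_of_injOn pos ?_ ?_
    · intro v hv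
      simp only [Finset.coe_filter, Finset.mem_range, Set.mem_ofPred_eq] at hv ⊢
      rw [hpos_ord v hv.1]
      exact ⟨hpos_lt v hv.1, hv.2⟩
    · intro v hv v' hv' hvv
      simp only [Finset.coe_filter, Finset.mem_range, Set.mem_ofPred_eq] at hv hv'
      rw [← hpos_ord v hv.1, hvv, hpos_ord v' hv'.1]
  refine ⟨fun v => sd (pos v), ⟨fun v _ => hsd _, fun u hu v hv _ _ huv h0 h2 => ?_⟩, ?_, ?_⟩
  · rw [hsd0] at h0
    rw [hsd2] at h2
    rw [← hpos_ord u hu, ← hpos_ord v hv] at huv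
    rcases lt_trichotomy (pos u) (pos v) with hlt | heq | hlt
    · exact ((hedge _ (hpos_lt u hu) _ (h.edge _ (hpos_lt u hu) _ (hpos_lt v hv) hlt huv)).1 h0.1).elim
        h2.1 h2.2
    · rw [heq] at h0
      exact h2.1 h0.1
    · exact h2.1 ((hedge _ (hpos_lt v hv) _ (h.edge _ (hpos_lt v hv) _ (hpos_lt u hu) hlt
        (hadj _ _ huv))).2 h0.1)
  · refine (hcount fun _ c => c = 1).trans ?_
    simp only [hsd1]
    rcases hin.eq_or_lt with rfl | hin
    · rw [Finset.filter_false_of_mem]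
      · simp
      · rintro x hx (rfl | hx')
        · simp at hx
        · have := h.elim.lt_n i x hx'
          have := h.elim.lt i x hx'
          omega
    · refine le_trans (Finset.card_le_card (t := insert i (κ i)) fun x hx => ?_)
        ((Finset.card_insert_le _ _).trans (Nat.add_le_add_right (h.card i hin) 1))
      simp only [Finset.mem_filter] at hx
      simpa using hx.2
  · rintro c (rfl | rfl)
    · rw [← hW]
      refine le_trans (Nat.mul_le_mul_left 3 ((hcount fun v c => W v ∧ c = 0).trans ?_)) hA
      refine Finset.card_le_card fun x hx => ?_
      simp only [Finset.mem_filter, hsd0] at hx ⊢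
      exact ⟨hx.1, hx.2.1, hx.2.2.1⟩
    · rw [← hW]
      refine le_trans (Nat.mul_le_mul_left 3 ((hcount fun v c => W v ∧ c = 2).trans ?_)) hR
      exact Finset.card_le_card fun x hx => by simpa only [Finset.mem_filter] using hx

/-! ### Elimination orders from separations -/

/-- The positive entries of a row. -/
def row (N : ℕ) (W : ℕ → ℕ → ℕ) (i : ℕ) : Finset ℕ := (Finset.range N).filter fun x => 0 < W i x

theorem mem_row {N : ℕ} {W : ℕ → ℕ → ℕ} {i x : ℕ} : x ∈ row N W i ↔ x < N ∧ 0 < W i x := by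
  simp [row]

/-- The last `top` vertices of an elimination order of a graph with `N` vertices have been found: in
reverse order, they are `nord 0, …, nord (top - 1)`. The row `F v` contains the later neighbours of
`v`. The remaining vertices are divided into blocks without edges between different blocks, `blk v`
is the number of the block of `v`, and the row `W c` contains the neighbours of block `c`. -/
structure Partial (N b : ℕ) (adj : ℕ → ℕ → Prop) (F W : ℕ → ℕ → ℕ) (nord blk : ℕ → ℕ)
    (top step : ℕ) : Prop where
  lt : ∀ r < top, nord r < N ∧ blk (nord r) = 0
  inj : ∀ r < top, ∀ r' < top, nord r = nord r' → r = r'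
  surj : ∀ v < N, blk v = 0 → ∃ r < top, nord r = v
  card : ∀ r < top, (row N F (nord r)).card ≤ 4 * b
  trans : ∀ p < top, ∀ j < p, ∀ l < j, 0 < F (nord p) (nord j) → 0 < F (nord p) (nord l) →
    0 < F (nord j) (nord l)
  edge : ∀ j < top, ∀ l < j, adj (nord j) (nord l) → 0 < F (nord j) (nord l)
  placed : ∀ v < N, 0 < blk v → ∀ x < N, 0 < W (blk v) x → blk x = 0
  cardW : ∀ v < N, 0 < blk v → (row N W (blk v)).card ≤ 3 * b
  clique : ∀ v < N, 0 < blk v → ∀ j < top, ∀ l < j, 0 < W (blk v) (nord j) → 0 < W (blk v) (nord l) →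
    0 < F (nord j) (nord l)
  edgeW : ∀ u < N, ∀ v < N, 0 < blk u → blk v = 0 → adj u v → 0 < W (blk u) v
  block : ∀ u < N, ∀ v < N, 0 < blk u → 0 < blk v → adj u v → blk u = blk v
  blk_le : ∀ v < N, blk v ≤ step + 1
  count : step ≤ top ∨ ∀ v < N, blk v = 0

/-- The separator `side = 1` has less than `b` elements, and both sides contain at most `2 * b`
elements of `W`. -/
structure Balanced (N b : ℕ) (adj : ℕ → ℕ → Prop) (U W : ℕ → Prop) (side : ℕ → ℕ) : Prop
    extends Separation N adj U side where
  card : ∀ S : Finset ℕ, (∀ v ∈ S, v < N ∧ U v ∧ side v = 1) → S.card < b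
  cardW : ∀ c, c = 0 ∨ c = 2 → ∀ S : Finset ℕ, (∀ v ∈ S, v < N ∧ W v ∧ side v = c) → S.card ≤ 2 * b

/-- The vertices of block `id` are divided according to `side`, and those with `side = 1` are placed. -/
structure Advance (N id new : ℕ) (F W : ℕ → ℕ → ℕ) (nord blk : ℕ → ℕ) (top : ℕ) (side : ℕ → ℕ)
    (F' W' : ℕ → ℕ → ℕ) (nord' blk' : ℕ → ℕ) (top' : ℕ) : Prop where
  F_new : ∀ v < N, blk v = id ∧ side v = 1 →
    ∀ x < N, 0 < F' v x ↔ 0 < W id x ∨ (blk x = id ∧ side x = 1)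
  F_old : ∀ v < N, ¬ (blk v = id ∧ side v = 1) → ∀ x < N, F' v x = F v x
  W_new : ∀ x < N, 0 < W' new x ↔ (0 < W id x ∨ (blk x = id ∧ side x = 1)) ∧ side x ≠ 0
  W_id : ∀ x < N, 0 < W' id x ↔ (0 < W id x ∨ (blk x = id ∧ side x = 1)) ∧ side x ≠ 2
  W_old : ∀ c, c ≠ new → c ≠ id → ∀ x < N, W' c x = W c x
  blk_eq : ∀ v < N, blk' v =
    if blk v = id ∧ side v = 1 then 0 else if blk v = id ∧ side v = 2 then new else blk v
  nord_old : ∀ r < top, nord' r = nord r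
  nord_new : ∀ r, top ≤ r → r < top' → nord' r < N ∧ blk (nord' r) = id ∧ side (nord' r) = 1
  inj : ∀ r, top ≤ r → r < top' → ∀ r', top ≤ r' → r' < top' → nord' r = nord' r' → r = r'
  surj : ∀ v < N, blk v = id → side v = 1 → ∃ r, top ≤ r ∧ r < top' ∧ nord' r = v

section

variable {N b : ℕ} {adj : ℕ → ℕ → Prop} {F W F' W' : ℕ → ℕ → ℕ} {nord blk nord' blk' : ℕ → ℕ}
  {top top' step : ℕ}

theorem Partial.top_le (h : Partial N b adj F W nord blk top step) : top ≤ N := by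
  have := Finset.card_le_card_of_injOn (s := Finset.range top) (t := Finset.range N) nord
    (fun r hr => by simpa using (h.lt r (by simpa using hr)).1)
    (fun r hr r' hr' => h.inj r (by simpa using hr) r' (by simpa using hr'))
  simpa using this

theorem Partial.idle (h : Partial N b adj F W nord blk top step) (h0 : ∀ v < N, blk v = 0) :
    Partial N b adj F W nord blk top (step + 1) :=
  { h with
    blk_le := fun v hv => by have := h.blk_le v hv; omega
    count := Or.inr h0 }

/-- The separator vertices inside the block are placed together with `u₀`, which guarantees
progress. They all receive the same row, the neighbours of the block and themselves: at most 3b + b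
elements. A side inherits the neighbours on its own side, at most 2b, and the separator with `u₀`,
at most b, so its own bound is 3b again. The separator need not separate anything outside the block
and its neighbours. -/
theorem Partial.advance (hadj : ∀ u v, adj u v → adj v u) (h : Partial N b adj F W nord blk top step)
    {u₀ : ℕ} (hu₀ : u₀ < N) (hpos : 0 < blk u₀) {side side' : ℕ → ℕ}
    (hb : Balanced N b adj (fun v => blk v = blk u₀ ∨ 0 < W (blk u₀) v) (fun v => 0 < W (blk u₀) v) side)
    (hside : ∀ v < N, side' v = if v = u₀ then 1 else side v)
    (ha : Advance N (blk u₀) (step + 2) F W nord blk top side' F' W' nord' blk' top') :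
    Partial N b adj F' W' nord' blk' top' (step + 1) := by
  obtain ⟨id, hid⟩ : ∃ id, blk u₀ = id := ⟨_, rfl⟩
  rw [hid] at hpos hb ha
  have hWid : ∀ x < N, 0 < W id x → blk x = 0 := hid ▸ h.placed u₀ hu₀ (by omega)
  have hnew₀ : blk u₀ = id ∧ side' u₀ = 1 := ⟨hid, by simp [hside u₀ hu₀]⟩
  have hside_ne : ∀ v < N, ¬ (blk v = id ∧ side' v = 1) → side' v = side v := fun v hv hn => by
    rw [hside v hv, if_neg]
    rintro rfl
    exact hn hnew₀
  have hside0 : ∀ v < N, blk v = 0 → side' v = side v := fun v hv h0 =>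
    hside_ne v hv fun h' => by omega
  have hlt' : ∀ v < N, side' v < 3 := fun v hv => by
    rw [hside v hv]; split_ifs; exacts [by omega, hb.lt v hv]
  have hsame : ∀ r < top, ∀ x < N, F' (nord r) x = F (nord r) x := fun r hr =>
    ha.F_old _ (h.lt r hr).1 fun h' => by have := (h.lt r hr).2; omega
  have hblk0 : ∀ x < N, blk x = 0 → blk' x = 0 := fun x hx h0 => by
    rw [ha.blk_eq x hx, if_neg (by omega), if_neg (by omega), h0]
  have hblkpos : ∀ x < N, 0 < blk' x → 0 < blk x ∧ ¬ (blk x = id ∧ side' x = 1) := fun x hx h1 => by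
    refine ⟨?_, fun h2 => ?_⟩
    · by_contra h2; rw [hblk0 x hx (by omega)] at h1; omega
    · rw [ha.blk_eq x hx, if_pos h2] at h1; omega
  have hcase : ∀ v < N, 0 < blk' v → (blk v = id ∧ side v = 0 ∧ side' v = 0 ∧ blk' v = id) ∨
      (blk v = id ∧ side v = 2 ∧ side' v = 2 ∧ blk' v = step + 2) ∨
      (blk v ≠ id ∧ blk v ≠ step + 2 ∧ blk' v = blk v) := by
    intro v hv h1
    obtain ⟨-, h2⟩ := hblkpos v hv h1
    have h3 := hside_ne v hv h2
    have h4 := hlt' v hv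
    have h5 := ha.blk_eq v hv
    have h6 := h.blk_le v hv
    rw [if_neg h2] at h5
    by_cases hv' : blk v = id
    · by_cases hs : side' v = 2
      · rw [if_pos ⟨hv', hs⟩] at h5
        exact Or.inr (Or.inl ⟨hv', by omega, hs, h5⟩)
      · rw [if_neg (by tauto)] at h5
        have : side' v ≠ 1 := fun h' => h2 ⟨hv', h'⟩
        exact Or.inl ⟨hv', by omega, by omega, by omega⟩
    · rw [if_neg (by tauto)] at h5
      exact Or.inr (Or.inr ⟨hv', by omega, h5⟩)
  -- Only the numbers up to `step + 1` are in use, so `step + 2` is a fresh block number.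
  have hidnew : id ≠ step + 2 := by have := h.blk_le u₀ hu₀; omega
  have hlt : ∀ r < top', nord' r < N ∧ blk' (nord' r) = 0 := by
    intro r hr
    rcases lt_or_ge r top with hr' | hr'
    · rw [ha.nord_old r hr']
      exact ⟨(h.lt r hr').1, hblk0 _ (h.lt r hr').1 (h.lt r hr').2⟩
    · obtain ⟨h1, h2⟩ := ha.nord_new r hr' hr
      exact ⟨h1, by rw [ha.blk_eq _ h1, if_pos h2]⟩
  -- The old neighbours of the block and the vertices placed now are pairwise joined: the former by
  -- `clique`, and the row of each new vertex contains all of them.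
  have hmm : ∀ j < top', ∀ l < j, (0 < W id (nord' j) ∨ (blk (nord' j) = id ∧ side' (nord' j) = 1)) →
      (0 < W id (nord' l) ∨ (blk (nord' l) = id ∧ side' (nord' l) = 1)) → 0 < F' (nord' j) (nord' l) := by
    intro j hj l hl h1 h2
    rcases lt_or_ge j top with hj' | hj'
    · have hl' : l < top := by omega
      rw [ha.nord_old j hj'] at h1 ⊢
      rw [ha.nord_old l hl'] at h2 ⊢
      rw [hsame j hj' _ (h.lt l hl').1]
      have e1 := (h.lt j hj').2
      have e2 := (h.lt l hl').2
      have := h.clique u₀ hu₀ (by omega) j hj' l hl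
      rw [hid] at this
      exact this (h1.resolve_right (by omega)) (h2.resolve_right (by omega))
    · obtain ⟨h3, h4⟩ := ha.nord_new j hj' hj
      exact (ha.F_new _ h3 h4 _ (hlt l (by omega)).1).2 h2
  -- A balanced separator has at most b - 1 elements, which leaves room for `u₀`.
  have hcard1 : ∀ S : Finset ℕ, (∀ x ∈ S, x < N ∧ (x = u₀ ∨ ((blk x = id ∨ 0 < W id x) ∧ side x = 1))) →
      S.card ≤ b := by
    intro S hS
    have h1 := hb.card (S.erase u₀) fun v hv => by
      obtain ⟨hne, hv⟩ := Finset.mem_erase.1 hv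
      obtain ⟨h1, h2⟩ := hS v hv
      exact ⟨h1, h2.resolve_left hne⟩
    have h2 := Finset.pred_card_le_card_erase (s := S) (a := u₀)
    omega
  have hsep1 : ∀ x < N, blk x = id ∧ side' x = 1 → x = u₀ ∨ ((blk x = id ∨ 0 < W id x) ∧ side x = 1) := by
    intro x hx h1
    by_cases hxu : x = u₀
    · exact Or.inl hxu
    · have := hside x hx
      rw [if_neg hxu] at this
      exact Or.inr ⟨Or.inl h1.1, by omega⟩
  have hcardmm : ∀ c, c = 0 ∨ c = 2 → ∀ S : Finset ℕ, (∀ x ∈ S, x < N ∧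
      (0 < W id x ∨ (blk x = id ∧ side' x = 1)) ∧ (side' x = 1 ∨ side' x = c)) → S.card ≤ 3 * b := by
    intro c hc S hS
    have h1 := Finset.card_filter_add_card_filter_not (s := S) (fun x => side' x = 1)
    have h2 := hcard1 (S.filter fun x => side' x = 1) fun x hx => by
      obtain ⟨hx, hx1⟩ := Finset.mem_filter.1 hx
      obtain ⟨h2, h3, h4⟩ := hS x hx
      refine ⟨h2, h3.elim (fun h3 => Or.inr ⟨Or.inr h3, ?_⟩) (hsep1 x h2)⟩
      rw [← hside0 x h2 (hWid x h2 h3)]; exact hx1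
    have h3 := hb.cardW c hc (S.filter fun x => ¬ side' x = 1) fun x hx => by
      obtain ⟨hx, hx1⟩ := Finset.mem_filter.1 hx
      obtain ⟨h2, h3, h4⟩ := hS x hx
      have h5 := h3.resolve_right fun h => hx1 h.2
      exact ⟨h2, h5, by rw [← hside0 x h2 (hWid x h2 h5)]; exact h4.resolve_left hx1⟩
    omega
  have hadj' : ∀ u < N, ∀ v < N, blk u = id → (blk v = id ∨ 0 < W id v) → adj u v →
      ¬ (side u = 0 ∧ side v = 2) ∧ ¬ (side u = 2 ∧ side v = 0) := fun u hu v hv h1 h2 h3 =>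
    ⟨fun h4 => hb.sep u hu v hv (Or.inl h1) h2 h3 h4.1 h4.2,
      fun h4 => hb.sep v hv u hu h2 (Or.inl h1) (hadj _ _ h3) h4.2 h4.1⟩
  have hinj₁ : ∀ r < top, ∀ r', top ≤ r' → r' < top' → nord' r ≠ nord' r' := by
    intro r hr r' hr1 hr2 he
    have h1 := (h.lt r hr).2
    rw [← ha.nord_old r hr, he] at h1
    have := (ha.nord_new r' hr1 hr2).2.1
    omega
  obtain ⟨r₀, hr₀, hr₀', -⟩ := ha.surj u₀ hu₀ hnew₀.1 hnew₀.2
  refine ⟨hlt, ?_, ?_, ?_, ?_, ?_, ?_, ?_, ?_, ?_, ?_, ?_, ?_⟩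
  · intro r hr r' hr' he
    rcases lt_or_ge r top with h1 | h1 <;> rcases lt_or_ge r' top with h2 | h2
    · rw [ha.nord_old r h1, ha.nord_old r' h2] at he
      exact h.inj r h1 r' h2 he
    · exact absurd he (hinj₁ r h1 r' h2 hr')
    · exact absurd he.symm (hinj₁ r' h2 r h1 hr)
    · exact ha.inj r h1 hr r' h2 hr' he
  · intro v hv h0
    by_cases h1 : blk v = id ∧ side' v = 1
    · obtain ⟨r, -, h2, h3⟩ := ha.surj v hv h1.1 h1.2
      exact ⟨r, h2, h3⟩
    · rw [ha.blk_eq v hv, if_neg h1] at h0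
      split_ifs at h0
      obtain ⟨r, h2, h3⟩ := h.surj v hv h0
      exact ⟨r, by omega, by rw [ha.nord_old r h2, h3]⟩
  · intro r hr
    rcases lt_or_ge r top with hr' | hr'
    · rw [ha.nord_old r hr']
      have : row N F' (nord r) = row N F (nord r) := Finset.filter_congr fun x hx => by
        rw [hsame r hr' x (Finset.mem_range.1 hx)]
      rw [this]
      exact h.card r hr'
    · obtain ⟨h1, h2⟩ := ha.nord_new r hr' hr
      have h3 : row N F' (nord' r) ⊆ row N W id ∪
          (Finset.range N).filter fun x => blk x = id ∧ side' x = 1 := fun x hx => by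
        obtain ⟨hx, hx'⟩ := mem_row.1 hx
        simp only [Finset.mem_union, mem_row, Finset.mem_filter, Finset.mem_range, hx, true_and]
        exact (ha.F_new _ h1 h2 x hx).1 hx'
      have h4 := hcard1 ((Finset.range N).filter fun x => blk x = id ∧ side' x = 1) fun x hx => by
        simp only [Finset.mem_filter, Finset.mem_range] at hx
        exact ⟨hx.1, hsep1 x hx.1 hx.2⟩
      have h5 := h.cardW u₀ hu₀ (by omega)
      rw [hid] at h5
      have := (Finset.card_le_card h3).trans (Finset.card_union_le _ _)
      omega
  · intro p hp j hj l hl h1 h2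
    rcases lt_or_ge p top with hp' | hp'
    · have hj' : j < top := by omega
      have hl' : l < top := by omega
      rw [ha.nord_old p hp', ha.nord_old j hj', hsame p hp' _ (h.lt j hj').1] at h1
      rw [ha.nord_old p hp', ha.nord_old l hl', hsame p hp' _ (h.lt l hl').1] at h2
      rw [ha.nord_old j hj', ha.nord_old l hl', hsame j hj' _ (h.lt l hl').1]
      exact h.trans p hp' j hj l hl h1 h2
    · obtain ⟨h3, h4⟩ := ha.nord_new p hp' hp
      exact hmm j (by omega) l hl ((ha.F_new _ h3 h4 _ (hlt j (by omega)).1).1 h1)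
        ((ha.F_new _ h3 h4 _ (hlt l (by omega)).1).1 h2)
  · intro j hj l hl h1
    rcases lt_or_ge j top with hj' | hj'
    · have hl' : l < top := by omega
      rw [ha.nord_old j hj', ha.nord_old l hl'] at h1
      rw [ha.nord_old j hj', ha.nord_old l hl', hsame j hj' _ (h.lt l hl').1]
      exact h.edge j hj' l hl h1
    · obtain ⟨h3, h4⟩ := ha.nord_new j hj' hj
      refine (ha.F_new _ h3 h4 _ (hlt l (by omega)).1).2 ?_
      rcases lt_or_ge l top with hl' | hl'
      · rw [ha.nord_old l hl'] at h1 ⊢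
        have := h.edgeW _ h3 _ (h.lt l hl').1 (by omega) (h.lt l hl').2 h1
        rw [h4.1] at this
        exact Or.inl this
      · exact Or.inr (ha.nord_new l hl' (by omega)).2
  · intro v hv h1 x hx h2
    have key : (0 < W id x ∨ (blk x = id ∧ side' x = 1)) → blk' x = 0 := by
      rintro (h3 | h3)
      · exact hblk0 x hx (hWid x hx h3)
      · rw [ha.blk_eq x hx, if_pos h3]
    rcases hcase v hv h1 with ⟨-, -, -, h4⟩ | ⟨-, -, -, h4⟩ | ⟨h5, h6, h4⟩
    · rw [h4, ha.W_id x hx] at h2; exact key h2.1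
    · rw [h4, ha.W_new x hx] at h2; exact key h2.1
    · rw [h4, ha.W_old _ h6 h5 x hx] at h2
      exact hblk0 x hx (h.placed v hv (by omega) x hx h2)
  · intro v hv h1
    rcases hcase v hv h1 with ⟨-, -, -, h4⟩ | ⟨-, -, -, h4⟩ | ⟨h5, h6, h4⟩
    · rw [h4]
      refine hcardmm 0 (Or.inl rfl) _ fun x hx => ?_
      obtain ⟨hx, hx'⟩ := mem_row.1 hx
      rw [ha.W_id x hx] at hx'
      have := hlt' x hx
      exact ⟨hx, hx'.1, by omega⟩
    · rw [h4]
      refine hcardmm 2 (Or.inr rfl) _ fun x hx => ?_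
      obtain ⟨hx, hx'⟩ := mem_row.1 hx
      rw [ha.W_new x hx] at hx'
      have := hlt' x hx
      exact ⟨hx, hx'.1, by omega⟩
    · rw [h4]
      have : row N W' (blk v) = row N W (blk v) := Finset.filter_congr fun x hx => by
        rw [ha.W_old _ h6 h5 x (Finset.mem_range.1 hx)]
      rw [this]
      exact h.cardW v hv (by omega)
  · intro v hv h1 j hj l hl h2 h3
    have hjN := (hlt j hj).1
    have hlN := (hlt l (by omega)).1
    rcases hcase v hv h1 with ⟨-, -, -, h4⟩ | ⟨-, -, -, h4⟩ | ⟨h5, h6, h4⟩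
    · rw [h4, ha.W_id _ hjN] at h2
      rw [h4, ha.W_id _ hlN] at h3
      exact hmm j hj l hl h2.1 h3.1
    · rw [h4, ha.W_new _ hjN] at h2
      rw [h4, ha.W_new _ hlN] at h3
      exact hmm j hj l hl h2.1 h3.1
    · rw [h4, ha.W_old _ h6 h5 _ hjN] at h2
      rw [h4, ha.W_old _ h6 h5 _ hlN] at h3
      have h7 := h.placed v hv (by omega) _ hjN h2
      have hj' : j < top := by
        by_contra hj'
        have := (ha.nord_new j (by omega) hj).2.1
        omega
      have hl' : l < top := by omega
      rw [ha.nord_old j hj'] at h2 ⊢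
      rw [ha.nord_old l hl'] at h3 ⊢
      rw [hsame j hj' _ (h.lt l hl').1]
      exact h.clique v hv (by omega) j hj' l hl h2 h3
  · intro u hu v hv h1 h0 huv
    have hv' : blk v = 0 ∨ (blk v = id ∧ side' v = 1) := by
      by_contra! hv'
      have := ha.blk_eq v hv
      rw [if_neg (by tauto)] at this
      split_ifs at this <;> omega
    have key : blk u = id → (0 < W id v ∨ (blk v = id ∧ side' v = 1)) ∧
        (side u = 0 → side' v ≠ 2) ∧ (side u = 2 → side' v ≠ 0) := by
      intro hu'
      rcases hv' with hv' | hv'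
      · have h2 : 0 < W id v := hu' ▸ h.edgeW u hu v hv (by omega) hv' huv
        have := hadj' u hu v hv hu' (Or.inr h2) huv
        rw [hside0 v hv hv']
        exact ⟨Or.inl h2, by tauto, by tauto⟩
      · exact ⟨Or.inr hv', by omega, by omega⟩
    rcases hcase u hu h1 with ⟨h2, h3, -, h4⟩ | ⟨h2, h3, -, h4⟩ | ⟨h5, h6, h4⟩
    · rw [h4, ha.W_id v hv]; exact ⟨(key h2).1, (key h2).2.1 h3⟩
    · rw [h4, ha.W_new v hv]; exact ⟨(key h2).1, (key h2).2.2 h3⟩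
    · rw [h4, ha.W_old _ h6 h5 v hv]
      rcases hv' with hv' | hv'
      · exact h.edgeW u hu v hv (by omega) hv' huv
      · exact absurd (h.block u hu v hv (by omega) (by omega) huv) (by omega)
  · intro u hu v hv h1 h2 huv
    have h3 := h.block u hu v hv (hblkpos u hu h1).1 (hblkpos v hv h2).1 huv
    have := hadj' u hu v hv
    rcases hcase u hu h1 with ⟨h4, h5, -, h6⟩ | ⟨h4, h5, -, h6⟩ | ⟨h4, h5, h6⟩ <;>
      rcases hcase v hv h2 with ⟨h7, h8, -, h9⟩ | ⟨h7, h8, -, h9⟩ | ⟨h7, h8, h9⟩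
    · omega
    · exact absurd ⟨h5, h8⟩ (this h4 (Or.inl h7) huv).1
    · omega
    · exact absurd ⟨h5, h8⟩ (this h4 (Or.inl h7) huv).2
    · omega
    · omega
    · omega
    · omega
    · omega
  · intro v hv
    have := h.blk_le v hv
    rw [ha.blk_eq v hv]
    split_ifs <;> omega
  · left
    rcases h.count with h1 | h1
    · omega
    · have := h1 u₀ hu₀; omega

/-- The elimination structure of a complete order. -/
def backRow (N : ℕ) (F : ℕ → ℕ → ℕ) (ord : ℕ → ℕ) (p : ℕ) : Finset ℕ :=
  (Finset.range N).filter fun p' => p < p' ∧ 0 < F (ord p) (ord p')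

theorem mem_backRow {ord : ℕ → ℕ} {p p' : ℕ} :
    p' ∈ backRow N F ord p ↔ p' < N ∧ p < p' ∧ 0 < F (ord p) (ord p') := by
  simp [backRow]

/-- Each step places a vertex unless none is left, so after `N` steps the order is complete.
Reversing it turns the vertices placed earlier into the later ones. -/
theorem Partial.layout (h : Partial N b adj F W nord blk top N) {ord : ℕ → ℕ}
    (hord : ∀ p < N, ord p = nord (N - 1 - p)) : Layout N adj (backRow N F ord) ord (4 * b) := by
  have htop : N ≤ top := by
    rcases h.count with h1 | h1
    · exact h1
    · have := Finset.card_le_card_of_surjOn (s := Finset.range top) (t := Finset.range N) nord fun v hv => by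
        have hv' : v < N := by simpa using hv
        obtain ⟨r, h2, h3⟩ := h.surj v hv' (h1 v hv')
        exact ⟨r, by simpa using h2, h3⟩
      simpa using this
  refine ⟨⟨fun p p' hp => (mem_backRow.1 hp).2.1, fun p p' hp => (mem_backRow.1 hp).1, ?_⟩, ?_, ?_, ?_, ?_⟩
  · intro p j hj l hl hjl
    obtain ⟨hjN, hpj, hj⟩ := mem_backRow.1 hj
    obtain ⟨hlN, hpl, hl⟩ := mem_backRow.1 hl
    refine mem_backRow.2 ⟨hlN, hjl, ?_⟩
    rw [hord p (by omega), hord j hjN] at hj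
    rw [hord p (by omega), hord l hlN] at hl
    rw [hord j hjN, hord l hlN]
    exact h.trans (N - 1 - p) (by omega) (N - 1 - j) (by omega) (N - 1 - l) (by omega) hj hl
  · intro p hp
    refine le_trans (Finset.card_le_card_of_injOn ord ?_ ?_) (h.card (N - 1 - p) (by omega))
    · intro x hx
      obtain ⟨h1, h2, h3⟩ := mem_backRow.1 hx
      rw [hord p hp] at h3
      refine mem_row.2 ⟨?_, h3⟩
      rw [hord x h1]; exact (h.lt _ (by omega)).1
    · intro x hx y hy hxy
      obtain ⟨h1, -⟩ := mem_backRow.1 hx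
      obtain ⟨h2, -⟩ := mem_backRow.1 hy
      rw [hord x h1, hord y h2] at hxy
      have := h.inj _ (by omega) _ (by omega) hxy
      omega
  · intro p hp
    rw [hord p hp]; exact (h.lt _ (by omega)).1
  · intro p hp q hq hpq
    rw [hord p hp, hord q hq] at hpq
    have := h.inj _ (by omega) _ (by omega) hpq
    omega
  · intro i hi j hj hij huv
    refine mem_backRow.2 ⟨hj, hij, ?_⟩
    rw [hord i hi, hord j hj] at huv ⊢
    exact h.edge _ (by omega) _ (by omega) huv

end

open Cmd

/-! ### More loops -/

/-- An expression with the value `1` if `e` and `f` have the same value, and `0` otherwise. -/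
def Exp.eq (e f : Exp) : Exp := 1 - ((e - f) + (f - e))

theorem Exp.eq_ev {e f : Exp} {s : St} : (e.eq f).ev s = if e.ev s = f.ev s then 1 else 0 := by
  simp only [Exp.eq, Exp.ev_sub, Exp.ev_lit, Exp.ev_add]
  split_ifs <;> omega

theorem pos_ite_iff {p : Prop} [Decidable p] : 0 < (if p then 1 else 0) ↔ p := by
  split_ifs with h <;> simp [h]

/-- Let the entries of row `e` of the array `A` be `1` where the condition `c` holds, and `0` elsewhere. -/
def fill (A : Arr) (e : Exp) (x : Var) (c : Exp) : Cmd :=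
  .loop .N x (.var .n) (.ite c (.put A e (.var x) 1) (.put A e (.var x) 0))

/-- Let `b` be the number of the `x` for which the condition `c` holds. -/
def count (b x : Var) (c : Exp) : Cmd :=
  .set b 0 ;; .loop .N x (.var .n) (.ite c (.set b (.var b + 1)) .skip)

section loops

variable {L : Lim} {s : St} {n : ℕ} {b x : Var} {A : Arr} {c e : Exp}

theorem fill_spec {P : ℕ → Prop} {r : ℕ} (hn : s.v .n = n) (hN : n ≤ L.lim .N) (hB : n ≤ L.B)
    (hB1 : 1 ≤ L.B) (hr : ∀ s', (fill A e x c).Agree s s' → e.ev s' = r)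
    (hc : ∀ i < n, ∀ s', (fill A e x c).Agree s s' → s'.v x = i → s'.a A r i = s.a A r i →
      (0 < c.ev s' ↔ P i)) :
    Spec L (fill A e x c) s fun s' => (∀ i < n, 0 < s'.a A r i ↔ P i) ∧
      ∀ r' i, r' ≠ r ∨ n ≤ i → s'.a A r' i = s.a A r' i := by
  refine spec_loop (n := n) (fun j s' => (∀ i < j, 0 < s'.a A r i ↔ P i) ∧
    ∀ r' i, r' ≠ r ∨ j ≤ i → s'.a A r' i = s.a A r' i) (by simp [hn]) hN hB (by simp) ?_ fun s' _ h => h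
  rintro j hj s' hs' ⟨h1, h2⟩
  replace hs' : (fill A e x c).Agree s s' := hs'
  have hs₁ := hs'.set (x := x) (by simp [fill, wv]) j
  have hP := hc j hj _ hs₁ (by simp) (h2 r j (Or.inr le_rfl))
  have key : ∀ v, (0 < v ↔ P j) → (∀ i < j + 1, 0 < (Function.update (s'.a A) r
      (Function.update (s'.a A r) j v)) r i ↔ P i) ∧ ∀ r' i, r' ≠ r ∨ j + 1 ≤ i →
        (Function.update (s'.a A) r (Function.update (s'.a A r) j v)) r' i = s.a A r' i := by
    intro v hv
    refine ⟨fun i hi => ?_, fun r' i hi => ?_⟩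
    · rw [Function.update_self, Function.update_apply]
      split_ifs with hij
      · rw [hij, hv]
      · exact h1 i (by omega)
    · rw [Function.update_apply]
      split_ifs with hr'
      · rw [Function.update_of_ne (by omega), h2 r i (by omega), hr']
      · exact h2 r' i (Or.inl hr')
  rw [spec_ite]
  split_ifs with h'
  · simp only [spec_put, Exp.ev_lit, Exp.ev_var, hr _ hs₁, St.set_v_self, St.put_a, if_true, St.set_a,
      hB1, true_and]
    exact key 1 (by simpa using hP.1 h')
  · simp only [spec_put, Exp.ev_lit, Exp.ev_var, hr _ hs₁, St.set_v_self, St.put_a, if_true, St.set_a,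
      Nat.zero_le, true_and]
    exact key 0 (by simpa using mt hP.2 h')

theorem count_spec {P : ℕ → Prop} [DecidablePred P] (hbx : b ≠ x) (hb : b ≠ .n) (hn : s.v .n = n)
    (hN : n ≤ L.lim .N) (hB : n ≤ L.B)
    (hc : ∀ i < n, ∀ s', (count b x c).Agree s s' → s'.v x = i → (0 < c.ev s' ↔ P i)) :
    Spec L (count b x c) s fun s' => s'.v b = ((Finset.range n).filter P).card := by
  simp only [count, spec_seq, spec_set, Exp.ev_lit, Nat.zero_le, true_and]
  have hs₁ : (count b x c).Agree s (s.set b 0) := (Agree.refl _ s).set (by simp [count, wv]) 0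
  refine spec_loop (n := n) (fun j s' => s'.v b = ((Finset.range j).filter P).card)
    (by simp [hb.symm, hn]) hN hB (by simp) ?_ fun s' _ h => h
  intro j hj s' hs' h
  have hs₂ : (count b x c).Agree s (s'.set x j) :=
    (hs₁.trans (hs'.weaken (by simp [count, wv]) (by simp [count, wa]) (by simp [count, wio]))).set
      (by simp [count, wv]) _
  have hP := hc j hj _ hs₂ (by simp)
  have hle : ((Finset.range j).filter P).card ≤ j := by
    simpa using Finset.card_filter_le (Finset.range j) P
  rw [spec_ite, Finset.range_add_one, Finset.filter_insert]
  split_ifs with h1 h2 h2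
  · rw [Finset.card_insert_of_notMem (by simp)]
    simp only [spec_set, Exp.ev_add, Exp.ev_var, Exp.ev_lit, St.set_v, hbx, if_false, h, if_true,
      and_true]
    omega
  · exact absurd (hP.1 h1) h2
  · exact absurd (hP.2 h2) h1
  · simpa [hbx] using h

end loops

/-! ### The search for balanced separators -/

/-- The adjacency of two vertices. -/
def adjExp (u w : Exp) : Exp := .ioP (2 + 4 * .var .size + u * .var .size + w)

/-- The vertex is in block `id` or in row `id` of `W`. -/
def memExp (u : Exp) : Exp := (Exp.arr .blk 0 u).eq (.var .id) + .arr .W (.var .id) u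

/-- The values are different, and different from `1`. -/
def apartExp (e f : Exp) : Exp := (1 - e.eq 1) * (1 - f.eq 1) * (1 - e.eq f)

/-- Compute the value of vertex `i` in the search for separators. -/
def sepProg : Cmd :=
  .set .u (.arr .ord 0 (.var .i)) ;;
  any .bad .l (.arr .K (.var .i) (.var .l) * memExp (.arr .ord 0 (.var .l)) *
    adjExp (.var .u) (.arr .ord 0 (.var .l)) *
    apartExp (.arr .phi 0 (.var .i)) (.arr .phi 0 (.var .l))) ;;
  .ite (memExp (.var .u))
    (.ite (.var .bad + .arr .W (.var .id) (.var .u) *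
        (1 - (Exp.arr .sig 0 (.var .u)).eq (.arr .phi 0 (.var .i))))
      (.set .val (.var .b)) (.set .val ((Exp.arr .phi 0 (.var .i)).eq 1)))
    (.set .val 0)

/-- Find a separator whose restriction to row `id` of `W` is prescribed. -/
def sepOptimize : Cmd :=
  optimize .totalWeightedTardiness sepProg ;; .set .tot 0 ;;
  .loop .N .i (.var .n) (sepProg ;; .set .tot (.var .tot + .var .val)) ;;
  .ite (.var .b - .var .tot)
    (.set .fnd 1 ;; .loop .N .z (.var .n) (.put .side 0 (.arr .ord 0 (.var .z)) (.arr .phi 0 (.var .z))))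
    .skip

/-- Find a balanced separator. -/
def sepSearch : Cmd :=
  .set .fnd 0 ;; rowCount .W .id ;; clear .sig ;;
  .loop .M .y (.var .num)
    (count .ca .z (.arr .W (.var .id) (.var .z) * (Exp.arr .sig 0 (.var .z)).eq 0) ;;
      count .cb .z (.arr .W (.var .id) (.var .z) * (Exp.arr .sig 0 (.var .z)).eq 2) ;;
      .ite ((.var .ca - (.var .b + .var .b)) + (.var .cb - (.var .b + .var .b))) .skip sepOptimize ;;
      odometer .W .id .sig)

/-- The vertex is in block `id` or in row `id` of `W`. -/
def InPart (blk : ℕ → ℕ) (W : ℕ → ℕ → ℕ) (id v : ℕ) : Prop := blk v = id ∨ 0 < W id v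

section

variable (N b id : ℕ) (adj : ℕ → ℕ → Prop) (blk : ℕ → ℕ) (W : ℕ → ℕ → ℕ) (sig : ℕ → ℕ)
  (κ : ℕ → Finset ℕ) (ord : ℕ → ℕ)

/-- Vertex `i` violates the prescription or is joined to the other side by an edge. -/
def SepBad (i : ℕ) (φ : ℕ → ℕ) : Prop :=
  (∃ l < N, l ∈ κ i ∧ InPart blk W id (ord l) ∧ adj (ord i) (ord l) ∧
    φ i ≠ 1 ∧ φ l ≠ 1 ∧ φ i ≠ φ l) ∨ (0 < W id (ord i) ∧ sig (ord i) ≠ φ i)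

open Classical in
/-- The value of vertex `i` in the search for separators. -/
noncomputable def sepVal (i : ℕ) (φ : ℕ → ℕ) : ℕ :=
  if InPart blk W id (ord i) then if SepBad N id adj blk W sig κ ord i φ then b
    else if φ i = 1 then 1 else 0
  else 0

variable {N b id adj blk W sig κ ord} {t : ℕ}

theorem sepVal_congr {i : ℕ} {φ ψ : ℕ → ℕ} (hi : i < N) (h : ∀ x < N, x = i ∨ x ∈ κ i → φ x = ψ x) :
    sepVal N b id adj blk W sig κ ord i φ = sepVal N b id adj blk W sig κ ord i ψ := by
  have h0 := h i hi (Or.inl rfl)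
  have : SepBad N id adj blk W sig κ ord i φ ↔ SepBad N id adj blk W sig κ ord i ψ := by
    unfold SepBad
    rw [h0]
    refine or_congr (exists_congr fun l => and_congr_right fun hl => and_congr_right fun hl' => ?_) Iff.rfl
    rw [h l hl (Or.inr hl')]
  unfold sepVal
  by_cases hb : SepBad N id adj blk W sig κ ord i φ
  · rw [if_pos hb, if_pos (this.1 hb)]
  · rw [if_neg hb, if_neg (mt this.2 hb), h0]

theorem sepVal_le (hb : 1 ≤ b) {i : ℕ} {φ : ℕ → ℕ} : sepVal N b id adj blk W sig κ ord i φ ≤ b := by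
  unfold sepVal
  split_ifs <;> omega

/-- An assignment of value less than `b` is a balanced separator. -/
theorem balanced_of_sum_lt (hadj : ∀ u v, adj u v → adj v u) (hlay : Layout N adj κ ord t) {φ side : ℕ → ℕ}
    (hφ : ∀ x < N, φ x < 3) (hside : ∀ x < N, side (ord x) = φ x)
    (hsum : ∑ i ∈ Finset.range N, sepVal N b id adj blk W sig κ ord i φ < b)
    (hsig : ∀ c, c = 0 ∨ c = 2 → ∀ S : Finset ℕ, (∀ v ∈ S, v < N ∧ 0 < W id v ∧ sig v = c) →
      S.card ≤ 2 * b) :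
    Balanced N b adj (InPart blk W id) (fun v => 0 < W id v) side := by
  -- A single bad vertex already costs `b`.
  have hgood : ∀ i < N, InPart blk W id (ord i) → ¬ SepBad N id adj blk W sig κ ord i φ := by
    intro i hi hm hbad
    have h1 := Finset.single_le_sum (f := fun i => sepVal N b id adj blk W sig κ ord i φ)
      (fun _ _ => Nat.zero_le _) (Finset.mem_range.2 hi)
    simp only [sepVal, if_pos hm, if_pos hbad] at h1
    simp only [sepVal] at hsum
    omega
  have key : ∀ i < N, ∀ j < N, i < j → InPart blk W id (ord i) → InPart blk W id (ord j) →
      adj (ord i) (ord j) → φ i ≠ 1 → φ j ≠ 1 → φ i = φ j := by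
    intro i hi j hj hij h1 h2 h3 h4 h5
    by_contra h6
    exact hgood i hi h1 (Or.inl ⟨j, hj, hlay.edge i hi j hj hij h3, h2, h3, h4, h5, h6⟩)
  refine ⟨⟨fun v hv => ?_, fun u hu v hv h1 h2 h3 h4 h5 => ?_⟩, fun S hS => ?_, fun c hc S hS => ?_⟩
  · obtain ⟨x, hx, rfl⟩ := hlay.exists_ord hv
    rw [hside x hx]; exact hφ x hx
  · obtain ⟨i, hi, rfl⟩ := hlay.exists_ord hu
    obtain ⟨j, hj, rfl⟩ := hlay.exists_ord hv
    rw [hside i hi] at h4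
    rw [hside j hj] at h5
    rcases lt_trichotomy i j with h | h | h
    · have := key i hi j hj h h1 h2 h3 (by omega) (by omega); omega
    · rw [h] at h4; omega
    · have := key j hj i hi h h2 h1 (hadj _ _ h3) (by omega) (by omega); omega
  · refine lt_of_le_of_lt ?_ hsum
    choose! pos hpos hpos' using fun v (hv : v < N) => hlay.exists_ord hv
    have h1 : S.card = ∑ i ∈ S.image pos, 1 := by
      rw [Finset.sum_const, smul_eq_mul, mul_one, Finset.card_image_of_injOn]
      intro v hv v' hv' hvv
      rw [← hpos' v (hS v hv).1, hvv, hpos' v' (hS v' hv').1]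
    rw [h1]
    refine (Finset.sum_le_sum fun i hi => ?_).trans (Finset.sum_le_sum_of_subset (fun i hi => ?_))
    · obtain ⟨v, hv, rfl⟩ := Finset.mem_image.1 hi
      obtain ⟨h2, h3, h4⟩ := hS v hv
      rw [← hpos' v h2, hside _ (hpos v h2)] at h4
      have h5 : InPart blk W id (ord (pos v)) := by rwa [hpos' v h2]
      rw [sepVal, if_pos h5, if_neg (hgood _ (hpos v h2) h5), if_pos h4]
    · obtain ⟨v, hv, rfl⟩ := Finset.mem_image.1 hi
      exact Finset.mem_range.2 (hpos v (hS v hv).1)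
  · refine hsig c hc S fun v hv => ?_
    obtain ⟨h1, h2, h3⟩ := hS v hv
    obtain ⟨x, hx, rfl⟩ := hlay.exists_ord h1
    have h4 := mt Or.inr (hgood x hx (Or.inr h2))
    rw [hside x hx] at h3
    refine ⟨h1, h2, ?_⟩
    by_contra h5
    exact h4 ⟨h2, by omega⟩

/-- A balanced separator that obeys the prescription has a value less than `b`. -/
theorem sum_lt_of_balanced (hlay : Layout N adj κ ord t) {side : ℕ → ℕ}
    (hb : Balanced N b adj (fun _ => True) (fun v => 0 < W id v) side) (hadj : ∀ u v, adj u v → adj v u)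
    (hsig : ∀ v < N, 0 < W id v → sig v = side v) :
    ∑ i ∈ Finset.range N, sepVal N b id adj blk W sig κ ord i (fun x => side (ord x)) < b := by
  -- No vertex is bad, since no edge joins the sides 0 and 2 and the prescription is obeyed. So at
  -- most the separator is counted.
  have h1 : ∀ i ∈ Finset.range N, sepVal N b id adj blk W sig κ ord i (fun x => side (ord x)) ≤
      if side (ord i) = 1 then 1 else 0 := by
    intro i hi
    have hi := Finset.mem_range.1 hi
    have hg : ¬ SepBad N id adj blk W sig κ ord i (fun x => side (ord x)) := by
      rintro (⟨l, hl, -, -, h3, h4, h5, h6⟩ | ⟨h2, h3⟩)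
      · have h7 := hb.lt _ (hlay.ord_lt i hi)
        have h8 := hb.lt _ (hlay.ord_lt l hl)
        have h9 := hb.sep _ (hlay.ord_lt i hi) _ (hlay.ord_lt l hl) trivial trivial h3
        have h10 := hb.sep _ (hlay.ord_lt l hl) _ (hlay.ord_lt i hi) trivial trivial (hadj _ _ h3)
        dsimp only at h4 h5 h6
        omega
      · exact h3 (hsig _ (hlay.ord_lt i hi) h2)
    rw [sepVal, if_neg hg]
    split_ifs <;> omega
  refine (Finset.sum_le_sum h1).trans_lt ?_
  rw [← Finset.sum_filter, Finset.sum_const, smul_eq_mul, mul_one]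
  rw [← Finset.card_image_of_injOn (f := ord) (s := (Finset.range N).filter fun i => side (ord i) = 1)]
  · refine hb.card _ fun v hv => ?_
    obtain ⟨x, hx, rfl⟩ := Finset.mem_image.1 hv
    simp only [Finset.mem_filter, Finset.mem_range] at hx
    exact ⟨hlay.ord_lt x hx.1, trivial, hx.2⟩
  · intro x hx y hy hxy
    simp only [Finset.coe_filter, Finset.mem_range, Set.mem_ofPred_eq] at hx hy
    exact hlay.ord_inj x hx.1 y hy.1 hxy

end

/-! ### Correctness of the search for balanced separators -/

open Cmd

/-- The state contains the data for the search for separators in the graph that is induced by the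
first `N` vertices. -/
structure GraphInput (L : Lim) (I : Instance) (k N b : ℕ) (κ : ℕ → Finset ℕ) (ord : ℕ → ℕ) (s : St) :
    Prop where
  lim : L.Suffices N 3 (4 * b + 1) b
  pow_le_M : 3 ^ (3 * b) ≤ L.lim .M
  one_le_b : 1 ≤ b
  reads : Reads I k s.io
  size : s.v .size = I.n
  N_le : N ≤ I.n
  hn : s.v .n = N
  hq : s.v .q = 3
  hb : s.v .b = b
  hK : ∀ i l, i < N → l < N → (0 < s.a .K i l ↔ l ∈ κ i)
  hord : ∀ l < N, s.a .ord 0 l = ord l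
  layout : Layout N (extRel I.graph.Adj) κ ord (4 * b + 1)

/-- The state contains the data for the search for a separator of block `id`. -/
structure SepInput (L : Lim) (I : Instance) (k N b id : ℕ) (κ : ℕ → Finset ℕ) (ord blk : ℕ → ℕ)
    (W : ℕ → ℕ → ℕ) (s : St) : Prop extends GraphInput L I k N b κ ord s where
  hid : s.v .id = id
  hblk : s.a .blk 0 = blk
  hW : s.a .W = W
  card : (row N W id).card ≤ 3 * b

section

variable {L : Lim} {I : Instance} {k N b id : ℕ} {κ : ℕ → Finset ℕ} {ord blk : ℕ → ℕ}
  {W : ℕ → ℕ → ℕ} {s s' : St}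

theorem GraphInput.congr (H : GraphInput L I k N b κ ord s)
    (hv : ∀ x ∈ [Var.n, .q, .b, .size], s'.v x = s.v x)
    (ha : ∀ A ∈ [Arr.K, .ord], s'.a A = s.a A) (hio : s'.io = s.io) :
    GraphInput L I k N b κ ord s' where
  __ := H
  reads := hio ▸ H.reads
  size := (hv _ (by simp)).trans H.size
  hn := (hv _ (by simp)).trans H.hn
  hq := (hv _ (by simp)).trans H.hq
  hb := (hv _ (by simp)).trans H.hb
  hK := by rw [ha _ (by simp)]; exact H.hK
  hord := by rw [ha _ (by simp)]; exact H.hord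

/-- The command does not assign to the data for the search for separators. -/
def Cmd.KeepsGraph (c : Cmd) : Bool :=
  [Var.n, .q, .b, .size].all (fun x => !c.wv x) && [Arr.K, .ord].all (fun A => !c.wa A) && !c.wio

theorem GraphInput.agree (H : GraphInput L I k N b κ ord s) {c : Cmd} (h : c.Agree s s')
    (hc : c.KeepsGraph = true) : GraphInput L I k N b κ ord s' := by
  simp only [Cmd.KeepsGraph, Bool.and_eq_true, List.all_eq_true, Bool.not_eq_true'] at hc
  exact H.congr (fun x hx => h.v x (hc.1.1 x hx)) (fun A hA => h.a A (hc.1.2 A hA)) (h.io hc.2)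

theorem GraphInput.set (H : GraphInput L I k N b κ ord s) {x : Var} {a : ℕ}
    (hx : (Cmd.set x 0).KeepsGraph = true) : GraphInput L I k N b κ ord (s.set x a) :=
  H.agree ((Agree.refl _ s).set (by simp [wv]) a) hx

theorem SepInput.congr (H : SepInput L I k N b id κ ord blk W s)
    (hv : ∀ x ∈ [Var.n, .q, .b, .id, .size], s'.v x = s.v x)
    (ha : ∀ A ∈ [Arr.blk, .W, .K, .ord], s'.a A = s.a A) (hio : s'.io = s.io) :
    SepInput L I k N b id κ ord blk W s' where
  __ := H.toGraphInput.congr (s' := s') (fun x hx => hv x (by revert x; decide))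
    (fun A hA => ha A (by revert A; decide)) hio
  hid := (hv _ (by simp)).trans H.hid
  hblk := by rw [ha _ (by simp)]; exact H.hblk
  hW := by rw [ha _ (by simp)]; exact H.hW
  card := H.card

/-- The command does not assign to the data for the search for a separator of a block. -/
def Cmd.KeepsSepInput (c : Cmd) : Bool :=
  [Var.n, .q, .b, .id, .size].all (fun x => !c.wv x) && [Arr.blk, .W, .K, .ord].all (fun A => !c.wa A) &&
    !c.wio

theorem SepInput.agree (H : SepInput L I k N b id κ ord blk W s) {c : Cmd} (h : c.Agree s s')
    (hc : c.KeepsSepInput = true) : SepInput L I k N b id κ ord blk W s' := by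
  simp only [Cmd.KeepsSepInput, Bool.and_eq_true, List.all_eq_true, Bool.not_eq_true'] at hc
  exact H.congr (fun x hx => h.v x (hc.1.1 x hx)) (fun A hA => h.a A (hc.1.2 A hA)) (h.io hc.2)

theorem SepInput.set (H : SepInput L I k N b id κ ord blk W s) {x : Var} {a : ℕ}
    (hx : (Cmd.set x 0).KeepsSepInput = true) : SepInput L I k N b id κ ord blk W (s.set x a) :=
  H.agree ((Agree.refl _ s).set (by simp [wv]) a) hx

theorem SepInput.near (H : SepInput L I k N b id κ ord blk W s) (h : Near s s') :
    SepInput L I k N b id κ ord blk W s' :=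
  H.congr (fun x hx => h.v x (by fin_cases hx <;> rfl)) (fun A hA => h.a A (by fin_cases hA <;> rfl)) h.io

theorem isLocal_sepProg : sepProg.IsLocal :=
  ⟨fun x hx => by cases x <;> first | rfl | simp [sepProg, any, wv] at hx, fun A => by cases A <;> rfl, rfl⟩

theorem adjExp_pos (H : SepInput L I k N b id κ ord blk W s) {e f : Exp} {u w : ℕ} (he : e.ev s = u)
    (hf : f.ev s = w) (hu : u < N) (hw : w < N) : 0 < (adjExp e f).ev s ↔ extRel I.graph.Adj u w := by
  have := H.reads.adj u (hu.trans_le H.N_le) w (hw.trans_le H.N_le)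
  simp only [adjExp, Exp.ev_ioP, Exp.ev_add, Exp.ev_mul, Exp.ev_lit, Exp.ev_var, H.size, he, hf]
  rw [← this]
  omega

theorem memExp_pos (H : SepInput L I k N b id κ ord blk W s) {e : Exp} {u : ℕ} (he : e.ev s = u) :
    0 < (memExp e).ev s ↔ InPart blk W id u := by
  simp only [memExp, Exp.ev_add, Exp.eq_ev, Exp.ev_arr, Exp.ev_var, Exp.ev_lit, he, H.hid, H.hW, H.hblk,
    InPart, add_pos_iff, pos_ite_iff]

theorem apartExp_pos {e f : Exp} :
    0 < (apartExp e f).ev s ↔ e.ev s ≠ 1 ∧ f.ev s ≠ 1 ∧ e.ev s ≠ f.ev s := by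
  by_cases h1 : e.ev s = 1 <;> by_cases h2 : f.ev s = 1 <;> by_cases h3 : e.ev s = f.ev s <;>
    simp [apartExp, Exp.eq_ev, h1, h2, h3]

theorem sepProg_spec (H : SepInput L I k N b id κ ord blk W s) (hi : s.v .i < N) :
    Spec L sepProg s fun s' => s'.v .val =
      sepVal N b id (extRel I.graph.Adj) blk W (s.a .sig 0) κ ord (s.v .i) (s.a .phi 0) := by
  obtain ⟨i, hi'⟩ : ∃ i, s.v .i = i := ⟨_, rfl⟩
  rw [hi'] at hi ⊢
  have hu := H.layout.ord_lt i hi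
  have hn := H.lim.n_le_B
  simp only [sepProg, spec_seq, spec_set, Exp.ev_arr, Exp.ev_var, Exp.ev_lit, hi', H.hord i hi]
  refine ⟨by omega, ?_⟩
  have H₁ : SepInput L I k N b id κ ord blk W (s.set .u (ord i)) :=
    H.set rfl
  refine (any_spec (n := N) (P := fun l => l ∈ κ i ∧ InPart blk W id (ord l) ∧
    extRel I.graph.Adj (ord i) (ord l) ∧ s.a .phi 0 i ≠ 1 ∧ s.a .phi 0 l ≠ 1 ∧ s.a .phi 0 i ≠ s.a .phi 0 l)
    (by simp) (by simp) H₁.hn H.lim.n_le_N hn H.lim.one_le_B ?_).mono ?_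
  · intro l hl s₁ hs₁ hl₁
    have H₂ := H₁.agree hs₁ rfl
    have e1 : s₁.v .i = i := by rw [hs₁.v .i rfl]; simp [hi']
    have e2 : s₁.v .u = ord i := by rw [hs₁.v .u rfl]; simp
    have e3 : s₁.a .phi = s.a .phi := by rw [hs₁.a .phi rfl]; simp
    have e4 : (Exp.arr .ord 0 (.var .l)).ev s₁ = ord l := by
      simp only [Exp.ev_arr, Exp.ev_lit, Exp.ev_var, hl₁, H₂.hord l hl]
    simp only [Exp.ev_mul, pos_mul_iff, apartExp_pos, memExp_pos H₂ e4,
      adjExp_pos H₂ (e := .var .u) e2 e4 hu (H.layout.ord_lt l hl), and_assoc]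
    simp only [Exp.ev_arr, Exp.ev_lit, Exp.ev_var, hl₁, e1, e3, H₂.hK i l hi hl]
  · rintro s₁ hs₁ ⟨-, hbad⟩
    have H₂ := H₁.agree hs₁ rfl
    have e1 : s₁.v .i = i := by rw [hs₁.v .i rfl]; simp [hi']
    have e2 : s₁.v .u = ord i := by rw [hs₁.v .u rfl]; simp
    have e3 : s₁.a .phi = s.a .phi := by rw [hs₁.a .phi rfl]; simp
    have e4 : s₁.a .sig = s.a .sig := by rw [hs₁.a .sig rfl]; simp
    have hcond : 0 < (Exp.var .bad + Exp.arr .W (.var .id) (.var .u) *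
        (1 - (Exp.arr .sig 0 (.var .u)).eq (.arr .phi 0 (.var .i)))).ev s₁ ↔
        SepBad N id (extRel I.graph.Adj) blk W (s.a .sig 0) κ ord i (s.a .phi 0) := by
      simp only [Exp.ev_add, Exp.ev_mul, Exp.ev_sub, add_pos_iff, pos_mul_iff, pos_one_sub_iff, Exp.eq_ev,
        pos_ite_iff, Exp.ev_arr, Exp.ev_var, Exp.ev_lit, e1, e2, e3, e4, hbad, H₂.hid, H₂.hW]
      rfl
    have hb : b ≤ L.B := (Nat.le_mul_of_pos_left _ (by positivity)).trans H.lim.G_le_B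
    have h1 := H.lim.one_le_B
    rw [spec_ite]
    by_cases hm : InPart blk W id (ord i)
    · rw [if_pos ((memExp_pos H₂ (e := .var .u) e2).2 hm), spec_ite, sepVal, if_pos hm]
      by_cases hbd : SepBad N id (extRel I.graph.Adj) blk W (s.a .sig 0) κ ord i (s.a .phi 0)
      · rw [if_pos (hcond.2 hbd), if_pos hbd]
        simpa [H₂.hb] using hb
      · rw [if_neg (mt hcond.1 hbd), if_neg hbd]
        simp only [spec_set, Exp.eq_ev, Exp.ev_arr, Exp.ev_var, Exp.ev_lit, e1, e3, St.set_v, if_true,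
          and_true]
        split_ifs <;> omega
    · rw [if_neg (mt (memExp_pos H₂ (e := .var .u) e2).1 hm), sepVal, if_neg hm]
      simp

/-- The separator that is searched for. -/
abbrev SepFound (N b id : ℕ) (adj : ℕ → ℕ → Prop) (blk : ℕ → ℕ) (W : ℕ → ℕ → ℕ) (side : ℕ → ℕ) : Prop :=
  Balanced N b adj (InPart blk W id) (fun v => 0 < W id v) side

theorem extRel_adj_symm {G : SimpleGraph (Fin N)} {u v : ℕ} (h : extRel G.Adj u v) :
    extRel G.Adj v u := by
  obtain ⟨hu, hv, h⟩ := h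
  exact ⟨hv, hu, h.symm⟩

theorem sepOptimize_spec (H : SepInput L I k N b id κ ord blk W s)
    (hsig : ∀ c, c = 0 ∨ c = 2 → ∀ S : Finset ℕ, (∀ v ∈ S, v < N ∧ 0 < W id v ∧ s.a .sig 0 v = c) →
      S.card ≤ 2 * b)
    (hfnd : 0 < s.v .fnd → SepFound N b id (extRel I.graph.Adj) blk W (s.a .side 0)) :
    Spec L sepOptimize s fun s' =>
      (0 < s'.v .fnd → SepFound N b id (extRel I.graph.Adj) blk W (s'.a .side 0)) ∧
      (0 < s.v .fnd → 0 < s'.v .fnd) ∧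
      ((∃ side, Balanced N b (extRel I.graph.Adj) (fun _ => True) (fun v => 0 < W id v) side ∧
        ∀ v < N, 0 < W id v → s.a .sig 0 v = side v) → 0 < s'.v .fnd) := by
  set g := sepVal N b id (extRel I.graph.Adj) blk W (s.a .sig 0) κ ord with hg
  have D : DPInput L N 3 (4 * b + 1) b κ .totalWeightedTardiness sepProg g s := by
    refine ⟨H.lim, H.layout.elim, H.layout.card, H.hn, H.hq, H.hK, isLocal_sepProg,
      fun s' hs' hi hφ => ?_, fun i hi φ ψ h => sepVal_congr hi h, fun i hi φ hφ => sepVal_le H.one_le_b⟩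
    have := sepProg_spec (H.near hs') hi
    rwa [hs'.a .sig rfl] at this
  simp only [sepOptimize, spec_seq]
  refine (optimize_spec D).mono ?_
  rintro s₁ hs₁ ⟨hφ, hmin⟩
  have near₁ := Near.of_agree (isScratch_optimize isLocal_sepProg) hs₁
  have H₁ := H.near near₁
  have hG : ∀ m ≤ N, ∑ i ∈ Finset.range m, g i (s₁.a .phi 0) ≤ L.B := fun m hm =>
    calc ∑ i ∈ Finset.range m, g i (s₁.a .phi 0) ≤ ∑ _i ∈ Finset.range m, b :=
          Finset.sum_le_sum fun i _ => sepVal_le H.one_le_b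
      _ = m * b := by simp
      _ ≤ 2 ^ N * b := Nat.mul_le_mul_right _ (hm.trans Nat.lt_two_pow_self.le)
      _ ≤ L.B := H.lim.G_le_B
  simp only [spec_set, Exp.ev_lit, Nat.zero_le, true_and]
  -- The forest may have several roots, so the minimum need not be a single table entry; it is
  -- recomputed from the assignment.
  refine spec_loop (n := N) (fun m s' => s'.v .tot = ∑ i ∈ Finset.range m, g i (s₁.a .phi 0))
    (by simp [H₁.hn]) H.lim.n_le_N H.lim.n_le_B (by simp) ?_ ?_
  · intro i hi s₂ hs₂ htot
    have H₂ : SepInput L I k N b id κ ord blk W (s₂.set .i i) :=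
      ((H₁.set rfl).agree hs₂ rfl).set rfl
    rw [spec_seq]
    refine (sepProg_spec H₂ (by simpa using hi)).mono fun s₃ hs₃ hval => ?_
    have e1 : s₃.v .tot = s₂.v .tot := by rw [hs₃.v .tot rfl]; simp
    have e2 : s₂.a .phi = s₁.a .phi := by rw [hs₂.a .phi rfl]; simp
    have e3 : s₂.a .sig = s.a .sig := by rw [hs₂.a .sig rfl]; simp [near₁.a .sig rfl]
    simp only [St.set_a, St.set_v, if_true, e2, e3] at hval
    have := hG (i + 1) hi
    rw [Finset.sum_range_succ] at this
    simp only [spec_set, Exp.ev_add, Exp.ev_var, e1, htot, hval, St.set_v, if_true,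
      Finset.sum_range_succ]
    exact ⟨this, rfl⟩
  · intro s₂ hs₂ htot
    have H₂ : SepInput L I k N b id κ ord blk W s₂ :=
      (H₁.set rfl).agree hs₂ rfl
    have e1 : s₂.v .fnd = s.v .fnd := by rw [hs₂.v .fnd rfl]; simp [near₁.v .fnd rfl]
    have e2 : s₂.a .side = s.a .side := by rw [hs₂.a .side rfl]; simp [near₁.a .side rfl]
    have e3 : s₂.a .phi = s₁.a .phi := by rw [hs₂.a .phi rfl]; simp
    have h1 := H.lim.one_le_B
    have hcond : 0 < (Exp.var .b - Exp.var .tot).ev s₂ ↔ ∑ i ∈ Finset.range N, g i (s₁.a .phi 0) < b := by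
      simp only [Exp.ev_sub, Exp.ev_var, H₂.hb, htot]; omega
    rw [spec_ite]
    by_cases hlt : ∑ i ∈ Finset.range N, g i (s₁.a .phi 0) < b
    · rw [if_pos (hcond.2 hlt)]
      simp only [spec_seq, spec_set, Exp.ev_lit, h1, true_and]
      refine spec_loop (n := N) (fun m s' => ∀ l < m, s'.a .side 0 (ord l) = s₁.a .phi 0 l)
        (by simp [H₂.hn]) H.lim.n_le_N H.lim.n_le_B (by simp) ?_ ?_
      · intro z hz s₃ hs₃ h
        have e4 : s₃.a .phi = s₁.a .phi := by rw [hs₃.a .phi rfl]; simp [e3]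
        have e5 : s₃.a .ord = s₂.a .ord := by rw [hs₃.a .ord rfl]; simp
        have h3 := H.lim.q_le_B
        have h4 := hφ z hz
        simp only [spec_put, Exp.ev_arr, Exp.ev_lit, Exp.ev_var, St.set_v, St.set_a, if_true, e4, e5,
          H₂.hord z hz, St.put_a, Function.update_self]
        refine ⟨by omega, fun l hl => ?_⟩
        rw [Function.update_apply]
        split_ifs with h5
        · rw [H.layout.ord_inj l (by omega) z hz h5]
        · exact h l (by
            have : l ≠ z := by rintro rfl; exact h5 rfl
            omega)
      · intro s₃ hs₃ h
        have e4 : s₃.v .fnd = 1 := by rw [hs₃.v .fnd rfl]; simp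
        refine ⟨fun _ => ?_, fun _ => by omega, fun _ => by omega⟩
        exact balanced_of_sum_lt (fun _ _ => extRel_adj_symm) H.layout hφ h hlt hsig
    · rw [if_neg (mt hcond.1 hlt)]
      simp only [spec_skip, e1, e2]
      refine ⟨hfnd, fun h => h, fun ⟨side, h2, h3⟩ => absurd ?_ hlt⟩
      refine lt_of_le_of_lt ?_ (sum_lt_of_balanced (blk := blk) H.layout h2 (fun _ _ => extRel_adj_symm) h3)
      exact hmin _ fun x hx => h2.lt _ (H.layout.ord_lt x hx)

/-- The possible restrictions of a separator to row `id` of `W` are enumerated as ternary numbers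
with at most 3b digits, and those with more than 2b neighbours on a side are skipped. Success is
promised if the whole graph has a balanced separator. The one that is found is only required to
separate the block and its row, which is all that the splitting uses. -/
theorem sepSearch_spec (H : SepInput L I k N b id κ ord blk W s) :
    Spec L sepSearch s fun s' =>
      (0 < s'.v .fnd → SepFound N b id (extRel I.graph.Adj) blk W (s'.a .side 0)) ∧
      ((∃ side, Balanced N b (extRel I.graph.Adj) (fun _ => True) (fun v => 0 < W id v) side) →
        0 < s'.v .fnd) := by
  have hrow : ∀ l < N, 0 < W id l ↔ l ∈ row N W id := fun l hl => by simp [mem_row, hl]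
  have hS : ∀ x ∈ row N W id, x < N := fun x hx => (mem_row.1 hx).1
  have hwgt : wgt 3 (row N W id) N = 3 ^ (row N W id).card := wgt_eq_pow hS
  have h1B := H.lim.one_le_B
  simp only [sepSearch, spec_seq, spec_set, Exp.ev_lit, Nat.zero_le, true_and]
  have H₁ : SepInput L I k N b id κ ord blk W (s.set .fnd 0) := H.set rfl
  refine (rowCount_spec (S := row N W id) (by simp) H₁.hn H₁.hq (by omega)
    (by rw [H₁.hid, H₁.hW]; exact hrow) hS H.lim.n_le_N H.lim.n_le_B H.lim.pow_le_B).mono ?_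
  intro s₁ hs₁ hnum
  have H₂ := H₁.agree hs₁ rfl
  refine (clear_spec H₂.hn H.lim.n_le_N H.lim.n_le_B).mono ?_
  intro s₂ hs₂ hclear
  have H₃ := H₂.agree hs₂ rfl
  have hnum₂ : s₂.v .num = 3 ^ (row N W id).card := (hs₂.v .num rfl).trans hnum
  have hfnd₂ : s₂.v .fnd = 0 := by rw [hs₂.v .fnd rfl, hs₁.v .fnd rfl]; simp
  refine spec_loop (n := 3 ^ (row N W id).card) (fun m s' => (∀ x < N, s'.a .sig 0 x < 3) ∧
      (m < 3 ^ (row N W id).card → code 3 (row N W id) (s'.a .sig 0) N = m) ∧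
      (0 < s'.v .fnd → SepFound N b id (extRel I.graph.Adj) blk W (s'.a .side 0)) ∧
      ∀ side, Balanced N b (extRel I.graph.Adj) (fun _ => True) (fun v => 0 < W id v) side →
        code 3 (row N W id) side N < m → 0 < s'.v .fnd)
    hnum₂ ((Nat.pow_le_pow_right (by omega) H.card).trans H.pow_le_M)
    (by rw [← hwgt]; exact (wgt_le_pow (by omega)).trans H.lim.pow_le_B) ?_ ?_ ?_
  · refine ⟨fun x hx => by rw [hclear x hx]; omega, fun _ => ?_, fun h => by omega, by simp⟩
    refine (code_congr (ψ := fun _ => 0) fun x hx _ => hclear x (hS x hx)).trans ?_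
    simp [code]
  · rintro m hm s' hs' ⟨i1, i2, i3, i4⟩
    have H' : SepInput L I k N b id κ ord blk W (s'.set .y m) := (H₃.agree hs' rfl).set rfl
    have hc : ∀ (c : ℕ) (s₃ : St), s₃.a .sig = s'.a .sig → SepInput L I k N b id κ ord blk W s₃ →
        ∀ i, s₃.v .z = i → ∀ e : Exp, e.ev s₃ = c →
        (0 < (Exp.arr .W (.var .id) (.var .z) * (Exp.arr .sig 0 (.var .z)).eq e).ev s₃ ↔
          0 < W id i ∧ s'.a .sig 0 i = c) := by
      intro c s₃ h1 h2 i h3 e he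
      simp only [Exp.ev_mul, pos_mul_iff, Exp.eq_ev, pos_ite_iff, Exp.ev_arr, Exp.ev_var, Exp.ev_lit, h1,
        h2.hid, h2.hW, h3, he]
    simp only [spec_seq]
    refine (count_spec (n := N) (P := fun i => 0 < W id i ∧ s'.a .sig 0 i = 0) (by simp) (by simp) H'.hn
      H.lim.n_le_N H.lim.n_le_B fun i hi s₃ hs₃ h => hc 0 s₃ ?_ (H'.agree hs₃ rfl) i h 0 rfl).mono ?_
    · rw [hs₃.a .sig rfl]; simp
    intro s₃ hs₃ hca
    have H₄ := H'.agree hs₃ rfl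
    have sig₃ : s₃.a .sig = s'.a .sig := by rw [hs₃.a .sig rfl]; simp
    refine (count_spec (n := N) (P := fun i => 0 < W id i ∧ s'.a .sig 0 i = 2) (by simp) (by simp) H₄.hn
      H.lim.n_le_N H.lim.n_le_B fun i hi s₄ hs₄ h => hc 2 s₄ ?_ (H₄.agree hs₄ rfl) i h 2 rfl).mono ?_
    · rw [hs₄.a .sig rfl, sig₃]
    intro s₄ hs₄ hcb
    have H₅ := H₄.agree hs₄ rfl
    have sig₄ : s₄.a .sig = s'.a .sig := by rw [hs₄.a .sig rfl, sig₃]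
    have fnd₄ : s₄.v .fnd = s'.v .fnd := by rw [hs₄.v .fnd rfl, hs₃.v .fnd rfl]; simp
    have side₄ : s₄.a .side = s'.a .side := by rw [hs₄.a .side rfl, hs₃.a .side rfl]; simp
    have ca₄ := (hs₄.v .ca rfl).trans hca
    have key : Spec L (.ite ((.var .ca - (.var .b + .var .b)) + (.var .cb - (.var .b + .var .b))) .skip
        sepOptimize) s₄ fun s' =>
        (0 < s'.v .fnd → SepFound N b id (extRel I.graph.Adj) blk W (s'.a .side 0)) ∧
        (0 < s₄.v .fnd → 0 < s'.v .fnd) ∧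
        ((∃ side, Balanced N b (extRel I.graph.Adj) (fun _ => True) (fun v => 0 < W id v) side ∧
          ∀ v < N, 0 < W id v → s₄.a .sig 0 v = side v) → 0 < s'.v .fnd) := by
      rw [spec_ite]
      split_ifs with hlt
      · simp only [Exp.ev_add, Exp.ev_sub, Exp.ev_var, ca₄, hcb, H₅.hb] at hlt
        rw [spec_skip, side₄, fnd₄]
        refine ⟨i3, fun h => h, fun ⟨side, h1, h2⟩ => ?_⟩
        have h3 := h1.cardW 0 (Or.inl rfl) ((Finset.range N).filter fun i => 0 < W id i ∧ s'.a .sig 0 i = 0)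
          fun v hv => by
            simp only [Finset.mem_filter, Finset.mem_range] at hv
            exact ⟨hv.1, hv.2.1, by rw [← h2 v hv.1 hv.2.1, sig₄, hv.2.2]⟩
        have h4 := h1.cardW 2 (Or.inr rfl) ((Finset.range N).filter fun i => 0 < W id i ∧ s'.a .sig 0 i = 2)
          fun v hv => by
            simp only [Finset.mem_filter, Finset.mem_range] at hv
            exact ⟨hv.1, hv.2.1, by rw [← h2 v hv.1 hv.2.1, sig₄, hv.2.2]⟩
        omega
      · simp only [Exp.ev_add, Exp.ev_sub, Exp.ev_var, ca₄, hcb, H₅.hb] at hlt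
        refine sepOptimize_spec H₅ ?_ (by rw [fnd₄, side₄]; exact i3)
        rw [sig₄]
        rintro c (rfl | rfl) S hS'
        · refine (Finset.card_le_card (t := (Finset.range N).filter fun i => 0 < W id i ∧
            s'.a .sig 0 i = 0) fun v hv => ?_).trans (by omega)
          simpa [and_assoc] using hS' v hv
        · refine (Finset.card_le_card (t := (Finset.range N).filter fun i => 0 < W id i ∧
            s'.a .sig 0 i = 2) fun v hv => ?_).trans (by omega)
          simpa [and_assoc] using hS' v hv
    refine key.mono ?_
    rintro s₅ hs₅ ⟨j1, j2, j3⟩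
    have H₆ := H₅.agree hs₅ rfl
    have sig₅ : s₅.a .sig = s'.a .sig := (hs₅.a .sig rfl).trans sig₄
    refine (odometer_spec (S := row N W id) (by simp) (by simp) H₆.hn H₆.hq
      (by rw [H₆.hid, H₆.hW]; exact hrow) (by rw [sig₅]; exact i1) H.lim.n_le_N H.lim.n_le_B h1B
      H.lim.q_le_B).mono ?_
    rintro s₆ hs₆ ⟨k1, k2⟩
    rw [hwgt, sig₅, i2 hm] at k2
    rw [hs₆.v .fnd rfl, hs₆.a .side rfl]
    refine ⟨k1, fun h => k2 h, j1, fun side h1 h2 => ?_⟩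
    rcases (show code 3 (row N W id) side N < m ∨ code 3 (row N W id) side N = m by omega) with h3 | h3
    · exact j2 (by rw [fnd₄]; exact i4 side h1 h3)
    -- In the round whose number represents the restriction of `side`, the prescription is this
    -- restriction.
    · refine j3 ⟨side, h1, fun v hv hW => ?_⟩
      rw [sig₄]
      exact code_inj (q := 3) (fun x hx => i1 x (hS x hx)) (fun x hx => h1.lt x (hS x hx))
        ((i2 hm).trans h3.symm) v ((hrow v hv).1 hW) hv
  · rintro s' - ⟨-, -, h3, h4⟩
    refine ⟨h3, fun ⟨side, h⟩ => h4 side h ?_⟩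
    rw [← hwgt]
    exact code_lt_wgt fun x hx => h.lt x (hS x hx)

end

/-! ### Splitting a block along a separator -/

open Cmd

/-- Place the vertices of the separator of block `id`, and split the block. -/
def splitProg : Cmd :=
  .put .side 0 (.var .sel) 1 ;; .set .cnt (.var .g + 2) ;;
  fill .pre 0 .z ((Exp.arr .blk 0 (.var .z)).eq (.var .id) * (Exp.arr .side 0 (.var .z)).eq 1) ;;
  fill .alive 0 .z (.arr .W (.var .id) (.var .z) + .arr .pre 0 (.var .z)) ;;
  .loop .N .z (.var .n)
    (.ite (.arr .pre 0 (.var .z))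
      (.put .nord 0 (.var .top) (.var .z) ;; .set .top (.var .top + 1) ;; .put .blk 0 (.var .z) 0 ;;
        fill .nK (.var .z) .l (.arr .alive 0 (.var .l)))
      (.ite ((Exp.arr .blk 0 (.var .z)).eq (.var .id) * (Exp.arr .side 0 (.var .z)).eq 2)
        (.put .blk 0 (.var .z) (.var .cnt)) .skip)) ;;
  fill .W (.var .cnt) .z (.arr .alive 0 (.var .z) * (1 - (Exp.arr .side 0 (.var .z)).eq 0)) ;;
  fill .W (.var .id) .z (.arr .alive 0 (.var .z) * (1 - (Exp.arr .side 0 (.var .z)).eq 2))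

/-- Find a vertex that has not been placed, and split its block. -/
def stepProg : Cmd :=
  .set .aux 0 ;;
  .loop .N .z (.var .n) (.ite (.arr .blk 0 (.var .z)) (.set .aux 1 ;; .set .sel (.var .z)) .skip) ;;
  .ite (.var .aux * .var .ok)
    (.set .id (.arr .blk 0 (.var .sel)) ;; sepSearch ;; .ite (.var .fnd) splitProg (.set .ok 0)) .skip

section

variable {L : Lim} {I : Instance} {k N b id : ℕ} {κ : ℕ → Finset ℕ} {ord blk : ℕ → ℕ}
  {W : ℕ → ℕ → ℕ} {s s' : St}

/-- The state after some iterations of the main loop of `splitProg`. -/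
structure Placing (N id new : ℕ) (F W : ℕ → ℕ → ℕ) (nord blk : ℕ → ℕ) (top : ℕ) (side : ℕ → ℕ)
    (m : ℕ) (F' : ℕ → ℕ → ℕ) (nord' blk' : ℕ → ℕ) (top' : ℕ) : Prop where
  F_new : ∀ v < m, blk v = id ∧ side v = 1 →
    ∀ x < N, 0 < F' v x ↔ 0 < W id x ∨ (blk x = id ∧ side x = 1)
  F_old : ∀ v < N, ¬ (blk v = id ∧ side v = 1) → ∀ x < N, F' v x = F v x
  blk_lt : ∀ v < m, blk' v =
    if blk v = id ∧ side v = 1 then 0 else if blk v = id ∧ side v = 2 then new else blk v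
  blk_ge : ∀ v, m ≤ v → blk' v = blk v
  top_le : top ≤ top'
  le_top : top' ≤ top + m
  nord_old : ∀ r < top, nord' r = nord r
  nord_new : ∀ r, top ≤ r → r < top' → nord' r < m ∧ blk (nord' r) = id ∧ side (nord' r) = 1
  inj : ∀ r, top ≤ r → r < top' → ∀ r', top ≤ r' → r' < top' → nord' r = nord' r' → r = r'
  surj : ∀ v < m, blk v = id → side v = 1 → ∃ r, top ≤ r ∧ r < top' ∧ nord' r = v

/-- The set of vertices to be placed and their common row are copied to `pre` and `alive`
beforehand, because the main loop changes the block numbers from which they are computed. -/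
theorem splitProg_spec {step top : ℕ} {side : ℕ → ℕ} (hn : s.v .n = N) (hN : N ≤ L.lim .N)
    (hB : step + 2 ≤ L.B) (hB' : 2 * N ≤ L.B) (hg : s.v .g = step) (hid : s.v .id = id)
    (hid' : id ≤ step + 1) (htop : s.v .top = top) (htop' : top ≤ N)
    (hside : Function.update (s.a .side 0) (s.v .sel) 1 = side) :
    Spec L splitProg s fun s' => Advance N id (step + 2) (s.a .nK) (s.a .W) (s.a .nord 0) (s.a .blk 0)
      top side (s'.a .nK) (s'.a .W) (s'.a .nord 0) (s'.a .blk 0) (s'.v .top) := by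
  have hNB : N ≤ L.B := by omega
  have h1B : 1 ≤ L.B := by omega
  simp only [splitProg, spec_seq, spec_put, spec_set, Exp.ev_lit, Exp.ev_add, Exp.ev_var, St.put_v, hg]
  refine ⟨h1B, hB, ?_⟩
  obtain ⟨s₁, hs₁⟩ : ∃ s₁, s₁ = (s.put .side 0 (s.v .sel) 1).set .cnt (step + 2) := ⟨_, rfl⟩
  rw [← hs₁]
  have v₁ : ∀ x, x ≠ Var.cnt → s₁.v x = s.v x := fun x hx => by simp [hs₁, hx]
  have cnt₁ : s₁.v .cnt = step + 2 := by simp [hs₁]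
  have a₁ : ∀ A, A ≠ Arr.side → s₁.a A = s.a A := fun A hA => by simp [hs₁, hA]
  have side₁ : s₁.a .side 0 = side := by simp [hs₁, hside]
  clear hs₁
  refine (fill_spec (n := N) (r := 0) (P := fun z => s.a .blk 0 z = id ∧ side z = 1)
    ((v₁ .n (by simp)).trans hn) hN hNB h1B (fun _ _ => rfl) ?_).mono ?_
  · intro z hz s₂ hs₂ h1 _
    simp only [Exp.ev_mul, pos_mul_iff, Exp.eq_ev, pos_ite_iff, Exp.ev_arr, Exp.ev_var, Exp.ev_lit, h1,
      hs₂.a .blk rfl, hs₂.a .side rfl, side₁, a₁ .blk (by simp), hs₂.v .id rfl, v₁ .id (by simp), hid]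
  rintro s₂ hs₂ ⟨hpre, hpre'⟩
  refine (fill_spec (n := N) (r := 0) (P := fun z => 0 < s.a .W id z ∨ s.a .blk 0 z = id ∧ side z = 1)
    ((hs₂.v .n rfl).trans ((v₁ .n (by simp)).trans hn)) hN hNB h1B (fun _ _ => rfl) ?_).mono ?_
  · intro z hz s₃ hs₃ h1 _
    simp only [Exp.ev_add, add_pos_iff, Exp.ev_arr, Exp.ev_var, Exp.ev_lit, h1, hs₃.a .W rfl, hs₂.a .W rfl,
      a₁ .W (by simp), hs₃.v .id rfl, hs₂.v .id rfl, v₁ .id (by simp), hid, hs₃.a .pre rfl, hpre z hz]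
  rintro s₃ hs₃ ⟨hmem, -⟩
  have v₃ : ∀ x, x ≠ Var.cnt → x ≠ .z → s₃.v x = s.v x := fun x h1 h2 => by
    rw [hs₃.v x (by simp [fill, wv, h2]), hs₂.v x (by simp [fill, wv, h2]), v₁ x h1]
  have a₃ : ∀ A, A ≠ Arr.side → A ≠ .pre → A ≠ .alive → s₃.a A = s.a A := fun A h1 h2 h3 => by
    rw [hs₃.a A (by simp [fill, wa, h3]), hs₂.a A (by simp [fill, wa, h2]), a₁ A h1]
  have cnt₃ : s₃.v .cnt = step + 2 := by rw [hs₃.v .cnt rfl, hs₂.v .cnt rfl, cnt₁]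
  have side₃ : s₃.a .side 0 = side := by rw [hs₃.a .side rfl, hs₂.a .side rfl, side₁]
  have hpre₃ : ∀ z < N, 0 < s₃.a .pre 0 z ↔ s.a .blk 0 z = id ∧ side z = 1 := by
    rw [hs₃.a .pre rfl]; exact hpre
  clear hs₃ hs₂ v₁ a₁ cnt₁ side₁ hpre hpre'
  refine spec_loop (n := N) (fun m s' => Placing N id (step + 2) (s.a .nK) (s.a .W) (s.a .nord 0)
    (s.a .blk 0) top side m (s'.a .nK) (s'.a .nord 0) (s'.a .blk 0) (s'.v .top))
    ((v₃ .n (by simp) (by simp)).trans hn) hN hNB ?_ ?_ ?_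
  · rw [a₃ .nK (by simp) (by simp) (by simp), a₃ .nord (by simp) (by simp) (by simp),
      a₃ .blk (by simp) (by simp) (by simp), v₃ .top (by simp) (by simp), htop]
    exact ⟨by simp, by simp, by simp, by simp, le_rfl, le_rfl, by simp, fun r h1 h2 => by omega,
      fun r h1 h2 => by omega, by simp⟩
  · intro m hm s₄ hs₄ h
    have e1 : s₄.v .cnt = step + 2 := (hs₄.v .cnt rfl).trans cnt₃
    have e2 : s₄.a .side 0 = side := by rw [hs₄.a .side rfl, side₃]
    have e3 : s₄.a .pre = s₃.a .pre := hs₄.a .pre rfl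
    have e4 : s₄.a .alive = s₃.a .alive := hs₄.a .alive rfl
    have e5 : s₄.v .id = id := by rw [hs₄.v .id rfl, v₃ .id (by simp) (by simp), hid]
    have e6 : s₄.v .n = N := by rw [hs₄.v .n rfl, v₃ .n (by simp) (by simp), hn]
    have e7 := h.blk_ge m le_rfl
    have hle := h.le_top
    rw [spec_ite]
    by_cases h1 : s.a .blk 0 m = id ∧ side m = 1
    · rw [if_pos (by simpa [e3] using (hpre₃ m hm).2 h1)]
      simp only [spec_seq, spec_put, spec_set, Exp.ev_lit, Exp.ev_add, Exp.ev_var, St.put_v, St.set_v,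
        if_true, if_false, reduceCtorEq, Nat.zero_le, true_and]
      refine ⟨by omega, by omega, ?_⟩
      refine (fill_spec (n := N) (r := m) (P := fun x => 0 < s.a .W id x ∨ s.a .blk 0 x = id ∧ side x = 1)
        (by simp [e6]) hN hNB h1B ?_ ?_).mono ?_
      · intro s₅ hs₅
        simp only [Exp.ev_var]
        rw [hs₅.v .z rfl]; simp
      · intro x hx s₅ hs₅ h2 _
        simp only [Exp.ev_arr, Exp.ev_var, Exp.ev_lit, h2, hs₅.a .alive rfl, St.put_a, St.set_a,
          reduceCtorEq, if_false, e4]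
        exact hmem x hx
      · rintro s₅ hs₅ ⟨h2, h3⟩
        simp only [St.put_a, St.set_a, reduceCtorEq, if_false] at h3
        rw [hs₅.a .nord rfl, hs₅.a .blk rfl, hs₅.v .top rfl]
        simp only [St.put_a, St.set_a, St.put_v, St.set_v, if_true, if_false, reduceCtorEq,
          Function.update_self]
        refine ⟨fun v hv hv' x hx => ?_, fun v hv hv' x hx => ?_, fun v hv => ?_, fun v hv => ?_,
          by have := h.top_le; omega, by omega, fun r hr => ?_, fun r hr hr' => ?_,
          fun r h4 h5 r' h6 h7 h8 => ?_, fun v hv h4 h5 => ?_⟩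
        · rcases (show v < m ∨ v = m by omega) with h4 | rfl
          · rw [h3 v x (Or.inl (by omega))]; exact h.F_new v h4 hv' x hx
          · exact h2 x hx
        · rw [h3 v x (Or.inl (by rintro rfl; exact hv' h1))]; exact h.F_old v hv hv' x hx
        · rw [Function.update_apply]
          by_cases h4 : v = m
          · rw [h4, if_pos rfl, if_pos h1]
          · rw [if_neg h4]; exact h.blk_lt v (by omega)
        · rw [Function.update_of_ne (by omega)]; exact h.blk_ge v (by omega)
        · rw [Function.update_of_ne (by have := h.top_le; omega)]; exact h.nord_old r hr
        · rw [Function.update_apply]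
          split_ifs with h4
          · exact ⟨by omega, h1⟩
          · have := h.nord_new r hr (by omega)
            exact ⟨by omega, this.2⟩
        · rw [Function.update_apply, Function.update_apply] at h8
          split_ifs at h8 with h9 h10 h10
          · omega
          · have := (h.nord_new r' h6 (by omega)).1; omega
          · have := (h.nord_new r h4 (by omega)).1; omega
          · exact h.inj r h4 (by omega) r' h6 (by omega) h8
        · rcases (show v < m ∨ v = m by omega) with h6 | rfl
          · obtain ⟨r, h7, h8, h9⟩ := h.surj v h6 h4 h5
            exact ⟨r, h7, by omega, by rwa [Function.update_of_ne (by omega)]⟩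
          · exact ⟨_, h.top_le, Nat.lt_succ_self _, Function.update_self _ _ _⟩
    · rw [if_neg (by simpa [e3] using mt (hpre₃ m hm).1 h1)]
      have key : ∀ c, c = (if s.a .blk 0 m = id ∧ side m = 2 then step + 2 else s.a .blk 0 m) →
          Placing N id (step + 2) (s.a .nK) (s.a .W) (s.a .nord 0) (s.a .blk 0) top side (m + 1)
            (s₄.a .nK) (s₄.a .nord 0) (Function.update (s₄.a .blk 0) m c) (s₄.v .top) := by
        intro c hc
        refine ⟨fun v hv hv' => ?_, h.F_old, fun v hv => ?_, fun v hv => ?_, h.top_le, by omega,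
          h.nord_old, fun r hr hr' => ?_, h.inj, fun v hv h4 h5 => ?_⟩
        · have : v ≠ m := by rintro rfl; exact h1 hv'
          exact h.F_new v (by omega) hv'
        · rw [Function.update_apply]
          by_cases h4 : v = m
          · rw [h4, if_pos rfl, if_neg h1, hc]
          · rw [if_neg h4]; exact h.blk_lt v (by omega)
        · rw [Function.update_of_ne (by omega)]; exact h.blk_ge v (by omega)
        · have := h.nord_new r hr hr'
          exact ⟨by omega, this.2⟩
        · have : v ≠ m := by rintro rfl; exact h1 ⟨h4, h5⟩
          exact h.surj v (by omega) h4 h5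
      have hcond : 0 < ((Exp.arr .blk 0 (.var .z)).eq (.var .id) *
          (Exp.arr .side 0 (.var .z)).eq 2).ev (s₄.set .z m) ↔ s.a .blk 0 m = id ∧ side m = 2 := by
        simp only [Exp.ev_mul, pos_mul_iff, Exp.eq_ev, pos_ite_iff, Exp.ev_arr, Exp.ev_var, Exp.ev_lit,
          St.set_v, St.set_a, if_true, if_false, reduceCtorEq, e2, e5, e7]
      rw [spec_ite]
      by_cases h2 : s.a .blk 0 m = id ∧ side m = 2
      · rw [if_pos (hcond.2 h2)]
        simp only [spec_put, Exp.ev_lit, Exp.ev_var, St.put_v, St.put_a, St.set_v, St.set_a,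
          if_true, if_false, reduceCtorEq, Function.update_self, e1]
        exact ⟨hB, key _ (by rw [if_pos h2])⟩
      · rw [if_neg (mt hcond.1 h2)]
        have := key (s₄.a .blk 0 m) (by rw [if_neg h2, e7])
        rw [Function.update_eq_self] at this
        simpa using this
  · intro s₄ hs₄ h
    have e1 : s₄.v .cnt = step + 2 := (hs₄.v .cnt rfl).trans cnt₃
    have e2 : s₄.a .side 0 = side := by rw [hs₄.a .side rfl, side₃]
    have e4 : s₄.a .alive = s₃.a .alive := hs₄.a .alive rfl
    have e5 : s₄.v .id = id := by rw [hs₄.v .id rfl, v₃ .id (by simp) (by simp), hid]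
    have e6 : s₄.v .n = N := by rw [hs₄.v .n rfl, v₃ .n (by simp) (by simp), hn]
    have e8 : s₄.a .W = s.a .W := by rw [hs₄.a .W rfl, a₃ .W (by simp) (by simp) (by simp)]
    refine (fill_spec (n := N) (r := step + 2) (P := fun x => (0 < s.a .W id x ∨
      s.a .blk 0 x = id ∧ side x = 1) ∧ side x ≠ 0) e6 hN hNB h1B (fun s₅ hs₅ => ?_) ?_).mono ?_
    · rw [Exp.ev_var, hs₅.v .cnt rfl, e1]
    · intro x hx s₅ hs₅ h1 _
      simp only [Exp.ev_mul, pos_mul_iff, Exp.ev_sub, pos_one_sub_iff, Exp.eq_ev, pos_ite_iff, Exp.ev_arr,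
        Exp.ev_var, Exp.ev_lit, h1, hs₅.a .alive rfl, hs₅.a .side rfl, e2, e4, hmem x hx, ne_eq]
    rintro s₅ hs₅ ⟨hW1, hW2⟩
    refine (fill_spec (n := N) (r := id) (P := fun x => (0 < s.a .W id x ∨
      s.a .blk 0 x = id ∧ side x = 1) ∧ side x ≠ 2) ((hs₅.v .n rfl).trans e6) hN hNB h1B
      (fun s₆ hs₆ => ?_) ?_).mono ?_
    · rw [Exp.ev_var, hs₆.v .id rfl, hs₅.v .id rfl, e5]
    · intro x hx s₆ hs₆ h1 _
      simp only [Exp.ev_mul, pos_mul_iff, Exp.ev_sub, pos_one_sub_iff, Exp.eq_ev, pos_ite_iff, Exp.ev_arr,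
        Exp.ev_var, Exp.ev_lit, h1, hs₆.a .alive rfl, hs₆.a .side rfl, hs₅.a .alive rfl,
        hs₅.a .side rfl, e2, e4, hmem x hx, ne_eq]
    rintro s₆ hs₆ ⟨hW3, hW4⟩
    rw [hs₆.a .nK rfl, hs₅.a .nK rfl, hs₆.a .nord rfl, hs₅.a .nord rfl, hs₆.a .blk rfl, hs₅.a .blk rfl,
      hs₆.v .top rfl, hs₅.v .top rfl]
    refine ⟨fun v hv => h.F_new v hv, h.F_old, fun x hx => ?_, hW3, fun c h1 h2 x hx => ?_,
      h.blk_lt, h.nord_old, fun r h1 h2 => h.nord_new r h1 h2, h.inj, h.surj⟩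
    · rw [hW4 _ _ (Or.inl (by omega))]; exact hW1 x hx
    · rw [hW4 _ _ (Or.inl h2), hW2 _ _ (Or.inl h1), e8]

-- The separation is taken in the whole graph and restricted to the first `N` vertices. Two thirds
-- of at most 3b elements are at most 2b.
open Classical in
theorem Layout.exists_balanced {n t : ℕ} {adj : ℕ → ℕ → Prop} (h : Layout n adj κ ord t)
    (hadj : ∀ u v, adj u v → adj v u) (hN : N ≤ n) (ht : t + 1 < b) {X : ℕ → Prop}
    [DecidablePred X] (hX : ((Finset.range N).filter X).card ≤ 3 * b) :
    ∃ side, Balanced N b adj (fun _ => True) X side := by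
  obtain ⟨side, h1, h2, h3⟩ := h.exists_separation hadj fun v => v < N ∧ X v
  refine ⟨side, ⟨fun v hv => h1.lt v (by omega), fun u hu v hv => h1.sep u (by omega) v (by omega)⟩,
    fun S hS => ?_, fun c hc S hS => ?_⟩
  · refine lt_of_le_of_lt (Finset.card_le_card fun v hv => ?_) (h2.trans_lt ht)
    obtain ⟨h4, -, h5⟩ := hS v hv
    simp only [Finset.mem_filter, Finset.mem_range]
    exact ⟨by omega, h5⟩
  · have h4 : 3 * ((Finset.range n).filter fun v => (v < N ∧ X v) ∧ side v = c).card ≤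
        2 * ((Finset.range n).filter fun v => v < N ∧ X v).card := by convert h3 c hc
    have h5 : ((Finset.range n).filter fun v => v < N ∧ X v).card ≤ 3 * b := by
      refine (Finset.card_le_card fun v hv => ?_).trans hX
      simp only [Finset.mem_filter, Finset.mem_range] at hv ⊢
      exact hv.2
    have h6 : S.card ≤ ((Finset.range n).filter fun v => (v < N ∧ X v) ∧ side v = c).card := by
      refine Finset.card_le_card fun v hv => ?_
      obtain ⟨h7, h8⟩ := hS v hv
      simp only [Finset.mem_filter, Finset.mem_range]
      exact ⟨by omega, ⟨h7, h8.1⟩, h8.2⟩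
    omega

theorem two_mul_le_three_pow (N : ℕ) : 2 * N ≤ 3 ^ N := by
  induction N with
  | zero => simp
  | succ N ih =>
    have := Nat.one_le_pow N 3 (by omega)
    rw [pow_succ]; omega

/-- The graph has a layout of width less than `b - 1`. -/
def Thin (I : Instance) (b : ℕ) : Prop :=
  ∃ κ ord t, Layout I.n (extRel I.graph.Adj) κ ord t ∧ t + 1 < b

/-- The variable `ok` is cleared only if there is no balanced separator, and
`Layout.exists_balanced` excludes this for thin graphs. -/
theorem stepProg_spec {step : ℕ} (H : GraphInput L I k N b κ ord s) (hg : s.v .g = step) (hs : step < N)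
    (hP : 0 < s.v .ok → Partial N b (extRel I.graph.Adj) (s.a .nK) (s.a .W) (s.a .nord 0) (s.a .blk 0)
      (s.v .top) step) (hT : Thin I b → 0 < s.v .ok) :
    Spec L stepProg s fun s' => (0 < s'.v .ok → Partial N b (extRel I.graph.Adj) (s'.a .nK) (s'.a .W)
      (s'.a .nord 0) (s'.a .blk 0) (s'.v .top) (step + 1)) ∧ (Thin I b → 0 < s'.v .ok) := by
  have h1B := H.lim.one_le_B
  have hNB := H.lim.n_le_B
  have h2N : 2 * N ≤ L.B := (two_mul_le_three_pow N).trans H.lim.pow_le_B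
  simp only [stepProg, spec_seq]
  rw [spec_set]
  refine ⟨Nat.zero_le _, ?_⟩
  refine spec_loop (n := N) (fun m s' => (s'.v .aux = 0 → ∀ v < m, s.a .blk 0 v = 0) ∧
    (0 < s'.v .aux → s'.v .sel < N ∧ 0 < s.a .blk 0 (s'.v .sel))) (by simp [H.hn]) H.lim.n_le_N hNB
    (by simp) ?_ ?_
  · rintro m hm s' hs' ⟨h1, h2⟩
    have e1 : s'.a .blk = s.a .blk := by rw [hs'.a .blk rfl]; simp
    rw [spec_ite]
    simp only [Exp.ev_arr, Exp.ev_lit, Exp.ev_var, St.set_a, St.set_v, if_true, e1]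
    split_ifs with h3
    · simp only [spec_seq, spec_set, Exp.ev_lit, Exp.ev_var, St.set_v, if_true, if_false, reduceCtorEq]
      exact ⟨h1B, by omega, fun h => absurd h (by simp), fun _ => ⟨hm, h3⟩⟩
    · simp only [spec_skip, St.set_v, if_false, reduceCtorEq]
      refine ⟨fun h4 v hv => ?_, h2⟩
      rcases (show v < m ∨ v = m by omega) with h5 | rfl
      exacts [h1 h4 v h5, by omega]
  rintro s₁ hs₁ ⟨h1, h2⟩
  have H₁ : GraphInput L I k N b κ ord s₁ := (H.set rfl).agree hs₁ rfl
  have a₁ : s₁.a = s.a := by funext A; rw [hs₁.a A rfl]; simp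
  have ok₁ : s₁.v .ok = s.v .ok := by rw [hs₁.v .ok rfl]; simp
  have top₁ : s₁.v .top = s.v .top := by rw [hs₁.v .top rfl]; simp
  have g₁ : s₁.v .g = step := by rw [hs₁.v .g rfl]; simp [hg]
  rw [spec_ite]
  simp only [Exp.ev_mul, pos_mul_iff, Exp.ev_var, ok₁]
  by_cases hok : 0 < s.v .ok
  swap
  · rw [if_neg (by tauto)]
    simp only [spec_skip, ok₁]
    exact ⟨fun h => absurd h hok, hT⟩
  have P := hP hok
  by_cases haux : 0 < s₁.v .aux
  swap
  · rw [if_neg (by tauto)]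
    simp only [spec_skip, ok₁, a₁, top₁]
    exact ⟨fun _ => P.idle (h1 (by omega)), hT⟩
  rw [if_pos ⟨haux, hok⟩]
  obtain ⟨hsel, hpos⟩ := h2 haux
  obtain ⟨u, hu⟩ : ∃ u, s₁.v .sel = u := ⟨_, rfl⟩
  rw [hu] at hsel hpos
  have hid := P.blk_le u hsel
  simp only [spec_seq]
  rw [spec_set]
  simp only [Exp.ev_arr, Exp.ev_lit, Exp.ev_var, hu, a₁]
  refine ⟨by omega, ?_⟩
  have H₂ : SepInput L I k N b (s.a .blk 0 u) κ ord (s.a .blk 0) (s.a .W) (s₁.set .id (s.a .blk 0 u)) :=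
    { H₁.set (x := .id) rfl with
      hid := by simp
      hblk := by simp [a₁]
      hW := by simp [a₁]
      card := P.cardW u hsel hpos }
  refine (sepSearch_spec H₂).mono ?_
  rintro s₃ hs₃ ⟨h3, h4⟩
  have H₃ := H₂.agree hs₃ rfl
  rw [spec_ite]
  by_cases hf : 0 < (Exp.var .fnd).ev s₃
  · rw [if_pos hf]
    have e1 : s₃.v .sel = u := by rw [hs₃.v .sel rfl]; simp [hu]
    have e2 : s₃.v .ok = s.v .ok := by rw [hs₃.v .ok rfl]; simp [ok₁]
    have e3 : s₃.v .top = s.v .top := by rw [hs₃.v .top rfl]; simp [top₁]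
    have e4 : s₃.a .nK = s.a .nK := by rw [hs₃.a .nK rfl]; simp [a₁]
    have e5 : s₃.a .nord = s.a .nord := by rw [hs₃.a .nord rfl]; simp [a₁]
    refine (splitProg_spec (step := step) (top := s.v .top) (id := s.a .blk 0 u) H₃.hn H.lim.n_le_N
      (by omega) h2N (by rw [hs₃.v .g rfl]; simp [g₁]) H₃.hid hid e3 P.top_le rfl).mono ?_
    intro s₄ hs₄ hadv
    rw [e4, e5, H₃.hW, H₃.hblk, e1] at hadv
    rw [hs₄.v .ok rfl, e2]
    refine ⟨fun _ => P.advance (fun _ _ => extRel_adj_symm) hsel hpos (h3 hf) (fun v _ => ?_) hadv,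
      fun _ => hok⟩
    rw [Function.update_apply]
  · rw [if_neg hf]
    simp only [spec_set, Exp.ev_lit, Nat.zero_le, true_and, St.set_v, if_true]
    refine ⟨fun h => absurd h (by omega), fun ⟨κ', ord', t, h5, h6⟩ => absurd (h4 ?_) hf⟩
    exact h5.exists_balanced (fun _ _ => extRel_adj_symm) H.N_le h6 (P.cardW u hsel hpos)

end

open Cmd

/-! ### The search for layouts -/

/-- Extend a layout by one more vertex, and transform it into one of width at most `4 * b`. -/
def stageProg : Cmd :=
  .set .n (.var .stage + 1) ;; .put .ord 0 (.var .stage) (.var .stage) ;;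
  .loop .N .z (.var .n) (.put .K (.var .z) (.var .stage) 1) ;; fill .K (.var .stage) .z 0 ;;
  .loop .N .z (.var .n) (.put .blk 0 (.var .z) 1 ;; .put .W 1 (.var .z) 0) ;; .set .top 0 ;;
  .loop .N .g (.var .n) stepProg ;;
  .ite (.var .ok)
    (.loop .N .z (.var .n) (.put .ord 0 (.var .z) (.arr .nord 0 (.var .n - (.var .z + 1)))) ;;
      .loop .N .g (.var .n) (fill .K (.var .g) .z
        ((.var .z - .var .g) * .arr .nK (.arr .ord 0 (.var .g)) (.arr .ord 0 (.var .z)))))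
    .skip

/-- Find a layout of width at most `4 * b`, if `b` is large enough. -/
def stagesProg : Cmd :=
  .set .ok 1 ;; .loop .N .stage (.var .size) (.ite (.var .ok) stageProg .skip)

/-- Find a layout. -/
def searchProg : Cmd :=
  .set .size (.ioP 1) ;; .set .q 3 ;; .set .done 0 ;;
  .loop .N .h (.var .size + 1) (.ite (.var .done) .skip
    (.set .b (.var .h + 1) ;; stagesProg ;; .ite (.var .ok) (.set .done 1) .skip))

/-- Find a layout, and an optimal schedule. -/
def scheduleAlone (o : Objective) : Cmd :=
  searchProg ;; .set .n (.var .size) ;; .set .q (.ioP 0) ;; schedule o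

section

variable {L : Lim} {I : Instance} {k N b t : ℕ} {κ : ℕ → Finset ℕ} {ord : ℕ → ℕ} {s s' : St}

theorem Lim.Suffices.mono {n n' q G : ℕ} (h : L.Suffices n q t G) (hn : n' ≤ n) :
    L.Suffices n' q t G where
  __ := h
  n_le_N := hn.trans h.n_le_N
  n_le_B := hn.trans h.n_le_B
  pow_le_B := (Nat.pow_le_pow_right h.one_le_q hn).trans h.pow_le_B
  G_le_B := (Nat.mul_le_mul_right _ (Nat.pow_le_pow_right (by omega) hn)).trans h.G_le_B

/-- The state contains the data for the search for a layout of width at most `4 * b`. -/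
structure SearchInput (L : Lim) (I : Instance) (k b : ℕ) (s : St) : Prop where
  lim : L.Suffices I.n 3 (4 * b + 1) b
  pow_le_M : 3 ^ (3 * b) ≤ L.lim .M
  one_le_b : 1 ≤ b
  reads : Reads I k s.io
  size : s.v .size = I.n
  hq : s.v .q = 3
  hb : s.v .b = b

/-- The command does not assign to the data for the search for a layout. -/
def Cmd.KeepsSearch (c : Cmd) : Bool := [Var.q, .b, .size].all (fun x => !c.wv x) && !c.wio

theorem SearchInput.agree (H : SearchInput L I k b s) {c : Cmd} (h : c.Agree s s')
    (hc : c.KeepsSearch = true) : SearchInput L I k b s' := by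
  simp only [Cmd.KeepsSearch, Bool.and_eq_true, List.all_eq_true, Bool.not_eq_true'] at hc
  have hv := fun x hx => h.v x (hc.1 x hx)
  exact { H with
    reads := h.io hc.2 ▸ H.reads
    size := (hv _ (by simp)).trans H.size
    hq := (hv _ (by simp)).trans H.hq
    hb := (hv _ (by simp)).trans H.hb }

/-- The state contains a layout of the graph that is induced by the first `N` vertices. -/
def HasLayout (I : Instance) (N t : ℕ) (s : St) : Prop :=
  ∃ κ ord, Layout N (extRel I.graph.Adj) κ ord t ∧
    (∀ i l, i < N → l < N → (0 < s.a .K i l ↔ l ∈ κ i)) ∧ ∀ l < N, s.a .ord 0 l = ord l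

/-- The new vertex becomes the last one and a later neighbour of all others, whatever its edges are.
-/
theorem Layout.extend {adj : ℕ → ℕ → Prop} (h : Layout N adj κ ord t) :
    Layout (N + 1) adj (fun p => if p < N then insert N (κ p) else ∅) (Function.update ord N N)
      (t + 1) := by
  have hne : ∀ {p}, p < N → Function.update ord N N p = ord p := fun hp =>
    Function.update_of_ne (by omega) _ _
  refine ⟨⟨fun p j hj => ?_, fun p j hj => ?_, fun p j hj l hl hjl => ?_⟩, fun p hp => ?_, fun p hp => ?_,
    fun p hp r hr hpr => ?_, fun p hp r hr hpr he => ?_⟩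
  · split_ifs at hj with hp
    · rcases Finset.mem_insert.1 hj with rfl | hj
      exacts [hp, h.elim.lt p j hj]
    · simp at hj
  · split_ifs at hj with hp
    · rcases Finset.mem_insert.1 hj with rfl | hj
      · omega
      · have := h.elim.lt_n p j hj; omega
    · simp at hj
  · split_ifs at hj hl with hp
    · rcases Finset.mem_insert.1 hl with rfl | hl
      · rw [if_pos hjl]; exact Finset.mem_insert_self _ _
      · have hlN := h.elim.lt_n p l hl
        rw [if_pos (by omega)]
        refine Finset.mem_insert_of_mem (h.elim.trans p j ?_ l hl hjl)
        exact (Finset.mem_insert.1 hj).resolve_left (by omega)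
    · simp at hj
  · split_ifs with hp'
    · exact (Finset.card_insert_le _ _).trans (Nat.succ_le_succ (h.card p hp'))
    · simp
  · rw [Function.update_apply]
    split_ifs with hp'
    · omega
    · have := h.ord_lt p (by omega); omega
  · rw [Function.update_apply, Function.update_apply] at hpr
    split_ifs at hpr with h1 h2 h2
    · omega
    · have := h.ord_lt r (by omega); omega
    · have := h.ord_lt p (by omega); omega
    · exact h.ord_inj p (by omega) r (by omega) hpr
  · rw [if_pos (by omega)]
    rcases (show r < N ∨ r = N by omega) with h1 | rfl
    · rw [hne (by omega), hne h1] at he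
      exact Finset.mem_insert_of_mem (h.edge p (by omega) r h1 hpr he)
    · exact Finset.mem_insert_self _ _

theorem Partial.start {adj : ℕ → ℕ → Prop} {F W : ℕ → ℕ → ℕ} {nord blk : ℕ → ℕ}
    (hblk : ∀ v < N, blk v = 1) (hW : ∀ x < N, W 1 x = 0) : Partial N b adj F W nord blk 0 0 where
  lt := by simp
  inj := by simp
  surj v hv h := by rw [hblk v hv] at h; omega
  card := by simp
  trans := by simp
  edge := by simp
  placed v hv _ x hx h := by rw [hblk v hv, hW x hx] at h; omega
  cardW v hv _ := by
    have : row N W (blk v) = ∅ := Finset.eq_empty_of_forall_notMem fun x hx => by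
      obtain ⟨h1, h2⟩ := mem_row.1 hx
      rw [hblk v hv, hW x h1] at h2; omega
    simp [this]
  clique := by simp
  edgeW u _ v hv _ h := by rw [hblk v hv] at h; omega
  block u hu v hv _ _ _ := by rw [hblk u hu, hblk v hv]
  blk_le v hv := (hblk v hv).le
  count := Or.inl le_rfl

/-- Iterative compression: the extended layout of width 4b + 1 is used only to search for
separators. These define a new layout, of width 4b, which replaces it. -/
theorem stageProg_spec {i : ℕ} (H : SearchInput L I k b s) (hi : s.v .stage = i) (hin : i < I.n)
    (hok : 0 < s.v .ok) (hl : HasLayout I i (4 * b) s) :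
    Spec L stageProg s fun s' => (0 < s'.v .ok → HasLayout I (i + 1) (4 * b) s') ∧
      (Thin I b → 0 < s'.v .ok) := by
  have lim := H.lim.mono (show i + 1 ≤ I.n from hin)
  have h1B := lim.one_le_B
  have hNB := lim.n_le_B
  obtain ⟨κ, ord, hlay, hK, hord⟩ := hl
  simp only [stageProg, spec_seq]
  rw [spec_set, spec_put]
  simp only [Exp.ev_add, Exp.ev_var, Exp.ev_lit, St.set_v, reduceCtorEq, if_false, hi]
  refine ⟨hNB, by omega, ?_⟩
  obtain ⟨s₁, hs₁⟩ : ∃ s₁, s₁ = (s.set .n (i + 1)).put .ord 0 i i := ⟨_, rfl⟩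
  rw [← hs₁]
  have hn₁ : s₁.v .n = i + 1 := by simp [hs₁]
  have stage₁ : s₁.v .stage = i := by simp [hs₁, hi]
  have ok₁ : s₁.v .ok = s.v .ok := by simp [hs₁]
  have K₁ : s₁.a .K = s.a .K := by simp [hs₁]
  have ord₁ : s₁.a .ord 0 = Function.update (s.a .ord 0) i i := by simp [hs₁]
  have H₁ : SearchInput L I k b s₁ := by
    rw [hs₁]
    exact ⟨H.lim, H.pow_le_M, H.one_le_b, H.reads, by simp [H.size], by simp [H.hq], by simp [H.hb]⟩
  clear hs₁
  refine spec_loop (n := i + 1) (fun m s' => (∀ p < m, 0 < s'.a .K p i) ∧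
    ∀ p l, l < i → s'.a .K p l = s.a .K p l) hn₁ lim.n_le_N hNB (by simp [K₁]) ?_ ?_
  · rintro m hm s' hs' ⟨h1, h2⟩
    have e1 : s'.v .stage = i := (hs'.v .stage rfl).trans stage₁
    simp only [spec_put, Exp.ev_lit, Exp.ev_var, St.set_v, if_true, if_false, reduceCtorEq, St.put_a,
      St.set_a, e1]
    refine ⟨h1B, fun p hp => ?_, fun p l hl => ?_⟩
    · by_cases hpm : p = m
      · simp [hpm]
      · simpa [hpm] using h1 p (by omega)
    · by_cases hpm : p = m
      · simpa [hpm, hl.ne] using h2 m l hl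
      · simpa [hpm] using h2 p l hl
  rintro s₂ hs₂ ⟨hKi, hKl⟩
  have stage₂ : s₂.v .stage = i := (hs₂.v .stage rfl).trans stage₁
  have hn₂ : s₂.v .n = i + 1 := (hs₂.v .n rfl).trans hn₁
  -- Row `i` may still hold entries from an attempt with a smaller `b`.
  refine (fill_spec (n := i + 1) (r := i) (P := fun _ => False) hn₂ lim.n_le_N hNB h1B
    (fun s' hs' => by rw [Exp.ev_var, hs'.v .stage rfl, stage₂]) (fun _ _ _ _ _ _ => by simp)).mono ?_
  rintro s₃ hs₃ ⟨hK3, hK3'⟩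
  have hn₃ : s₃.v .n = i + 1 := (hs₃.v .n rfl).trans hn₂
  refine spec_loop (n := i + 1) (fun m s' => (∀ v < m, s'.a .blk 0 v = 1) ∧ ∀ x < m, s'.a .W 1 x = 0) hn₃
    lim.n_le_N hNB (by simp) ?_ ?_
  · rintro m hm s' hs' ⟨h1, h2⟩
    simp only [spec_seq, spec_put, Exp.ev_lit, Exp.ev_var, St.set_v, if_true, if_false, reduceCtorEq,
      St.put_a, St.put_v, St.set_a, Nat.zero_le, true_and, Function.update_self]
    refine ⟨h1B, fun v hv => ?_, fun v hv => ?_⟩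
    all_goals
      rw [Function.update_apply]
      split_ifs with h
      · rfl
    exacts [h1 v (by omega), h2 v (by omega)]
  rintro s₄ hs₄ ⟨hblk, hW⟩
  rw [spec_set]
  refine ⟨Nat.zero_le _, ?_⟩
  have H₄ : SearchInput L I k b s₄ := ((H₁.agree hs₂ rfl).agree hs₃ rfl).agree hs₄ rfl
  have hn₄ : s₄.v .n = i + 1 := (hs₄.v .n rfl).trans hn₃
  have ok₄ : s₄.v .ok = s.v .ok := by rw [hs₄.v .ok rfl, hs₃.v .ok rfl, hs₂.v .ok rfl, ok₁]
  have G : GraphInput L I k (i + 1) b (fun p => if p < i then insert i (κ p) else ∅)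
      (Function.update ord i i) (s₄.set .top 0) := by
    refine GraphInput.set (x := .top) ⟨lim, H.pow_le_M, H.one_le_b, H₄.reads, H₄.size, hin, hn₄, H₄.hq, H₄.hb,
      fun p l hp hl => ?_, fun l hl => ?_, hlay.extend⟩ rfl
    · rw [hs₄.a .K rfl]
      by_cases hpi : p < i
      · rw [hK3' p l (Or.inl (by omega)), if_pos hpi, Finset.mem_insert]
        by_cases hli : l = i
        · simpa [hli] using hKi p hp
        · rw [hKl p l (by omega), hK p l hpi (by omega)]
          simp [hli]
      · obtain rfl : p = i := by omega
        rw [if_neg hpi, hK3 l hl]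
        simp
    · rw [hs₄.a .ord rfl, hs₃.a .ord rfl, hs₂.a .ord rfl, ord₁, Function.update_apply, Function.update_apply]
      split_ifs with h
      · rfl
      · exact hord l (by omega)
  refine spec_loop (n := i + 1) (fun m s' => (0 < s'.v .ok → Partial (i + 1) b (extRel I.graph.Adj) (s'.a .nK)
    (s'.a .W) (s'.a .nord 0) (s'.a .blk 0) (s'.v .top) m) ∧ (Thin I b → 0 < s'.v .ok)) G.hn
    lim.n_le_N hNB ?_ ?_ ?_
  · simp only [St.set_v, St.set_a, if_true, if_false, reduceCtorEq, ok₄]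
    exact ⟨fun _ => Partial.start hblk hW, fun _ => hok⟩
  · rintro m hm s₅ hs₅ ⟨h1, h2⟩
    exact stepProg_spec ((G.agree hs₅ rfl).set rfl) (by simp) hm (by simpa using h1) (by simpa using h2)
  rintro s₅ hs₅ ⟨h1, h2⟩
  have hn₅ : s₅.v .n = i + 1 := (G.agree hs₅ rfl).hn
  rw [spec_ite]
  by_cases hok₅ : 0 < (Exp.var .ok).ev s₅
  swap
  · rw [if_neg hok₅]
    exact spec_skip.2 ⟨fun h => absurd h hok₅, h2⟩
  rw [if_pos hok₅]
  have lay := (h1 hok₅).layout (ord := fun p => s₅.a .nord 0 (i - p)) fun p _ => by rw [Nat.add_sub_cancel]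
  rw [spec_seq]
  refine spec_loop (n := i + 1) (fun m s' => ∀ p < m, s'.a .ord 0 p = s₅.a .nord 0 (i - p)) hn₅ lim.n_le_N
    hNB (by simp) ?_ ?_
  · intro m hm s₆ hs₆ h
    have e1 : s₆.a .nord = s₅.a .nord := hs₆.a .nord rfl
    have e2 : s₆.v .n = i + 1 := (hs₆.v .n rfl).trans hn₅
    have h3 := lay.ord_lt m hm
    simp only [spec_put, Exp.ev_lit, Exp.ev_var, Exp.ev_arr, Exp.ev_add, Exp.ev_sub, St.set_v, if_true,
      if_false, reduceCtorEq, St.put_a, St.set_a, e1, e2, Function.update_self, Nat.add_sub_add_right]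
    refine ⟨by omega, fun p hp => ?_⟩
    rw [Function.update_apply]
    split_ifs with hpm
    · rw [hpm]
    · exact h p (by omega)
  intro s₆ hs₆ hord₆
  have nK₆ : s₆.a .nK = s₅.a .nK := hs₆.a .nK rfl
  have hn₆ : s₆.v .n = i + 1 := (hs₆.v .n rfl).trans hn₅
  refine spec_loop (n := i + 1) (fun m s' => ∀ p < m, ∀ l < i + 1, 0 < s'.a .K p l ↔
    l ∈ backRow (i + 1) (s₅.a .nK) (fun p => s₅.a .nord 0 (i - p)) p) hn₆ lim.n_le_N hNB (by simp) ?_ ?_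
  · intro m hm s₇ hs₇ h
    have e1 : s₇.a .nK = s₅.a .nK := (hs₇.a .nK rfl).trans nK₆
    have e2 : s₇.a .ord = s₆.a .ord := hs₇.a .ord rfl
    refine (fill_spec (n := i + 1) (r := m) (P := fun l => l ∈ backRow (i + 1) (s₅.a .nK)
      (fun p => s₅.a .nord 0 (i - p)) m) (by simp [hs₇.v .n rfl, hn₆]) lim.n_le_N hNB h1B
      (fun s₈ hs₈ => by rw [Exp.ev_var, hs₈.v .g rfl]; simp) ?_).mono ?_
    · intro l hl s₈ hs₈ h3 _
      have e3 : s₈.v .g = m := by rw [hs₈.v .g rfl]; simp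
      have e4 : s₈.a .nK = s₅.a .nK := by rw [hs₈.a .nK rfl]; simp [e1]
      have e5 : s₈.a .ord = s₆.a .ord := by rw [hs₈.a .ord rfl]; simp [e2]
      simp only [Exp.ev_mul, pos_mul_iff, Exp.ev_sub, Exp.ev_arr, Exp.ev_var, Exp.ev_lit, h3, e3, e4, e5,
        mem_backRow, hord₆ m hm, hord₆ l hl, tsub_pos_iff_lt, hl, true_and]
    · rintro s₈ hs₈ ⟨h3, h4⟩ p hp l hl
      rcases (show p < m ∨ p = m by omega) with h5 | rfl
      · rw [h4 p l (Or.inl (by omega))]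
        simpa using h p h5 l hl
      · exact h3 l hl
  intro s₇ hs₇ hK₇
  have ok₇ : s₇.v .ok = s₅.v .ok := (hs₇.v .ok rfl).trans (hs₆.v .ok rfl)
  refine ⟨fun _ => ⟨_, _, lay, fun p l hp hl => hK₇ p hp l hl, fun l hl => ?_⟩, fun h => ok₇ ▸ h2 h⟩
  rw [hs₇.a .ord rfl, hord₆ l hl]

theorem stagesProg_spec (H : SearchInput L I k b s) :
    Spec L stagesProg s fun s' => (0 < s'.v .ok → HasLayout I I.n (4 * b) s') ∧
      (Thin I b → 0 < s'.v .ok) := by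
  rw [stagesProg, spec_seq, spec_set]
  refine ⟨H.lim.one_le_B, ?_⟩
  have H₁ : SearchInput L I k b (s.set .ok 1) :=
    H.agree (c := .set .ok 1) ((Agree.refl _ s).set (by simp [wv]) 1) rfl
  refine spec_loop (n := I.n) (fun m s' => (0 < s'.v .ok → HasLayout I m (4 * b) s') ∧
    (Thin I b → 0 < s'.v .ok)) H₁.size H.lim.n_le_N H.lim.n_le_B ?_ ?_ fun _ _ h => h
  · refine ⟨fun _ => ⟨fun _ => ∅, fun _ => 0, ⟨⟨by simp, by simp, by simp⟩, by simp, by simp, by simp,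
      by simp⟩, by simp, by simp⟩, fun _ => by simp⟩
  · rintro i hi s₁ hs₁ ⟨h1, h2⟩
    rw [spec_ite]
    by_cases hok : 0 < s₁.v .ok
    · rw [if_pos (by simpa using hok)]
      refine stageProg_spec (k := k) ?_ (by simp) hi (by simpa using hok) (h1 hok)
      exact (H₁.agree hs₁ rfl).agree (c := .set .stage 0) ((Agree.refl _ _).set (by simp [wv]) _) rfl
    · rw [if_neg (by simpa using hok)]
      exact spec_skip.2 ⟨fun h => absurd (by simpa using h) hok, fun h => absurd (h2 h) hok⟩

theorem Layout.mono {t' : ℕ} {adj : ℕ → ℕ → Prop} (h : Layout N adj κ ord t) (ht : t ≤ t') :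
    Layout N adj κ ord t' :=
  { h with card := fun i hi => (h.card i hi).trans ht }

theorem HasLayout.congr (h : HasLayout I N t s) (hK : s'.a .K = s.a .K) (hord : s'.a .ord = s.a .ord) :
    HasLayout I N t s' := by
  unfold HasLayout
  rw [hK, hord]
  exact h

/-- The given layout is unknown to the program. It shows that the attempt with b = t₀ + 2 cannot
fail, and `t₀ < n` that this attempt is among the n + 1 that are provided for. After a success the
remaining ones are skipped, so limits are needed only up to this b. -/
theorem searchProg_spec {t₀ : ℕ} (hR : Reads I k s.io) (hlay : Layout I.n (extRel I.graph.Adj) κ ord t₀)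
    (ht : t₀ < I.n) (hN : I.n + 1 ≤ L.lim .N) (hB : I.n + 1 ≤ L.B) (h3 : 3 ≤ L.B)
    (hL : ∀ b, 1 ≤ b → b ≤ t₀ + 2 → L.Suffices I.n 3 (4 * b + 1) b ∧ 3 ^ (3 * b) ≤ L.lim .M) :
    Spec L searchProg s fun s' => s'.v .size = I.n ∧ HasLayout I I.n (4 * (t₀ + 2)) s' := by
  simp only [searchProg, spec_seq]
  rw [spec_set, spec_set, spec_set]
  simp only [Exp.ev_ioP, Exp.ev_lit, hR.n, Int.toNat_natCast, Nat.zero_le, true_and]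
  refine ⟨by omega, h3, ?_⟩
  refine spec_loop (n := I.n + 1) (fun m s' => (s'.v .done = 0 → m ≤ t₀ + 1) ∧
    (0 < s'.v .done → HasLayout I I.n (4 * (t₀ + 2)) s')) (by simp) hN hB (by simp) ?_ ?_
  · rintro h hh s₁ hs₁ ⟨h1, h2⟩
    rw [spec_ite]
    simp only [Exp.ev_var, St.set_v, reduceCtorEq, if_false]
    by_cases hd : 0 < s₁.v .done
    · rw [if_pos hd, spec_skip]
      simp only [St.set_v, reduceCtorEq, if_false]
      exact ⟨fun h => by omega, fun h => (h2 h).congr rfl rfl⟩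
    rw [if_neg hd]
    have hle := h1 (by omega)
    obtain ⟨hL1, hL2⟩ := hL (h + 1) (by omega) (by omega)
    rw [spec_seq, spec_set]
    simp only [Exp.ev_add, Exp.ev_var, Exp.ev_lit, St.set_v, if_true]
    refine ⟨by omega, ?_⟩
    have S : SearchInput L I k (h + 1) ((s₁.set .h h).set .b (h + 1)) := by
      refine ⟨hL1, hL2, by omega, ?_, ?_, ?_, by simp⟩
      · simp [hs₁.io rfl, hR]
      · simp [hs₁.v .size rfl]
      · simp [hs₁.v .q rfl]
    rw [spec_seq]
    refine (stagesProg_spec S).mono ?_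
    rintro s₂ hs₂ ⟨h4, h5⟩
    have e1 : s₂.v .done = s₁.v .done := by rw [hs₂.v .done rfl]; simp
    rw [spec_ite]
    by_cases hok : 0 < (Exp.var .ok).ev s₂
    · rw [if_pos hok, spec_set]
      simp only [Exp.ev_lit, St.set_v, if_true]
      refine ⟨by omega, fun h => absurd h (by simp), fun _ => ?_⟩
      obtain ⟨κ', ord', h6, h7⟩ := h4 hok
      exact ⟨κ', ord', h6.mono (by omega), h7⟩
    · rw [if_neg hok, spec_skip, e1]
      refine ⟨fun _ => ?_, fun h => absurd h hd⟩
      by_contra h6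
      exact hok (h5 ⟨κ, ord, t₀, hlay, by omega⟩)
  · rintro s₁ hs₁ ⟨h1, h2⟩
    refine ⟨by rw [hs₁.v .size rfl]; simp, h2 (Nat.pos_of_ne_zero fun h => ?_)⟩
    have := h1 h; omega

theorem scheduleAlone_spec {o : Objective} {t₀ : ℕ} (hR : Reads I k s.io)
    (hlay : Layout I.n (extRel I.graph.Adj) κ ord t₀) (ht : t₀ < I.n) (hN : I.n + 1 ≤ L.lim .N)
    (hB : I.n + 1 ≤ L.B) (h3 : 3 ≤ L.B)
    (hL : ∀ b, 1 ≤ b → b ≤ t₀ + 2 → L.Suffices I.n 3 (4 * b + 1) b ∧ 3 ^ (3 * b) ≤ L.lim .M)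
    (hJ : L.SufficesJobs I k (4 * (t₀ + 2)))
    (hex : ∃ C : I.Schedule, I.IsOptimal o C ∧ I.makespan C ≤ k) :
    Spec L (scheduleAlone o) s fun s' =>
      ∃ C : I.Schedule, I.IsOptimal o C ∧ ∀ j : Fin I.n, s'.io (j : ℕ) = C j := by
  rw [scheduleAlone, spec_seq]
  refine (searchProg_spec hR hlay ht hN hB h3 hL).mono ?_
  rintro s₁ hs₁ ⟨hsize, κ', ord', h1, h2, h4⟩
  have io₁ : s₁.io = s.io := hs₁.io rfl
  simp only [spec_seq]
  rw [spec_set, spec_set]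
  simp only [Exp.ev_var, Exp.ev_ioP, Exp.ev_lit, St.set_io, io₁, hR.k, hsize, Int.toNat_natCast]
  refine ⟨by omega, hJ.q_le_B, ?_⟩
  exact schedule_spec hJ (by simpa [io₁] using hR) h1 (by simp) (by simp) h2 h4 hex

end

open Cmd

/-! ### Treewidth -/

/-- The tree decomposition with a single bag. -/
def TreeDecomposition.single {n : ℕ} (G : SimpleGraph (Fin n)) : TreeDecomposition G where
  m := 1
  tree := ⊥
  isTree := .of_subsingleton
  bag _ := Finset.univ
  vertex_mem v := ⟨0, Finset.mem_univ v⟩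
  edge_mem u v _ := ⟨0, Finset.mem_univ u, Finset.mem_univ v⟩
  connected v := by
    have : Nonempty {i : Fin 1 | v ∈ (Finset.univ : Finset (Fin n))} := ⟨⟨0, Finset.mem_univ v⟩⟩
    exact ⟨.of_subsingleton⟩

variable {I : Instance} {o : Objective} {k : ℕ}

theorem TreeDecomposition.width_lt (D : TreeDecomposition I.graph) : D.width < I.n := by
  have h1 : (Finset.univ.sup fun i => (D.bag i).card) ≤ I.n := Finset.sup_le fun i _ => by
    simpa using Finset.card_le_univ (D.bag i)
  have := I.n_pos
  unfold width
  omega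

/-- The existence is extracted from the correctness of `layoutProg`, applied with sufficiently large
limits and k = 0. -/
theorem TreeDecomposition.exists_layout (D : TreeDecomposition I.graph) :
    ∃ κ ord, Layout I.n (extRel I.graph.Adj) κ ord D.width := by
  have h := layoutProg_spec (L := ⟨1 + D.m + (2 + 4 * I.n + I.n * I.n), fun _ => I.n + D.m⟩)
    (k := 0) (ConcSched.reads_init I 0 D.encode) (D.reads_init I 0) (by simp) (by simp) (by simp; omega) (by simp)
    (by simp; omega) (by simp) (fun _ _ _ => rfl)
  exact ⟨_, _, h.2.2.2.2.1⟩

/-- The single-bag decomposition shows that the infimum is not taken over the empty set, so it is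
attained. -/
theorem exists_width_eq_treewidth (I : Instance) :
    ∃ D : TreeDecomposition I.graph, D.width = treewidth I.graph :=
  Nat.sInf_mem (s := Set.range fun D : TreeDecomposition I.graph => D.width) ⟨_, .single _, rfl⟩

/-- With makespan 1, all jobs are being processed at time 0. -/
theorem Instance.not_adj_of_makespan (h : ∃ C : I.Schedule, I.IsOptimal o C ∧ I.makespan C ≤ 1)
    (i j : Fin I.n) : ¬ I.graph.Adj i j := by
  obtain ⟨C, hC, hk⟩ := h
  intro hij
  have h1 : ∀ i, C i ≤ 1 := fun i => (Finset.le_sup (f := C) (Finset.mem_univ i)).trans hk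
  have h2 := fun i => hC.1.1 i
  have h3 := Set.disjoint_left.1 (hC.1.2 i j hij)
  refine @h3 0 ?_ ?_
  all_goals rw [Set.mem_Ico]
  · have := h1 i; have := h2 i; have := I.p_pos i; omega
  · have := h1 j; have := h2 j; have := I.p_pos j; omega

/-- The search takes a power of k + 2, which has to be bounded by a power of k. For k ≥ 2 this
follows from k + 2 ≤ k ^ 2 and 2 (8 t + 19) ≤ 38 (t + 1). For k = 1 powers of k absorb nothing, but
then the graph has no edges, there is a layout of width 0, and only the constant 3 ^ 19 is left. -/
theorem exists_layout_of_makespan (h : ∃ C : I.Schedule, I.IsOptimal o C ∧ I.makespan C ≤ k) :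
    ∃ κ ord t, Layout I.n (extRel I.graph.Adj) κ ord t ∧ t < I.n ∧
      (k + 2) ^ (8 * t + 19) ≤ 3 ^ 19 * k ^ (38 * (treewidth I.graph + 1)) := by
  rcases (Instance.one_le_of_makespan h).eq_or_lt with rfl | hk
  · refine ⟨fun _ => ∅, id, 0, ⟨⟨by simp, by simp, by simp⟩, by simp, fun _ h => h, fun _ _ _ _ h => h, ?_⟩,
      I.n_pos, by simp⟩
    rintro i _ j _ - ⟨_, _, hij⟩
    exact absurd hij (Instance.not_adj_of_makespan h _ _)
  · obtain ⟨D, hD⟩ := exists_width_eq_treewidth I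
    obtain ⟨κ, ord, hlay⟩ := D.exists_layout
    refine ⟨κ, ord, D.width, hlay, D.width_lt, ?_⟩
    calc (k + 2) ^ (8 * D.width + 19) ≤ (k ^ 2) ^ (8 * D.width + 19) :=
          Nat.pow_le_pow_left (by nlinarith) _
      _ = k ^ (16 * D.width + 38) := by rw [← pow_mul]; congr 1; ring
      _ ≤ k ^ (38 * (treewidth I.graph + 1)) := Nat.pow_le_pow_right (by omega) (by omega)
      _ ≤ _ := Nat.le_mul_of_pos_left _ (by positivity)

/-- As 3 ≤ k + 2, the limit (k + 2) ^ (4 t + 9) covers the 3 ^ (4 b + 1) table entries and the 3 ^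
(3 b) prescriptions for all b ≤ t + 2. -/
theorem Instance.Bounded.suffices_search {U t M b : ℕ} (h : I.Bounded k U) (hk : 1 ≤ k) (ht : t < I.n)
    (hM : (k + 2) ^ (4 * t + 9) ≤ M) (hb : b ≤ t + 2) :
    (limits U (k + 2) M).Suffices I.n 3 (4 * b + 1) b ∧
      3 ^ (3 * b) ≤ (limits U (k + 2) M).lim .M := by
  have hsq : (U + 2) ^ 2 = U * U + 4 * U + 4 := by ring
  have hn := h.n
  have h3 : ∀ e ≤ 4 * t + 9, 3 ^ e ≤ M := fun e he =>
    ((Nat.pow_le_pow_left (by omega) e).trans (Nat.pow_le_pow_right (by omega) he)).trans hM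
  refine ⟨⟨by omega, ?_, ?_, h3 _ (by omega), le_limits' (by omega), le_limits' (by omega), ?_, ?_⟩,
    h3 _ (by omega)⟩
  · simp only [limits]; omega
  · simp only [limits]; omega
  · refine le_limits (e := 2 * U) ?_ (by omega)
    calc 3 ^ I.n ≤ (2 ^ 2) ^ I.n := Nat.pow_le_pow_left (by omega) _
      _ = 2 ^ (2 * I.n) := by rw [pow_mul]
      _ ≤ 2 ^ (2 * U) := Nat.pow_le_pow_right (by omega) (by omega)
  · refine le_limits (e := U + U) ?_ (by omega)
    rw [pow_add]
    have := Nat.lt_two_pow_self (n := U)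
    exact Nat.mul_le_mul (Nat.pow_le_pow_right (by omega) hn) (by omega)

-- The loops of class `M` are nested twice, tables inside prescriptions, and those of class `q`
-- once. With the limits (k + 2) ^ (4 t₀ + 9) and k + 2 this gives the exponent 2 (4 t₀ + 9) + 1 = 8
-- t₀ + 19. The same limits cover the final dynamic programming with its tables of at most k ^ (4
-- (t₀ + 2)) entries.
set_option maxRecDepth 4000 in
theorem exists_scheduleAlone (o : Objective) : ∃ (P : Prog) (c : ℕ), ∀ (I : Instance) (k : ℕ),
    (∃ C : I.Schedule, I.IsOptimal o C ∧ I.makespan C ≤ k) →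
    P.SolvesWithin ((k : ℤ) :: I.encode)
      (c * (unarySize I.encode + Nat.size k) ^ c * k ^ (c * (treewidth I.graph + 1)))
      (I.HoldsOptimal o) := by
  obtain ⟨C, hC⟩ := (scheduleAlone o).exists_solves
  obtain ⟨c, hc⟩ := exists_polynomial (C * 3 ^ 19) ((scheduleAlone o).depth .N)
  refine ⟨(scheduleAlone o).comp 0, c + 38, fun I k hex => ?_⟩
  have hk := Instance.one_le_of_makespan hex
  obtain ⟨κ, ord, t₀, hlay, ht, hpow⟩ := exists_layout_of_makespan hex
  set U := unarySize I.encode + k.size with hU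
  have hb : I.Bounded k U := I.bounded k le_rfl
  have hU1 : 1 ≤ U := I.n_pos.trans_le hb.n
  have hsq : (U + 2) ^ 2 = U * U + 4 * U + 4 := by ring
  have hn := hb.n
  obtain ⟨s, t, h1, h2, h3⟩ := hC (limits U (k + 2) ((k + 2) ^ (4 * t₀ + 9))) ((U + 2) ^ 2)
    ((k : ℤ) :: I.encode) (I.HoldsOptimal o) (by omega)
    (by simp [limits]) (by
      rintro (_ | _ | _)
      exacts [by simp only [limits]; omega, by simp only [limits]; omega, Nat.one_le_pow _ _ (by omega)])
    (by
      intro a ha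
      rcases List.mem_cons.1 ha with rfl | ha
      · exact le_limits hb.k_lt.le (by omega)
      · have := natAbs_lt_unarySize ha
        exact le_limits' (by omega))
    ((scheduleAlone_spec (k := k) (by simpa using reads_init I k []) hlay ht
      (by simp only [limits]; omega) (le_limits' (by omega)) (le_limits' (by omega))
      (fun b _ hb' => hb.suffices_search hk ht le_rfl hb')
      (hb.sufficesJobs hk (by omega) ((Nat.pow_le_pow_left (by omega) _).trans
        (Nat.pow_le_pow_right (by omega) (by omega)))) hex).mono fun s' _ ⟨C, h1, h2⟩ mem hmem =>
        ⟨C, h1, fun j => by rw [hmem, h2]⟩)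
  refine ⟨s, t, h1, h2.trans ?_, h3⟩
  have e1 : (scheduleAlone o).depth .q = 1 := by cases o <;> rfl
  have e2 : (scheduleAlone o).depth .M = 2 := by cases o <;> rfl
  calc C * ((U + 2) ^ 2) ^ 3 * (limits U (k + 2) ((k + 2) ^ (4 * t₀ + 9))).weight (scheduleAlone o)
      = C * ((U + 2) ^ 2) ^ 3 * (2 * U + 3) ^ (scheduleAlone o).depth .N * (k + 2) ^ (8 * t₀ + 19) := by
        simp only [Lim.weight, e1, e2, limits]; ring
    _ ≤ C * ((U + 2) ^ 2) ^ 3 * (2 * U + 3) ^ (scheduleAlone o).depth .N *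
        (3 ^ 19 * k ^ (38 * (treewidth I.graph + 1))) := Nat.mul_le_mul_left _ hpow
    _ = C * 3 ^ 19 * ((U + 2) ^ 2) ^ 3 * (2 * U + 3) ^ (scheduleAlone o).depth .N *
        k ^ (38 * (treewidth I.graph + 1)) := by ring
    _ ≤ _ := Nat.mul_le_mul ((hc U hU1).trans (Nat.mul_le_mul (by omega)
        (Nat.pow_le_pow_right hU1 (by omega)))) (Nat.pow_le_pow_right hk
        (Nat.mul_le_mul_right _ (by omega)))

end ConcSched

theorem mainTheorem10 (obj : ConcSched.Objective) :
    -- a tree decomposition `D` is given: time `k ^ (width + 1)`, up to a polynomial factor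
    (∃ (P : ConcSched.Prog) (c : ℕ),
      ∀ (I : ConcSched.Instance) (D : ConcSched.TreeDecomposition I.graph) (k : ℕ),
        (∃ C : I.Schedule, I.IsOptimal obj C ∧ I.makespan C ≤ k) →
        P.SolvesWithin ((k : ℤ) :: (I.encode ++ D.encode))
          (c * (ConcSched.unarySize (I.encode ++ D.encode) + Nat.size k) ^ c * k ^ (D.width + 1))
          (I.HoldsOptimal obj)) ∧
    -- no tree decomposition is given: time `k ^ O(tw + 1)`, up to a polynomial factor
    (∃ (P : ConcSched.Prog) (c : ℕ),
      ∀ (I : ConcSched.Instance) (k : ℕ),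
        (∃ C : I.Schedule, I.IsOptimal obj C ∧ I.makespan C ≤ k) →
        P.SolvesWithin ((k : ℤ) :: I.encode)
          (c * (ConcSched.unarySize I.encode + Nat.size k) ^ c *
            k ^ (c * (ConcSched.treewidth I.graph + 1)))
          (I.HoldsOptimal obj)) :=
  ⟨ConcSched.exists_scheduleAlong obj, ConcSched.exists_scheduleAlone obj⟩
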